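/- Let $\Bbbk$ be a commutative ring and $n\ge 0$. All superalgebras are $\Bbbk$-linear and $\mathbb Z$-graded, and $\otimes$ between superalgebras is the super tensor product. **Algebras.** $\mathrm{ONH}_m$ is the odd nilHecke algebra: generators $x_1,\dots,x_m$ (degree $2$, odd) and $\tau_1,\dots,\tau_{m-1}$ (degree $-2$, odd), relations $\tau_i^2=0$, $\tau_i\tau_{i+1}\tau_i=\tau_{i+1}\tau_i\tau_{i+1}$, $x_i\tau_i+\tau_ix_{i+1}=1=\tau_ix_i+x_{i+1}\tau_i$, $x_ix_j+x_jx_i=0$ ($i\ne j$), $\tau_i\tau_j+\tau_j\tau_i=0$ ($|i-j|>1$), $x_i\tau_j+\tau_jx_i=0$ ($i\neq j,j+1$). $A_n$ is the supercommutative superalgebra generated by even $\chi_1,\dots,\chi_{\lfloor n/2\rfloor}$ with $\deg\chi_i=4i$ and an odd $d$ of degree $2$, with $d^2=0$ and, if $n$ is even, $d\chi_{n/2}=0$ (where $\chi_0=1$). Put $c_{2i}=\chi_i$, $c_{2i+1}=d\chi_i$, $a^n(t)=\sum_{l=0}^n(-1)^lt^lc_{n-l}$, and $\mathrm{ONH}_m^n=(\mathrm{ONH}_m\otimes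 A_n)/\langle a^n(x_1)\rangle$, with $\mathrm{ONH}_0^n=A_n$. For $m\le m'$ there is a canonical morphism $\mathrm{ONH}_m^n\to\mathrm{ONH}_{m'}^n$ fixing generators. For $N=m-l+1$ put $\tau_{\omega_0[l,m]}=(\tau_l\cdots\tau_{m-1})(\tau_l\cdots\tau_{m-2})\cdots\tau_l$ and $$e_{[l,m]}=(-1)^{\binom N3}\tau_{\omega_0[l,m]}x_m^0x_{m-1}^1\cdots x_l^{m-l},\qquad e'_{[l,m]}=(-1)^{\binom N3}x_l^0x_{l+1}^1\cdots x_m^{m-l}\tau_{\omega_0[l,m]}$$ (both equal to $1$ when $m\le l$). **Complexes.** For $a,b\ge 0$ consider the sequence with terms $T_m=e'_{[a+1,m]}\mathrm{ONH}_m^ne_{[b+1,m]}$ for $\max(a,b)\le m\le n$ and $T_m=0$ for other $m$, and with maps $\mathsf d_m:T_m\to T_{m+1}$, $h\mapsto e'_{[a+1,m+1]}he_{[b+1,m+1]}$. For $0\le k\le n$, the case $a=n-k$, $b=k$ is, up to grading shifts, the complex $\Phi_n(\Theta\mathbf 1_{-n+2k})$ of $(\mathrm{ONH}_{n-k}^n,\mathrm{ONH}_k^n)$-superbimodules,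 with $T_r$ in cohomological degree $r-k$; let $C_{n,k}=T_n/\operatorname{im}\mathsf d_{n-1}$ be its cohomology in the top degree $n-k$. **Grassmannian superalgebras.** Let $\mathrm{OPol}_k$ be the skew polynomial superalgebra in $x_1,\dots,x_k$ ($x_ix_j=-x_jx_i$ for $i\ne j$), let $\partial_i$ be the odd divided difference operators ($\partial_i(x_j)=1$ if $j\in\{i,i+1\}$ and $0$ otherwise, $\partial_i(fg)=\partial_i(f)g+s_i(f)\partial_i(g)$, where $s_i$ is the algebra automorphism $x_j\mapsto-x_{s_i(j)}$), let $\mathrm{O\Lambda}_k=\bigcap_{i=1}^{k-1}\ker\partial_i$, and $h_m=\sum_{1\le i_1\le\dots\le i_m\le k}\tilde x_{i_1}\cdots\tilde x_{i_m}$ with $\tilde x_i=(-1)^{i-1}x_i$. Put $h'_m=\sum_{r=0}^m(-1)^rh_{m-r}\otimes c_r$ and $M_k^n=(\mathrm{O\Lambda}_k\otimes A_n)/\langle h'_m\mid n-k+1\le m\le n\rangle$. A graded $(S,R)$-superbimodule $P$ (with $\Bbbk$ acting symmetrically) is *invertible* if there is a graded $(R,S)$-superbimodule $Q$ with $P\otimes_RQ\cong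 S$ and $Q\otimes_SP\cong R$ as graded superbimodules. **Theorem.** 1. For all $a,b\ge0$ and all $m\ne n$, the above sequence is exact at $T_m$: $\ker\mathsf d_m=\operatorname{im}\mathsf d_{m-1}$ (with $\operatorname{im}\mathsf d_{m-1}=0$ for $m=0$). In particular, for every $0\le k\le n$ the complex $\Phi_n(\Theta\mathbf 1_{-n+2k})$ is exact except in its top cohomological degree $n-k$. 2. For every $0\le k\le n$, $C_{n,k}$ is an invertible graded $(\mathrm{ONH}_{n-k}^n,\mathrm{ONH}_k^n)$-superbimodule. 3. For every $0\le k\le n$ there are isomorphisms of graded superalgebras $M_{n-k}^n\cong e'_{[1,n-k]}\mathrm{ONH}_{n-k}^ne'_{[1,n-k]}$ and $M_k^n\cong e_{[1,k]}\mathrm{ONH}_k^ne_{[1,k]}$ such that $e'_{[1,n-k]}C_{n,k}e_{[1,k]}$, with the actions obtained through them, is an invertible graded $(M_{n-k}^n,M_k^n)$-superbimodule. -/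

import Mathlib

open scoped TensorProduct

universe u

namespace OddCR

/-! ## The deformed cyclotomic quotients of the odd nilHecke algebras -/

section Presentation

variable (𝕜 : Type u) [CommRing 𝕜] (n k : ℕ)

/-- Generators of the superalgebra `ONH_k ⊗ A_n`: the odd nilHecke generators `x_1, …, x_k` and
`τ_1, …, τ_{k-1}`, and the generators `χ_1, …, χ_{⌊n/2⌋}` and `d` of `A_n`. -/
inductive Gen (n k : ℕ) : Type
  | x (i : Fin k)
  | tau (i : Fin (k - 1))
  | chi (i : Fin (n / 2))
  | d

/-- (degree, parity) of the generators. -/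
def Gen.deg {n k : ℕ} : Gen n k → ℤ × ZMod 2
  | .x _ => (2, 1)
  | .tau _ => (-2, 1)
  | .chi i => (4 * ((i : ℕ) + 1 : ℤ), 0)
  | .d => (2, 1)

/-- The letter `x_i` (`1 ≤ i ≤ k`). -/
noncomputable def fx (i : ℕ) : FreeAlgebra 𝕜 (Gen n k) :=
  if h : 1 ≤ i ∧ i ≤ k then FreeAlgebra.ι 𝕜 (Gen.x ⟨i - 1, by omega⟩) else 0

/-- The letter `τ_i` (`1 ≤ i ≤ k - 1`). -/
noncomputable def ftau (i : ℕ) : FreeAlgebra 𝕜 (Gen n k) :=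
  if h : 1 ≤ i ∧ i + 1 ≤ k then FreeAlgebra.ι 𝕜 (Gen.tau ⟨i - 1, by omega⟩) else 0

/-- The letter `χ_i` (`1 ≤ i ≤ ⌊n/2⌋`), with `χ_0 = 1`. -/
noncomputable def fchi (i : ℕ) : FreeAlgebra 𝕜 (Gen n k) :=
  if i = 0 then 1 else
  if h : 1 ≤ i ∧ i ≤ n / 2 then FreeAlgebra.ι 𝕜 (Gen.chi ⟨i - 1, by omega⟩) else 0

/-- The letter `d`. -/
noncomputable def fd : FreeAlgebra 𝕜 (Gen n k) := FreeAlgebra.ι 𝕜 Gen.d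

/-- `c_r = χ_{r/2}` for `r` even and `c_r = d χ_{(r-1)/2}` for `r` odd. -/
noncomputable def fc (r : ℕ) : FreeAlgebra 𝕜 (Gen n k) :=
  if Even r then fchi 𝕜 n k (r / 2) else fd 𝕜 n k * fchi 𝕜 n k (r / 2)

/-- `a^n(x_1) = ∑_{l=0}^{n} (-1)^l x_1^l c_{n-l}`. -/
noncomputable def fa : FreeAlgebra 𝕜 (Gen n k) :=
  ∑ l ∈ Finset.range (n + 1), (-1) ^ l * fx 𝕜 n k 1 ^ l * fc 𝕜 n k (n - l)

/-- The relations of `ONH_k^n = (ONH_k ⊗ A_n) / a^n(x_1)`: those of `ONH_k`, those of the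
supercommutative superalgebra `A_n`, supercommutation of the two tensor factors, and
`a^n(x_1) = 0` (if there is a variable `x_1`). -/
inductive Rel : FreeAlgebra 𝕜 (Gen n k) → FreeAlgebra 𝕜 (Gen n k) → Prop
  | tau_sq (i : ℕ) (hi : 1 ≤ i ∧ i + 1 ≤ k) : Rel (ftau 𝕜 n k i * ftau 𝕜 n k i) 0
  | braid (i : ℕ) (hi : 1 ≤ i ∧ i + 2 ≤ k) :
      Rel (ftau 𝕜 n k i * ftau 𝕜 n k (i + 1) * ftau 𝕜 n k i)
        (ftau 𝕜 n k (i + 1) * ftau 𝕜 n k i * ftau 𝕜 n k (i + 1))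
  | x_tau (i : ℕ) (hi : 1 ≤ i ∧ i + 1 ≤ k) :
      Rel (fx 𝕜 n k i * ftau 𝕜 n k i + ftau 𝕜 n k i * fx 𝕜 n k (i + 1)) 1
  | tau_x (i : ℕ) (hi : 1 ≤ i ∧ i + 1 ≤ k) :
      Rel (ftau 𝕜 n k i * fx 𝕜 n k i + fx 𝕜 n k (i + 1) * ftau 𝕜 n k i) 1
  | x_x (i j : ℕ) (hi : 1 ≤ i ∧ i ≤ k) (hj : 1 ≤ j ∧ j ≤ k) (hij : i ≠ j) :
      Rel (fx 𝕜 n k i * fx 𝕜 n k j + fx 𝕜 n k j * fx 𝕜 n k i) 0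
  | tau_tau (i j : ℕ) (hi : 1 ≤ i ∧ i + 1 ≤ k) (hj : 1 ≤ j ∧ j + 1 ≤ k)
      (hij : i + 1 < j ∨ j + 1 < i) :
      Rel (ftau 𝕜 n k i * ftau 𝕜 n k j + ftau 𝕜 n k j * ftau 𝕜 n k i) 0
  | x_tau_far (i j : ℕ) (hi : 1 ≤ i ∧ i ≤ k) (hj : 1 ≤ j ∧ j + 1 ≤ k)
      (hij : i ≠ j) (hij' : i ≠ j + 1) :
      Rel (fx 𝕜 n k i * ftau 𝕜 n k j + ftau 𝕜 n k j * fx 𝕜 n k i) 0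
  | d_sq : Rel (fd 𝕜 n k * fd 𝕜 n k) 0
  | d_chi_top (hn : Even n) : Rel (fd 𝕜 n k * fchi 𝕜 n k (n / 2)) 0
  | chi_chi (i j : ℕ) (hi : 1 ≤ i ∧ i ≤ n / 2) (hj : 1 ≤ j ∧ j ≤ n / 2) :
      Rel (fchi 𝕜 n k i * fchi 𝕜 n k j) (fchi 𝕜 n k j * fchi 𝕜 n k i)
  | chi_d (i : ℕ) (hi : 1 ≤ i ∧ i ≤ n / 2) :
      Rel (fchi 𝕜 n k i * fd 𝕜 n k) (fd 𝕜 n k * fchi 𝕜 n k i)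
  | x_chi (i j : ℕ) (hi : 1 ≤ i ∧ i ≤ k) (hj : 1 ≤ j ∧ j ≤ n / 2) :
      Rel (fchi 𝕜 n k j * fx 𝕜 n k i) (fx 𝕜 n k i * fchi 𝕜 n k j)
  | tau_chi (i j : ℕ) (hi : 1 ≤ i ∧ i + 1 ≤ k) (hj : 1 ≤ j ∧ j ≤ n / 2) :
      Rel (fchi 𝕜 n k j * ftau 𝕜 n k i) (ftau 𝕜 n k i * fchi 𝕜 n k j)
  | x_d (i : ℕ) (hi : 1 ≤ i ∧ i ≤ k) :
      Rel (fd 𝕜 n k * fx 𝕜 n k i) (-(fx 𝕜 n k i * fd 𝕜 n k))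
  | tau_d (i : ℕ) (hi : 1 ≤ i ∧ i + 1 ≤ k) :
      Rel (fd 𝕜 n k * ftau 𝕜 n k i) (-(ftau 𝕜 n k i * fd 𝕜 n k))
  | cyc (hk : 1 ≤ k) : Rel (fa 𝕜 n k) 0

/-- The deformed cyclotomic quotient `ONH_k^n` over `𝕜`. -/
def ONH : Type u := RingQuot (Rel 𝕜 n k)

noncomputable instance : Ring (ONH 𝕜 n k) := inferInstanceAs (Ring (RingQuot (Rel 𝕜 n k)))

noncomputable instance : Algebra 𝕜 (ONH 𝕜 n k) :=
  inferInstanceAs (Algebra 𝕜 (RingQuot (Rel 𝕜 n k)))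

namespace ONH

/-- The quotient map from the free algebra. -/
noncomputable def mk : FreeAlgebra 𝕜 (Gen n k) →ₐ[𝕜] ONH 𝕜 n k := RingQuot.mkAlgHom 𝕜 (Rel 𝕜 n k)

variable {𝕜 n k}

/-- The image of a generator. -/
noncomputable def gen (g : Gen n k) : ONH 𝕜 n k := mk 𝕜 n k (FreeAlgebra.ι 𝕜 g)

/-- The element `x_i` of `ONH_k^n` (meaningful for `1 ≤ i ≤ k`). -/
noncomputable def x (i : ℕ) : ONH 𝕜 n k := mk 𝕜 n k (fx 𝕜 n k i)

/-- The element `τ_i` of `ONH_k^n` (meaningful for `1 ≤ i ≤ k - 1`). -/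
noncomputable def tau (i : ℕ) : ONH 𝕜 n k := mk 𝕜 n k (ftau 𝕜 n k i)

/-- The element `χ_i`. -/
noncomputable def chi (i : ℕ) : ONH 𝕜 n k := mk 𝕜 n k (fchi 𝕜 n k i)

/-- The element `d`. -/
noncomputable def d : ONH 𝕜 n k := mk 𝕜 n k (fd 𝕜 n k)

lemma mk_rel {a b : FreeAlgebra 𝕜 (Gen n k)} (h : Rel 𝕜 n k a b) : mk 𝕜 n k a = mk 𝕜 n k b :=
  RingQuot.mkAlgHom_rel 𝕜 h

lemma induction {p : ONH 𝕜 n k → Prop} (hc : ∀ r, p (algebraMap 𝕜 _ r)) (hg : ∀ g, p (gen g))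
    (ha : ∀ a b, p a → p b → p (a + b)) (hm : ∀ a b, p a → p b → p (a * b)) (a : ONH 𝕜 n k) :
    p a := by
  obtain ⟨f, rfl⟩ := RingQuot.mkAlgHom_surjective 𝕜 (Rel 𝕜 n k) a
  change p (mk 𝕜 n k f)
  induction f using FreeAlgebra.induction with
  | grade0 r => simpa using hc r
  | grade1 g => exact hg g
  | mul a b h1 h2 => rw [map_mul]; exact hm _ _ h1 h2
  | add a b h1 h2 => rw [map_add]; exact ha _ _ h1 h2

variable (𝕜 n k) in
/-- The homogeneous component of `ONH_k^n` of the given degree and parity: the span of all words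
in the generators of that total degree and parity. -/
noncomputable def homog (g : ℤ × ZMod 2) : Submodule 𝕜 (ONH 𝕜 n k) :=
  Submodule.span 𝕜 {y | ∃ w : List (Gen n k), (w.map Gen.deg).sum = g ∧ y = (w.map gen).prod}

/-- Images in `ONH_b^n` of the generators of `ONH_a^n`. -/
noncomputable def inclGen (a b : ℕ) : Gen n a → ONH 𝕜 n b
  | .x i => x ((i : ℕ) + 1)
  | .tau i => tau ((i : ℕ) + 1)
  | .chi i => chi ((i : ℕ) + 1)
  | .d => d

section incl

variable (a b : ℕ)

lemma lift_fx (i : ℕ) (hi : 1 ≤ i ∧ i ≤ a) :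
    FreeAlgebra.lift 𝕜 (inclGen (𝕜 := 𝕜) (n := n) a b) (fx 𝕜 n a i) = x i := by
  rw [fx, dif_pos hi, FreeAlgebra.lift_ι_apply]
  simp only [inclGen]
  congr 1; omega

lemma lift_ftau (i : ℕ) (hi : 1 ≤ i ∧ i + 1 ≤ a) :
    FreeAlgebra.lift 𝕜 (inclGen (𝕜 := 𝕜) (n := n) a b) (ftau 𝕜 n a i) = tau i := by
  rw [ftau, dif_pos hi, FreeAlgebra.lift_ι_apply]
  simp only [inclGen]
  congr 1; omega

lemma lift_fchi (i : ℕ) :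
    FreeAlgebra.lift 𝕜 (inclGen (𝕜 := 𝕜) (n := n) a b) (fchi 𝕜 n a i) = chi i := by
  unfold fchi
  split_ifs with h h'
  · simp [chi, fchi, h]
  · rw [FreeAlgebra.lift_ι_apply]
    simp only [inclGen]
    congr 1; omega
  · simp [chi, fchi, h, h']

lemma lift_fd :
    FreeAlgebra.lift 𝕜 (inclGen (𝕜 := 𝕜) (n := n) a b) (fd 𝕜 n a) = d := by
  rw [fd, FreeAlgebra.lift_ι_apply]; rfl

lemma lift_fa (ha : 1 ≤ a) :
    FreeAlgebra.lift 𝕜 (inclGen (𝕜 := 𝕜) (n := n) a b) (fa 𝕜 n a) = mk 𝕜 n b (fa 𝕜 n b) := by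
  have hc : ∀ r, FreeAlgebra.lift 𝕜 (inclGen (𝕜 := 𝕜) (n := n) a b) (fc 𝕜 n a r)
      = mk 𝕜 n b (fc 𝕜 n b r) := by
    intro r
    unfold fc
    split_ifs
    · rw [lift_fchi]; rfl
    · rw [map_mul, map_mul, lift_fchi, lift_fd]; rfl
  have hx := lift_fx (𝕜 := 𝕜) (n := n) a b 1 ⟨le_rfl, ha⟩
  simp only [fa, map_sum, map_mul, map_pow, map_neg, map_one, hc, hx]
  rfl

end incl

/-- The canonical morphism `ONH_a^n → ONH_b^n` for `a ≤ b`, fixing the generators. -/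
noncomputable def incl {a b : ℕ} (h : a ≤ b) : ONH 𝕜 n a →ₐ[𝕜] ONH 𝕜 n b :=
  RingQuot.liftAlgHom 𝕜 ⟨FreeAlgebra.lift 𝕜 (inclGen a b), by
    intro u v huv
    induction huv with
    | tau_sq i hi =>
      have := mk_rel (Rel.tau_sq (𝕜 := 𝕜) (n := n) (k := b) i (by omega))
      simpa [lift_ftau, hi, tau] using this
    | braid i hi =>
      have := mk_rel (Rel.braid (𝕜 := 𝕜) (n := n) (k := b) i (by omega))
      have h1 := lift_ftau (𝕜 := 𝕜) (n := n) a b i (by omega)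
      have h2 := lift_ftau (𝕜 := 𝕜) (n := n) a b (i + 1) (by omega)
      simpa [h1, h2, tau] using this
    | x_tau i hi =>
      have := mk_rel (Rel.x_tau (𝕜 := 𝕜) (n := n) (k := b) i (by omega))
      have h1 := lift_ftau (𝕜 := 𝕜) (n := n) a b i (by omega)
      have h2 := lift_fx (𝕜 := 𝕜) (n := n) a b i (by omega)
      have h3 := lift_fx (𝕜 := 𝕜) (n := n) a b (i + 1) (by omega)
      simpa [h1, h2, h3, tau, x] using this
    | tau_x i hi =>
      have := mk_rel (Rel.tau_x (𝕜 := 𝕜) (n := n) (k := b) i (by omega))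
      have h1 := lift_ftau (𝕜 := 𝕜) (n := n) a b i (by omega)
      have h2 := lift_fx (𝕜 := 𝕜) (n := n) a b i (by omega)
      have h3 := lift_fx (𝕜 := 𝕜) (n := n) a b (i + 1) (by omega)
      simpa [h1, h2, h3, tau, x] using this
    | x_x i j hi hj hij =>
      have := mk_rel (Rel.x_x (𝕜 := 𝕜) (n := n) (k := b) i j (by omega) (by omega) hij)
      simpa [lift_fx, hi, hj, x] using this
    | tau_tau i j hi hj hij =>
      have := mk_rel (Rel.tau_tau (𝕜 := 𝕜) (n := n) (k := b) i j (by omega) (by omega) hij)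
      simpa [lift_ftau, hi, hj, tau] using this
    | x_tau_far i j hi hj hij hij' =>
      have := mk_rel (Rel.x_tau_far (𝕜 := 𝕜) (n := n) (k := b) i j (by omega) (by omega) hij hij')
      simpa [lift_ftau, lift_fx, hi, hj, tau, x] using this
    | d_sq =>
      have := mk_rel (Rel.d_sq (𝕜 := 𝕜) (n := n) (k := b))
      simpa [lift_fd, d] using this
    | d_chi_top hn =>
      have := mk_rel (Rel.d_chi_top (𝕜 := 𝕜) (n := n) (k := b) hn)
      simpa [lift_fd, lift_fchi, d, chi] using this
    | chi_chi i j hi hj =>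
      have := mk_rel (Rel.chi_chi (𝕜 := 𝕜) (n := n) (k := b) i j hi hj)
      simpa [lift_fchi, chi] using this
    | chi_d i hi =>
      have := mk_rel (Rel.chi_d (𝕜 := 𝕜) (n := n) (k := b) i hi)
      simpa [lift_fchi, lift_fd, chi, d] using this
    | x_chi i j hi hj =>
      have := mk_rel (Rel.x_chi (𝕜 := 𝕜) (n := n) (k := b) i j (by omega) hj)
      simpa [lift_fchi, lift_fx, hi, chi, x] using this
    | tau_chi i j hi hj =>
      have := mk_rel (Rel.tau_chi (𝕜 := 𝕜) (n := n) (k := b) i j (by omega) hj)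
      simpa [lift_fchi, lift_ftau, hi, chi, tau] using this
    | x_d i hi =>
      have := mk_rel (Rel.x_d (𝕜 := 𝕜) (n := n) (k := b) i (by omega))
      simpa [lift_fd, lift_fx, hi, d, x] using this
    | tau_d i hi =>
      have := mk_rel (Rel.tau_d (𝕜 := 𝕜) (n := n) (k := b) i (by omega))
      simpa [lift_fd, lift_ftau, hi, d, tau] using this
    | cyc hk =>
      have := mk_rel (Rel.cyc (𝕜 := 𝕜) (n := n) (k := b) (by omega))
      rw [lift_fa a b hk, this]; simp⟩

lemma incl_gen {a b : ℕ} (h : a ≤ b) (g : Gen n a) :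
    incl (𝕜 := 𝕜) h (gen g) = inclGen a b g := by
  unfold incl gen mk
  erw [RingQuot.liftAlgHom_mkAlgHom_apply]
  rw [FreeAlgebra.lift_ι_apply]

lemma incl_incl {a b c : ℕ} (h : a ≤ b) (h' : b ≤ c) (s : ONH 𝕜 n a) :
    incl h' (incl h s) = incl (h.trans h') s := by
  induction s using ONH.induction with
  | hc r => simp
  | hg g =>
    rw [incl_gen, incl_gen]
    cases g with
    | x i =>
      have : (x ((i : ℕ) + 1) : ONH 𝕜 n b) = gen (Gen.x ⟨i, by omega⟩) := by
        simp only [x, fx, gen]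
        rw [dif_pos (by omega)]; rfl
      simp only [inclGen]
      rw [this, incl_gen]; rfl
    | tau i =>
      have : (tau ((i : ℕ) + 1) : ONH 𝕜 n b) = gen (Gen.tau ⟨i, by omega⟩) := by
        simp only [tau, ftau, gen]
        rw [dif_pos (by omega)]; rfl
      simp only [inclGen]
      rw [this, incl_gen]; rfl
    | chi i =>
      have : (chi ((i : ℕ) + 1) : ONH 𝕜 n b) = gen (Gen.chi i) := by
        simp only [chi, fchi, gen]
        rw [if_neg (by omega), dif_pos (by omega)]; rfl
      simp only [inclGen]
      rw [this, incl_gen]; rfl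
    | d =>
      have : (d : ONH 𝕜 n b) = gen Gen.d := rfl
      simp only [inclGen]
      rw [this, incl_gen]; rfl
  | ha a b h1 h2 => simp [h1, h2]
  | hm a b h1 h2 => simp [h1, h2]

/-! ### Idempotents -/

/-- `x_m^0 x_{m-1}^1 ⋯ x_l^{m-l}`. -/
noncomputable def xDown (l m : ℕ) : ONH 𝕜 n k :=
  ((List.range (m + 1 - l)).map fun s => x (m - s) ^ s).prod

/-- `x_l^0 x_{l+1}^1 ⋯ x_m^{m-l}`. -/
noncomputable def xUp (l m : ℕ) : ONH 𝕜 n k :=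
  ((List.range (m + 1 - l)).map fun s => x (l + s) ^ s).prod

/-- `τ_{ω₀[l,m]} = (τ_l ⋯ τ_{m-1}) (τ_l ⋯ τ_{m-2}) ⋯ τ_l`. -/
noncomputable def tauLong (l m : ℕ) : ONH 𝕜 n k :=
  ((List.range (m - l)).map fun t => ((List.range (m - l - t)).map fun s => tau (l + s)).prod).prod

/-- The idempotent `e_{[l,m]} = (-1)^{binom(m-l+1,3)} τ_{ω₀[l,m]} x_m^0 x_{m-1}^1 ⋯ x_l^{m-l}`
(equal to `1` if `m ≤ l`). -/
noncomputable def e (l m : ℕ) : ONH 𝕜 n k :=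
  (-1) ^ (m + 1 - l).choose 3 * (tauLong l m * xDown l m)

/-- The idempotent `e'_{[l,m]} = (-1)^{binom(m-l+1,3)} x_l^0 x_{l+1}^1 ⋯ x_m^{m-l} τ_{ω₀[l,m]}`
(equal to `1` if `m ≤ l`). -/
noncomputable def e' (l m : ℕ) : ONH 𝕜 n k :=
  (-1) ^ (m + 1 - l).choose 3 * (xUp l m * tauLong l m)

section commute

variable {A : Type*} [Ring A]

lemma sc_mul {y z w : A} {p q : ℕ} (h1 : y * z = (-1) ^ p * (z * y))
    (h2 : y * w = (-1) ^ q * (w * y)) : y * (z * w) = (-1) ^ (p + q) * ((z * w) * y) := by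
  have hc : Commute z ((-1 : A) ^ q) := ((Commute.neg_one_right z).pow_right q)
  rw [← mul_assoc, h1, mul_assoc, mul_assoc, h2, ← mul_assoc z, hc.eq, pow_add]
  simp only [mul_assoc]

lemma sc_pow {y z : A} {p : ℕ} (h : y * z = (-1) ^ p * (z * y)) (s : ℕ) :
    y * z ^ s = (-1) ^ (p * s) * (z ^ s * y) := by
  induction s with
  | zero => simp
  | succ s ih =>
    rw [pow_succ, mul_add, mul_one]
    exact sc_mul ih h

lemma sc_list {ι : Type*} {y : A} (f : ι → A) (p : ι → ℕ) (L : List ι)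
    (h : ∀ t ∈ L, y * f t = (-1) ^ p t * (f t * y)) :
    y * (L.map f).prod = (-1) ^ (L.map p).sum * ((L.map f).prod * y) := by
  induction L with
  | nil => simp
  | cons t L ih =>
    simp only [List.map_cons, List.prod_cons, List.sum_cons]
    exact sc_mul (h t (by simp)) (ih fun u hu => h u (by simp [hu]))

lemma sum_range_list (f : ℕ → ℕ) (N : ℕ) :
    ((List.range N).map f).sum = ∑ i ∈ Finset.range N, f i := by
  induction N with
  | zero => simp
  | succ N ih => rw [List.range_succ, Finset.sum_range_succ]; simp [ih]

lemma sum_parity (ε l m : ℕ) :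
    (∑ s ∈ Finset.range (m + 1 - l), ε * s) = ∑ t ∈ Finset.range (m - l), ε * (m - l - t) := by
  by_cases h : l ≤ m
  · obtain ⟨M, rfl⟩ := Nat.exists_eq_add_of_le h
    have h1 : l + M + 1 - l = M + 1 := by omega
    have h2 : l + M - l = M := by omega
    rw [h1, h2, ← Finset.mul_sum, ← Finset.mul_sum]
    congr 1
    rw [← Finset.sum_range_reflect, Finset.sum_range_succ]
    simp
  · have h1 : m + 1 - l = 0 := by omega
    have h2 : m - l = 0 := by omega
    simp [h1, h2]

variable {y : ONH 𝕜 n k} {l m ε : ℕ}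

lemma sc_tauLong (ht : ∀ j, l ≤ j → j + 1 ≤ m → y * tau j = (-1) ^ ε * (tau j * y)) :
    y * tauLong l m = (-1) ^ (∑ t ∈ Finset.range (m - l), ε * (m - l - t)) * (tauLong l m * y) := by
  rw [← sum_range_list]
  refine sc_list _ (fun t => ε * (m - l - t)) _ fun t ht' => ?_
  have := sc_list (y := y) (fun s => (tau (l + s) : ONH 𝕜 n k)) (fun _ => ε)
    (List.range (m - l - t)) (fun s hs => ht (l + s) (by omega) (by
      rw [List.mem_range] at hs; omega))
  simpa [mul_comm] using this

lemma sc_even {y z w : ONH 𝕜 n k} {p q N : ℕ} (hpq : p = q) (h1 : y * z = (-1) ^ p * (z * y))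
    (h2 : y * w = (-1) ^ q * (w * y)) : Commute y ((-1) ^ N * (z * w)) := by
  have h := sc_mul h1 h2
  rw [hpq, ← two_mul, pow_mul, neg_one_sq, one_pow, one_mul] at h
  exact ((Commute.neg_one_right y).pow_right N).mul_right h

lemma commute_e (hx : ∀ j, l ≤ j → j ≤ m → y * x j = (-1) ^ ε * (x j * y))
    (ht : ∀ j, l ≤ j → j + 1 ≤ m → y * tau j = (-1) ^ ε * (tau j * y)) :
    Commute y (e l m) := by
  have h : y * xDown l m
      = (-1) ^ (∑ s ∈ Finset.range (m + 1 - l), ε * s) * (xDown l m * y) := by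
    rw [← sum_range_list]
    refine sc_list _ (fun s => ε * s) _ fun s hs => sc_pow (hx _ ?_ ?_) s <;>
    (rw [List.mem_range] at hs; omega)
  exact sc_even (sum_parity ε l m).symm (sc_tauLong ht) h

lemma commute_e' (hx : ∀ j, l ≤ j → j ≤ m → y * x j = (-1) ^ ε * (x j * y))
    (ht : ∀ j, l ≤ j → j + 1 ≤ m → y * tau j = (-1) ^ ε * (tau j * y)) :
    Commute y (e' l m) := by
  have h : y * xUp l m
      = (-1) ^ (∑ s ∈ Finset.range (m + 1 - l), ε * s) * (xUp l m * y) := by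
    rw [← sum_range_list]
    refine sc_list _ (fun s => ε * s) _ fun s hs => sc_pow (hx _ ?_ ?_) s <;>
    (rw [List.mem_range] at hs; omega)
  exact sc_even (sum_parity ε l m) h (sc_tauLong ht)

/-- The image of `ONH_a^n` in `ONH_m^n` commutes with `e_{[a+1,m]}` and `e'_{[a+1,m]}`. -/
lemma commute_incl {a m : ℕ} (h : a ≤ m) (s : ONH 𝕜 n a) :
    Commute (incl h s) (e (a + 1) m) ∧ Commute (incl h s) (e' (a + 1) m) := by
  induction s using ONH.induction with
  | hc r => simp only [AlgHom.commutes]; exact ⟨Algebra.commutes _ _, Algebra.commutes _ _⟩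
  | hg g =>
    rw [incl_gen]
    suffices ∃ ε : ℕ, (∀ j, a + 1 ≤ j → j ≤ m → inclGen (𝕜 := 𝕜) a m g * x j
        = (-1) ^ ε * (x j * inclGen a m g)) ∧ (∀ j, a + 1 ≤ j → j + 1 ≤ m →
        inclGen (𝕜 := 𝕜) a m g * tau j = (-1) ^ ε * (tau j * inclGen a m g)) by
      obtain ⟨ε, h1, h2⟩ := this
      exact ⟨commute_e h1 h2, commute_e' h1 h2⟩
    cases g with
    | x i =>
      refine ⟨1, fun j h1 h2 => ?_, fun j h1 h2 => ?_⟩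
      · have := mk_rel (Rel.x_x (𝕜 := 𝕜) (n := n) (k := m) (i + 1) j (by omega) (by omega)
          (by omega))
        simpa [inclGen, x, eq_neg_iff_add_eq_zero] using this
      · have := mk_rel (Rel.x_tau_far (𝕜 := 𝕜) (n := n) (k := m) (i + 1) j (by omega) (by omega)
          (by omega) (by omega))
        simpa [inclGen, x, tau, eq_neg_iff_add_eq_zero] using this
    | tau i =>
      refine ⟨1, fun j h1 h2 => ?_, fun j h1 h2 => ?_⟩
      · have := mk_rel (Rel.x_tau_far (𝕜 := 𝕜) (n := n) (k := m) j (i + 1) (by omega) (by omega)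
          (by omega) (by omega))
        simpa [inclGen, x, tau, eq_neg_iff_add_eq_zero, add_comm] using this
      · have := mk_rel (Rel.tau_tau (𝕜 := 𝕜) (n := n) (k := m) (i + 1) j (by omega) (by omega)
          (by omega))
        simpa [inclGen, tau, eq_neg_iff_add_eq_zero] using this
    | chi i =>
      refine ⟨0, fun j h1 h2 => ?_, fun j h1 h2 => ?_⟩
      · have := mk_rel (Rel.x_chi (𝕜 := 𝕜) (n := n) (k := m) j (i + 1) (by omega) (by omega))
        simpa [inclGen, x, chi] using this
      · have := mk_rel (Rel.tau_chi (𝕜 := 𝕜) (n := n) (k := m) j (i + 1) (by omega) (by omega))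
        simpa [inclGen, tau, chi] using this
    | d =>
      refine ⟨1, fun j h1 h2 => ?_, fun j h1 h2 => ?_⟩
      · have := mk_rel (Rel.x_d (𝕜 := 𝕜) (n := n) (k := m) j (by omega))
        simpa [inclGen, x, d] using this
      · have := mk_rel (Rel.tau_d (𝕜 := 𝕜) (n := n) (k := m) j (by omega))
        simpa [inclGen, tau, d] using this
  | ha a b h1 h2 => simp only [map_add]; exact ⟨h1.1.add_left h2.1, h1.2.add_left h2.2⟩
  | hm a b h1 h2 => simp only [map_mul]; exact ⟨h1.1.mul_left h2.1, h1.2.mul_left h2.2⟩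

end commute

/-! ### The complexes -/

variable (𝕜 n)

/-- The map `h ↦ p * h * q`. -/
noncomputable def sandwich {A : Type u} [Ring A] [Algebra 𝕜 A] (p q : A) : A →ₗ[𝕜] A :=
  LinearMap.mulLeft 𝕜 p ∘ₗ LinearMap.mulRight 𝕜 q

/-- The `m`-th term of the complex with parameters `a`, `b`: it is
`e'_{[a+1,m]} ONH_m^n e_{[b+1,m]}` for `max a b ≤ m ≤ n`, and zero otherwise. -/
noncomputable def T (a b m : ℕ) : Submodule 𝕜 (ONH 𝕜 n m) :=
  if a ≤ m ∧ b ≤ m ∧ m ≤ n then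
    LinearMap.range (sandwich 𝕜 (e' (𝕜 := 𝕜) (n := n) (a + 1) m) (e (b + 1) m))
  else ⊥

/-- The differential `h ↦ e'_{[a+1,m+1]} h e_{[b+1,m+1]}`. -/
noncomputable def diff (a b m : ℕ) : T 𝕜 n a b m →ₗ[𝕜] T 𝕜 n a b (m + 1) :=
  if h : a ≤ m ∧ b ≤ m ∧ m + 1 ≤ n then
    LinearMap.codRestrict (T 𝕜 n a b (m + 1))
      (sandwich 𝕜 (e' (𝕜 := 𝕜) (n := n) (a + 1) (m + 1)) (e (b + 1) (m + 1)) ∘ₗ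
        (incl (Nat.le_succ m)).toLinearMap ∘ₗ (T 𝕜 n a b m).subtype)
      (fun c => by
        rw [T, if_pos (by omega)]
        exact LinearMap.mem_range_self _ _)
  else 0

lemma diff_coe {a b m : ℕ} (h : a ≤ m ∧ b ≤ m ∧ m + 1 ≤ n) (c : T 𝕜 n a b m) :
    (diff 𝕜 n a b m c : ONH 𝕜 n (m + 1))
      = e' (a + 1) (m + 1) * (incl (Nat.le_succ m) (c : ONH 𝕜 n m) * e (b + 1) (m + 1)) := by
  rw [diff, dif_pos h]; rfl

lemma diff_zero {a b m : ℕ} (h : ¬ (a ≤ m ∧ b ≤ m ∧ m + 1 ≤ n)) : diff 𝕜 n a b m = 0 := by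
  rw [diff, dif_neg h]

/-- The image in the `m`-th term of the incoming differential. -/
noncomputable def bdry (a b : ℕ) : (m : ℕ) → Submodule 𝕜 (T 𝕜 n a b m)
  | 0 => ⊥
  | m + 1 => LinearMap.range (diff 𝕜 n a b m)

variable {𝕜 n}

lemma lmul_mem {a b m : ℕ} (ha : a ≤ m) (s : ONH 𝕜 n a) {h : ONH 𝕜 n m}
    (hh : h ∈ T 𝕜 n a b m) : incl ha s * h ∈ T 𝕜 n a b m := by
  unfold T at *
  split_ifs at * with hc
  · obtain ⟨g, rfl⟩ := hh
    refine ⟨incl ha s * g, ?_⟩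
    simp only [sandwich, LinearMap.comp_apply, LinearMap.mulLeft_apply, LinearMap.mulRight_apply]
    rw [← mul_assoc (incl ha s), (commute_incl ha s).2.eq]
    simp only [mul_assoc]
  · rw [Submodule.mem_bot] at *
    simp [hh]

lemma rmul_mem {a b m : ℕ} (hb : b ≤ m) (s : ONH 𝕜 n b) {h : ONH 𝕜 n m}
    (hh : h ∈ T 𝕜 n a b m) : h * incl hb s ∈ T 𝕜 n a b m := by
  unfold T at *
  split_ifs at * with hc
  · obtain ⟨g, rfl⟩ := hh
    refine ⟨g * incl hb s, ?_⟩
    simp only [sandwich, LinearMap.comp_apply, LinearMap.mulLeft_apply, LinearMap.mulRight_apply]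
    rw [mul_assoc g, (commute_incl hb s).1.eq]
    simp only [mul_assoc]
  · rw [Submodule.mem_bot] at *
    simp [hh]

/-- Left multiplication by elements of `ONH_a^n` on the terms of the complex. -/
noncomputable def lmul {a b m : ℕ} (ha : a ≤ m) (s : ONH 𝕜 n a) :
    T 𝕜 n a b m →ₗ[𝕜] T 𝕜 n a b m :=
  (LinearMap.mulLeft 𝕜 (incl ha s)).restrict fun _ hh => by
    rw [LinearMap.mulLeft_apply]; exact lmul_mem ha s hh

lemma lmul_coe {a b m : ℕ} (ha : a ≤ m) (s : ONH 𝕜 n a) (c : T 𝕜 n a b m) :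
    (lmul ha s c : ONH 𝕜 n m) = incl ha s * c := rfl

/-- Right multiplication by elements of `ONH_b^n` on the terms of the complex. -/
noncomputable def rmul {a b m : ℕ} (hb : b ≤ m) (s : ONH 𝕜 n b) :
    T 𝕜 n a b m →ₗ[𝕜] T 𝕜 n a b m :=
  (LinearMap.mulRight 𝕜 (incl hb s)).restrict fun _ hh => by
    rw [LinearMap.mulRight_apply]; exact rmul_mem hb s hh

lemma rmul_coe {a b m : ℕ} (hb : b ≤ m) (s : ONH 𝕜 n b) (c : T 𝕜 n a b m) :
    (rmul hb s c : ONH 𝕜 n m) = c * incl hb s := rfl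

lemma lmul_bdry {a b m : ℕ} (ha : a ≤ m) (s : ONH 𝕜 n a) :
    bdry 𝕜 n a b m ≤ (bdry 𝕜 n a b m).comap (lmul ha s) := by
  cases m with
  | zero => simp [bdry]
  | succ m =>
    rintro _ ⟨c, rfl⟩
    by_cases hc : a ≤ m ∧ b ≤ m ∧ m + 1 ≤ n
    · refine ⟨lmul hc.1 s c, ?_⟩
      apply Subtype.ext
      rw [diff_coe 𝕜 n hc, lmul_coe, lmul_coe, diff_coe 𝕜 n hc, map_mul, incl_incl]
      rw [← mul_assoc (incl ha s), (commute_incl ha s).2.eq]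
      simp only [mul_assoc]
    · rw [diff_zero 𝕜 n hc]; simp

lemma rmul_bdry {a b m : ℕ} (hb : b ≤ m) (s : ONH 𝕜 n b) :
    bdry 𝕜 n a b m ≤ (bdry 𝕜 n a b m).comap (rmul hb s) := by
  cases m with
  | zero => simp [bdry]
  | succ m =>
    rintro _ ⟨c, rfl⟩
    by_cases hc : a ≤ m ∧ b ≤ m ∧ m + 1 ≤ n
    · refine ⟨rmul hc.2.1 s c, ?_⟩
      apply Subtype.ext
      rw [diff_coe 𝕜 n hc, rmul_coe, rmul_coe, diff_coe 𝕜 n hc, map_mul, incl_incl]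
      rw [mul_assoc (incl _ (c : ONH 𝕜 n m)), (commute_incl hb s).1.eq]
      simp only [mul_assoc]
    · rw [diff_zero 𝕜 n hc]; simp

variable (𝕜 n)

/-- `C_{n,k}`: the cohomology at the last term (`m = n`, where the outgoing differential is zero) of
the complex with parameters `a = n - k`, `b = k`. -/
def C (k : Fin (n + 1)) : Type u := T 𝕜 n (n - k) k n ⧸ bdry 𝕜 n (n - k) k n

noncomputable instance (k : Fin (n + 1)) : AddCommGroup (C 𝕜 n k) :=
  inferInstanceAs (AddCommGroup (T 𝕜 n (n - k) k n ⧸ bdry 𝕜 n (n - k) k n))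

noncomputable instance (k : Fin (n + 1)) : Module 𝕜 (C 𝕜 n k) :=
  inferInstanceAs (Module 𝕜 (T 𝕜 n (n - k) k n ⧸ bdry 𝕜 n (n - k) k n))

/-- The class in `C_{n,k}` of an element of the last term of the complex. -/
noncomputable def toC (k : Fin (n + 1)) : T 𝕜 n (n - k) k n →ₗ[𝕜] C 𝕜 n k :=
  (bdry 𝕜 n (n - k) k n).mkQ

/-- The left action of `ONH_{n-k}^n` on `C_{n,k}`, induced by left multiplication. -/
noncomputable def lactC (k : Fin (n + 1)) : ONH 𝕜 n (n - k) →+* Module.End 𝕜 (C 𝕜 n k) where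
  toFun s := (bdry 𝕜 n (n - k) k n).mapQ (bdry 𝕜 n (n - k) k n)
    (lmul (Nat.sub_le n k) s) (lmul_bdry _ s)
  map_one' := by
    refine LinearMap.ext fun c => ?_
    induction c using Submodule.Quotient.induction_on with
    | _ c => exact congrArg _ (Subtype.ext (by simp [lmul_coe]))
  map_mul' s t := by
    refine LinearMap.ext fun c => ?_
    induction c using Submodule.Quotient.induction_on with
    | _ c => exact congrArg _ (Subtype.ext (by simp [lmul_coe, mul_assoc]))
  map_zero' := by
    refine LinearMap.ext fun c => ?_
    induction c using Submodule.Quotient.induction_on with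
    | _ c => exact congrArg _ (Subtype.ext (by simp [lmul_coe]))
  map_add' s t := by
    refine LinearMap.ext fun c => ?_
    induction c using Submodule.Quotient.induction_on with
    | _ c => exact congrArg _ (Subtype.ext (by simp [lmul_coe, add_mul]))

/-- The right action of `ONH_k^n` on `C_{n,k}`, induced by right multiplication. -/
noncomputable def ractC (k : Fin (n + 1)) : (ONH 𝕜 n k)ᵐᵒᵖ →+* Module.End 𝕜 (C 𝕜 n k) where
  toFun s := (bdry 𝕜 n (n - k) k n).mapQ (bdry 𝕜 n (n - k) k n)
    (rmul (Nat.lt_succ_iff.mp k.2) s.unop) (rmul_bdry _ s.unop)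
  map_one' := by
    refine LinearMap.ext fun c => ?_
    induction c using Submodule.Quotient.induction_on with
    | _ c => exact congrArg _ (Subtype.ext (by simp [rmul_coe]))
  map_mul' s t := by
    refine LinearMap.ext fun c => ?_
    induction c using Submodule.Quotient.induction_on with
    | _ c => exact congrArg _ (Subtype.ext (by simp [rmul_coe, mul_assoc]))
  map_zero' := by
    refine LinearMap.ext fun c => ?_
    induction c using Submodule.Quotient.induction_on with
    | _ c => exact congrArg _ (Subtype.ext (by simp [rmul_coe]))
  map_add' s t := by
    refine LinearMap.ext fun c => ?_
    induction c using Submodule.Quotient.induction_on with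
    | _ c => exact congrArg _ (Subtype.ext (by simp [rmul_coe, mul_add]))

noncomputable instance (k : Fin (n + 1)) : Module (ONH 𝕜 n (n - k)) (C 𝕜 n k) :=
  Module.compHom (C 𝕜 n k) (lactC 𝕜 n k)

noncomputable instance (k : Fin (n + 1)) : Module (ONH 𝕜 n k)ᵐᵒᵖ (C 𝕜 n k) :=
  Module.compHom (C 𝕜 n k) (ractC 𝕜 n k)

/-- The homogeneous components of `C_{n,k}`: classes of homogeneous elements. -/
noncomputable def gradC (k : Fin (n + 1)) (g : ℤ × ZMod 2) : Submodule 𝕜 (C 𝕜 n k) :=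
  ((homog 𝕜 n n g).comap (T 𝕜 n (n - k) k n).subtype).map (toC 𝕜 n k)

/-- `e'_{[1,n-k]} C_{n,k} e_{[1,k]}`. -/
noncomputable def cutC (k : Fin (n + 1)) : Submodule 𝕜 (C 𝕜 n k) :=
  LinearMap.range (lactC 𝕜 n k (e' 1 (n - k)) ∘ₗ ractC 𝕜 n k (MulOpposite.op (e 1 k)))

/-- The homogeneous components of `e'_{[1,n-k]} C_{n,k} e_{[1,k]}`. -/
noncomputable def gradCutC (k : Fin (n + 1)) (g : ℤ × ZMod 2) : Submodule 𝕜 (cutC 𝕜 n k) :=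
  (gradC 𝕜 n k g).comap (cutC 𝕜 n k).subtype

end ONH

end Presentation

/-! ## The odd equivariant Grassmannian cohomology superalgebras -/

section Grassmannian

variable (𝕜 : Type u) [CommRing 𝕜] (n k : ℕ)

/-- Generators of the superalgebra `OPol_k ⊗ A_n`. -/
inductive PGen (n k : ℕ) : Type
  | x (i : Fin k)
  | chi (i : Fin (n / 2))
  | d

/-- (degree, parity) of the generators. -/
def PGen.deg {n k : ℕ} : PGen n k → ℤ × ZMod 2
  | .x _ => (2, 1)
  | .chi i => (4 * ((i : ℕ) + 1 : ℤ), 0)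
  | .d => (2, 1)

/-- The relations of `OPol_k ⊗ A_n`: those of the skew polynomial algebra `OPol_k`, those of `A_n`,
and supercommutation of the two tensor factors. -/
inductive PRel : FreeAlgebra 𝕜 (PGen n k) → FreeAlgebra 𝕜 (PGen n k) → Prop
  | x_x (i j : Fin k) (hij : i ≠ j) : PRel (FreeAlgebra.ι 𝕜 (.x i) * FreeAlgebra.ι 𝕜 (.x j))
      (-(FreeAlgebra.ι 𝕜 (.x j) * FreeAlgebra.ι 𝕜 (.x i)))
  | d_sq : PRel (FreeAlgebra.ι 𝕜 .d * FreeAlgebra.ι 𝕜 .d) 0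
  | d_chi_top (i : Fin (n / 2)) (hn : Even n) (hi : (i : ℕ) + 1 = n / 2) :
      PRel (FreeAlgebra.ι 𝕜 .d * FreeAlgebra.ι 𝕜 (.chi i)) 0
  | d_zero (hn : n = 0) : PRel (FreeAlgebra.ι 𝕜 .d) 0
  | chi_chi (i j : Fin (n / 2)) : PRel (FreeAlgebra.ι 𝕜 (.chi i) * FreeAlgebra.ι 𝕜 (.chi j))
      (FreeAlgebra.ι 𝕜 (.chi j) * FreeAlgebra.ι 𝕜 (.chi i))
  | chi_d (i : Fin (n / 2)) : PRel (FreeAlgebra.ι 𝕜 (.chi i) * FreeAlgebra.ι 𝕜 .d)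
      (FreeAlgebra.ι 𝕜 .d * FreeAlgebra.ι 𝕜 (.chi i))
  | x_chi (i : Fin k) (j : Fin (n / 2)) : PRel (FreeAlgebra.ι 𝕜 (.chi j) * FreeAlgebra.ι 𝕜 (.x i))
      (FreeAlgebra.ι 𝕜 (.x i) * FreeAlgebra.ι 𝕜 (.chi j))
  | x_d (i : Fin k) : PRel (FreeAlgebra.ι 𝕜 .d * FreeAlgebra.ι 𝕜 (.x i))
      (-(FreeAlgebra.ι 𝕜 (.x i) * FreeAlgebra.ι 𝕜 .d))

/-- The superalgebra `OPol_k ⊗ A_n`. -/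
def OPolA : Type u := RingQuot (PRel 𝕜 n k)

noncomputable instance : Ring (OPolA 𝕜 n k) := inferInstanceAs (Ring (RingQuot (PRel 𝕜 n k)))

noncomputable instance : Algebra 𝕜 (OPolA 𝕜 n k) :=
  inferInstanceAs (Algebra 𝕜 (RingQuot (PRel 𝕜 n k)))

namespace OPolA

/-- The quotient map from the free algebra. -/
noncomputable def mk : FreeAlgebra 𝕜 (PGen n k) →ₐ[𝕜] OPolA 𝕜 n k :=
  RingQuot.mkAlgHom 𝕜 (PRel 𝕜 n k)

/-- The image of a generator. -/
noncomputable def gen (g : PGen n k) : OPolA 𝕜 n k := mk 𝕜 n k (FreeAlgebra.ι 𝕜 g)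

lemma rel {a b : FreeAlgebra 𝕜 (PGen n k)} (h : PRel 𝕜 n k a b) : mk 𝕜 n k a = mk 𝕜 n k b :=
  RingQuot.mkAlgHom_rel 𝕜 h

/-- The homogeneous component of the given degree and parity. -/
noncomputable def homog (g : ℤ × ZMod 2) : Submodule 𝕜 (OPolA 𝕜 n k) :=
  Submodule.span 𝕜
    {y | ∃ w : List (PGen n k), (w.map PGen.deg).sum = g ∧ y = (w.map (gen 𝕜 n k)).prod}

/-- `∂_i(x_j)`, which is `1` for `j = i, i + 1` and `0` otherwise. Here `p`, `q` are the two indices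
exchanged by `s_i`. -/
noncomputable def delta (p q j : Fin k) : OPolA 𝕜 n k := if j = p ∨ j = q then 1 else 0

/-- The matrices `[s_i(y), ∂_i(y); 0, y]` for `y` a generator, where `s_i(x_j) = -x_{s_i(j)}`,
`s_i(χ_j) = χ_j`, `s_i(d) = -d`, and `∂_i(χ_j) = ∂_i(d) = 0`. Here `p`, `q` are the two
indices exchanged by `s_i`. -/
noncomputable def divMatGen (p q : Fin k) : PGen n k → Matrix (Fin 2) (Fin 2) (OPolA 𝕜 n k)
  | .x j => !![-gen 𝕜 n k (.x (Equiv.swap p q j)), delta 𝕜 n k p q j;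
      0, gen 𝕜 n k (.x j)]
  | .chi j => !![gen 𝕜 n k (.chi j), 0; 0, gen 𝕜 n k (.chi j)]
  | .d => !![-gen 𝕜 n k .d, 0; 0, gen 𝕜 n k .d]

/-- The algebra morphism `f ↦ [s(f), ∂(f); 0, f]`, which encodes the twisted Leibniz rule
`∂(fg) = ∂(f) g + s(f) ∂(g)`. -/
noncomputable def divMat (p q : Fin k) :
    OPolA 𝕜 n k →ₐ[𝕜] Matrix (Fin 2) (Fin 2) (OPolA 𝕜 n k) :=
  RingQuot.liftAlgHom 𝕜 ⟨FreeAlgebra.lift 𝕜 (divMatGen 𝕜 n k p q), by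
    intro u v huv
    induction huv with
    | x_x i j hij =>
      have h0 := rel 𝕜 n k (PRel.x_x i j hij)
      have h1 := rel 𝕜 n k (PRel.x_x (n := n) (𝕜 := 𝕜) (Equiv.swap p q i) (Equiv.swap p q j)
        (fun h => hij ((Equiv.swap p q).injective h)))
      simp only [map_mul, map_neg] at h0 h1
      change gen 𝕜 n k _ * gen 𝕜 n k _ = -(gen 𝕜 n k _ * gen 𝕜 n k _) at h0
      change gen 𝕜 n k _ * gen 𝕜 n k _ = -(gen 𝕜 n k _ * gen 𝕜 n k _) at h1
      simp only [map_mul, map_neg, FreeAlgebra.lift_ι_apply, divMatGen]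
      ext a b
      fin_cases a <;> fin_cases b
      · simp [Matrix.mul_apply, Fin.sum_univ_two, h1]
      · simp only [Matrix.mul_apply, Fin.sum_univ_two, Matrix.neg_apply]
        simp only [Matrix.of_apply, Matrix.cons_val', Matrix.cons_val_fin_one, Fin.zero_eta,
          Fin.mk_one, Matrix.cons_val_zero, Matrix.cons_val_one]
        by_cases hi : i = p ∨ i = q <;> by_cases hj : j = p ∨ j = q
        · have e1 : Equiv.swap p q i = j := by
            rcases hi with rfl | rfl <;> rcases hj with rfl | rfl <;> simp_all
          have e2 : Equiv.swap p q j = i := by rw [← e1]; simp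
          simp [delta, hi, hj, e1, e2]
        · have e2 : Equiv.swap p q j = j :=
            Equiv.swap_apply_of_ne_of_ne (fun h => hj (.inl h)) (fun h => hj (.inr h))
          simp [delta, hi, hj, e2]
        · have e1 : Equiv.swap p q i = i :=
            Equiv.swap_apply_of_ne_of_ne (fun h => hi (.inl h)) (fun h => hi (.inr h))
          simp [delta, hi, hj, e1]
        · simp [delta, hi, hj]
      · simp [Matrix.mul_apply, Fin.sum_univ_two]
      · simp [Matrix.mul_apply, Fin.sum_univ_two, h0]
    | d_sq =>
      have h0 := rel 𝕜 n k PRel.d_sq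
      simp only [map_mul, map_zero] at h0
      change gen 𝕜 n k _ * gen 𝕜 n k _ = 0 at h0
      simp only [map_mul, map_zero, FreeAlgebra.lift_ι_apply, divMatGen]
      ext a b
      fin_cases a <;> fin_cases b <;> simp [Matrix.mul_apply, Fin.sum_univ_two, h0]
    | d_chi_top i hn hi =>
      have h0 := rel 𝕜 n k (PRel.d_chi_top i hn hi)
      simp only [map_mul, map_zero] at h0
      change gen 𝕜 n k _ * gen 𝕜 n k _ = 0 at h0
      simp only [map_mul, map_zero, FreeAlgebra.lift_ι_apply, divMatGen]
      ext a b
      fin_cases a <;> fin_cases b <;> simp [Matrix.mul_apply, Fin.sum_univ_two, h0]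
    | d_zero hn =>
      have h0 := rel 𝕜 n k (PRel.d_zero hn)
      simp only [map_zero] at h0
      change gen 𝕜 n k _ = 0 at h0
      simp only [map_zero, FreeAlgebra.lift_ι_apply, divMatGen]
      ext a b
      fin_cases a <;> fin_cases b <;> simp [h0]
    | chi_chi i j =>
      have h0 := rel 𝕜 n k (PRel.chi_chi i j)
      simp only [map_mul] at h0
      change gen 𝕜 n k _ * gen 𝕜 n k _ = gen 𝕜 n k _ * gen 𝕜 n k _ at h0
      simp only [map_mul, FreeAlgebra.lift_ι_apply, divMatGen]
      ext a b
      fin_cases a <;> fin_cases b <;> simp [Matrix.mul_apply, Fin.sum_univ_two, h0]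
    | chi_d i =>
      have h0 := rel 𝕜 n k (PRel.chi_d i)
      simp only [map_mul] at h0
      change gen 𝕜 n k _ * gen 𝕜 n k _ = gen 𝕜 n k _ * gen 𝕜 n k _ at h0
      simp only [map_mul, FreeAlgebra.lift_ι_apply, divMatGen]
      ext a b
      fin_cases a <;> fin_cases b <;> simp [Matrix.mul_apply, Fin.sum_univ_two, h0]
    | x_chi i j =>
      have h0 := rel 𝕜 n k (PRel.x_chi i j)
      have h1 := rel 𝕜 n k (PRel.x_chi (Equiv.swap p q i) j)
      simp only [map_mul] at h0 h1
      change gen 𝕜 n k _ * gen 𝕜 n k _ = gen 𝕜 n k _ * gen 𝕜 n k _ at h0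
      change gen 𝕜 n k _ * gen 𝕜 n k _ = gen 𝕜 n k _ * gen 𝕜 n k _ at h1
      simp only [map_mul, FreeAlgebra.lift_ι_apply, divMatGen]
      ext a b
      fin_cases a <;> fin_cases b <;>
      by_cases hi : i = p ∨ i = q <;>
      simp [Matrix.mul_apply, Fin.sum_univ_two, h0, h1, delta, hi]
    | x_d i =>
      have h0 := rel 𝕜 n k (PRel.x_d i)
      have h1 := rel 𝕜 n k (PRel.x_d (Equiv.swap p q i))
      simp only [map_mul, map_neg] at h0 h1
      change gen 𝕜 n k _ * gen 𝕜 n k _ = -(gen 𝕜 n k _ * gen 𝕜 n k _) at h0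
      change gen 𝕜 n k _ * gen 𝕜 n k _ = -(gen 𝕜 n k _ * gen 𝕜 n k _) at h1
      simp only [map_mul, map_neg, FreeAlgebra.lift_ι_apply, divMatGen]
      ext a b
      fin_cases a <;> fin_cases b <;>
      by_cases hi : i = p ∨ i = q <;>
      simp [Matrix.mul_apply, Fin.sum_univ_two, h0, h1, delta, hi]⟩

/-- The odd divided difference operator exchanging the variables `x_p` and `x_q`. -/
noncomputable def divDiff (p q : Fin k) (f : OPolA 𝕜 n k) : OPolA 𝕜 n k :=
  divMat 𝕜 n k p q f 0 1

lemma divMat_gen (p q : Fin k) (g : PGen n k) :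
    divMat 𝕜 n k p q (gen 𝕜 n k g) = divMatGen 𝕜 n k p q g := by
  unfold divMat gen mk
  erw [RingQuot.liftAlgHom_mkAlgHom_apply]
  rw [FreeAlgebra.lift_ι_apply]

lemma divMat_lower (p q : Fin k) (f : OPolA 𝕜 n k) :
    divMat 𝕜 n k p q f 1 0 = 0 ∧ divMat 𝕜 n k p q f 1 1 = f := by
  obtain ⟨f, rfl⟩ := RingQuot.mkAlgHom_surjective 𝕜 (PRel 𝕜 n k) f
  change divMat 𝕜 n k p q (mk 𝕜 n k f) 1 0 = 0 ∧ divMat 𝕜 n k p q (mk 𝕜 n k f) 1 1 = mk 𝕜 n k f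
  induction f using FreeAlgebra.induction with
  | grade0 r => simp [Matrix.algebraMap_matrix_apply]
  | grade1 g =>
    change divMat 𝕜 n k p q (gen 𝕜 n k g) 1 0 = 0 ∧
      divMat 𝕜 n k p q (gen 𝕜 n k g) 1 1 = gen 𝕜 n k g
    rw [divMat_gen]
    cases g <;> simp [divMatGen]
  | mul a b h1 h2 => simp [Matrix.mul_apply, Fin.sum_univ_two, h1, h2]
  | add a b h1 h2 => simp [h1, h2]

/-- `OΛ_k ⊗ A_n`: the subalgebra of `OPol_k ⊗ A_n` of elements killed by the odd divided difference
operators `∂_1, …, ∂_{k-1}`. -/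
noncomputable def OSymA : Subalgebra 𝕜 (OPolA 𝕜 n k) where
  carrier := {f | ∀ p q : Fin k, (p : ℕ) + 1 = q → divDiff 𝕜 n k p q f = 0}
  mul_mem' {f g} hf hg p q h := by
    have h1 := hf p q h
    have h2 := hg p q h
    unfold divDiff at *
    simp [Matrix.mul_apply, Fin.sum_univ_two, h1, h2, divMat_lower]
  add_mem' {f g} hf hg p q h := by
    have h1 := hf p q h
    have h2 := hg p q h
    unfold divDiff at *
    simp [h1, h2]
  algebraMap_mem' r p q h := by
    unfold divDiff
    simp [Matrix.algebraMap_matrix_apply]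

/-- `x̃_i = (-1)^{i-1} x_i` for `1 ≤ i ≤ k` (here `i` is counted from `0`). -/
noncomputable def xt (i : Fin k) : OPolA 𝕜 n k := (-1) ^ (i : ℕ) * gen 𝕜 n k (.x i)

open Classical in
/-- `h_m = ∑_{i_1 ≤ ⋯ ≤ i_m} x̃_{i_1} ⋯ x̃_{i_m}`. -/
noncomputable def hsym (m : ℕ) : OPolA 𝕜 n k :=
  ∑ f : Fin m → Fin k, if Monotone f then (List.ofFn fun s => xt 𝕜 n k (f s)).prod else 0

/-- `χ_i`, with `χ_0 = 1`. -/
noncomputable def chi (i : ℕ) : OPolA 𝕜 n k :=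
  if i = 0 then 1 else if h : 1 ≤ i ∧ i ≤ n / 2 then gen 𝕜 n k (.chi ⟨i - 1, by omega⟩) else 0

/-- `c_r = χ_{r/2}` for `r` even and `c_r = d χ_{(r-1)/2}` for `r` odd. -/
noncomputable def c (r : ℕ) : OPolA 𝕜 n k :=
  if Even r then chi 𝕜 n k (r / 2) else gen 𝕜 n k .d * chi 𝕜 n k (r / 2)

/-- `h'_m = ∑_{r=0}^m (-1)^r h_{m-r} ⊗ c_r`. -/
noncomputable def hPrime (m : ℕ) : OPolA 𝕜 n k :=
  ∑ r ∈ Finset.range (m + 1), (-1) ^ r * hsym 𝕜 n k (m - r) * c 𝕜 n k r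

end OPolA

/-- The relations `h'_m = 0` for `n - k + 1 ≤ m ≤ n`. -/
def MRel (f g : OPolA.OSymA 𝕜 n k) : Prop :=
  g = 0 ∧ ∃ m : ℕ, n + 1 ≤ m + k ∧ m ≤ n ∧ (f : OPolA 𝕜 n k) = OPolA.hPrime 𝕜 n k m

/-- `M_k^n = (OΛ_k ⊗ A_n) / ⟨h'_m, n - k + 1 ≤ m ≤ n⟩`. -/
def M : Type u := RingQuot (MRel 𝕜 n k)

noncomputable instance : Ring (M 𝕜 n k) := inferInstanceAs (Ring (RingQuot (MRel 𝕜 n k)))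

noncomputable instance : Algebra 𝕜 (M 𝕜 n k) := inferInstanceAs (Algebra 𝕜 (RingQuot (MRel 𝕜 n k)))

/-- The homogeneous components of `M_k^n`. -/
noncomputable def M.homog (g : ℤ × ZMod 2) : Submodule 𝕜 (M 𝕜 n k) :=
  ((OPolA.homog 𝕜 n k g).comap (OPolA.OSymA 𝕜 n k).val.toLinearMap).map
    (RingQuot.mkAlgHom 𝕜 (MRel 𝕜 n k)).toLinearMap

end Grassmannian

/-! ## Invertible graded superbimodules -/

section Invertible

variable {𝕜 : Type u} [CommRing 𝕜]

/-- `P` is a graded `(S, R)`-superbimodule over `𝕜`, where `S`, `R` are (`ℤ × ℤ/2`)-graded by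
`gS`, `gR`, and `P` is graded by `gP`. A right `R`-module is a module over the opposite ring. -/
structure IsGradedBimodule {S R P : Type u} [Ring S] [Algebra 𝕜 S] [Ring R] [Algebra 𝕜 R]
    [AddCommGroup P] [Module 𝕜 P] [Module S P] [Module Rᵐᵒᵖ P]
    (gS : ℤ × ZMod 2 → Submodule 𝕜 S) (gR : ℤ × ZMod 2 → Submodule 𝕜 R)
    (gP : ℤ × ZMod 2 → Submodule 𝕜 P) : Prop where
  isInternal : DirectSum.IsInternal gP
  smul_mem : ∀ g h s p, s ∈ gS g → p ∈ gP h → s • p ∈ gP (g + h)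
  op_smul_mem : ∀ g h r p, p ∈ gP g → r ∈ gR h → MulOpposite.op r • p ∈ gP (g + h)
  smul_op_smul : ∀ (s : S) (r : R) (p : P),
    s • (MulOpposite.op r • p) = MulOpposite.op r • (s • p)
  algebraMap_smul : ∀ (c : 𝕜) (p : P), algebraMap 𝕜 S c • p = c • p
  algebraMap_op_smul : ∀ (c : 𝕜) (p : P), MulOpposite.op (algebraMap 𝕜 R c) • p = c • p

/-- The relations `(p r) ⊗ q = p ⊗ (r q)` in `P ⊗ Q`. -/
def balancedRel (𝕜 R P Q : Type u) [CommRing 𝕜] [Ring R] [AddCommGroup P]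
    [Module 𝕜 P] [Module Rᵐᵒᵖ P] [AddCommGroup Q] [Module 𝕜 Q] [Module R Q] :
    Submodule 𝕜 (P ⊗[𝕜] Q) :=
  Submodule.span 𝕜 {z | ∃ (p : P) (r : R) (q : Q),
    z = (MulOpposite.op r • p) ⊗ₜ[𝕜] q - p ⊗ₜ[𝕜] (r • q)}

/-- The tensor product `P ⊗_R Q` of a right module and a left module over a `𝕜`-algebra `R`. -/
abbrev BalancedTensor (𝕜 R P Q : Type u) [CommRing 𝕜] [Ring R] [AddCommGroup P]
    [Module 𝕜 P] [Module Rᵐᵒᵖ P] [AddCommGroup Q] [Module 𝕜 Q] [Module R Q] : Type u :=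
  (P ⊗[𝕜] Q) ⧸ balancedRel 𝕜 R P Q

/-- `p ⊗ q` in `P ⊗_R Q`. -/
def btmul (R : Type u) {P Q : Type u} [Ring R] [AddCommGroup P]
    [Module 𝕜 P] [Module Rᵐᵒᵖ P] [AddCommGroup Q] [Module 𝕜 Q] [Module R Q] (p : P) (q : Q) :
    BalancedTensor 𝕜 R P Q :=
  (balancedRel 𝕜 R P Q).mkQ (p ⊗ₜ[𝕜] q)

/-- `f : P ⊗_R Q → S` is a degree-preserving isomorphism of `(S, S)`-superbimodules, for `P` an
`(S, R)`-superbimodule and `Q` an `(R, S)`-superbimodule. -/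
def IsGradedBimoduleIso {S R P Q : Type u} [Ring S] [Algebra 𝕜 S] [Ring R]
    [AddCommGroup P] [Module 𝕜 P] [Module S P] [Module Rᵐᵒᵖ P]
    [AddCommGroup Q] [Module 𝕜 Q] [Module R Q] [Module Sᵐᵒᵖ Q]
    (gS : ℤ × ZMod 2 → Submodule 𝕜 S) (gP : ℤ × ZMod 2 → Submodule 𝕜 P)
    (gQ : ℤ × ZMod 2 → Submodule 𝕜 Q) (f : BalancedTensor 𝕜 R P Q ≃ₗ[𝕜] S) : Prop :=
  (∀ (s : S) (p : P) (q : Q), f (btmul R (s • p) q) = s * f (btmul R p q)) ∧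
  (∀ (s : S) (p : P) (q : Q), f (btmul R p (MulOpposite.op s • q)) = f (btmul R p q) * s) ∧
  (∀ g h p q, p ∈ gP g → q ∈ gQ h → f (btmul R p q) ∈ gS (g + h))

/-- `P` is an invertible graded `(S, R)`-superbimodule: there is a graded `(R, S)`-superbimodule
`Q` such that `P ⊗_R Q ≅ S` and `Q ⊗_S P ≅ R` as graded superbimodules. -/
def IsInvertible {S R P : Type u} [Ring S] [Algebra 𝕜 S] [Ring R] [Algebra 𝕜 R]
    [AddCommGroup P] [Module 𝕜 P] [Module S P] [Module Rᵐᵒᵖ P]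
    (gS : ℤ × ZMod 2 → Submodule 𝕜 S) (gR : ℤ × ZMod 2 → Submodule 𝕜 R)
    (gP : ℤ × ZMod 2 → Submodule 𝕜 P) : Prop :=
  IsGradedBimodule gS gR gP ∧
  ∃ (Q : Type u) (_ : AddCommGroup Q) (_ : Module 𝕜 Q) (_ : Module R Q) (_ : Module Sᵐᵒᵖ Q)
    (gQ : ℤ × ZMod 2 → Submodule 𝕜 Q), IsGradedBimodule gR gS gQ ∧
    (∃ f : BalancedTensor 𝕜 R P Q ≃ₗ[𝕜] S, IsGradedBimoduleIso gS gP gQ f) ∧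
    (∃ f : BalancedTensor 𝕜 S Q P ≃ₗ[𝕜] R, IsGradedBimoduleIso gR gQ gP f)

end Invertible

end OddCR

noncomputable section

namespace OddCR

open MulOpposite (op op_neg op_sub op_mul op_add op_zero op_one op_smul unop unop_op unop_mul)

/-- Side goals of linear arithmetic. -/
local notation "ω" => by omega

open Finset (range mul_sum sum_congr sum_mul sum_range_succ sum_range_succ' sum_eq_zero mem_range)

open Submodule (smul_mem span subset_span span_induction mem_iSup_of_mem span_le span_mono mem_bot)

open FreeAlgebra (lift_ι_apply)

variable {K : Type u} [CommRing K] {a b i j k l m n p q s L N : ℕ} {v w : List ℕ}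
  {α : ℕ → ℕ} {S : Set ℕ} {g : ℤ × ZMod 2}

/-! ## Words in a nilCoxeter monoid -/

section Words

variable {Q : Type*} [Monoid Q]

/-- The product `T_l T_{l+1} ⋯ T_{l+N-1}`. -/
def asc (T : ℕ → Q) (l N : ℕ) : Q := ((List.range N).map fun s => T (l + s)).prod

/-- The product `T_{l+N-1} ⋯ T_{l+1} T_l`. -/
def desc (T : ℕ → Q) (l : ℕ) : ℕ → Q
  | 0 => 1
  | N + 1 => T (l + N) * desc T l N

/-- The word of the longest element of the symmetric group on `l, …, l + N`. -/
def tl (T : ℕ → Q) (l N : ℕ) : Q := ((List.range N).map fun t => asc T l (N - t)).prod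

/-- The product of the letters of a word. -/
def wd (T : ℕ → Q) (w : List ℕ) : Q := (w.map T).prod

variable (T : ℕ → Q) (l N : ℕ)

@[simp] lemma asc_zero : asc T l 0 = 1 := by simp [asc]
@[simp] lemma desc_zero : desc T l 0 = 1 := rfl
@[simp] lemma tl_zero : tl T l 0 = 1 := by simp [tl]
@[simp] lemma asc_one : asc T l 1 = T l := by simp [asc]
@[simp] lemma desc_one : desc T l 1 = T l := by simp [desc]
@[simp] lemma wd_nil : wd T [] = 1 := rfl
@[simp] lemma wd_cons (i : ℕ) (w : List ℕ) : wd T (i :: w) = T i * wd T w := by simp [wd]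
@[simp] lemma wd_append (v w : List ℕ) : wd T (v ++ w) = wd T v * wd T w := by simp [wd]

lemma asc_succ : asc T l (N + 1) = asc T l N * T (l + N) := by
  simp [asc, List.range_succ]

lemma asc_succ' : asc T l (N + 1) = T l * asc T (l + 1) N := by
  simp only [asc, List.range_succ_eq_map, List.map_cons, List.map_map, List.prod_cons, add_zero]
  congr 3
  funext s
  simp only [Function.comp_apply]
  congr 1; omega

lemma desc_succ : desc T l (N + 1) = T (l + N) * desc T l N := rfl

lemma desc_succ' : desc T l (N + 1) = desc T (l + 1) N * T l := by
  induction N with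
  | zero => simp
  | succ N ih =>
    rw [desc_succ, ih, desc_succ T (l + 1), mul_assoc]
    congr 2; omega

lemma tl_succ : tl T l (N + 1) = asc T l (N + 1) * tl T l N := by
  simp only [tl, List.range_succ_eq_map, List.map_cons, List.map_map, List.prod_cons]
  congr 3
  funext t
  simp

lemma asc_eq_wd : asc T l N = wd T (List.range' l N) := by
  induction N generalizing l with
  | zero => simp
  | succ N ih => rw [asc_succ', ih, List.range'_succ]; simp

lemma map_asc {R : Type*} [Monoid R] (f : Q →* R) : f (asc T l N) = asc (fun i => f (T i)) l N := by
  simp [asc, map_list_prod, Function.comp_def]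

lemma map_desc {R : Type*} [Monoid R] (f : Q →* R) :
    f (desc T l N) = desc (fun i => f (T i)) l N := by
  induction N with
  | zero => simp
  | succ N ih => simp [desc_succ, ih]

lemma map_tl {R : Type*} [Monoid R] (f : Q →* R) : f (tl T l N) = tl (fun i => f (T i)) l N := by
  simp [tl, map_list_prod, Function.comp_def, map_asc]

lemma map_wd {R : Type*} [Monoid R] (f : Q →* R) (w : List ℕ) :
    f (wd T w) = wd (fun i => f (T i)) w := by
  simp [wd, map_list_prod, Function.comp_def]

variable {T l N}

lemma commute_asc {y : Q} (h : ∀ i, l ≤ i → i < l + N → Commute y (T i)) :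
    Commute y (asc T l N) := by
  induction N with
  | zero => simp
  | succ N ih =>
    rw [asc_succ]
    exact (ih fun i h1 h2 => h i h1 ω).mul_right (h _ ω ω)

lemma commute_desc {y : Q} (h : ∀ i, l ≤ i → i < l + N → Commute y (T i)) :
    Commute y (desc T l N) := by
  induction N with
  | zero => simp
  | succ N ih =>
    rw [desc_succ]
    exact (h _ ω ω).mul_right (ih fun i h1 h2 => h i h1 ω)

lemma commute_tl {y : Q} (h : ∀ i, l ≤ i → i < l + N → Commute y (T i)) :
    Commute y (tl T l N) := by
  induction N with
  | zero => simp
  | succ N ih =>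
    rw [tl_succ]
    exact (commute_asc h).mul_right (ih fun i h1 h2 => h i h1 ω)

/-- The relations of the nilCoxeter monoid, with `z` in the role of zero. -/
structure NilCox (k : ℕ) (T : ℕ → Q) (z : Q) : Prop where
  zmul : ∀ a, z * a = z
  mulz : ∀ a, a * z = z
  sq : ∀ i, 1 ≤ i → i < k → T i * T i = z
  braid : ∀ i, 1 ≤ i → i + 1 < k → T i * T (i + 1) * T i = T (i + 1) * T i * T (i + 1)
  far : ∀ i j, 1 ≤ i → i < k → 1 ≤ j → j < k → i + 1 < j → Commute (T i) (T j)

namespace NilCox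

variable {z : Q} (H : NilCox k T z)
include H

lemma far' (hi : 1 ≤ i ∧ i < k) (hj : 1 ≤ j ∧ j < k) (h : i + 1 < j ∨ j + 1 < i) :
    Commute (T i) (T j) := by
  rcases h with h | h
  · exact H.far _ _ hi.1 hi.2 hj.1 hj.2 h
  · exact (H.far _ _ hj.1 hj.2 hi.1 hi.2 h).symm

lemma far_asc (hj : 1 ≤ j ∧ j < k) (hl : 1 ≤ l) (hN : l + N ≤ k)
    (h : j + 1 < l ∨ l + N < j) : Commute (T j) (asc T l N) :=
  commute_asc fun i h1 h2 => H.far' hj ω ω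

lemma far_desc (hj : 1 ≤ j ∧ j < k) (hl : 1 ≤ l) (hN : l + N ≤ k)
    (h : j + 1 < l ∨ l + N < j) : Commute (T j) (desc T l N) :=
  commute_desc fun i h1 h2 => H.far' hj ω ω

lemma far_tl (hj : 1 ≤ j ∧ j < k) (hl : 1 ≤ l) (hN : l + N ≤ k)
    (h : j + 1 < l ∨ l + N < j) : Commute (T j) (tl T l N) :=
  commute_tl fun i h1 h2 => H.far' hj ω ω

lemma asc_T (hl : 1 ≤ l) (hN : l + N ≤ k) (h1 : l ≤ i) (h2 : i + 1 < l + N) :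
    asc T l N * T i = T (i + 1) * asc T l N := by
  induction N generalizing i with
  | zero => omega
  | succ N ih =>
    rw [asc_succ]
    by_cases h : i + 1 < l + N
    · rw [mul_assoc, (H.far' (i := l + N) (j := i) ω ω ω).eq, ← mul_assoc, ih ω h1 h, mul_assoc]
    · obtain ⟨M, rfl⟩ : ∃ M, N = M + 1 := ⟨N - 1, ω⟩
      have hi : i = l + M := ω
      subst hi
      rw [asc_succ]
      have hb := H.braid (l + M) ω ω
      have hc := H.far_asc (j := l + M + 1) (l := l) (N := M) ω hl ω ω
      rw [show l + (M + 1) = l + M + 1 by omega]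
      calc asc T l M * T (l + M) * T (l + M + 1) * T (l + M)
          = asc T l M * (T (l + M) * T (l + M + 1) * T (l + M)) := by simp only [mul_assoc]
        _ = (asc T l M * T (l + M + 1)) * (T (l + M) * T (l + M + 1)) := by
            rw [hb]; simp only [mul_assoc]
        _ = _ := by rw [← hc.eq]; simp only [mul_assoc]

lemma desc_T (hl : 1 ≤ l) (hN : l + N ≤ k) (h1 : l ≤ i) (h2 : i + 1 < l + N) :
    desc T l N * T (i + 1) = T i * desc T l N := by
  induction N generalizing i with
  | zero => omega
  | succ N ih =>
    by_cases h : i + 1 < l + N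
    · rw [desc_succ, mul_assoc, ih ω h1 h, ← mul_assoc,
        (H.far' (i := l + N) (j := i) ω ω ω).eq, mul_assoc]
    · obtain ⟨M, rfl⟩ : ∃ M, N = M + 1 := ⟨N - 1, ω⟩
      obtain rfl : i = l + M := ω
      have hb := H.braid (l + M) ω ω
      have hc := H.far_desc (j := l + M + 1) (l := l) (N := M) ω hl ω
        ω
      rw [desc_succ, desc_succ, show l + (M + 1) = l + M + 1 by omega]
      calc T (l + M + 1) * (T (l + M) * desc T l M) * T (l + M + 1)
          = T (l + M + 1) * T (l + M) * (desc T l M * T (l + M + 1)) := by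
            simp only [mul_assoc]
        _ = (T (l + M + 1) * T (l + M) * T (l + M + 1)) * desc T l M := by
            rw [← hc.eq]; simp only [mul_assoc]
        _ = _ := by rw [← hb]; simp only [mul_assoc]

lemma T_asc_zero (hl : 1 ≤ l) (hN : l + N ≤ k) (h : 1 ≤ N) : T l * asc T l N = z := by
  obtain ⟨M, rfl⟩ : ∃ M, N = M + 1 := ⟨N - 1, ω⟩
  rw [asc_succ', ← mul_assoc, H.sq l hl ω, H.zmul]

lemma asc_T_zero (hl : 1 ≤ l) (hN : l + N ≤ k) (h : i + 1 = l + N) (h1 : l ≤ i) :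
    asc T l N * T i = z := by
  obtain ⟨M, rfl⟩ : ∃ M, N = M + 1 := ⟨N - 1, ω⟩
  obtain rfl : i = l + M := ω
  rw [asc_succ, mul_assoc, H.sq _ ω ω, H.mulz]

lemma asc_tl (hl : 1 ≤ l) (hN : l + N + 1 ≤ k) :
    asc T l (N + 1) * tl T l N = tl T (l + 1) N * asc T l (N + 1) := by
  have key : ∀ M t, t + M ≤ N → asc T l (N + 1) * asc T (l + t) M
      = asc T (l + 1 + t) M * asc T l (N + 1) := by
    intro M
    induction M with
    | zero => simp
    | succ M ih =>
      intro t ht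
      rw [asc_succ T (l + t) M, ← mul_assoc, ih t ω, mul_assoc,
        H.asc_T hl ω ω ω, ← mul_assoc, asc_succ T (l + 1 + t) M]
      congr 3; omega
  have : ∀ M ≤ N, asc T l (N + 1) * tl T l M = tl T (l + 1) M * asc T l (N + 1) := by
    intro M
    induction M with
    | zero => simp
    | succ M ih =>
      intro hM
      have h0 := key (M + 1) 0 ω
      simp only [add_zero] at h0
      rw [tl_succ, ← mul_assoc, h0, mul_assoc, ih ω, ← mul_assoc, tl_succ]
  exact this N le_rfl

lemma tl_right_asc (hl : 1 ≤ l) (hN : l + N + 1 ≤ k) :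
    tl T l (N + 1) = tl T (l + 1) N * asc T l (N + 1) := by
  rw [tl_succ, H.asc_tl hl hN]

lemma tl_right_desc (hl : 1 ≤ l) (hN : l + N + 1 ≤ k) :
    tl T l (N + 1) = tl T l N * desc T l (N + 1) := by
  induction N with
  | zero => simp [tl_succ]
  | succ N ih =>
    rw [tl_succ, ih ω, desc_succ T l (N + 1), asc_succ T l (N + 1), mul_assoc,
      ← mul_assoc (T _), (H.far_tl (j := l + (N + 1)) ω hl ω ω).eq,
      mul_assoc, ← mul_assoc (asc T l (N + 1)), ← tl_succ, ← mul_assoc, ih ω]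
    simp only [mul_assoc]

lemma tl_left_desc (hl : 1 ≤ l) (hN : l + N + 1 ≤ k) :
    tl T l (N + 1) = desc T l (N + 1) * tl T (l + 1) N := by
  induction N generalizing l with
  | zero => simp [tl_succ]
  | succ N ih =>
    rw [H.tl_right_asc hl hN, ih (l := l + 1) ω ω, asc_succ', mul_assoc, ← mul_assoc (tl _ _ _),
      ← (H.far_tl (j := l) ω ω ω ω).eq, mul_assoc, ← H.tl_right_asc ω ω, ← mul_assoc, ← desc_succ',
      ih (l := l + 1) ω ω]

lemma T_tl (hl : 1 ≤ l) (hN : l + N ≤ k) (h1 : l ≤ i) (h2 : i < l + N) :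
    T i * tl T l N = z := by
  induction N generalizing i with
  | zero => omega
  | succ N ih =>
    rw [tl_succ]
    by_cases h : i = l
    · subst h
      rw [← mul_assoc, H.T_asc_zero hl hN ω, H.zmul]
    · obtain ⟨j, rfl⟩ : ∃ j, i = j + 1 := ⟨i - 1, ω⟩
      rw [← mul_assoc, ← H.asc_T hl hN ω ω, mul_assoc, ih ω ω
        ω, H.mulz]

lemma tl_T (hl : 1 ≤ l) (hN : l + N ≤ k) (h1 : l ≤ i) (h2 : i < l + N) :
    tl T l N * T i = z := by
  induction N generalizing i l with
  | zero => omega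
  | succ N ih =>
    rw [H.tl_right_asc hl ω]
    by_cases h : i + 1 = l + (N + 1)
    · rw [mul_assoc, H.asc_T_zero hl hN h h1, H.mulz]
    · rw [mul_assoc, H.asc_T hl hN ω ω, ← mul_assoc, ih ω ω ω ω, H.zmul]

lemma wd_normal (hl : 1 ≤ l) (hN : l + N ≤ k) (w : List ℕ) (hw : ∀ i ∈ w, l ≤ i ∧ i < l + N) :
    wd T w = z ∨ ∃ (w' : List ℕ) (M : ℕ), (∀ i ∈ w', l + 1 ≤ i ∧ i < l + N) ∧ M ≤ N ∧
      wd T w = wd T w' * asc T l M ∧ w.length = w'.length + M := by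
  induction w using List.reverseRecOn with
  | nil => exact .inr ⟨[], 0, by simp⟩
  | append_singleton w i ih =>
    have hi := hw i (by simp)
    rcases ih fun j hj => hw j (by simp [hj]) with h | ⟨w', M, h1, h2, h3, h4⟩
    · left; simp [h, H.zmul]
    rw [wd_append, h3]
    simp only [wd_cons, wd_nil, mul_one, List.length_append, List.length_cons, List.length_nil]
    by_cases c1 : i = l + M
    · exact .inr ⟨w', M + 1, h1, ω, by rw [asc_succ, c1, mul_assoc], ω⟩
    by_cases c2 : i + 1 = l + M
    · left
      rw [mul_assoc, H.asc_T_zero hl ω c2 hi.1, H.mulz]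
    right
    by_cases c3 : l + M < i
    · refine ⟨w' ++ [i], M, ?_, h2, ?_, by simp; omega⟩
      · intro j hj
        simp only [List.mem_append, List.mem_singleton] at hj
        rcases hj with hj | rfl
        · exact h1 j hj
        · omega
      · rw [mul_assoc, ← (H.far_asc (j := i) ω hl ω ω).eq]
        simp [mul_assoc]
    · refine ⟨w' ++ [i + 1], M, ?_, h2, ?_, by simp; omega⟩
      · intro j hj
        simp only [List.mem_append, List.mem_singleton] at hj
        rcases hj with hj | rfl
        · exact h1 j hj
        · omega
      · rw [mul_assoc, H.asc_T hl ω hi.1 ω]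
        simp [mul_assoc]

lemma wd_eq_zero (hl : 1 ≤ l) (hN : l + N ≤ k) (w : List ℕ) (hw : ∀ i ∈ w, l ≤ i ∧ i < l + N)
    (h : N * (N + 1) < w.length) : wd T w = z := by
  induction N generalizing l w with
  | zero =>
    cases w with
    | nil => simp at h
    | cons i w => have := hw i (by simp); omega
  | succ N ih =>
    rcases H.wd_normal hl hN w hw with h' | ⟨w', M, h1, h2, h3, h4⟩
    · exact h'
    · rw [h3, ih ω ω w' (fun i hi => ⟨(h1 i hi).1, by have := (h1 i hi).2; omega⟩)
        (by nlinarith), H.zmul]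

/-! The word crossing `b` strands with `a` strands. -/

end NilCox

/-- The word `(T_a ⋯ T_{a+b-1}) ⋯ (T_2 ⋯ T_{b+1}) (T_1 ⋯ T_b)`. -/
def crossing (T : ℕ → Q) (b : ℕ) : ℕ → Q
  | 0 => 1
  | a + 1 => asc T (a + 1) b * crossing T b a

lemma map_crossing {R : Type*} [Monoid R] (f : Q →* R) (a b : ℕ) :
    f (crossing T b a) = crossing (fun i => f (T i)) b a := by
  induction a with
  | zero => simp [crossing]
  | succ a ih => simp [crossing, ih, map_asc]

lemma commute_crossing {y : Q} (h : ∀ i, 1 ≤ i → i < a + b → Commute y (T i)) :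
    Commute y (crossing T b a) := by
  induction a with
  | zero => simp [crossing]
  | succ a ih =>
    exact (commute_asc fun i h1 h2 => h i ω ω).mul_right
      (ih fun i h1 h2 => h i h1 ω)

namespace NilCox

variable {z : Q} (H : NilCox k T z)
include H

lemma T_crossing (hk : a + b ≤ k) (h1 : 1 ≤ j) (h2 : j < b) :
    T (a + j) * crossing T b a = crossing T b a * T j := by
  induction a with
  | zero => simp [crossing]
  | succ a ih =>
    rw [crossing, ← mul_assoc, show a + 1 + j = a + j + 1 by omega,
      ← H.asc_T (l := a + 1) (N := b) ω ω ω ω, mul_assoc, ih ω, mul_assoc]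

lemma crossing_succ (hk : a + b + 1 ≤ k) :
    crossing T (b + 1) a = crossing T b a * desc T (b + 1) a := by
  induction a with
  | zero => simp [crossing]
  | succ a ih =>
    have hc : Commute (T (a + b + 1)) (crossing T b a) :=
      commute_crossing fun i h1 h2 => H.far' ω ω ω
    rw [crossing, crossing, ih ω, asc_succ, desc_succ,
      show a + 1 + b = a + b + 1 by omega, show b + 1 + a = a + b + 1 by omega]
    simp only [mul_assoc]
    congr 1
    rw [← mul_assoc, hc.eq, mul_assoc]

lemma crossing_T (hk : a + b ≤ k) (h1 : 1 ≤ i) (h2 : i < a) :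
    crossing T b a * T (b + i) = T i * crossing T b a := by
  induction b with
  | zero =>
    have : ∀ a, crossing T 0 a = 1 := by
      intro a; induction a with
      | zero => rfl
      | succ a ih => simp [crossing, ih]
    simp [this]
  | succ b ih =>
    rw [H.crossing_succ ω, mul_assoc, show b + 1 + i = b + i + 1 by omega,
      H.desc_T ω ω ω ω, ← mul_assoc, ih ω, mul_assoc]

end NilCox

end Words

/-! ## Elements up to sign -/

section Sign

variable {E : Type*} [Ring E]

/-- Equality up to sign. -/
def PM (a b : E) : Prop := a = b ∨ a = -b

/-- Equality up to sign, as a congruence of the multiplicative monoid. -/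
def signCon (E : Type*) [Ring E] : Con E where
  r := PM
  iseqv := ⟨fun _ => .inl rfl, fun h => h.elim (fun h => .inl h.symm) (fun h => .inr (by simp [h])),
    fun h h' => by
      rcases h with rfl | rfl <;> rcases h' with rfl | rfl <;> simp [PM]⟩
  mul' h h' := by
    rcases h with rfl | rfl <;> rcases h' with rfl | rfl <;> simp [PM]

/-- Elements of a ring up to sign. -/
abbrev SQ (E : Type*) [Ring E] := (signCon E).Quotient

/-- The class of an element up to sign. -/
def sq : E →* SQ E := (signCon E).mk'

lemma sq_eq {a b : E} : sq a = sq b ↔ PM a b := (signCon E).eq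

namespace PM

variable {a b c a' b' : E}

@[refl] lemma refl (a : E) : PM a a := .inl rfl
lemma symm (h : PM a b) : PM b a := (signCon E).symm h
lemma trans (h : PM a b) (h' : PM b c) : PM a c := (signCon E).trans h h'
lemma mul (h : PM a b) (h' : PM a' b') : PM (a * a') (b * b') := (signCon E).mul h h'
lemma mul_left (c : E) (h : PM a b) : PM (c * a) (c * b) := (refl c).mul h
lemma mul_right (c : E) (h : PM a b) : PM (a * c) (b * c) := h.mul (refl c)
lemma neg (h : PM a b) : PM (-a) b := h.elim (fun h => .inr (by rw [h])) (fun h => .inl (by simp [h]))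
lemma of_add (h : a + b = 0) : PM a b := .inr (eq_neg_of_add_eq_zero_left h)
lemma of_eq (h : a = b) : PM a b := .inl h

lemma zero_iff : PM a 0 ↔ a = 0 := by simp [PM]
lemma eq_zero (h : PM a b) (hb : b = 0) : a = 0 := by rcases h with h | h <;> simp [h, hb]

lemma unit_mul (i : ℕ) (a : E) : PM ((-1) ^ i * a) a := by
  rcases neg_one_pow_eq_or E i with h | h <;> simp [h, PM]

lemma map {F : Type*} [Ring F] (f : E →+* F) (h : PM a b) : PM (f a) (f b) := by
  rcases h with rfl | rfl <;> simp [PM]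

lemma exists_sign (h : PM a b) : ∃ s : ℕ, a = (-1) ^ s * b :=
  h.elim (fun h => ⟨0, by simp [h]⟩) (fun h => ⟨1, by simp [h]⟩)

lemma mem {R : Type*} [SetLike R E] [AddSubgroupClass R E] {p : R} (h : PM a b) (hb : b ∈ p) : a ∈ p := by
  rcases h with rfl | rfl
  · exact hb
  · exact neg_mem hb

lemma mul_pow (h : PM (a * b) (b * a)) : PM (a * b ^ p) (b ^ p * a) := by
  induction p with
  | zero => simp [PM]
  | succ p ih =>
    rw [pow_succ, ← mul_assoc]
    refine (ih.mul_right b).trans ?_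
    rw [mul_assoc, mul_assoc]
    exact h.mul_left _

lemma mul_mul (h : PM (a * b) (b * a)) (h' : PM (a * c) (c * a)) :
    PM (a * (b * c)) ((b * c) * a) := by
  rw [← mul_assoc]
  refine (h.mul_right c).trans ?_
  rw [mul_assoc, mul_assoc]
  exact h'.mul_left _

lemma mul_list {ι : Type*} (f : ι → E) (L : List ι) (h : ∀ i ∈ L, PM (a * f i) (f i * a)) :
    PM (a * (L.map f).prod) ((L.map f).prod * a) := by
  induction L with
  | nil => simp [PM]
  | cons i L ih =>
    rw [List.map_cons, List.prod_cons]
    exact mul_mul (h i (by simp)) (ih fun j hj => h j (by simp [hj]))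

end PM

end Sign

/-! ## Systems of elements satisfying the odd nilHecke relations -/

section Sys

/-- `c_r = χ_{r/2}` for `r` even and `c_r = d χ_{(r-1)/2}` for `r` odd. -/
def cOf {E : Type*} [Mul E] (χ : ℕ → E) (d : E) (r : ℕ) : E :=
  if Even r then χ (r / 2) else d * χ (r / 2)

/-- `∑_{l=0}^{n} (-1)^l y^l c_{n-l}`. -/
def aOf {E : Type*} [Ring E] (n : ℕ) (χ : ℕ → E) (d y : E) : E :=
  ∑ l ∈ range (n + 1), (-1) ^ l * y ^ l * cOf χ d (n - l)

/-- The relations of `ONH_k ⊗ A_n`. -/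
structure Sys (n k : ℕ) {E : Type*} [Ring E] (x τ χ : ℕ → E) (d : E) : Prop where
  chi_zero : χ 0 = 1
  tau_sq : ∀ i, 1 ≤ i → i < k → τ i * τ i = 0
  braid : ∀ i, 1 ≤ i → i + 1 < k → τ i * τ (i + 1) * τ i = τ (i + 1) * τ i * τ (i + 1)
  x_tau : ∀ i, 1 ≤ i → i < k → x i * τ i + τ i * x (i + 1) = 1
  tau_x : ∀ i, 1 ≤ i → i < k → τ i * x i + x (i + 1) * τ i = 1
  x_x : ∀ i j, 1 ≤ i → i ≤ k → 1 ≤ j → j ≤ k → i ≠ j → x i * x j + x j * x i = 0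
  tau_tau : ∀ i j, 1 ≤ i → i < k → 1 ≤ j → j < k → (i + 1 < j ∨ j + 1 < i) →
    τ i * τ j + τ j * τ i = 0
  x_tau_far : ∀ i j, 1 ≤ i → i ≤ k → 1 ≤ j → j < k → i ≠ j → i ≠ j + 1 → x i * τ j + τ j * x i = 0
  d_sq : d * d = 0
  d_chi_top : Even n → d * χ (n / 2) = 0
  chi_chi : ∀ i j, 1 ≤ i → i ≤ n / 2 → 1 ≤ j → j ≤ n / 2 → χ i * χ j = χ j * χ i
  chi_d : ∀ i, 1 ≤ i → i ≤ n / 2 → χ i * d = d * χ i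
  x_chi : ∀ i j, 1 ≤ i → i ≤ k → 1 ≤ j → j ≤ n / 2 → χ j * x i = x i * χ j
  tau_chi : ∀ i j, 1 ≤ i → i < k → 1 ≤ j → j ≤ n / 2 → χ j * τ i = τ i * χ j
  x_d : ∀ i, 1 ≤ i → i ≤ k → d * x i = -(x i * d)
  tau_d : ∀ i, 1 ≤ i → i < k → d * τ i = -(τ i * d)

namespace Sys

variable {E : Type*} [Ring E] {x τ χ : ℕ → E} {d : E} (H : Sys n k x τ χ d)
include H

lemma nilCox : NilCox k (fun i => sq (τ i)) (sq (0 : E)) where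
  zmul a := by
    obtain ⟨a, rfl⟩ := (signCon E).mk'_surjective a
    change sq 0 * sq a = _
    rw [← map_mul, zero_mul]
  mulz a := by
    obtain ⟨a, rfl⟩ := (signCon E).mk'_surjective a
    change sq a * sq 0 = _
    rw [← map_mul, mul_zero]
  sq i h1 h2 := by rw [← map_mul, H.tau_sq i h1 h2]
  braid i h1 h2 := by simp only [← map_mul, H.braid i h1 h2]
  far i j h1 h2 h3 h4 h5 := by
    change sq _ * sq _ = sq _ * sq _
    rw [← map_mul, ← map_mul, sq_eq]
    exact PM.of_add (H.tau_tau i j h1 h2 h3 h4 (.inl h5))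

lemma flip : Sys n k (fun i => x (k + 1 - i)) (fun i => τ (k - i)) χ d where
  chi_zero := H.chi_zero
  tau_sq i h1 h2 := H.tau_sq _ ω ω
  braid i h1 h2 := by
    have := H.braid (k - (i + 1)) ω ω
    rw [show k - (i + 1) + 1 = k - i by omega] at this
    exact this.symm
  x_tau i h1 h2 := by
    have := H.tau_x (k - i) ω ω
    rw [show k - i + 1 = k + 1 - i by omega, add_comm] at this
    rwa [show k + 1 - (i + 1) = k - i by omega]
  tau_x i h1 h2 := by
    have := H.x_tau (k - i) ω ω
    rw [show k - i + 1 = k + 1 - i by omega, add_comm] at this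
    rwa [show k + 1 - (i + 1) = k - i by omega]
  x_x i j h1 h2 h3 h4 h5 := H.x_x _ _ ω ω ω ω ω
  tau_tau i j h1 h2 h3 h4 h5 := H.tau_tau _ _ ω ω ω ω ω
  x_tau_far i j h1 h2 h3 h4 h5 h6 := H.x_tau_far _ _ ω ω ω ω ω ω
  d_sq := H.d_sq
  d_chi_top := H.d_chi_top
  chi_chi := H.chi_chi
  chi_d := H.chi_d
  x_chi i j h1 h2 h3 h4 := H.x_chi _ _ ω ω h3 h4
  tau_chi i j h1 h2 h3 h4 := H.tau_chi _ _ ω ω h3 h4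
  x_d i h1 h2 := H.x_d _ ω ω
  tau_d i h1 h2 := H.tau_d _ ω ω

lemma pm_xx (h1 : 1 ≤ i ∧ i ≤ k) (h2 : 1 ≤ j ∧ j ≤ k) : PM (x i * x j) (x j * x i) := by
  by_cases h : i = j
  · subst h; rfl
  · exact PM.of_add (H.x_x i j h1.1 h1.2 h2.1 h2.2 h)

lemma pm_xtau (h1 : 1 ≤ i ∧ i ≤ k) (h2 : 1 ≤ j ∧ j < k) (h3 : i ≠ j) (h4 : i ≠ j + 1) :
    PM (x i * τ j) (τ j * x i) := PM.of_add (H.x_tau_far i j h1.1 h1.2 h2.1 h2.2 h3 h4)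

lemma pm_taux (h1 : 1 ≤ i ∧ i ≤ k) (h2 : 1 ≤ j ∧ j < k) (h3 : i ≠ j) (h4 : i ≠ j + 1) :
    PM (τ j * x i) (x i * τ j) := (H.pm_xtau h1 h2 h3 h4).symm

omit H in
lemma sq_asc (l N : ℕ) : sq (asc τ l N) = asc (fun i => sq (τ i)) l N := map_asc τ l N sq
omit H in
lemma sq_desc (l N : ℕ) : sq (desc τ l N) = desc (fun i => sq (τ i)) l N := map_desc τ l N sq
omit H in
lemma sq_tl (l N : ℕ) : sq (tl τ l N) = tl (fun i => sq (τ i)) l N := map_tl τ l N sq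

lemma tau_tl (hl : 1 ≤ l) (hN : l + N ≤ k) (h1 : l ≤ i) (h2 : i < l + N) :
    τ i * tl τ l N = 0 := by
  rw [← PM.zero_iff, ← sq_eq, map_mul, sq_tl]
  exact H.nilCox.T_tl hl hN h1 h2

lemma tl_tau (hl : 1 ≤ l) (hN : l + N ≤ k) (h1 : l ≤ i) (h2 : i < l + N) :
    tl τ l N * τ i = 0 := by
  rw [← PM.zero_iff, ← sq_eq, map_mul, sq_tl]
  exact H.nilCox.tl_T hl hN h1 h2

lemma tl_right_asc (hl : 1 ≤ l) (hN : l + N + 1 ≤ k) :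
    PM (tl τ l (N + 1)) (tl τ (l + 1) N * asc τ l (N + 1)) := by
  rw [← sq_eq, map_mul, sq_tl, sq_tl, sq_asc]
  exact H.nilCox.tl_right_asc hl hN

lemma tl_right_desc (hl : 1 ≤ l) (hN : l + N + 1 ≤ k) :
    PM (tl τ l (N + 1)) (tl τ l N * desc τ l (N + 1)) := by
  rw [← sq_eq, map_mul, sq_tl, sq_tl, sq_desc]
  exact H.nilCox.tl_right_desc hl hN

lemma tl_left_desc (hl : 1 ≤ l) (hN : l + N + 1 ≤ k) :
    PM (tl τ l (N + 1)) (desc τ l (N + 1) * tl τ (l + 1) N) := by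
  rw [← sq_eq, map_mul, sq_tl, sq_tl, sq_desc]
  exact H.nilCox.tl_left_desc hl hN

omit H in
lemma pm_asc {y : E} (h : ∀ i, l ≤ i → i < l + N → PM (y * τ i) (τ i * y)) :
    PM (y * asc τ l N) (asc τ l N * y) :=
  PM.mul_list _ _ fun s hs => h _ ω (by rw [List.mem_range] at hs; omega)

omit H in
lemma pm_desc {y : E} (h : ∀ i, l ≤ i → i < l + N → PM (y * τ i) (τ i * y)) :
    PM (y * desc τ l N) (desc τ l N * y) := by
  induction N with
  | zero => simp [PM]
  | succ N ih => exact PM.mul_mul (h _ ω ω) (ih fun i h1 h2 => h i h1 ω)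

omit H in
lemma pm_tl {y : E} (h : ∀ i, l ≤ i → i < l + N → PM (y * τ i) (τ i * y)) :
    PM (y * tl τ l N) (tl τ l N * y) := PM.mul_list _ _ fun s hs => pm_asc fun i h1 h2 => h i h1 ω

lemma tau_x_pow (h1 : 1 ≤ i) (h2 : i < k) (M : ℕ) :
    τ i * x i ^ M = ∑ b ∈ range M, (-1) ^ b * x (i + 1) ^ b * x i ^ (M - 1 - b)
      + (-1) ^ M * x (i + 1) ^ M * τ i := by
  induction M with
  | zero => simp
  | succ M ih =>
    have h := H.tau_x i h1 h2
    rw [pow_succ', ← mul_assoc, eq_sub_of_add_eq h, sub_mul, one_mul, mul_assoc, ih, mul_add,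
      sum_range_succ', mul_sum, add_tsub_cancel_right]
    have : ∀ b ∈ range M, x (i + 1) * ((-1) ^ b * x (i + 1) ^ b * x i ^ (M - 1 - b))
        = -((-1) ^ (b + 1) * x (i + 1) ^ (b + 1) * x i ^ (M - (b + 1))) := by
      intro b _
      rw [pow_succ' (x (i + 1)), pow_succ, show M - 1 - b = M - (b + 1) by omega]
      rcases neg_one_pow_eq_or E b with h | h <;> simp [h, mul_assoc]
    rw [sum_congr rfl this, pow_succ' (x (i + 1)) M, pow_succ (-1 : E) M]
    rcases neg_one_pow_eq_or E M with h | h <;> simp [h, mul_assoc] <;> abel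

lemma tau_xs_pow (h1 : 1 ≤ i) (h2 : i < k) (M : ℕ) :
    τ i * x (i + 1) ^ M = ∑ b ∈ range M, (-1) ^ b * x i ^ b * x (i + 1) ^ (M - 1 - b)
      + (-1) ^ M * x i ^ M * τ i := by
  have := H.flip.tau_x_pow (i := k - i) ω ω M
  simpa only [show k - (k - i) = i by omega, show k + 1 - (k - i) = i + 1 by omega,
    show k + 1 - (k - i + 1) = i by omega] using this

lemma asc_x_pow {M : ℕ} (hl : 1 ≤ l) (hN : l + N ≤ k) (hM : M ≤ N) {g : E}
    (hg : ∀ i, l ≤ i → i < l + N → τ i * g = 0) :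
    (M < N → asc τ l N * x (l + N) ^ M * g = 0) ∧
    (M = N → PM (asc τ l N * x (l + N) ^ M * g) g) := by
  induction N generalizing M with
  | zero => obtain rfl : M = 0 := ω
            simp [PM]
  | succ N ih =>
    have hc : ∀ p, PM (asc τ l N * x (l + N + 1) ^ p) (x (l + N + 1) ^ p * asc τ l N) := fun p => by
      refine PM.mul_pow (PM.symm (pm_asc fun i h1 h2 => H.pm_xtau ?_ ?_ ?_ ?_)) <;> omega
    have key : asc τ l (N + 1) * x (l + N + 1) ^ M * g = ∑ b ∈ range M,
        asc τ l N * ((-1) ^ b * x (l + N) ^ b * x (l + N + 1) ^ (M - 1 - b)) * g := by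
      rw [asc_succ, mul_assoc (asc τ l N), H.tau_xs_pow ω ω, mul_add, add_mul, mul_sum, sum_mul]
      simp only [mul_assoc, hg (l + N) ω ω, mul_zero, add_zero]
    have hz : ∀ b ∈ range M, PM
        (asc τ l N * ((-1) ^ b * x (l + N) ^ b * x (l + N + 1) ^ (M - 1 - b)) * g)
        (x (l + N + 1) ^ (M - 1 - b) * (asc τ l N * x (l + N) ^ b * g)) := by
      intro b _
      have h1 : PM ((-1) ^ b * x (l + N) ^ b * x (l + N + 1) ^ (M - 1 - b))
          (x (l + N + 1) ^ (M - 1 - b) * x (l + N) ^ b) := by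
        rw [mul_assoc]
        refine (PM.unit_mul b _).trans (PM.mul_pow (PM.symm (PM.mul_pow (H.pm_xx ?_ ?_)))) <;> omega
      refine ((h1.mul_left (asc τ l N)).mul_right g).trans ?_
      rw [← mul_assoc]
      refine PM.trans (((hc (M - 1 - b)).mul_right _).mul_right _) ?_
      simp only [mul_assoc]
      rfl
    rw [show l + (N + 1) = l + N + 1 by omega, key]
    have ih' := fun {M} (hM : M ≤ N) => ih ω hM fun i h1 h2 => hg i h1 ω
    refine ⟨fun h => sum_eq_zero fun b hb => (hz b hb).eq_zero ?_, ?_⟩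
    · rw [mem_range] at hb
      rw [(ih' ω).1 ω, mul_zero]
    · rintro rfl
      rw [sum_range_succ, sum_eq_zero, zero_add]
      · refine (hz N (by simp)).trans ?_
        simpa using (ih' le_rfl).2 rfl
      · intro b hb
        rw [mem_range] at hb
        refine (hz b (by simp; omega)).eq_zero ?_
        rw [(ih' ω).1 hb, mul_zero]

omit H in
lemma map {F : Type*} [Ring F] (f : E →+* F) (H : Sys n k x τ χ d) :
    Sys n k (fun i => f (x i)) (fun i => f (τ i)) (fun i => f (χ i)) (f d) := by
  constructor <;> intros <;> (try simp only [← map_mul, ← map_add, ← map_neg]) <;> first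
    | rw [H.chi_zero, map_one]
    | rw [H.tau_sq _ ‹_› ‹_›, map_zero]
    | rw [H.braid _ ‹_› ‹_›]
    | rw [H.x_tau _ ‹_› ‹_›, map_one]
    | rw [H.tau_x _ ‹_› ‹_›, map_one]
    | rw [H.d_sq, map_zero]
    | rw [H.d_chi_top ‹_›, map_zero]
    | (rw [H.x_x] <;> first | exact map_zero f | assumption)
    | (rw [H.tau_tau] <;> first | exact map_zero f | assumption)
    | (rw [H.x_tau_far] <;> first | exact map_zero f | assumption)
    | exact congrArg f (H.chi_chi _ _ ‹_› ‹_› ‹_› ‹_›)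
    | exact congrArg f (H.chi_d _ ‹_› ‹_›)
    | exact congrArg f (H.x_chi _ _ ‹_› ‹_› ‹_› ‹_›)
    | exact congrArg f (H.tau_chi _ _ ‹_› ‹_› ‹_› ‹_›)
    | exact congrArg f (H.x_d _ ‹_› ‹_›)
    | exact congrArg f (H.tau_d _ ‹_› ‹_›)

end Sys

end Sys

/-! ## Idempotent identities -/

/-- `x_l^0 x_{l+1}^1 ⋯ x_{l+M-1}^{M-1}`. -/
def xup {E : Type*} [Monoid E] (x : ℕ → E) (l M : ℕ) : E :=
  ((List.range M).map fun s => x (l + s) ^ s).prod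

/-- `x_{l+M-1}^0 ⋯ x_{l+1}^{M-2} x_l^{M-1}`. -/
def xdown {E : Type*} [Monoid E] (x : ℕ → E) (l M : ℕ) : E :=
  ((List.range M).map fun s => x (l + M - 1 - s) ^ s).prod

namespace Sys

variable {E : Type*} [Ring E] {x τ χ : ℕ → E} {d : E}

section

variable (H : Sys n k x τ χ d)
include H

lemma tl_xup_mul {M : ℕ} (hl : 1 ≤ l) (hM : l + M ≤ k + 1) {g : E}
    (hg : ∀ i, l ≤ i → i + 1 < l + M → τ i * g = 0) :
    PM (tl τ l (M - 1) * xup x l M * g) g := by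
  induction M generalizing g with
  | zero => simp [xup, PM]
  | succ M ih =>
    rcases M with _ | M
    · simp [xup, PM]
    simp only [Nat.add_sub_cancel] at ih ⊢
    have h3 : xup x l (M + 1 + 1) = xup x l (M + 1) * x (l + (M + 1)) ^ (M + 1) := by
      simp [xup, List.range_succ, mul_assoc]
    have h1 := ih ω (g := x (l + (M + 1)) ^ (M + 1) * g) fun i h1 h2 => by
      rw [← mul_assoc]
      refine ((PM.mul_pow (H.pm_taux ?_ ?_ ?_ ?_)).mul_right g).eq_zero ?_ <;> try omega
      rw [mul_assoc, hg i h1 ω, mul_zero]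
    have h2 := (H.asc_x_pow (g := g) hl ω (le_refl (M + 1))
      fun i h1 h2 => hg i h1 ω).2 rfl
    rw [h3, tl_succ τ l M]
    simp only [mul_assoc] at h1 h2 ⊢
    exact (h1.mul_left _).trans h2

lemma tl_xup_tl {M : ℕ} (hl : 1 ≤ l) (hM : l + M ≤ k + 1) :
    PM (tl τ l (M - 1) * xup x l M * tl τ l (M - 1)) (tl τ l (M - 1)) :=
  H.tl_xup_mul hl hM fun i h1 h2 => H.tau_tl hl ω h1 ω

lemma tl_flip (hl : 1 ≤ l) (hN : l + N ≤ k) :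
    PM (tl (fun i => τ (k - i)) l N) (tl τ (k + 1 - l - N) N) := by
  induction N with
  | zero => simp [PM]
  | succ N ih =>
    have h : asc (fun i => τ (k - i)) l (N + 1) = desc τ (k + 1 - l - (N + 1)) (N + 1) := by
      clear ih
      induction N with
      | zero => simp; congr 1; omega
      | succ N ih =>
        rw [asc_succ, ih ω, desc_succ' _ _ (N + 1)]
        congr 2 <;> omega
    rw [tl_succ, h]
    refine PM.trans ?_ (H.tl_left_desc ω ω).symm
    have := ih ω
    rw [show k + 1 - l - N = k + 1 - l - (N + 1) + 1 by omega] at this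
    exact this.mul_left _

lemma tl_xdown_tl {M : ℕ} (hl : 1 ≤ l) (hM : l + M ≤ k + 1) :
    PM (tl τ l (M - 1) * xdown x l M * tl τ l (M - 1)) (tl τ l (M - 1)) := by
  rcases M with _ | M
  · simp [xdown, PM]
  have h := H.flip.tl_xup_tl (l := k + 1 - l - M) (M := M + 1) ω ω
  have h1 := H.tl_flip (l := k + 1 - l - M) (N := M) ω ω
  rw [show k + 1 - (k + 1 - l - M) - M = l by omega] at h1
  have h2 : xup (fun i => x (k + 1 - i)) (k + 1 - l - M) (M + 1) = xdown x l (M + 1) := by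
    unfold xup xdown
    congr 1
    refine List.map_congr_left fun s hs => ?_
    rw [List.mem_range] at hs
    simp only
    congr 2
    omega
  rw [Nat.add_sub_cancel] at h ⊢
  rw [h2] at h
  exact ((h1.symm.mul_right _).mul h1.symm).trans (h.trans h1)

lemma tl_desc_step (hl : 1 ≤ l) (hN : l + N + 1 ≤ k) (hp : p ≤ N) :
    ∃ s : ℕ, tl τ l N * desc τ (l + N + 1 - p) p
      = tl τ l N * desc τ (l + N - p) (p + 1) * x (l + N - p)
        + (-1) ^ s * (x (l + N + 1) * (tl τ l N * desc τ (l + N - p) (p + 1))) := by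
  induction p with
  | zero =>
    have h1 : PM (x (l + N + 1) * tl τ l N) (tl τ l N * x (l + N + 1)) :=
      pm_tl fun i h1 h2 => H.pm_xtau ω ω ω ω
    obtain ⟨s, hs⟩ := h1.symm.exists_sign
    refine ⟨s, ?_⟩
    have h := H.tau_x (l + N) ω ω
    simp only [Nat.sub_zero, desc_zero, zero_add, desc_one, mul_one]
    rw [mul_assoc, eq_sub_of_add_eq h, mul_sub, mul_one, ← mul_assoc, hs]
    simp only [mul_assoc]; abel
  | succ p ih =>
    obtain ⟨s, hs⟩ := ih ω
    have e1 : l + N + 1 - (p + 1) = l + N - p := ω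
    have e2 : l + N - p = l + N - (p + 1) + 1 := ω
    rw [e1]
    refine ⟨s + 1, ?_⟩
    have h := H.tau_x (l + N - (p + 1)) ω ω
    rw [← e2] at h
    have h0 : tl τ l N * desc τ (l + N + 1 - p) p * τ (l + N - (p + 1)) = 0 := by
      have : PM (τ (l + N - (p + 1)) * desc τ (l + N + 1 - p) p)
          (desc τ (l + N + 1 - p) p * τ (l + N - (p + 1))) :=
        pm_desc fun i h1 h2 => PM.of_add (H.tau_tau _ _ ω ω ω ω
          ω)
      rw [mul_assoc]
      refine (this.symm.mul_left _).eq_zero ?_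
      rw [← mul_assoc, H.tl_tau hl ω ω ω, zero_mul]
    rw [desc_succ' τ (l + N - (p + 1)), ← e2]
    set D := tl τ l N * desc τ (l + N - p) (p + 1) with hD
    rw [← mul_assoc (tl τ l N), ← hD, mul_assoc D, eq_sub_of_add_eq h, mul_sub, mul_one,
      ← mul_assoc D]
    have h3 : D * x (l + N - p) * τ (l + N - (p + 1))
        = -((-1) ^ s * (x (l + N + 1) * D) * τ (l + N - (p + 1))) := by
      rw [eq_neg_iff_add_eq_zero, ← add_mul, ← hs, h0]
    rw [h3, pow_succ]
    simp only [mul_assoc, mul_neg, mul_one, neg_mul, sub_neg_eq_add]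
    abel

lemma tl_mem_sum (hl : 1 ≤ l) (hN : l + N + 1 ≤ k) :
    ∃ r : ℕ → E, tl τ l N
      = ∑ i ∈ range (N + 2), x (l + N + 1) ^ i * (tl τ l (N + 1) * r i) := by
  have key : ∀ q p, p + q = N + 1 → ∃ r : ℕ → E, tl τ l N * desc τ (l + N + 1 - p) p
      = ∑ i ∈ range (q + 1), x (l + N + 1) ^ i * (tl τ l (N + 1) * r i) := by
    intro q
    induction q with
    | zero =>
      intro p hp
      obtain rfl : p = N + 1 := ω
      have h := H.tl_right_desc hl hN
      obtain ⟨s, hs⟩ := h.symm.exists_sign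
      refine ⟨fun _ => (-1) ^ s, ?_⟩
      rw [show l + N + 1 - (N + 1) = l by omega, hs]
      simp only [zero_add, Finset.range_one, Finset.sum_singleton, pow_zero, one_mul]
      rcases neg_one_pow_eq_or E s with h | h <;> simp [h]
    | succ q ih =>
      intro p hp
      obtain ⟨r, hr⟩ := ih (p + 1) ω
      rw [show l + N + 1 - (p + 1) = l + N - p by omega] at hr
      obtain ⟨s, hs⟩ := H.tl_desc_step hl hN (show p ≤ N by omega)
      rw [hs, hr]
      refine ⟨fun i => (if i < q + 1 then r i * x (l + N - p) else 0) +
        (if i = 0 then 0 else (-1) ^ s * r (i - 1)), ?_⟩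
      simp only [mul_add, Finset.sum_add_distrib]
      congr 1
      · rw [sum_range_succ _ (q + 1)]
        simp only [lt_self_iff_false, if_false, mul_zero, add_zero, sum_mul]
        refine sum_congr rfl fun i hi => ?_
        rw [mem_range] at hi
        simp [hi, mul_assoc]
      · rw [sum_range_succ' _ (q + 1)]
        simp only [if_true, mul_zero, add_zero, mul_sum]
        refine sum_congr rfl fun i hi => ?_
        rcases neg_one_pow_eq_or E s with h | h <;> simp [h, pow_succ', mul_assoc]
  obtain ⟨r, hr⟩ := key (N + 1) 0 ω
  exact ⟨r, by simpa using hr⟩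

lemma pow_indep {R : ℕ} (hl : 1 ≤ l) (hN : l + N ≤ k) (hR : R ≤ N) (g : ℕ → E)
    (hg : ∀ j i, l ≤ i → i < l + N → τ i * g j = 0)
    (h : ∑ i ∈ range (R + 1), x (l + N) ^ i * g i = 0) : ∀ i < R + 1, g i = 0 := by
  induction R with
  | zero => intro i hi; obtain rfl : i = 0 := ω
            simpa using h
  | succ R ih =>
    have h0 : g (R + 1) = 0 := by
      have h1 := congrArg (asc τ (l + N - (R + 1)) (R + 1) * ·) h
      simp only [mul_zero, mul_sum, ← mul_assoc] at h1
      have h2 := fun {M} (hM : M ≤ R + 1) j => H.asc_x_pow (l := l + N - (R + 1)) (g := g j)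
        ω ω hM fun i h1 h2 => hg j i ω ω
      rw [show l + N - (R + 1) + (R + 1) = l + N by omega] at h2
      rw [sum_range_succ, sum_eq_zero, zero_add] at h1
      · exact (((h2 le_rfl _).2 rfl).symm).eq_zero h1
      · intro i hi
        rw [mem_range] at hi
        exact (h2 ω i).1 hi
    rw [sum_range_succ, h0, mul_zero, add_zero] at h
    intro i hi
    rcases Nat.lt_succ_iff_lt_or_eq.mp hi with hi | rfl
    · exact ih ω h i hi
    · exact h0

lemma exists_full_family (hl : 1 ≤ l) (hN : N = 0 ∨ l + N ≤ k) :
    ∃ (ι : Type) (_ : Fintype ι) (κ : ι → E), Fintype.card ι = (N + 1).factorial ∧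
      (∀ i, ∃ v : List ℕ, (∀ j ∈ v, l < j ∧ j ≤ l + N) ∧ κ i = wd x v) ∧
      (∀ h : E, ∃ r : ι → E, h = ∑ i, κ i * (tl τ l N * r i)) ∧
      (∀ g : ι → E, (∀ j i, l ≤ i → i < l + N → τ i * g j = 0) → ∑ i, κ i * g i = 0 →
        ∀ i, g i = 0) := by
  induction N with
  | zero =>
    refine ⟨Unit, inferInstance, fun _ => 1, by simp, fun _ => ⟨[], by simp⟩,
      fun h => ⟨fun _ => h, by simp⟩, ?_⟩
    intro g _ h i
    simpa using h
  | succ N ih =>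
    replace hN : l + (N + 1) ≤ k := ω
    obtain ⟨ι, _, κ, h1, h2, h3, h4⟩ := ih ω
    refine ⟨ι × Fin (N + 2), inferInstance, fun p => κ p.1 * x (l + N + 1) ^ (p.2 : ℕ), ?_, ?_,
      ?_, ?_⟩
    · rw [Fintype.card_prod, h1, Fintype.card_fin, mul_comm, Nat.factorial_succ (N + 1)]
    · rintro ⟨i, e⟩
      obtain ⟨v, hv, hk⟩ := h2 i
      refine ⟨v ++ List.replicate e (l + N + 1), ?_, ?_⟩
      · intro j hj
        rw [List.mem_append, List.mem_replicate] at hj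
        rcases hj with hj | ⟨_, rfl⟩
        · have := hv j hj; omega
        · omega
      · rw [wd_append, ← hk]; simp [wd]
    · intro h
      obtain ⟨r, rfl⟩ := h3 h
      obtain ⟨s, hs⟩ := H.tl_mem_sum hl ω
      refine ⟨fun p => s p.2 * r p.1, ?_⟩
      rw [Fintype.sum_prod_type]
      refine sum_congr rfl fun i _ => ?_
      rw [hs, sum_mul, mul_sum, Finset.sum_range]
      simp only [mul_assoc]
    · intro g hg h
      rw [Fintype.sum_prod_type] at h
      simp only [mul_assoc, ← mul_sum] at h
      have h5 := h4 (fun i => ∑ j : Fin (N + 2), x (l + N + 1) ^ (j : ℕ) * g (i, j)) ?_ h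
      · rintro ⟨i, j⟩
        have h6 := h5 i
        have h7 := H.pow_indep hl hN le_rfl
          (fun e => if he : e < N + 2 then g (i, ⟨e, he⟩) else 0) ?_ ?_ j j.2
        · simpa using h7
        · intro e t h1 h2
          split_ifs
          · exact hg _ _ h1 h2
          · simp
        · rw [Finset.sum_range]
          simpa [add_assoc] using h6
      · intro j i hi1 hi2
        rw [mul_sum]
        refine sum_eq_zero fun e _ => ?_
        have h6 : PM (τ i * x (l + N + 1) ^ (e : ℕ)) (x (l + N + 1) ^ (e : ℕ) * τ i) :=
          PM.mul_pow (H.pm_taux ω ω ω ω)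
        rw [← mul_assoc]
        refine (h6.mul_right _).eq_zero ?_
        rw [mul_assoc, hg _ _ hi1 ω, mul_zero]

open MulOpposite in
lemma opp : Sys n k (fun i => op (x i)) (fun i => op (τ i)) (fun i => op (χ i)) (op d) where
  chi_zero := by rw [H.chi_zero, op_one]
  tau_sq i h1 h2 := by rw [← op_mul, H.tau_sq i h1 h2, op_zero]
  braid i h1 h2 := by
    simp only [← op_mul]; rw [← mul_assoc, ← mul_assoc, H.braid i h1 h2]
  x_tau i h1 h2 := by rw [← op_mul, ← op_mul, ← op_add, H.tau_x i h1 h2, op_one]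
  tau_x i h1 h2 := by rw [← op_mul, ← op_mul, ← op_add, H.x_tau i h1 h2, op_one]
  x_x i j h1 h2 h3 h4 h5 := by
    rw [← op_mul, ← op_mul, ← op_add, add_comm, H.x_x i j h1 h2 h3 h4 h5, op_zero]
  tau_tau i j h1 h2 h3 h4 h5 := by
    rw [← op_mul, ← op_mul, ← op_add, add_comm, H.tau_tau i j h1 h2 h3 h4 h5, op_zero]
  x_tau_far i j h1 h2 h3 h4 h5 h6 := by
    rw [← op_mul, ← op_mul, ← op_add, add_comm, H.x_tau_far i j h1 h2 h3 h4 h5 h6, op_zero]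
  d_sq := by rw [← op_mul, H.d_sq, op_zero]
  d_chi_top h := by
    rw [← op_mul]
    rcases Nat.eq_zero_or_pos (n / 2) with h0 | h0
    · have := H.d_chi_top h
      rw [h0, H.chi_zero, mul_one] at this
      rw [this, mul_zero, op_zero]
    · rw [H.chi_d _ h0 le_rfl, H.d_chi_top h, op_zero]
  chi_chi i j h1 h2 h3 h4 := by rw [← op_mul, ← op_mul, H.chi_chi i j h1 h2 h3 h4]
  chi_d i h1 h2 := by rw [← op_mul, ← op_mul, H.chi_d i h1 h2]
  x_chi i j h1 h2 h3 h4 := by rw [← op_mul, ← op_mul, H.x_chi i j h1 h2 h3 h4]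
  tau_chi i j h1 h2 h3 h4 := by rw [← op_mul, ← op_mul, H.tau_chi i j h1 h2 h3 h4]
  x_d i h1 h2 := by rw [← op_mul, ← op_mul, ← op_neg, H.x_d i h1 h2, neg_neg]
  tau_d i h1 h2 := by rw [← op_mul, ← op_mul, ← op_neg, H.tau_d i h1 h2, neg_neg]

omit H in
lemma asc_op (l N : ℕ) :
    asc (fun i => op (τ i)) l N = op (desc τ l N) := by
  induction N with
  | zero => simp
  | succ N ih => rw [asc_succ, ih, desc_succ, MulOpposite.op_mul]

omit H in
lemma wd_op (v : List ℕ) : wd (fun i => op (τ i)) v = op (wd τ v.reverse) := by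
  induction v with
  | nil => simp
  | cons i v ih => simp [ih, MulOpposite.op_mul]

lemma tl_op (hl : 1 ≤ l) (hN : N = 0 ∨ l + N ≤ k) :
    PM (tl (fun i => op (τ i)) l N) (op (tl τ l N)) := by
  induction N with
  | zero => simp [PM]
  | succ N ih =>
    rw [tl_succ, asc_op]
    refine ((ih ω).mul_left _).trans ?_
    rw [← MulOpposite.op_mul]
    rcases H.tl_right_desc hl (ω : l + N + 1 ≤ k) with h | h
    · exact .inl (by rw [h])
    · exact .inr (by rw [h, MulOpposite.op_neg, neg_neg])

lemma exists_full_family_right (hl : 1 ≤ l) (hN : N = 0 ∨ l + N ≤ k) :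
    ∃ (ι : Type) (_ : Fintype ι) (κ : ι → E), Fintype.card ι = (N + 1).factorial ∧
      (∀ i, ∃ v : List ℕ, (∀ j ∈ v, l < j ∧ j ≤ l + N) ∧ κ i = wd x v) ∧
      (∀ h : E, ∃ r : ι → E, h = ∑ i, (r i * tl τ l N) * κ i) ∧
      (∀ g : ι → E, (∀ j i, l ≤ i → i < l + N → g j * τ i = 0) → ∑ i, g i * κ i = 0 →
        ∀ i, g i = 0) := by
  obtain ⟨ι, _, κ, h1, h2, h3, h4⟩ := H.opp.exists_full_family hl hN
  refine ⟨ι, inferInstance, fun i => (κ i).unop, h1, ?_, ?_, ?_⟩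
  · intro i
    obtain ⟨v, hv, hk⟩ := h2 i
    exact ⟨v.reverse, by simpa using hv, by simp only [hk, wd_op, MulOpposite.unop_op]⟩
  · intro h
    obtain ⟨r, hr⟩ := h3 (op h)
    have hr := congrArg unop hr
    rw [Finset.unop_sum] at hr
    rcases H.tl_op hl hN with hs | hs
    · refine ⟨fun i => (r i).unop, hr.trans (sum_congr rfl fun i _ => ?_)⟩
      rw [hs, MulOpposite.unop_mul, MulOpposite.unop_mul, MulOpposite.unop_op]
    · refine ⟨fun i => -(r i).unop, hr.trans (sum_congr rfl fun i _ => ?_)⟩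
      rw [hs, MulOpposite.unop_mul, MulOpposite.unop_mul, MulOpposite.unop_neg,
        MulOpposite.unop_op, mul_neg, neg_mul]
      simp only [neg_mul]
  · intro g hg h i
    have := h4 (fun i => op (g i)) (fun j i h1 h2 => by
      rw [← MulOpposite.op_mul, hg j i h1 h2, MulOpposite.op_zero])
      (by rw [← MulOpposite.unop_inj, Finset.unop_sum]; simpa using h) i
    exact MulOpposite.op_injective this

end

end Sys

lemma Sys.neg_d {E : Type*} [Ring E] {x τ χ : ℕ → E} {d : E} (H : Sys n k x τ χ d) :
    Sys n k x τ χ (-d) := { H with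
    d_sq := by rw [neg_mul_neg, H.d_sq]
    d_chi_top := fun h => by rw [neg_mul, H.d_chi_top h, neg_zero]
    chi_d := fun i h1 h2 => by rw [mul_neg, neg_mul, H.chi_d i h1 h2]
    x_d := fun i h1 h2 => by rw [neg_mul, H.x_d i h1 h2, mul_neg]
    tau_d := fun i h1 h2 => by rw [neg_mul, H.tau_d i h1 h2, mul_neg] }

namespace ONH

section

lemma chi_zero : (chi 0 : ONH K n k) = 1 := by simp [chi, fchi]

lemma sys : Sys n k (x : ℕ → ONH K n k) tau chi d where
  chi_zero := chi_zero
  tau_sq i h1 h2 := by simpa [tau] using mk_rel (Rel.tau_sq (𝕜 := K) (n := n) (k := k) i ⟨h1, h2⟩)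
  braid i h1 h2 := by
    simpa [tau] using mk_rel (Rel.braid (𝕜 := K) (n := n) (k := k) i ⟨h1, h2⟩)
  x_tau i h1 h2 := by
    simpa [tau, x] using mk_rel (Rel.x_tau (𝕜 := K) (n := n) (k := k) i ⟨h1, h2⟩)
  tau_x i h1 h2 := by
    simpa [tau, x] using mk_rel (Rel.tau_x (𝕜 := K) (n := n) (k := k) i ⟨h1, h2⟩)
  x_x i j h1 h2 h3 h4 h5 := by
    simpa [x] using mk_rel (Rel.x_x (𝕜 := K) (n := n) (k := k) i j ⟨h1, h2⟩ ⟨h3, h4⟩ h5)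
  tau_tau i j h1 h2 h3 h4 h5 := by
    simpa [tau] using mk_rel (Rel.tau_tau (𝕜 := K) (n := n) (k := k) i j ⟨h1, h2⟩ ⟨h3, h4⟩ h5)
  x_tau_far i j h1 h2 h3 h4 h5 h6 := by
    simpa [tau, x] using
      mk_rel (Rel.x_tau_far (𝕜 := K) (n := n) (k := k) i j ⟨h1, h2⟩ ⟨h3, h4⟩ h5 h6)
  d_sq := by simpa [d] using mk_rel (Rel.d_sq (𝕜 := K) (n := n) (k := k))
  d_chi_top h := by simpa [d, chi] using mk_rel (Rel.d_chi_top (𝕜 := K) (n := n) (k := k) h)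
  chi_chi i j h1 h2 h3 h4 := by
    simpa [chi] using mk_rel (Rel.chi_chi (𝕜 := K) (n := n) (k := k) i j ⟨h1, h2⟩ ⟨h3, h4⟩)
  chi_d i h1 h2 := by
    simpa [chi, d] using mk_rel (Rel.chi_d (𝕜 := K) (n := n) (k := k) i ⟨h1, h2⟩)
  x_chi i j h1 h2 h3 h4 := by
    simpa [chi, x] using mk_rel (Rel.x_chi (𝕜 := K) (n := n) (k := k) i j ⟨h1, h2⟩ ⟨h3, h4⟩)
  tau_chi i j h1 h2 h3 h4 := by
    simpa [chi, tau] using mk_rel (Rel.tau_chi (𝕜 := K) (n := n) (k := k) i j ⟨h1, h2⟩ ⟨h3, h4⟩)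
  x_d i h1 h2 := by
    simpa [d, x] using mk_rel (Rel.x_d (𝕜 := K) (n := n) (k := k) i ⟨h1, h2⟩)
  tau_d i h1 h2 := by
    simpa [d, tau] using mk_rel (Rel.tau_d (𝕜 := K) (n := n) (k := k) i ⟨h1, h2⟩)

lemma sysOf (K : Type u) [CommRing K] (n k : ℕ) : Sys n k (x : ℕ → ONH K n k) tau chi d := sys

lemma mk_fc (r : ℕ) : mk K n k (fc K n k r) = cOf chi d r := by
  unfold fc cOf
  split_ifs
  · rfl
  · rw [map_mul]; rfl

lemma mk_fa : mk K n k (fa K n k) = aOf n chi d (x 1) := by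
  simp only [fa, aOf, map_sum, map_mul, map_pow, map_neg, map_one, mk_fc]
  rfl

lemma aOf_x_one (hk : 1 ≤ k) : aOf n (chi : ℕ → ONH K n k) d (x 1) = 0 := by
  rw [← mk_fa, mk_rel (Rel.cyc hk), map_zero]

lemma gen_x (i : Fin k) : gen (.x i) = (x (i + 1) : ONH K n k) := by
  simp only [x, fx, gen]
  rw [dif_pos ω]; rfl

lemma gen_tau (i : Fin (k - 1)) : gen (.tau i) = (tau (i + 1) : ONH K n k) := by
  simp only [tau, ftau, gen]
  rw [dif_pos ω]; rfl

lemma gen_chi (i : Fin (n / 2)) : gen (.chi i) = (chi (i + 1) : ONH K n k) := by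
  simp only [chi, fchi, gen]
  rw [if_neg ω, dif_pos ω]; rfl

lemma gen_d : gen .d = (d : ONH K n k) := rfl

lemma chi_of_lt (h : n / 2 < i) : (chi i : ONH K n k) = 0 := by
  simp only [chi, fchi]
  rw [if_neg ω, dif_neg ω, map_zero]

section lift

variable {E : Type*} [Ring E] [Algebra K E] {X T χ : ℕ → E} {D : E}

/-- Images of the generators under `lift`. -/
def liftGen (X T χ : ℕ → E) (D : E) : Gen n k → E
  | .x i => X (i + 1)
  | .tau i => T (i + 1)
  | .chi i => χ (i + 1)
  | .d => D

lemma liftGen_fx (h1 : 1 ≤ i) (h2 : i ≤ k) :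
    FreeAlgebra.lift K (liftGen (n := n) (k := k) X T χ D) (fx K n k i) = X i := by
  rw [fx, dif_pos ⟨h1, h2⟩, lift_ι_apply]
  simp only [liftGen]
  congr 1; omega

lemma liftGen_ftau (h1 : 1 ≤ i) (h2 : i + 1 ≤ k) :
    FreeAlgebra.lift K (liftGen (n := n) (k := k) X T χ D) (ftau K n k i) = T i := by
  rw [ftau, dif_pos ⟨h1, h2⟩, lift_ι_apply]
  simp only [liftGen]
  congr 1; omega

lemma liftGen_fchi (h0 : χ 0 = 1) (h2 : i ≤ n / 2) :
    FreeAlgebra.lift K (liftGen (n := n) (k := k) X T χ D) (fchi K n k i) = χ i := by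
  unfold fchi
  split_ifs with h h'
  · rw [h, h0, map_one]
  · rw [lift_ι_apply]
    simp only [liftGen]
    congr 1; omega
  · omega

lemma liftGen_fd :
    FreeAlgebra.lift K (liftGen (n := n) (k := k) X T χ D) (fd K n k) = D := by
  rw [fd, lift_ι_apply]; rfl

lemma liftGen_fa (h0 : χ 0 = 1) (hk : 1 ≤ k) :
    FreeAlgebra.lift K (liftGen (n := n) (k := k) X T χ D) (fa K n k) = aOf n χ D (X 1) := by
  have hc : ∀ r ≤ n, FreeAlgebra.lift K (liftGen (n := n) (k := k) X T χ D) (fc K n k r)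
      = cOf χ D r := by
    intro r hr
    unfold fc cOf
    split_ifs
    · rw [liftGen_fchi h0 ω]
    · rw [map_mul, liftGen_fchi h0 ω, liftGen_fd]
  simp only [fa, aOf, map_sum, map_mul, map_pow, map_neg, map_one, liftGen_fx le_rfl hk]
  exact sum_congr rfl fun l hl => by rw [hc _ ω]

/-- The universal property of `ONH_k^n`. -/
def lift (H : Sys n k X T χ D) (hc : 1 ≤ k → aOf n χ D (X 1) = 0) :
    ONH K n k →ₐ[K] E :=
  RingQuot.liftAlgHom K ⟨FreeAlgebra.lift K (liftGen (n := n) (k := k) X T χ D), by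
    intro u v huv
    induction huv with
    | tau_sq i hi =>
      simp (discharger := omega) only [map_mul, map_zero, liftGen_ftau, H.tau_sq]
    | braid i hi =>
      simp (discharger := omega) only [map_mul, liftGen_ftau, H.braid]
    | x_tau i hi =>
      simp (discharger := omega) only [map_mul, map_add, map_one, liftGen_fx, liftGen_ftau, H.x_tau]
    | tau_x i hi =>
      simp (discharger := omega) only [map_mul, map_add, map_one, liftGen_fx, liftGen_ftau, H.tau_x]
    | x_x i j hi hj hij =>
      simp (discharger := omega) only [map_mul, map_add, map_zero, liftGen_fx, H.x_x]
    | tau_tau i j hi hj hij =>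
      simp (discharger := omega) only [map_mul, map_add, map_zero, liftGen_ftau, H.tau_tau]
    | x_tau_far i j hi hj hij hij' =>
      simp (discharger := omega) only [map_mul, map_add, map_zero, liftGen_fx, liftGen_ftau,
        H.x_tau_far]
    | d_sq => simp only [map_mul, map_zero, liftGen_fd, H.d_sq]
    | d_chi_top hn =>
      simp only [map_mul, map_zero, liftGen_fd, liftGen_fchi H.chi_zero le_rfl, H.d_chi_top hn]
    | chi_chi i j hi hj =>
      rw [map_mul, map_mul, liftGen_fchi H.chi_zero hi.2, liftGen_fchi H.chi_zero hj.2,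
        H.chi_chi i j hi.1 hi.2 hj.1 hj.2]
    | chi_d i hi =>
      rw [map_mul, map_mul, liftGen_fchi H.chi_zero hi.2, liftGen_fd, H.chi_d i hi.1 hi.2]
    | x_chi i j hi hj =>
      rw [map_mul, map_mul, liftGen_fchi H.chi_zero hj.2, liftGen_fx hi.1 hi.2,
        H.x_chi i j hi.1 hi.2 hj.1 hj.2]
    | tau_chi i j hi hj =>
      rw [map_mul, map_mul, liftGen_fchi H.chi_zero hj.2, liftGen_ftau hi.1 hi.2,
        H.tau_chi i j hi.1 hi.2 hj.1 hj.2]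
    | x_d i hi => rw [map_mul, map_neg, map_mul, liftGen_fd, liftGen_fx hi.1 hi.2, H.x_d i hi.1 hi.2]
    | tau_d i hi =>
      rw [map_mul, map_neg, map_mul, liftGen_fd, liftGen_ftau hi.1 hi.2, H.tau_d i hi.1 hi.2]
    | cyc hk => rw [liftGen_fa H.chi_zero hk, hc hk, map_zero]⟩

variable (H : Sys n k X T χ D) (hc : 1 ≤ k → aOf n χ D (X 1) = 0)

lemma lift_mk (f : FreeAlgebra K (Gen n k)) : lift H hc (mk K n k f)
    = FreeAlgebra.lift K (liftGen (n := n) (k := k) X T χ D) f :=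
  RingQuot.liftAlgHom_mkAlgHom_apply K _ _ f

lemma lift_gen (g : Gen n k) : lift H hc (gen g : ONH K n k) = liftGen X T χ D g := by
  rw [gen, lift_mk, lift_ι_apply]

lemma lift_x (h1 : 1 ≤ i) (h2 : i ≤ k) : lift H hc (x i : ONH K n k) = X i := by
  rw [x, lift_mk, liftGen_fx h1 h2]

lemma lift_tau (h1 : 1 ≤ i) (h2 : i < k) : lift H hc (tau i : ONH K n k) = T i := by
  rw [tau, lift_mk, liftGen_ftau h1 h2]

lemma lift_chi (h : i ≤ n / 2) : lift H hc (chi i : ONH K n k) = χ i := by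
  rw [chi, lift_mk, liftGen_fchi H.chi_zero h]

lemma lift_d : lift H hc (d : ONH K n k) = D := by rw [d, lift_mk, liftGen_fd]

end lift

lemma algHom_ext {E : Type*} [Ring E] [Algebra K E] {f g : ONH K n k →ₐ[K] E}
    (h : ∀ u, f (gen u) = g (gen u)) : f = g := by
  ext a
  induction a using ONH.induction with
  | hc r => simp
  | hg u => exact h u
  | ha a b h1 h2 => simp [h1, h2]
  | hm a b h1 h2 => simp [h1, h2]

section incl

variable (h : k ≤ m)

lemma incl_x (h1 : 1 ≤ i) (h2 : i ≤ k) :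
    incl h (x i : ONH K n k) = x i := by
  have := incl_gen (𝕜 := K) (n := n) h (.x ⟨i - 1, ω⟩)
  rw [gen_x] at this
  simpa only [inclGen, Nat.sub_add_cancel h1] using this

lemma incl_tau (h1 : 1 ≤ i) (h2 : i < k) :
    incl h (tau i : ONH K n k) = tau i := by
  have := incl_gen (𝕜 := K) (n := n) h (.tau ⟨i - 1, ω⟩)
  rw [gen_tau] at this
  simpa only [inclGen, Nat.sub_add_cancel h1] using this

lemma incl_chi (i : ℕ) : incl h (chi i : ONH K n k) = chi i := by
  rcases Nat.eq_zero_or_pos i with rfl | h1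
  · rw [chi_zero, chi_zero, map_one]
  by_cases h2 : i ≤ n / 2
  · have := incl_gen (𝕜 := K) (n := n) h (.chi ⟨i - 1, ω⟩)
    rw [gen_chi] at this
    simpa only [inclGen, Nat.sub_add_cancel h1] using this
  · rw [chi_of_lt ω, chi_of_lt ω, map_zero]

lemma incl_d : incl h (d : ONH K n k) = d := incl_gen h .d

lemma incl_wd_x (hv : ∀ i ∈ v, 1 ≤ i ∧ i ≤ k) :
    incl h (wd x v : ONH K n k) = wd x v := by
  induction v with
  | nil => simp
  | cons i v ih =>
    have := hv i (by simp)
    rw [wd_cons, map_mul, incl_x h this.1 this.2, ih fun j hj => hv j (by simp [hj]), wd_cons]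

lemma incl_wd_tau (hv : ∀ i ∈ v, 1 ≤ i ∧ i < k) :
    incl h (wd tau v : ONH K n k) = wd tau v := by
  induction v with
  | nil => simp
  | cons i v ih =>
    have := hv i (by simp)
    rw [wd_cons, map_mul, incl_tau h this.1 this.2, ih fun j hj => hv j (by simp [hj]), wd_cons]

lemma incl_refl (s : ONH K n k) : incl le_rfl s = s := by
  have : (incl le_rfl : ONH K n k →ₐ[K] ONH K n k) = AlgHom.id _ _ := by
    refine algHom_ext fun u => ?_
    rw [incl_gen]
    cases u with
    | x i => exact (gen_x i).symm
    | tau i => exact (gen_tau i).symm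
    | chi i => exact (gen_chi i).symm
    | d => rfl
  rw [this]; rfl

end incl

/-! ### The reversal anti-automorphism -/

lemma aOf_op (hk : 1 ≤ k) :
    aOf n (fun i => op (chi i : ONH K n k)) ((-1) ^ (n + 1) * op d)
      (op (x 1)) = 0 := by
  rw [← MulOpposite.op_zero, ← aOf_x_one (K := K) (n := n) hk, aOf, aOf, Finset.op_sum]
  refine sum_congr rfl fun l hl => ?_
  have hl : l ≤ n := by rw [mem_range] at hl; omega
  have hχ : ∀ i, chi i * (x 1 : ONH K n k) = x 1 * chi i := by
    intro i
    rcases Nat.eq_zero_or_pos i with rfl | h1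
    · simp [chi_zero]
    by_cases h2 : i ≤ n / 2
    · exact sys.x_chi _ _ le_rfl hk h1 h2
    · simp [chi_of_lt (show n / 2 < i by omega)]
  have hχ' : ∀ i, chi i * (x 1 : ONH K n k) ^ l = x 1 ^ l * chi i := fun i =>
    (show Commute (chi i : ONH K n k) (x 1) from hχ i).pow_right l
  have hd : d * (x 1 : ONH K n k) ^ l = (-1) ^ l * (x 1 ^ l * d) := by
    have := sc_pow (y := (d : ONH K n k)) (z := x 1) (p := 1)
      (by rw [sys.x_d 1 le_rfl hk]; simp) l
    simpa using this
  have hcd : ∀ i, chi i * (d : ONH K n k) = d * chi i := by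
    intro i
    rcases Nat.eq_zero_or_pos i with rfl | h1
    · simp [chi_zero]
    by_cases h2 : i ≤ n / 2
    · exact sys.chi_d _ h1 h2
    · simp [chi_of_lt (show n / 2 < i by omega)]
  have hs : ∀ p : ℕ, ((-1) ^ p : (ONH K n k)ᵐᵒᵖ) = op ((-1) ^ p) := fun p => by simp
  unfold cOf
  split_ifs with he
  · rw [hs, ← MulOpposite.op_pow, ← MulOpposite.op_mul, ← MulOpposite.op_mul]
    congr 1
    rw [← mul_assoc, hχ']
    rcases neg_one_pow_eq_or (ONH K n k) l with h | h <;> simp [h]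
  · rw [hs, hs, ← MulOpposite.op_pow, ← MulOpposite.op_mul, ← MulOpposite.op_mul,
      ← MulOpposite.op_mul, ← MulOpposite.op_mul]
    congr 1
    have hp : ((-1) ^ (n + 1) : ONH K n k) = (-1) ^ l := by
      have h2 : n + 1 = l + (n - l + 1) := ω
      rw [h2, pow_add, (Nat.not_even_iff_odd.mp he).add_one.neg_one_pow, mul_one]
    rw [hp]
    have h1 : d * (x 1 : ONH K n k) ^ l * (-1) ^ l = x 1 ^ l * d := by
      rw [hd]
      rcases neg_one_pow_eq_or (ONH K n k) l with h | h <;> simp [h]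
    calc chi ((n - l) / 2) * (d * (-1) ^ l) * (x 1 ^ l * (-1) ^ l)
        = chi ((n - l) / 2) * (d * x 1 ^ l * (-1) ^ l) * (-1) ^ l := by
          rcases neg_one_pow_eq_or (ONH K n k) l with h | h <;> simp [h, mul_assoc]
      _ = (-1) ^ l * x 1 ^ l * (d * chi ((n - l) / 2)) := by
          rw [h1, ← mul_assoc, hχ', mul_assoc (x 1 ^ l), hcd]
          rcases neg_one_pow_eq_or (ONH K n k) l with h | h <;> simp [h]

/-- The anti-automorphism fixing the `x_i`, `τ_i` and `χ_i`. -/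
def rev : ONH K n k →ₐ[K] (ONH K n k)ᵐᵒᵖ := lift (X := fun i => op (x i)) (T := fun i => op (tau i))
    (χ := fun i => op (chi i)) (D := (-1) ^ (n + 1) * op d) (by
      rcases neg_one_pow_eq_or (ONH K n k)ᵐᵒᵖ (n + 1) with h | h <;> rw [h]
      · rw [one_mul]; exact sys.opp
      · rw [neg_one_mul]; exact sys.opp.neg_d) aOf_op

end

end ONH

/-! ## The coefficient ring -/

/-- The ring `A_n`, as a ring of scalars. -/
def Coef (K : Type u) [CommRing K] (n : ℕ) : Type u := ONH K n 0

section

instance : Ring (Coef K n) := inferInstanceAs (Ring (ONH K n 0))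

lemma ONH.commute_gen_zero (g h : Gen n 0) : Commute (ONH.gen g : ONH K n 0) (ONH.gen h) := by
  cases g with
  | x i => exact i.elim0
  | tau i => exact i.elim0
  | chi i =>
    cases h with
    | x i => exact i.elim0
    | tau i => exact i.elim0
    | chi j =>
      rw [ONH.gen_chi, ONH.gen_chi]
      exact ONH.sys.chi_chi _ _ ω ω ω ω
    | d => rw [ONH.gen_chi]; exact ONH.sys.chi_d _ ω ω
  | d =>
    cases h with
    | x i => exact i.elim0
    | tau i => exact i.elim0
    | chi j => rw [ONH.gen_chi]; exact (ONH.sys.chi_d _ ω ω).symm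
    | d => exact Commute.refl _

lemma ONH.mul_comm_zero (a b : ONH K n 0) : a * b = b * a := by
  change Commute a b
  induction a using ONH.induction with
  | hc r => exact Algebra.commutes _ _
  | hg g =>
    induction b using ONH.induction with
    | hc r => exact (Algebra.commutes _ _).symm
    | hg h => exact ONH.commute_gen_zero g h
    | ha a b h1 h2 => exact h1.add_right h2
    | hm a b h1 h2 => exact h1.mul_right h2
  | ha a b h1 h2 => exact h1.add_left h2
  | hm a b h1 h2 => exact h1.mul_left h2

instance : CommRing (Coef K n) := { (inferInstanceAs (Ring (ONH K n 0)) : Ring (Coef K n)) with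
    mul_comm := ONH.mul_comm_zero }

instance : Algebra K (Coef K n) := inferInstanceAs (Algebra K (ONH K n 0))

namespace Coef

/-- The scalar `χ_i`. -/
def chi (i : ℕ) : Coef K n := (ONH.chi i : ONH K n 0)

/-- The scalar `d`. -/
def d : Coef K n := (ONH.d : ONH K n 0)

lemma induction {p : Coef K n → Prop} (hc : ∀ r, p (algebraMap K _ r))
    (hχ : ∀ i, 1 ≤ i → i ≤ n / 2 → p (chi i)) (hd : p d)
    (ha : ∀ a b, p a → p b → p (a + b)) (hm : ∀ a b, p a → p b → p (a * b)) (a : Coef K n) :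
    p a := by
  refine ONH.induction (k := 0) (p := p) hc (fun g => ?_) ha hm a
  cases g with
  | x i => exact i.elim0
  | tau i => exact i.elim0
  | chi i => rw [ONH.gen_chi]; exact hχ _ ω ω
  | d => exact hd

/-- The universal property of the scalars. -/
def lift {E : Type*} [Ring E] [Algebra K E] {X T χ : ℕ → E} {D : E}
    (H : Sys n 0 X T χ D) : Coef K n →ₐ[K] E := (ONH.lift H (by simp) : ONH K n 0 →ₐ[K] E)

lemma lift_chi {E : Type*} [Ring E] [Algebra K E] {X T χ : ℕ → E} {D : E}
    (H : Sys n 0 X T χ D) (h : i ≤ n / 2) : lift H (chi i : Coef K n) = χ i := ONH.lift_chi _ _ h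

lemma lift_d {E : Type*} [Ring E] [Algebra K E] {X T χ : ℕ → E} {D : E}
    (H : Sys n 0 X T χ D) : lift H (d : Coef K n) = D := ONH.lift_d _ _

lemma sys : Sys n 0 (fun _ => 0) (fun _ => 0) (chi : ℕ → Coef K n) d :=
  have H := ONH.sysOf K n 0
  { chi_zero := H.chi_zero
    tau_sq := fun i h1 h2 => ω
    braid := fun i h1 h2 => ω
    x_tau := fun i h1 h2 => ω
    tau_x := fun i h1 h2 => ω
    x_x := fun i j h1 h2 => ω
    tau_tau := fun i j h1 h2 => ω
    x_tau_far := fun i j h1 h2 => ω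
    d_sq := H.d_sq
    d_chi_top := H.d_chi_top
    chi_chi := H.chi_chi
    chi_d := H.chi_d
    x_chi := fun i j h1 h2 => ω
    tau_chi := fun i j h1 h2 => ω
    x_d := fun i h1 h2 => ω
    tau_d := fun i h1 h2 => ω }

lemma chi_zero : (chi 0 : Coef K n) = 1 := ONH.chi_zero

/-- The parity automorphism of the scalars. -/
def parity : Coef K n →ₐ[K] Coef K n := lift sys.neg_d

lemma parity_chi (h : i ≤ n / 2) : parity (chi i : Coef K n) = chi i := lift_chi _ h

lemma parity_d : parity (d : Coef K n) = -d := lift_d _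

lemma parity_parity (a : Coef K n) : parity (parity a) = a := by
  induction a using Coef.induction with
  | hc r => simp
  | hχ i h1 h2 => rw [parity_chi h2, parity_chi h2]
  | hd => rw [parity_d, map_neg, parity_d, neg_neg]
  | ha a b h1 h2 => rw [map_add, map_add, h1, h2]
  | hm a b h1 h2 => rw [map_mul, map_mul, h1, h2]

/-- The element `c_r` as a scalar. -/
def c (r : ℕ) : Coef K n := cOf chi d r

end Coef

namespace ONH

/-- The structure map of `ONH_k^n` over `A_n`. -/
def cf (k : ℕ) : Coef K n →ₐ[K] ONH K n k := incl (Nat.zero_le k)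

instance : Module (Coef K n) (ONH K n k) := Module.compHom _ (cf k).toRingHom

lemma smul_def (a : Coef K n) (h : ONH K n k) : a • h = cf k a * h := rfl

instance : IsScalarTower (Coef K n) (ONH K n k) (ONH K n k) :=
  ⟨fun a g h => by simp only [smul_def, smul_eq_mul, mul_assoc]⟩

lemma incl_cf (h : k ≤ m) (a : Coef K n) : incl h (cf k a) = cf m a := incl_incl _ _ a

lemma incl_smul (h : k ≤ m) (a : Coef K n) (g : ONH K n k) :
    incl h (a • g) = a • incl h g := by rw [smul_def, smul_def, map_mul, incl_cf]

lemma cf_chi (i : ℕ) : cf k (Coef.chi i : Coef K n) = chi i := incl_chi _ i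

lemma cf_d : cf k (Coef.d : Coef K n) = d := incl_d _

lemma cf_c (r : ℕ) : cf k (Coef.c r : Coef K n) = cOf chi d r := by
  unfold Coef.c cOf
  split_ifs
  · exact cf_chi _
  · rw [map_mul, cf_chi, cf_d]

/-- Elements which commute with the scalars up to an endomorphism of the scalars. -/
def Twist (g : ONH K n k) : Prop := ∀ a : Coef K n, ∃ a' : Coef K n, g * cf k a = cf k a' * g

lemma Twist.one : Twist (1 : ONH K n k) := fun a => ⟨a, by simp⟩

lemma Twist.mul {g h : ONH K n k} (hg : Twist g) (hh : Twist h) : Twist (g * h) := fun a => by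
  obtain ⟨b, hb⟩ := hh a
  obtain ⟨c, hc⟩ := hg b
  exact ⟨c, by rw [mul_assoc, hb, ← mul_assoc, hc, mul_assoc]⟩

lemma Twist.pow {g : ONH K n k} (hg : Twist g) (p : ℕ) : Twist (g ^ p) := by
  induction p with
  | zero => simpa using Twist.one
  | succ p ih => rw [pow_succ]; exact ih.mul hg

lemma Twist.list {ι : Type*} {f : ι → ONH K n k} {L : List ι} (h : ∀ i ∈ L, Twist (f i)) :
    Twist (L.map f).prod := by
  induction L with
  | nil => simpa using Twist.one
  | cons i L ih =>
    rw [List.map_cons, List.prod_cons]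
    exact (h i (by simp)).mul (ih fun j hj => h j (by simp [hj]))

lemma parity_comm {g : ONH K n k} (hχ : ∀ i, 1 ≤ i → i ≤ n / 2 → chi i * g = g * chi i)
    (hd : d * g = -(g * d)) (a : Coef K n) : g * cf k a = cf k (Coef.parity a) * g := by
  induction a using Coef.induction with
  | hc r => simp only [AlgHom.commutes]; exact (Algebra.commutes _ _).symm
  | hχ i h1 h2 => rw [Coef.parity_chi h2, cf_chi, hχ i h1 h2]
  | hd => rw [Coef.parity_d, map_neg, cf_d, neg_mul, hd, neg_neg]
  | ha a b h1 h2 => rw [map_add, map_add, map_add, mul_add, add_mul, h1, h2]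
  | hm a b h1 h2 => rw [map_mul, map_mul, map_mul, ← mul_assoc, h1, mul_assoc, h2, mul_assoc]

lemma x_cf (h1 : 1 ≤ i) (h2 : i ≤ k) (a : Coef K n) :
    x i * cf k a = cf k (Coef.parity a) * x i :=
  parity_comm (fun j hj hj' => sys.x_chi i j h1 h2 hj hj') (sys.x_d i h1 h2) a

lemma tau_cf (h1 : 1 ≤ i) (h2 : i < k) (a : Coef K n) :
    tau i * cf k a = cf k (Coef.parity a) * tau i :=
  parity_comm (fun j hj hj' => sys.tau_chi i j h1 h2 hj hj') (sys.tau_d i h1 h2) a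

lemma twist_x (h1 : 1 ≤ i) (h2 : i ≤ k) : Twist (x i : ONH K n k) := fun a => ⟨_, x_cf h1 h2 a⟩

lemma twist_tau (h1 : 1 ≤ i) (h2 : i < k) : Twist (tau i : ONH K n k) :=
  fun a => ⟨_, tau_cf h1 h2 a⟩

lemma twist_wd_x (hv : ∀ i ∈ v, 1 ≤ i ∧ i ≤ k) : Twist (wd x v : ONH K n k) :=
  Twist.list fun i hi => twist_x (hv i hi).1 (hv i hi).2

lemma twist_wd_tau (hv : ∀ i ∈ v, 1 ≤ i ∧ i < k) : Twist (wd tau v : ONH K n k) :=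
  Twist.list fun i hi => twist_tau (hv i hi).1 (hv i hi).2

lemma Twist.mul_smul {g : ONH K n k} (hg : Twist g) (a : Coef K n) (h : ONH K n k) :
    ∃ a' : Coef K n, g * a • h = a' • (g * h) := by
  obtain ⟨a', ha⟩ := hg a
  exact ⟨a', by rw [smul_def, ← mul_assoc, ha, smul_def, mul_assoc]⟩

lemma Twist.mul_mem {g : ONH K n k} (hg : Twist g) {P : Submodule (Coef K n) (ONH K n k)}
    {X : Set (ONH K n k)} (h : ∀ z ∈ X, g * z ∈ P) {z : ONH K n k}
    (hz : z ∈ span (Coef K n) X) : g * z ∈ P := by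
  induction hz using span_induction with
  | mem z hz => exact h z hz
  | zero => simp
  | add y z _ _ h1 h2 => rw [mul_add]; exact P.add_mem h1 h2
  | smul a z _ h1 =>
    obtain ⟨a', ha⟩ := hg.mul_smul a z
    rw [ha]; exact P.smul_mem _ h1

lemma mem_mul {g : ONH K n k} {P : Submodule (Coef K n) (ONH K n k)}
    {X : Set (ONH K n k)} (h : ∀ z ∈ X, z * g ∈ P) {z : ONH K n k}
    (hz : z ∈ span (Coef K n) X) : z * g ∈ P :=
  (span_le (p := P.comap (LinearMap.mulRight _ g))).2 h hz

lemma eq_top_of_stable {P : Submodule (Coef K n) (ONH K n k)} (h1 : (1 : ONH K n k) ∈ P)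
    (hx : ∀ i, 1 ≤ i → i ≤ k → ∀ z ∈ P, x i * z ∈ P)
    (ht : ∀ i, 1 ≤ i → i < k → ∀ z ∈ P, tau i * z ∈ P) : P = ⊤ := by
  have key : ∀ h z : ONH K n k, z ∈ P → h * z ∈ P := by
    intro h
    induction h using ONH.induction with
    | hc r => intro z hz
              have : algebraMap K (ONH K n k) r * z = (algebraMap K (Coef K n) r) • z := by
                rw [smul_def, AlgHom.commutes]
              rw [this]; exact P.smul_mem _ hz
    | hg g =>
      intro z hz
      cases g with
      | x i => rw [gen_x]; exact hx _ ω ω z hz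
      | tau i => rw [gen_tau]; exact ht _ ω ω z hz
      | chi i =>
        rw [gen_chi, ← cf_chi]; exact P.smul_mem _ hz
      | d => rw [gen_d, ← cf_d]; exact P.smul_mem _ hz
    | ha a b h1 h2 => intro z hz; rw [add_mul]; exact P.add_mem (h1 z hz) (h2 z hz)
    | hm a b h1 h2 => intro z hz; rw [mul_assoc]; exact h1 _ (h2 z hz)
  refine eq_top_iff.mpr fun h _ => ?_
  simpa using key h 1 h1

end ONH

end

/-- `A_n`-submodules of `ONH_m^n`. -/
abbrev CSub (K : Type u) [CommRing K] (n m : ℕ) := Submodule (Coef K n) (ONH K n m)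

/-! ## Spanning sets -/

section Words

/-- The word `l^{α l} (l+1)^{α (l+1)} ⋯ (l+N-1)^{α (l+N-1)}`. -/
def mw (α : ℕ → ℕ) (l : ℕ) : ℕ → List ℕ
  | 0 => []
  | N + 1 => List.replicate (α l) l ++ mw α (l + 1) N

lemma mem_mw (h : i ∈ mw α l N) : l ≤ i ∧ i < l + N := by
  induction N generalizing l with
  | zero => simp [mw] at h
  | succ N ih =>
    rw [mw, List.mem_append, List.mem_replicate] at h
    rcases h with ⟨_, rfl⟩ | h
    · omega
    · have := ih h; omega

lemma mw_congr {α β : ℕ → ℕ} (h : ∀ i, l ≤ i → i < l + N → α i = β i) :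
    mw α l N = mw β l N := by
  induction N generalizing l with
  | zero => rfl
  | succ N ih =>
    rw [mw, mw, h l le_rfl ω, ih fun i h1 h2 => h i ω ω]

lemma mw_add (α : ℕ → ℕ) (l N M : ℕ) : mw α l (N + M) = mw α l N ++ mw α (l + N) M := by
  induction N generalizing l with
  | zero => simp [mw]
  | succ N ih =>
    rw [show N + 1 + M = N + M + 1 by omega, mw, ih, mw, List.append_assoc,
      show l + 1 + N = l + (N + 1) by omega]

variable {E : Type*} [Ring E]

@[simp] lemma wd_replicate (x : ℕ → E) (a i : ℕ) : wd x (List.replicate a i) = x i ^ a := by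
  simp [wd]

lemma PM.mul_wd {T : ℕ → E} {y : E} (h : ∀ i ∈ w, PM (y * T i) (T i * y)) :
    PM (y * wd T w) (wd T w * y) := PM.mul_list _ _ h

end Words

namespace Sys

variable {E : Type*} [Ring E] {x τ χ : ℕ → E} {d : E} (H : Sys n k x τ χ d)
include H

lemma pm_wd_tau_x {w v : List ℕ} (hw : ∀ i ∈ w, 1 ≤ i ∧ i < k) (hv : ∀ i ∈ v, 1 ≤ i ∧ i ≤ k)
    (h : ∀ i ∈ w, ∀ j ∈ v, j ≠ i ∧ j ≠ i + 1) :
    PM (wd τ w * wd x v) (wd x v * wd τ w) := PM.mul_wd fun j hj => PM.symm (PM.mul_wd fun i hi =>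
    H.pm_xtau (hv j hj) (hw i hi) (h i hi j hj).1 (h i hi j hj).2)

lemma pm_tau_wd_x (hi : 1 ≤ i ∧ i < k) (hv : ∀ i ∈ v, 1 ≤ i ∧ i ≤ k)
    (h : ∀ j ∈ v, j ≠ i ∧ j ≠ i + 1) : PM (τ i * wd x v) (wd x v * τ i) :=
  PM.mul_wd fun j hj => H.pm_taux (hv j hj) hi (h j hj).1 (h j hj).2

lemma pm_x_wd_x (hi : 1 ≤ i ∧ i ≤ k) (hv : ∀ i ∈ v, 1 ≤ i ∧ i ≤ k) :
    PM (x i * wd x v) (wd x v * x i) := PM.mul_wd fun j hj => H.pm_xx hi (hv j hj)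

lemma pull_last (hj : j + 1 ≤ k) (hv : ∀ i ∈ v, 1 ≤ i ∧ i ≤ j + 1) :
    ∃ (v' : List ℕ) (D : ℕ), (∀ i ∈ v', 1 ≤ i ∧ i ≤ j) ∧ PM (wd x v) (wd x v' * x (j + 1) ^ D) := by
  induction v with
  | nil => exact ⟨[], 0, by simp, by simp [PM]⟩
  | cons i v ih =>
    obtain ⟨v', D, h1, h2⟩ := ih fun i hi => hv i (by simp [hi])
    have hi := hv i (by simp)
    rw [wd_cons]
    by_cases h : i = j + 1
    · subst h
      refine ⟨v', D + 1, h1, (h2.mul_left _).trans ?_⟩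
      rw [pow_succ', ← mul_assoc, ← mul_assoc]
      exact (H.pm_x_wd_x ω fun i hi => by have := h1 i hi; omega).mul_right _
    · refine ⟨i :: v', D, ?_, ?_⟩
      · simp only [List.mem_cons, forall_eq_or_imp]
        exact ⟨ω, h1⟩
      · rw [wd_cons, mul_assoc]; exact h2.mul_left _

end Sys

namespace ONH

/-- Combinations of monomials in `x_1, …, x_j` times words of length at least `L` in
`τ_1, …, τ_{j-1}`. -/
def polW (j L : ℕ) : CSub K n m :=
  span _ {z | ∃ v w : List ℕ, (∀ i ∈ v, 1 ≤ i ∧ i ≤ j) ∧ (∀ i ∈ w, 1 ≤ i ∧ i < j) ∧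
    L ≤ w.length ∧ z = wd x v * wd tau w}

lemma polW_mono {j j' L L' : ℕ} (hj : j ≤ j') (hL : L' ≤ L) :
    (polW j L : CSub K n m) ≤ polW j' L' := by
  refine span_mono ?_
  rintro _ ⟨v, w, h1, h2, h3, rfl⟩
  exact ⟨v, w, fun i hi => by have := h1 i hi; omega, fun i hi => by have := h2 i hi; omega,
    hL.trans h3, rfl⟩

lemma mem_polW (h1 : ∀ i ∈ v, 1 ≤ i ∧ i ≤ j)
    (h2 : ∀ i ∈ w, 1 ≤ i ∧ i < j) (h3 : L ≤ w.length) :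
    wd x v * wd tau w ∈ (polW j L : CSub K n m) :=
  subset_span ⟨v, w, h1, h2, h3, rfl⟩

lemma x_mul_polW (hj : j ≤ m) (h1 : 1 ≤ i) (h2 : i ≤ j) {z : ONH K n m}
    (hz : z ∈ polW (K := K) j L) : x i * z ∈ polW (K := K) j L := by
  refine (twist_x h1 (h2.trans hj)).mul_mem ?_ hz
  rintro _ ⟨v, w, h3, h4, h5, rfl⟩
  rw [← mul_assoc, ← wd_cons]
  exact mem_polW (by simp only [List.mem_cons, forall_eq_or_imp]; exact ⟨⟨h1, h2⟩, h3⟩) h4 h5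

lemma tau_mul_polW (hj : j ≤ m) (h1 : 1 ≤ i) (h2 : i < j) {z : ONH K n m}
    (hz : z ∈ polW (K := K) j L) : tau i * z ∈ polW (K := K) j L := by
  refine (twist_tau h1 (h2.trans_le hj)).mul_mem ?_ hz
  rintro _ ⟨v, w, h3, h4, h5, rfl⟩
  induction v with
  | nil =>
    rw [wd_nil, one_mul, ← wd_cons, ← one_mul (wd tau _), ← wd_nil x]
    exact mem_polW (by simp) (by simp only [List.mem_cons, forall_eq_or_imp]; exact ⟨⟨h1, h2⟩, h4⟩)
      (by simp; omega)
  | cons a v ih =>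
    have ha := h3 a (by simp)
    have hv : ∀ i ∈ v, 1 ≤ i ∧ i ≤ j := fun i hi => h3 i (by simp [hi])
    have ih := ih hv
    have h6 : wd x v * wd tau w ∈ (polW j L : CSub K n m) := mem_polW hv h4 h5
    rw [wd_cons, mul_assoc, ← mul_assoc (tau i)]
    by_cases c1 : a = i
    · subst c1
      rw [eq_sub_of_add_eq (sys.tau_x a h1 ω), sub_mul, one_mul, mul_assoc]
      exact Submodule.sub_mem _ h6 (x_mul_polW hj ω ω ih)
    by_cases c2 : a = i + 1
    · subst c2
      have := (sysOf K n m).x_tau i h1 ω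
      rw [eq_sub_of_add_eq' this, sub_mul, one_mul, mul_assoc]
      exact Submodule.sub_mem _ h6 (x_mul_polW hj ω ω ih)
    · refine PM.mem ((sys.pm_taux ω ω c1 c2).mul_right _) ?_
      rw [mul_assoc]
      exact x_mul_polW hj ω ω ih

lemma polW_top : (polW m 0 : CSub K n m) = ⊤ :=
  have h := mem_polW (K := K) (n := n) (m := m) (j := m) (L := 0)
    (v := []) (w := []) (by simp) (by simp) (by simp)
  eq_top_of_stable (by simpa using h)
    (fun _ h1 h2 _ hz => x_mul_polW le_rfl h1 h2 hz)
    (fun _ h1 h2 _ hz => tau_mul_polW le_rfl h1 h2 hz)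

lemma polW_bot : (polW m ((m - 1) * (m - 1 + 1) + 1) :
    CSub K n m) = ⊥ := by
  rw [eq_bot_iff]
  refine span_le.mpr ?_
  rintro _ ⟨v, w, h1, h2, h3, rfl⟩
  have : wd tau w = (0 : ONH K n m) := by
    rcases Nat.eq_zero_or_pos m with rfl | hm
    · cases w with
      | nil => simp at h3
      | cons a w => have := h2 a (by simp); omega
    rw [← PM.zero_iff, ← sq_eq, map_wd]
    exact (sysOf K n m).nilCox.wd_eq_zero (l := 1) (N := m - 1) le_rfl ω w
      (fun i hi => by have := h2 i hi; omega) ω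
  simp [this]

/-- Polynomials in `x_1, …, x_j` of degree less than `D` in `x_j`. -/
def lower (j D : ℕ) : CSub K n m :=
  span _ {z | ∃ (v : List ℕ) (i : ℕ), (∀ i ∈ v, 1 ≤ i ∧ i < j) ∧ i < D ∧ z = wd x v * x j ^ i}

lemma mem_lower {D : ℕ} (hv : ∀ i ∈ v, 1 ≤ i ∧ i < j) (hi : i < D) :
    wd x v * x j ^ i ∈ (lower j D : CSub K n m) :=
  subset_span ⟨v, i, hv, hi, rfl⟩

lemma pow_mem_lower (h1 : 1 ≤ j) (hj : j ≤ m) {D : ℕ} (hD : D + j = n + 1) :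
    x j ^ D ∈ (lower j D ⊔ polW j 1 : CSub K n m) := by
  induction j, h1 using Nat.le_induction generalizing D with
  | base =>
    obtain rfl : D = n := ω
    refine Submodule.mem_sup_left ?_
    have h := aOf_x_one (K := K) (n := D) (k := m) hj
    rw [aOf, sum_range_succ, Nat.sub_self, cOf, if_pos (by simp), Nat.zero_div, chi_zero,
      mul_one, add_comm] at h
    refine PM.mem ((PM.unit_mul D _).symm.trans (PM.of_add h)) (Submodule.sum_mem _ fun l hl => ?_)
    rw [mem_range] at hl
    obtain ⟨a', ha⟩ := (twist_x (K := K) (n := D) le_rfl hj).pow l (Coef.c (D - l))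
    rw [cf_c] at ha
    rw [mul_assoc]
    refine PM.mem (PM.unit_mul l _) ?_
    rw [ha]
    refine smul_mem _ a' ?_
    simpa using mem_lower (K := K) (n := D) (m := m) (j := 1) (v := []) (by simp) hl
  | succ j h1 ih =>
    obtain ⟨l, hl, p, hp, hlp⟩ := Submodule.mem_sup.mp (ih ω (D := D + 1) ω)
    have h := (sysOf K n m).tau_x_pow h1 ω (D + 1)
    rw [sum_range_succ, Nat.add_sub_cancel, Nat.sub_self, pow_zero, mul_one, ← hlp, mul_add] at h
    set P : CSub K n m := lower (j + 1) D ⊔ polW (j + 1) 1 with hP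
    have key : ∀ b a, b < D → (-1) ^ b * x (j + 1) ^ b * x j ^ a ∈ P := by
      intro b a hb
      refine Submodule.mem_sup_left (PM.mem (b := wd x (List.replicate a j) * x (j + 1) ^ b) ?_ ?_)
      · rw [mul_assoc, wd_replicate]
        refine (PM.unit_mul b _).trans ?_
        exact PM.mul_pow (PM.symm (PM.mul_pow (sys.pm_xx ω ω)))
      · exact mem_lower (fun i hi => by rw [List.mem_replicate] at hi; omega) hb
    have key2 : ∀ b, x (j + 1) ^ b * tau j ∈ (polW (j + 1) 1 : CSub K n m) := by
      intro b
      have := mem_polW (K := K) (n := n) (m := m) (j := j + 1) (L := 1)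
        (v := List.replicate b (j + 1)) (w := [j])
        (fun i hi => by rw [List.mem_replicate] at hi; omega) (by simp; omega) (by simp)
      simpa using this
    have e1 : tau j * p ∈ P := Submodule.mem_sup_right
      (tau_mul_polW ω h1 ω (polW_mono ω le_rfl hp))
    have e2 : tau j * l ∈ P := by
      refine (twist_tau h1 ω).mul_mem ?_ hl
      rintro _ ⟨v, i, hv, hi, rfl⟩
      have c1 := (sysOf K n m).pm_tau_wd_x (i := j) (v := v) ω
        (fun i hi => by have := hv i hi; omega) (fun i hi => by have := hv i hi; omega)
      rw [← mul_assoc]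
      refine PM.mem (c1.mul_right _) ?_
      rw [mul_assoc, sys.tau_x_pow h1 ω, mul_add, mul_sum]
      refine P.add_mem (P.sum_mem fun b hb => ?_) ?_
      · rw [mem_range] at hb
        refine Submodule.mem_sup_left (PM.mem
          (b := wd x (v ++ List.replicate (i - 1 - b) j) * x (j + 1) ^ b) ?_ ?_)
        · rw [wd_append, wd_replicate, mul_assoc (wd x v), mul_assoc ((-1) ^ b)]
          refine PM.mul_left _ ((PM.unit_mul b _).trans ?_)
          exact PM.mul_pow (PM.symm (PM.mul_pow (sys.pm_xx ω ω)))
        · refine mem_lower (fun i hi => ?_) ω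
          rw [List.mem_append, List.mem_replicate] at hi
          rcases hi with hi | hi
          · have := hv i hi; omega
          · omega
      · have := mem_polW (K := K) (n := n) (m := m) (j := j + 1) (L := 1)
          (v := v ++ List.replicate i (j + 1)) (w := [j]) (fun a ha => by
            rw [List.mem_append, List.mem_replicate] at ha
            rcases ha with ha | ha
            · have := hv a ha; omega
            · omega) (by simp; omega) (by simp)
        refine Submodule.mem_sup_right (PM.mem ?_ this)
        rw [wd_append, wd_replicate, wd_cons, wd_nil, mul_one, mul_assoc ((-1) ^ i), mul_assoc]
        exact PM.mul_left _ (PM.unit_mul i _)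
    have e3 : (-1) ^ D * x (j + 1) ^ D ∈ P := by
      have e4 : (-1) ^ D * x (j + 1) ^ D = tau j * l + tau j * p
          - ∑ b ∈ range D, (-1) ^ b * x (j + 1) ^ b * x j ^ (D - b)
          - (-1) ^ (D + 1) * x (j + 1) ^ (D + 1) * tau j := by rw [h]; abel
      rw [e4]
      refine P.sub_mem (P.sub_mem (P.add_mem e2 e1) (P.sum_mem fun b hb => key _ _ ?_)) ?_
      · simpa using hb
      · rw [mul_assoc]
        exact Submodule.mem_sup_right (PM.mem (PM.unit_mul _ _) (key2 _))
    exact PM.mem (PM.unit_mul D _).symm e3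

/-- Bounded monomials times words. -/
def bdW : CSub K n m :=
  span _ {z | ∃ (α : ℕ → ℕ) (w : List ℕ), (∀ i, 1 ≤ i → i ≤ m → α i + i ≤ n) ∧
    (∀ i ∈ w, 1 ≤ i ∧ i < m) ∧ z = wd x (mw α 1 m) * wd tau w}

lemma bdW_step (hj : j ≤ m) (hm : m ≤ n)
    (ihL : (polW m (L + 1) : CSub K n m) ≤ bdW) (v w : List ℕ) (α : ℕ → ℕ)
    (hv : ∀ i ∈ v, 1 ≤ i ∧ i ≤ j) (hw : ∀ i ∈ w, 1 ≤ i ∧ i < m) (hL : L ≤ w.length)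
    (hα : ∀ i, j < i → i ≤ m → α i + i ≤ n) :
    wd x v * (wd x (mw α (j + 1) (m - j)) * wd tau w) ∈ (bdW : CSub K n m) := by
  induction j generalizing v α with
  | zero =>
    cases v with
    | nil => 
      rw [wd_nil, one_mul]
      exact subset_span ⟨α, w, fun i h1 h2 => hα i h1 h2, hw, rfl⟩
    | cons a v => have := hv a (by simp); omega
  | succ j ih =>
    have ih := ih ω
    set Y := (wd x (mw α (j + 1 + 1) (m - (j + 1))) * wd tau w : ONH K n m) with hY
    obtain ⟨v', D, hv', hD⟩ := (sysOf K n m).pull_last ω hv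
    refine PM.mem (hD.mul_right Y) ?_
    clear hD hv v
    induction D using Nat.strong_induction_on generalizing v' with
    | _ D ihD =>
      by_cases hDn : D + (j + 1) ≤ n
      · have := ih v' (Function.update α (j + 1) D) hv' (fun i h1 h2 => by
          by_cases h : i = j + 1
          · subst h; simpa using hDn
          · rw [Function.update_of_ne h]; exact hα i ω h2)
        rw [show m - j = m - (j + 1) + 1 by omega, mw, mw_congr (β := α) (fun i h1 h2 =>
          Function.update_of_ne ω _ _), Function.update_self, wd_append, wd_replicate,
          mul_assoc (x (j + 1) ^ D), ← hY, ← mul_assoc] at this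
        exact this
      · obtain ⟨D1, rfl⟩ : ∃ D1, D = D1 + (n - j) := ⟨D - (n - j), ω⟩
        obtain ⟨l, hl, p, hp, hlp⟩ := Submodule.mem_sup.mp
          (pow_mem_lower (K := K) (n := n) (m := m) (j := j + 1) ω hj (D := n - j)
            ω)
        have ht : Twist (wd x v' * x (j + 1) ^ D1 : ONH K n m) :=
          (twist_wd_x fun i hi => by have := hv' i hi; omega).mul
            ((twist_x ω ω).pow _)
        rw [pow_add, ← mul_assoc (wd x v'), ← hlp, mul_add, add_mul]
        refine Submodule.add_mem _ ?_ ?_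
        · rw [mul_assoc]
          refine ht.mul_mem (P := bdW) (X := {z | ∃ (u : List ℕ) (i : ℕ), (∀ i ∈ u, 1 ≤ i ∧ i < j + 1)
            ∧ i < n - j ∧ z = wd x u * x (j + 1) ^ i * Y}) ?_ ?_
          · rintro _ ⟨u, i, hu, hi, rfl⟩
            refine PM.mem ?_ (ihD (D1 + i) ω (v' ++ u) fun a ha => by
              rw [List.mem_append] at ha
              rcases ha with ha | ha
              · exact hv' a ha
              · have := hu a ha; omega)
            rw [wd_append, ← mul_assoc]
            refine PM.mul_right _ ?_
            rw [pow_add]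
            have h6 : PM (x (j + 1) ^ D1 * wd x u) (wd x u * x (j + 1) ^ D1 : ONH K n m) :=
              PM.symm (PM.mul_pow (PM.symm ((sysOf K n m).pm_x_wd_x (i := j + 1)
              (v := u) ω fun a ha => by have := hu a ha; omega)))
            have h7 := PM.mul_right (x (j + 1) ^ i) (PM.mul_left (wd x v') h6)
            simpa only [mul_assoc] using h7
          · refine mem_mul ?_ hl
            rintro _ ⟨u, i, hu, hi, rfl⟩
            exact subset_span ⟨u, i, hu, hi, rfl⟩
        · refine ihL ?_
          rw [mul_assoc]
          refine ht.mul_mem (P := polW m (L + 1)) (X := {z | ∃ u t : List ℕ,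
            (∀ i ∈ u, 1 ≤ i ∧ i ≤ j + 1) ∧ (∀ i ∈ t, 1 ≤ i ∧ i < j + 1) ∧ 1 ≤ t.length ∧
            z = wd x u * wd tau t * Y}) ?_ ?_
          · rintro _ ⟨u, t, hu, ht, ht', rfl⟩
            have hc : ∀ i ∈ mw α (j + 1 + 1) (m - (j + 1)), j + 2 ≤ i ∧ i ≤ m := fun i hi => by
              have := mem_mw hi; omega
            refine PM.mem (b := wd x (v' ++ List.replicate D1 (j + 1) ++ u ++
              mw α (j + 1 + 1) (m - (j + 1))) * wd tau (t ++ w)) ?_ (mem_polW ?_ ?_ ?_)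
            · simp only [wd_append, wd_replicate, hY]
              have := (sysOf K n m).pm_wd_tau_x (w := t)
                (v := mw α (j + 1 + 1) (m - (j + 1))) (fun i hi => by have := ht i hi; omega)
                (fun i hi => by have := hc i hi; omega)
                (fun i hi a ha => by have := hc a ha; have := ht i hi; omega)
              have := ((this.mul_left (wd x v' * x (j + 1) ^ D1 * wd x u)).mul_right (wd tau w))
              simpa only [mul_assoc] using this
            · intro i hi
              simp only [List.mem_append, List.mem_replicate] at hi
              rcases hi with ((hi | hi) | hi) | hi
              · have := hv' i hi; omega
              · omega
              · have := hu i hi; omega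
              · have := hc i hi; omega
            · intro i hi
              rw [List.mem_append] at hi
              rcases hi with hi | hi
              · have := ht i hi; omega
              · exact hw i hi
            · rw [List.length_append]; omega
          · refine mem_mul ?_ hp
            rintro _ ⟨u, t, hu, ht, ht', rfl⟩
            exact subset_span ⟨u, t, hu, ht, ht', rfl⟩

lemma bdW_top (hm : m ≤ n) : (bdW : CSub K n m) = ⊤ := by
  have key : ∀ q L, L + q = (m - 1) * (m - 1 + 1) + 1 →
      (polW m L : CSub K n m) ≤ bdW := by
    intro q
    induction q with
    | zero =>
      intro L hL
      obtain rfl : L = (m - 1) * (m - 1 + 1) + 1 := ω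
      rw [polW_bot]; exact bot_le
    | succ q ih =>
      intro L hL
      refine span_le.mpr ?_
      rintro _ ⟨v, w, hv, hw, hL', rfl⟩
      have := bdW_step le_rfl hm (ih (L + 1) ω) v w (fun _ => 0) hv hw hL'
        (fun i h1 h2 => ω)
      simpa [mw] using this
  rw [eq_top_iff, ← polW_top]
  exact key _ 0 (by rw [zero_add])

end ONH

namespace Sys

variable {E : Type*} [Ring E] {x τ χ : ℕ → E} {d : E} (H : Sys n k x τ χ d)
include H

lemma pm_pow_pow (h1 : 1 ≤ i ∧ i ≤ k) (h2 : 1 ≤ j ∧ j ≤ k) (p q : ℕ) :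
    PM (x i ^ p * x j ^ q) (x j ^ q * x i ^ p) := PM.mul_pow (PM.symm (PM.mul_pow (H.pm_xx h2 h1)))

lemma pm_succ_succ (h1 : 1 ≤ i) (h2 : i < k) (p q : ℕ) :
    PM (x i ^ (p + 1) * x (i + 1) ^ (q + 1)) (x i * x (i + 1) * (x i ^ p * x (i + 1) ^ q)) := by
  have h3 := H.pm_pow_pow (i := i) (j := i + 1) ω ω p 1
  rw [pow_one] at h3
  rw [pow_succ' (x i), pow_succ' (x (i + 1))]
  simpa only [mul_assoc] using (h3.mul_left (x i)).mul_right (x (i + 1) ^ q)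

lemma tau_mul_xx (h1 : 1 ≤ i) (h2 : i < k) :
    τ i * (x i * x (i + 1)) = -(x i * x (i + 1) * τ i) := by
  rw [← mul_assoc, eq_sub_of_add_eq (H.tau_x i h1 h2), sub_mul, one_mul, mul_assoc,
    eq_sub_of_add_eq' (H.x_tau i h1 h2), mul_sub, mul_one, sub_sub_cancel, ← mul_assoc,
    eq_neg_of_add_eq_zero_left (H.x_x (i + 1) i ω ω ω ω ω), neg_mul]

lemma tau_pow_pow (h1 : 1 ≤ i) (h2 : i < k) (p c : ℕ) :
    ∃ (s : ℕ → ℕ) (s' : ℕ), τ i * (x i ^ p * x (i + 1) ^ (p + c + 1))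
      = ∑ b ∈ range (c + 1), (-1) ^ s b * (x i ^ (p + b) * x (i + 1) ^ (p + c - b))
        + (-1) ^ s' * (x i ^ (p + c + 1) * x (i + 1) ^ p * τ i) := by
  induction p with
  | zero =>
    refine ⟨id, c + 1, ?_⟩
    simpa [mul_assoc] using H.tau_xs_pow h1 h2 (c + 1)
  | succ p ih =>
    obtain ⟨s, s', h⟩ := ih
    have hk := H.pm_succ_succ h1 h2
    obtain ⟨t, ht⟩ := (hk p (p + c + 1)).exists_sign
    choose f hf using fun b => (hk (p + b) (p + c - b)).symm.exists_sign
    obtain ⟨g, hg⟩ := (hk (p + c + 1) p).symm.exists_sign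
    refine ⟨fun b => t + 1 + s b + f b, t + 1 + s' + g, ?_⟩
    rw [show p + 1 + c + 1 = p + c + 1 + 1 by omega, ht]
    have e3 : τ i * ((-1) ^ t * (x i * x (i + 1) * (x i ^ p * x (i + 1) ^ (p + c + 1))))
        = (-1) ^ (t + 1) * (x i * x (i + 1) * (τ i * (x i ^ p * x (i + 1) ^ (p + c + 1)))) := by
      rw [pow_succ _ t]
      have := congrArg (· * (x i ^ p * x (i + 1) ^ (p + c + 1))) (H.tau_mul_xx h1 h2)
      simp only [neg_mul, mul_assoc] at this
      rcases neg_one_pow_eq_or E t with h | h <;> simp [h, mul_assoc, this]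
    rw [e3, h, mul_add, mul_add, mul_sum, mul_sum]
    congr 1
    · refine sum_congr rfl fun b hb => ?_
      rw [mem_range] at hb
      rw [show p + 1 + b = p + b + 1 by omega, show p + 1 + c - b = p + c - b + 1 by omega]
      have := hf b
      have h5 : x i * x (i + 1) * ((-1) ^ s b * (x i ^ (p + b) * x (i + 1) ^ (p + c - b)))
          = (-1) ^ s b * (x i * x (i + 1) * (x i ^ (p + b) * x (i + 1) ^ (p + c - b))) := by
        rcases neg_one_pow_eq_or E (s b) with h | h <;> simp [h]
      rw [h5, this, pow_add _ (t + 1 + s b), pow_add _ (t + 1)]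
      simp only [mul_assoc]
    · have h5 : x i * x (i + 1) * ((-1) ^ s' * (x i ^ (p + c + 1) * x (i + 1) ^ p * τ i))
          = (-1) ^ s' * (x i * x (i + 1) * (x i ^ (p + c + 1) * x (i + 1) ^ p)) * τ i := by
        rcases neg_one_pow_eq_or E s' with h | h <;> simp [h, mul_assoc]
      rw [h5, hg, pow_add _ (t + 1 + s'), pow_add _ (t + 1)]
      simp only [mul_assoc]

lemma tau_pow_eq (h1 : 1 ≤ i) (h2 : i < k) (p : ℕ) :
    PM (τ i * (x i ^ p * x (i + 1) ^ p)) (x i ^ p * x (i + 1) ^ p * τ i) := by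
  have hp : PM (x i ^ p * x (i + 1) ^ p) ((x i * x (i + 1)) ^ p) := by
    induction p with
    | zero => simp [PM]
    | succ p ih =>
      rw [pow_succ' (x i * x (i + 1))]
      exact (H.pm_succ_succ h1 h2 p p).trans (ih.mul_left _)
  exact (hp.mul_left _).trans ((PM.mul_pow (.inr (H.tau_mul_xx h1 h2))).trans (hp.symm.mul_right _))

lemma tau_pow_pow' (h1 : 1 ≤ i) (h2 : i < k) (p q : ℕ) :
    ∃ (N : ℕ) (f g s : ℕ → ℕ) (s' : ℕ), (∀ b < N, f b < max p q ∧ g b < max p q) ∧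
      τ i * (x i ^ q * x (i + 1) ^ p)
        = ∑ b ∈ range N, (-1) ^ s b * (x i ^ f b * x (i + 1) ^ g b)
          + (-1) ^ s' * (x i ^ p * x (i + 1) ^ q * τ i) := by
  rcases lt_trichotomy q p with h | rfl | h
  · obtain ⟨c, rfl⟩ : ∃ c, p = q + c + 1 := ⟨p - q - 1, ω⟩
    obtain ⟨s, s', hs⟩ := H.tau_pow_pow h1 h2 q c
    exact ⟨c + 1, fun b => q + b, fun b => q + c - b, s, s', fun b hb => by simp; omega, hs⟩
  · obtain ⟨s', hs⟩ := (H.tau_pow_eq h1 h2 q).exists_sign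
    exact ⟨0, id, id, id, s', by simp, by simpa using hs⟩
  · obtain ⟨c, rfl⟩ : ∃ c, q = p + c + 1 := ⟨q - p - 1, ω⟩
    obtain ⟨s, s', hs⟩ := H.flip.tau_pow_pow (i := k - i) ω ω p c
    simp only [show k - (k - i) = i by omega, show k + 1 - (k - i) = i + 1 by omega,
      show k + 1 - (k - i + 1) = i by omega] at hs
    have hc := H.pm_pow_pow (i := i) (j := i + 1) ω ω
    obtain ⟨t, ht⟩ := (hc (p + c + 1) p).exists_sign
    choose f hf using fun b => (hc (p + c - b) (p + b)).symm.exists_sign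
    obtain ⟨g, hg⟩ := (hc p (p + c + 1)).symm.exists_sign
    refine ⟨c + 1, fun b => p + c - b, fun b => p + b, fun b => t + s b + f b, t + s' + g,
      fun b hb => by simp; omega, ?_⟩
    have e1 : τ i * ((-1) ^ t * (x (i + 1) ^ p * x i ^ (p + c + 1)))
        = (-1) ^ t * (τ i * (x (i + 1) ^ p * x i ^ (p + c + 1))) := by
      rcases neg_one_pow_eq_or E t with h | h <;> simp [h]
    rw [ht, e1, hs, hg, mul_add, mul_sum]
    congr 1
    · refine sum_congr rfl fun b hb => ?_
      rw [hf b, pow_add _ (t + s b), pow_add _ t]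
      simp only [mul_assoc]
    · rw [pow_add _ (t + s'), pow_add _ t]
      simp only [mul_assoc]

end Sys

section Words

/-- Replacing the exponents of `i` and `i + 1`. -/
def upd (α : ℕ → ℕ) (i p q : ℕ) : ℕ → ℕ := fun j => if j = i then p else if j = i + 1 then q else α j

lemma mw_upd (α : ℕ → ℕ) (h1 : 1 ≤ i) (h2 : i < m) (p q : ℕ) :
    mw (upd α i p q) 1 m = mw α 1 (i - 1) ++ (List.replicate p i ++ (List.replicate q (i + 1) ++
      mw α (i + 2) (m - i - 1))) := by
  have e : m = (i - 1) + (m - i - 1 + 1 + 1) := ω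
  conv_lhs => rw [e]
  rw [mw_add, mw, mw, show 1 + (i - 1) = i by omega]
  congr 1
  · exact mw_congr fun j hj1 hj2 => by
      unfold upd; rw [if_neg ω, if_neg ω]
  · congr 1
    · simp [upd]
    · congr 1
      · simp [upd]
      · exact mw_congr fun j hj1 hj2 => by
          unfold upd; rw [if_neg ω, if_neg ω]

lemma upd_self (α : ℕ → ℕ) (i : ℕ) : upd α i (α i) (α (i + 1)) = α := by
  funext j
  unfold upd
  split_ifs with h h'
  · rw [h]
  · rw [h']
  · rfl

/-- The pairs of a word in `τ` and a number of free variables which remain in the analysis of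
`ONH_m^n` modulo `τ_i ONH` (`i > a`) and `ONH τ_i` (`i > b`). -/
def wordList : ℕ → ℕ → ℕ → List ℕ → List (ℕ × List ℕ)
  | 0, _, B, v => [(B, v)]
  | s + 1, q, B, v =>
    ((List.range (B - q)).flatMap fun j => wordList s (q + 1) B (List.range' (q + 1) j ++ v)) ++
      wordList s (q + 1) (B + 1) (List.range' (q + 1) (B - q) ++ v)

lemma mem_range'_append {B : ℕ} (hv : ∀ i ∈ v, 1 ≤ i ∧ i < B) (hB : B ≤ L) (hq : q + 1 + j ≤ L) :
    ∀ i ∈ List.range' (q + 1) j ++ v, 1 ≤ i ∧ i < L := fun i hi => by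
  rw [List.mem_append, List.mem_range'_1] at hi
  rcases hi with hi | hi
  · omega
  · have := hv i hi; omega

lemma mem_wordList {B : ℕ} (hq : q ≤ B) (hv : ∀ i ∈ v, 1 ≤ i ∧ i < B)
    {z : ℕ × List ℕ} (hz : z ∈ wordList s q B v) :
    B ≤ z.1 ∧ q + s ≤ z.1 ∧ ∀ i ∈ z.2, 1 ≤ i ∧ i < z.1 := by
  induction s generalizing q B v with
  | zero =>
    simp only [wordList, List.mem_singleton] at hz
    subst hz
    exact ⟨le_rfl, by simpa using hq, hv⟩
  | succ s ih =>
    rw [wordList, List.mem_append, List.mem_flatMap] at hz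
    rcases hz with ⟨j, hj, hz⟩ | hz
    · rw [List.mem_range] at hj
      have := ih ω (mem_range'_append hv le_rfl ω) hz
      exact ⟨this.1, ω, this.2.2⟩
    · have := ih ω (mem_range'_append hv ω ω) hz
      exact ⟨ω, ω, this.2.2⟩

end Words

namespace ONH

/-- The monomial with exponents `α 1, …, α m`. -/
def mon (α : ℕ → ℕ) : ONH K n m := wd x (mw α 1 m)

lemma mon_upd (α : ℕ → ℕ) (h1 : 1 ≤ i) (h2 : i < m) (p q : ℕ) :
    (mon (upd α i p q) : ONH K n m)
      = wd x (mw α 1 (i - 1)) * ((x i ^ p * x (i + 1) ^ q) * wd x (mw α (i + 2) (m - i - 1))) := by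
  rw [mon, mw_upd α h1 h2]
  simp only [wd_append, wd_replicate, mul_assoc]

lemma tau_mon_left (α : ℕ → ℕ) (h1 : 1 ≤ i) (h2 : i < m) :
    PM (tau i * wd x (mw α 1 (i - 1)) : ONH K n m) (wd x (mw α 1 (i - 1)) * tau i) :=
  sys.pm_tau_wd_x ⟨h1, h2⟩ (fun j hj => by have := mem_mw hj; omega)
    (fun j hj => by have := mem_mw hj; omega)

lemma tau_mon_right (α : ℕ → ℕ) (h1 : 1 ≤ i) (h2 : i < m) :
    PM (tau i * wd x (mw α (i + 2) (m - i - 1)) : ONH K n m)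
      (wd x (mw α (i + 2) (m - i - 1)) * tau i) :=
  sys.pm_tau_wd_x ⟨h1, h2⟩ (fun j hj => by have := mem_mw hj; omega)
    (fun j hj => by have := mem_mw hj; omega)

/-- Boundedness of exponents. -/
def Bdd (n m : ℕ) (α : ℕ → ℕ) : Prop := ∀ i, 1 ≤ i → i ≤ m → α i + i ≤ n

variable {P : CSub K n m}

lemma Bdd.upd (hα : Bdd n m α) (hp : p + i ≤ n) (hq : q + (i + 1) ≤ n) :
    Bdd n m (upd α i p q) := fun j hj1 hj2 => by
  unfold OddCR.upd
  split_ifs with c1 c2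
  · rwa [c1]
  · rwa [c2]
  · exact hα j hj1 hj2

lemma mon_left_tau_mem (h1 : 1 ≤ i) (h2 : i < m) (hP : ∀ h, tau i * h ∈ P)
    (z : ONH K n m) : wd x (mw α 1 (i - 1)) * (tau i * z) ∈ P := by
  have h5 := (tau_mon_left (K := K) (n := n) α h1 h2).symm.mul_right z
  rw [mul_assoc, mul_assoc] at h5
  exact h5.mem (hP _)

lemma sign_mem_of_mon_upd (h1 : 1 ≤ i) (h2 : i < m) {y : ONH K n m}
    (hy : mon (upd α i p q) * y ∈ P) (s : ℕ) : wd x (mw α 1 (i - 1)) *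
      ((-1) ^ s * (x i ^ p * x (i + 1) ^ q) * (wd x (mw α (i + 2) (m - i - 1)) * y)) ∈ P := by
  rw [mon_upd α h1 h2, mul_assoc, mul_assoc] at hy
  exact (((PM.unit_mul s _).mul_right _).mul_left _).mem hy

lemma mon_tau_mem (h1 : 1 ≤ i) (h2 : i < m) (hP : ∀ h, tau i * h ∈ P) {y : ONH K n m}
    (hy : ∀ α, Bdd n m α → mon α * y ∈ P) (hα : Bdd n m α) :
    mon α * (tau i * y) ∈ P := by
  obtain ⟨N, f, g, s, s', hN, h⟩ := (sysOf K n m).tau_pow_pow' h1 h2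
    (α i) (α (i + 1))
  set L : ONH K n m := wd x (mw α 1 (i - 1))
  set R : ONH K n m := wd x (mw α (i + 2) (m - i - 1))
  have e1 : (mon α : ONH K n m) = L * ((x i ^ α i * x (i + 1) ^ α (i + 1)) * R) := by
    conv_lhs => rw [← upd_self α i]
    rw [mon_upd α h1 h2]
  have e2 : PM (mon α * (tau i * y))
      (L * ((-1) ^ s' * (x i ^ α i * x (i + 1) ^ α (i + 1) * tau i) * (R * y))) := by
    rw [e1]
    have h3 := ((tau_mon_right (K := K) (n := n) α h1 h2).symm.mul_right y).mul_left
      (L * (x i ^ α i * x (i + 1) ^ α (i + 1)))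
    have h4 : PM (L * (x i ^ α i * x (i + 1) ^ α (i + 1)) * (tau i * R * y))
        (L * ((-1) ^ s' * (x i ^ α i * x (i + 1) ^ α (i + 1) * tau i) * (R * y))) := by
      have := ((PM.unit_mul s' (x i ^ α i * x (i + 1) ^ α (i + 1) * tau i :
        ONH K n m)).symm.mul_right (R * y)).mul_left L
      simpa only [mul_assoc] using this
    refine PM.trans ?_ h4
    simpa only [mul_assoc] using h3
  refine PM.mem e2 ?_
  rw [eq_sub_of_add_eq' h.symm, sub_mul, mul_sub, sum_mul, mul_sum]
  refine P.sub_mem ?_ (P.sum_mem fun c hc => ?_)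
  · rw [mul_assoc (tau i)]; exact mon_left_tau_mem h1 h2 hP _
  · rw [mem_range] at hc
    have := hy (upd α i (f c) (g c)) (fun j hj1 hj2 => by
      have := hN c hc
      have h6 := hα i h1 ω
      have h7 := hα (i + 1) ω h2
      exact hα.upd ω ω j hj1 hj2)
    exact sign_mem_of_mon_upd h1 h2 this _

lemma mon_swap_mem (h1 : 1 ≤ i) (h2 : i < m) (hP : ∀ h, tau i * h ∈ P)
    (hP' : ∀ h, h * tau i ∈ P) {y : ONH K n m} (hy : PM (tau i * y) (y * tau i))
    {c : ℕ} (hc : α i + c = α (i + 1))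
    (hlt : ∀ b, b < c → mon (upd α i (α i + (b + 1)) (α i + c - (b + 1))) * y ∈ P) :
    mon α * y ∈ P := by
  obtain ⟨s, s', h⟩ := (sysOf K n m).tau_pow_pow h1 h2 (α i) c
  set L : ONH K n m := wd x (mw α 1 (i - 1))
  set R : ONH K n m := wd x (mw α (i + 2) (m - i - 1))
  have e1 : (mon α : ONH K n m) = L * ((x i ^ α i * x (i + 1) ^ (α i + c)) * R) := by
    conv_lhs => rw [← upd_self α i]
    rw [mon_upd α h1 h2, hc]
  rw [sum_range_succ', add_zero, Nat.sub_zero] at h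
  have e2 : PM (mon α * y)
      (L * (((-1) ^ s 0 * (x i ^ α i * x (i + 1) ^ (α i + c))) * (R * y))) := by
    rw [e1]
    have := ((PM.unit_mul (s 0) (x i ^ α i * x (i + 1) ^ (α i + c) : ONH K n m)).symm.mul_right
      (R * y)).mul_left L
    simpa only [mul_assoc] using this
  have e3 : (-1) ^ s 0 * (x i ^ α i * x (i + 1) ^ (α i + c))
      = tau i * (x i ^ α i * x (i + 1) ^ (α i + c + 1))
        - (-1) ^ s' * (x i ^ (α i + c + 1) * x (i + 1) ^ α i * tau i)
        - ∑ b ∈ range c, (-1) ^ s (b + 1) *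
            (x i ^ (α i + (b + 1)) * x (i + 1) ^ (α i + c - (b + 1)) : ONH K n m) := by
    rw [h]; abel
  refine PM.mem e2 ?_
  rw [e3, sub_mul, sub_mul, mul_sub, mul_sub, sum_mul, mul_sum]
  refine P.sub_mem (P.sub_mem ?_ ?_) (P.sum_mem fun e he => ?_)
  · rw [mul_assoc (tau i)]; exact mon_left_tau_mem h1 h2 hP _
  · have h5 : PM (tau i * (R * y)) (R * y * tau i) :=
      PM.mul_mul (tau_mon_right (K := K) (n := n) α h1 h2) hy
    refine PM.mem (b := L * (x i ^ (α i + c + 1) * x (i + 1) ^ α i) * (R * y) * tau i) ?_ (hP' _)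
    have h6 := ((PM.unit_mul s' (x i ^ (α i + c + 1) * x (i + 1) ^ α i : ONH K n m)).mul
      h5).mul_left L
    simpa only [mul_assoc] using h6
  · rw [mem_range] at he
    have := hlt e he
    exact sign_mem_of_mon_upd h1 h2 this _

lemma mon_mem_of_decreasing {y : List ℕ}
    (hP : ∀ i, p < i → i < m → ∀ h, tau i * h ∈ P) (hP' : ∀ i, p < i → i < m → ∀ h, h * tau i ∈ P)
    (hy : ∀ i ∈ y, 1 ≤ i ∧ i < p)
    (H : ∀ α, Bdd n m α → (∀ i, p < i → i < m → α (i + 1) < α i) → mon α * wd tau y ∈ P)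
    (hα : Bdd n m α) : mon α * wd tau y ∈ P := by
  induction hw : (mw α 1 m).sum using Nat.strong_induction_on generalizing α with
  | _ W ih =>
    by_cases hd : ∀ i, p < i → i < m → α (i + 1) < α i
    · exact H α hα hd
    push Not at hd
    obtain ⟨i, h1, h2, h3⟩ := hd
    obtain ⟨c, hc⟩ := Nat.exists_eq_add_of_le h3
    refine mon_swap_mem ω h2 (hP i h1 h2) (hP' i h1 h2) ?_ hc.symm fun b hb => ?_
    · exact PM.mul_wd fun j hj => PM.of_add
        (sys.tau_tau _ _ ω ω (hy j hj).1 (by have := hy j hj; omega)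
          (by have := hy j hj; omega))
    · refine ih _ ?_ (fun j hj1 hj2 => ?_) rfl
      · rw [← hw]
        conv_rhs => rw [← upd_self α i]
        rw [mw_upd α ω h2, mw_upd α ω h2]
        simp only [List.sum_append, List.sum_replicate, smul_eq_mul]
        rw [hc]
        obtain ⟨e, rfl⟩ := Nat.exists_eq_add_of_lt hb
        rw [show α i + (b + e + 1) - (b + 1) = α i + e by omega]
        nlinarith
      · have h6 := hα i ω ω
        have h7 := hα (i + 1) ω h2
        exact hα.upd ω ω j hj1 hj2

lemma mon_word_mem (ham : a ≤ m) (hPl : ∀ i, a < i → i < m → ∀ h, tau i * h ∈ P)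
    (hPr : ∀ i, b < i → i < m → ∀ h, h * tau i ∈ P) {B : ℕ} (hs : q + s = a)
    (hb : b ≤ B) (hq : q ≤ B) (hB : B ≤ m) (hv : ∀ i ∈ v, 1 ≤ i ∧ i < B)
    (H : ∀ z ∈ wordList s q B v, z.1 ≤ m → ∀ α, Bdd n m α → mon α * wd tau z.2 ∈ P)
    (hw : ∀ i ∈ w, q < i ∧ i < m) (hα : Bdd n m α) :
    mon α * (wd tau w * wd tau v) ∈ P := by
  induction s generalizing q B v w α with
  | zero =>
    induction w generalizing α with
    | nil =>
      rw [wd_nil, one_mul]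
      exact H (B, v) (by simp [wordList]) hB α hα
    | cons i w ih =>
      have hi := hw i (by simp)
      rw [wd_cons, mul_assoc]
      exact mon_tau_mem ω hi.2 (hPl i ω hi.2)
        (fun α hα => ih (fun j hj => hw j (by simp [hj])) hα) hα
  | succ s ih =>
    have hN := (sysOf K n m).nilCox.wd_normal (l := q + 1) (N := m - (q + 1))
      ω ω w (fun i hi => by have := hw i hi; omega)
    simp only [wordList, List.mem_append, List.mem_flatMap, List.mem_range] at H
    rcases hN with h0 | ⟨w', M, h3, h4, h5, -⟩
    · rw [← map_wd, sq_eq, PM.zero_iff] at h0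
      simp [h0]
    rw [← map_wd, ← map_wd, ← map_asc, ← map_mul, sq_eq, asc_eq_wd] at h5
    refine PM.mem ((h5.mul_right _).mul_left _) ?_
    rw [mul_assoc (wd tau w')]
    have hw' : ∀ i ∈ w', q + 1 < i ∧ i < m := fun i hi => by have := h3 i hi; omega
    by_cases c1 : M < B - q
    · rw [← wd_append]
      refine ih ω hb ω hB (mem_range'_append hv le_rfl ω)
        (fun z hz hzm => H z (.inl ⟨M, c1, hz⟩) hzm) hw' hα
    obtain ⟨e, rfl⟩ : ∃ e, M = B - q + e := ⟨M - (B - q), ω⟩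
    rcases e with _ | e
    · rw [add_zero, ← wd_append]
      refine ih (B := B + 1) ω ω ω ω (mem_range'_append hv ω ω)
        (fun z hz hzm => H z (.inr hz) hzm) hw' hα
    · rw [← asc_eq_wd, show B - q + (e + 1) = (B - q + e) + 1 by omega, asc_succ]
      have h6 : PM (tau (q + 1 + (B - q + e)) * wd tau v : ONH K n m)
          (wd tau v * tau (q + 1 + (B - q + e))) :=
        PM.mul_wd fun j hj => PM.of_add (sys.tau_tau _ _ ω ω (hv j hj).1
          (by have := hv j hj; omega) (by have := hv j hj; omega))
      refine PM.mem (b := mon α * (wd tau w' * (asc tau (q + 1) (B - q + e) * wd tau v)) *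
        tau (q + 1 + (B - q + e))) ?_ (hPr _ ω ω _)
      have h7 := h6.mul_left (mon α * (wd tau w' * asc tau (q + 1) (B - q + e)))
      simpa only [mul_assoc] using h7

lemma eq_top_of_mon (hm : m ≤ n) (ham : a ≤ m) (hbm : b ≤ m)
    (hPl : ∀ i, a < i → i < m → ∀ h, tau i * h ∈ P)
    (hPr : ∀ i, b < i → i < m → ∀ h, h * tau i ∈ P)
    (H : ∀ z ∈ wordList a 0 b [], z.1 ≤ m → ∀ α, Bdd n m α →
      (∀ i, z.1 < i → i < m → α (i + 1) < α i) → mon α * wd tau z.2 ∈ P) : P = ⊤ := by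
  rw [eq_top_iff, ← bdW_top hm]
  refine span_le.mpr ?_
  rintro _ ⟨α, w, hα, hw, rfl⟩
  have := mon_word_mem (v := []) ham hPl hPr (zero_add a) le_rfl (Nat.zero_le b) hbm (by simp)
    (fun z hz hzm α hα => ?_) hw hα
  · simpa [mon] using this
  · have h3 := mem_wordList (Nat.zero_le b) (by simp) hz
    rw [zero_add] at h3
    exact mon_mem_of_decreasing (fun i h1 h2 => hPl i ω h2)
      (fun i h1 h2 => hPr i ω h2) h3.2.2 (H z hz hzm) hα

end ONH

/-! ## The skew polynomial superalgebra -/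

/-- The relations of `OPol_k ⊗ A_n`. -/
structure PSys (n k : ℕ) {E : Type*} [Ring E] (x χ : ℕ → E) (d : E) : Prop where
  chi_zero : χ 0 = 1
  x_x : ∀ i j, 1 ≤ i → i ≤ k → 1 ≤ j → j ≤ k → i ≠ j → x i * x j = -(x j * x i)
  d_sq : d * d = 0
  d_chi_top : Even n → d * χ (n / 2) = 0
  chi_chi : ∀ i j, 1 ≤ i → i ≤ n / 2 → 1 ≤ j → j ≤ n / 2 → χ i * χ j = χ j * χ i
  chi_d : ∀ i, 1 ≤ i → i ≤ n / 2 → χ i * d = d * χ i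
  x_chi : ∀ i j, 1 ≤ i → i ≤ k → 1 ≤ j → j ≤ n / 2 → χ j * x i = x i * χ j
  x_d : ∀ i, 1 ≤ i → i ≤ k → d * x i = -(x i * d)

lemma Sys.psys {E : Type*} [Ring E] {x τ χ : ℕ → E} {d : E} (H : Sys n k x τ χ d) :
    PSys n k x χ d where
  chi_zero := H.chi_zero
  x_x i j h1 h2 h3 h4 h := eq_neg_of_add_eq_zero_left (H.x_x i j h1 h2 h3 h4 h)
  d_sq := H.d_sq
  d_chi_top := H.d_chi_top
  chi_chi := H.chi_chi
  chi_d := H.chi_d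
  x_chi := H.x_chi
  x_d := H.x_d

namespace OPolA

/-- The variable `x_i`, for `1 ≤ i ≤ k`. -/
def X (i : ℕ) : OPolA K n k := if h : 1 ≤ i ∧ i ≤ k then gen K n k (.x ⟨i - 1, ω⟩) else 0

/-- The element `d`. -/
def D : OPolA K n k := gen K n k .d

lemma gen_x (i : Fin k) : gen K n k (.x i) = X ((i : ℕ) + 1) := by
  rw [X, dif_pos ω]; rfl

lemma X_eq (h1 : 1 ≤ i) (h2 : i ≤ k) :
    (X i : OPolA K n k) = gen K n k (.x ⟨i - 1, ω⟩) := by rw [X, dif_pos ⟨h1, h2⟩]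

lemma gen_chi (i : Fin (n / 2)) : gen K n k (.chi i) = chi K n k ((i : ℕ) + 1) := by
  rw [chi, if_neg ω, dif_pos ω]; rfl

lemma chi_eq (h1 : 1 ≤ i) (h2 : i ≤ n / 2) :
    chi K n k i = gen K n k (.chi ⟨i - 1, ω⟩) := by
  rw [chi, if_neg ω, dif_pos ⟨h1, h2⟩]

lemma chi_zero : chi K n k 0 = 1 := by simp [chi]

lemma gen_mul_gen {g h : PGen n k} : mk K n k (FreeAlgebra.ι K g * FreeAlgebra.ι K h)
    = gen K n k g * gen K n k h := map_mul _ _ _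

lemma psys : PSys n k (X : ℕ → OPolA K n k) (chi K n k) D where
  chi_zero := chi_zero
  x_x i j h1 h2 h3 h4 h5 := by
    rw [X_eq h1 h2, X_eq h3 h4, ← gen_mul_gen, ← gen_mul_gen, ← map_neg]
    exact rel K n k (.x_x _ _ (by simpa [Fin.ext_iff] using ω))
  d_sq := by rw [D, ← gen_mul_gen, rel K n k .d_sq, map_zero]
  d_chi_top h := by
    rcases Nat.eq_zero_or_pos (n / 2) with h0 | h0
    · have hn : n = 0 := by rcases h with ⟨r, rfl⟩; omega
      have := rel K n k (.d_zero hn)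
      rw [map_zero] at this
      change D = 0 at this
      rw [this, zero_mul]
    · rw [chi_eq h0 le_rfl, D, ← gen_mul_gen, rel K n k (.d_chi_top _ h (by simp; omega)), map_zero]
  chi_chi i j h1 h2 h3 h4 := by
    rw [chi_eq h1 h2, chi_eq h3 h4, ← gen_mul_gen, rel K n k (.chi_chi _ _), gen_mul_gen]
  chi_d i h1 h2 := by
    rw [chi_eq h1 h2, D, ← gen_mul_gen, rel K n k (.chi_d _), gen_mul_gen]
  x_chi i j h1 h2 h3 h4 := by
    rw [X_eq h1 h2, chi_eq h3 h4, ← gen_mul_gen, rel K n k (.x_chi _ _), gen_mul_gen]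
  x_d i h1 h2 := by
    rw [X_eq h1 h2, D, ← gen_mul_gen, rel K n k (.x_d _), map_neg, gen_mul_gen]

lemma induction {p : OPolA K n k → Prop} (hc : ∀ r, p (algebraMap K _ r))
    (hx : ∀ i, 1 ≤ i → i ≤ k → p (X i)) (hχ : ∀ i, 1 ≤ i → i ≤ n / 2 → p (chi K n k i))
    (hd : p D) (ha : ∀ a b, p a → p b → p (a + b)) (hm : ∀ a b, p a → p b → p (a * b))
    (a : OPolA K n k) : p a := by
  obtain ⟨f, rfl⟩ := RingQuot.mkAlgHom_surjective K (PRel K n k) a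
  change p (mk K n k f)
  induction f using FreeAlgebra.induction with
  | grade0 r => simpa using hc r
  | grade1 g =>
    change p (gen K n k g)
    cases g with
    | x i => rw [gen_x]; exact hx _ ω ω
    | chi i => rw [gen_chi]; exact hχ _ ω ω
    | d => exact hd
  | mul a b h1 h2 => rw [map_mul]; exact hm _ _ h1 h2
  | add a b h1 h2 => rw [map_add]; exact ha _ _ h1 h2

section lift

variable {E : Type*} [Ring E] [Algebra K E] {x χ : ℕ → E} {d : E}

/-- Images of the generators under `lift`. -/
def liftGen (x χ : ℕ → E) (d : E) : PGen n k → E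
  | .x i => x (i + 1)
  | .chi i => χ (i + 1)
  | .d => d

/-- The universal property of `OPol_k ⊗ A_n`. -/
def lift (H : PSys n k x χ d) : OPolA K n k →ₐ[K] E :=
  RingQuot.liftAlgHom K ⟨FreeAlgebra.lift K (liftGen (n := n) (k := k) x χ d), by
    intro u v huv
    induction huv with
    | x_x i j hij =>
      simp only [map_mul, map_neg, lift_ι_apply, liftGen]
      exact H.x_x _ _ ω ω ω ω
        (fun h => hij (Fin.ext ω))
    | d_sq => simp only [map_mul, map_zero, lift_ι_apply, liftGen, H.d_sq]
    | d_chi_top i hn hi =>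
      simp only [map_mul, map_zero, lift_ι_apply, liftGen, hi, H.d_chi_top hn]
    | d_zero hn =>
      subst hn
      have := H.d_chi_top (by simp)
      rw [Nat.zero_div, H.chi_zero, mul_one] at this
      simp only [map_zero, lift_ι_apply, liftGen, this]
    | chi_chi i j =>
      simp only [map_mul, lift_ι_apply, liftGen]
      exact H.chi_chi _ _ ω ω ω ω
    | chi_d i =>
      simp only [map_mul, lift_ι_apply, liftGen]
      exact H.chi_d _ ω ω
    | x_chi i j =>
      simp only [map_mul, lift_ι_apply, liftGen]
      exact H.x_chi _ _ ω ω ω ω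
    | x_d i =>
      simp only [map_mul, map_neg, lift_ι_apply, liftGen]
      exact H.x_d _ ω ω⟩

variable (H : PSys n k x χ d)

lemma lift_gen (g : PGen n k) : lift H (gen K n k g) = liftGen x χ d g := by
  unfold lift gen mk
  erw [RingQuot.liftAlgHom_mkAlgHom_apply]
  rw [lift_ι_apply]

lemma lift_X (h1 : 1 ≤ i) (h2 : i ≤ k) : lift H (X i : OPolA K n k) = x i := by
  rw [X_eq h1 h2, lift_gen]
  simp only [liftGen]
  congr 1; omega

lemma lift_chi (h : i ≤ n / 2) : lift H (chi K n k i) = χ i := by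
  rcases Nat.eq_zero_or_pos i with rfl | h1
  · rw [chi_zero, map_one, H.chi_zero]
  rw [chi_eq h1 h, lift_gen]
  simp only [liftGen]
  congr 1; omega

lemma lift_D : lift H (D : OPolA K n k) = d := by rw [D, lift_gen]; rfl

end lift

/-! ### Odd divided difference operators -/

/-- The twist `s_i`. -/
def sw (i : ℕ) : Module.End K (OPolA K n k) := if h : 1 ≤ i ∧ i < k then
    (Matrix.entryLinearMap K (OPolA K n k) (0 : Fin 2) (0 : Fin 2)).comp
      (divMat K n k ⟨i - 1, ω⟩ ⟨i, h.2⟩).toLinearMap else 0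

/-- The odd divided difference operator `∂_i`. -/
def dv (i : ℕ) : Module.End K (OPolA K n k) := if h : 1 ≤ i ∧ i < k then
    (Matrix.entryLinearMap K (OPolA K n k) (0 : Fin 2) (1 : Fin 2)).comp
      (divMat K n k ⟨i - 1, ω⟩ ⟨i, h.2⟩).toLinearMap else 0

section dv

variable (h1 : 1 ≤ i) (h2 : i < k)
include h1 h2

lemma dv_eq (f : OPolA K n k) :
    dv i f = divMat K n k ⟨i - 1, ω⟩ ⟨i, h2⟩ f 0 1 := by
  rw [dv, dif_pos ⟨h1, h2⟩]; rfl

lemma sw_eq (f : OPolA K n k) :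
    sw i f = divMat K n k ⟨i - 1, ω⟩ ⟨i, h2⟩ f 0 0 := by
  rw [sw, dif_pos ⟨h1, h2⟩]; rfl

lemma dv_mul (f g : OPolA K n k) : dv i (f * g) = dv i f * g + sw i f * dv i g := by
  simp only [dv_eq h1 h2, sw_eq h1 h2, map_mul, Matrix.mul_apply, Fin.sum_univ_two,
    (divMat_lower K n k _ _ _).2]
  rw [add_comm]

lemma sw_mul (f g : OPolA K n k) : sw i (f * g) = sw i f * sw i g := by
  simp only [sw_eq h1 h2, map_mul, Matrix.mul_apply, Fin.sum_univ_two,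
    (divMat_lower K n k _ _ _).1, mul_zero, add_zero]

lemma dv_algebraMap (r : K) : dv i (algebraMap K (OPolA K n k) r) = 0 := by
  rw [dv_eq h1 h2, AlgHom.commutes]; simp [Matrix.algebraMap_matrix_apply]

lemma sw_algebraMap (r : K) : sw i (algebraMap K (OPolA K n k) r) = algebraMap K _ r := by
  rw [sw_eq h1 h2, AlgHom.commutes]; simp [Matrix.algebraMap_matrix_apply]

lemma dv_one : dv i (1 : OPolA K n k) = 0 := by
  simpa using dv_algebraMap (K := K) (n := n) h1 h2 1

lemma sw_one : sw i (1 : OPolA K n k) = 1 := by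
  simpa using sw_algebraMap (K := K) (n := n) h1 h2 1

lemma dv_D : dv i (D : OPolA K n k) = 0 := by
  rw [dv_eq h1 h2, D, divMat_gen]; simp [divMatGen]

lemma sw_D : sw i (D : OPolA K n k) = -D := by
  rw [sw_eq h1 h2, D, divMat_gen]; simp [divMatGen]

lemma dv_chi (j : ℕ) : dv i (chi K n k j) = 0 := by
  rcases Nat.eq_zero_or_pos j with rfl | h3
  · rw [chi_zero, dv_one h1 h2]
  by_cases h4 : j ≤ n / 2
  · rw [dv_eq h1 h2, chi_eq h3 h4, divMat_gen]; simp [divMatGen]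
  · rw [chi, if_neg ω, dif_neg ω, map_zero]

lemma sw_chi (j : ℕ) : sw i (chi K n k j) = chi K n k j := by
  rcases Nat.eq_zero_or_pos j with rfl | h3
  · rw [chi_zero, sw_one h1 h2]
  by_cases h4 : j ≤ n / 2
  · rw [sw_eq h1 h2, chi_eq h3 h4, divMat_gen]; simp [divMatGen]
  · rw [chi, if_neg ω, dif_neg ω, map_zero]

lemma dv_X (h3 : 1 ≤ j) (h4 : j ≤ k) :
    dv i (X j : OPolA K n k) = if j = i ∨ j = i + 1 then 1 else 0 := by
  rw [dv_eq h1 h2, X_eq h3 h4, divMat_gen]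
  simp only [divMatGen, Matrix.of_apply, Matrix.cons_val', Matrix.cons_val_zero,
    Matrix.cons_val_one, Matrix.cons_val_fin_one, delta, Fin.mk.injEq]
  split_ifs <;> first | rfl | omega

lemma sw_X (h3 : 1 ≤ j) (h4 : j ≤ k) :
    sw i (X j : OPolA K n k) = -X (if j = i then i + 1 else if j = i + 1 then i else j) := by
  rw [sw_eq h1 h2, X_eq h3 h4, divMat_gen]
  simp only [divMatGen, Matrix.of_apply, Matrix.cons_val', Matrix.cons_val_zero,
    Matrix.cons_val_fin_one, Equiv.swap_apply_def, Fin.mk.injEq]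
  split_ifs with c1 c2 c3 c4 c5 <;> first | omega | skip
  all_goals
    rw [X_eq ω ω]
  all_goals rfl

end dv

/-- Left multiplication operators. -/
abbrev lm (f : OPolA K n k) : Module.End K (OPolA K n k) := LinearMap.mulLeft K f

lemma op_eq_zero {β : Module.End K (OPolA K n k)} (h1 : β 1 = 0)
    (hx : ∀ i, 1 ≤ i → i ≤ k → ∃ u, β * lm (X i) = lm u * β)
    (hχ : ∀ i, 1 ≤ i → i ≤ n / 2 → ∃ u, β * lm (chi K n k i) = lm u * β)
    (hd : ∃ u, β * lm D = lm u * β) : β = 0 := by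
  have aux : ∀ f, (∃ u, β * lm f = lm u * β) → ∀ g, β g = 0 → β (f * g) = 0 := by
    rintro f ⟨u, hu⟩ g hg
    have := LinearMap.congr_fun hu g
    simp only [Module.End.mul_apply, LinearMap.mulLeft_apply, hg, mul_zero] at this
    exact this
  have key : ∀ f g, β g = 0 → β (f * g) = 0 := by
    intro f
    induction f using OPolA.induction with
    | hc r => intro g hg; rw [← Algebra.smul_def, map_smul, hg, smul_zero]
    | hx i h3 h4 => exact aux _ (hx i h3 h4)
    | hχ i h3 h4 => exact aux _ (hχ i h3 h4)
    | hd => exact aux _ hd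
    | ha a b h3 h4 => intro g hg; rw [add_mul, map_add, h3 g hg, h4 g hg, add_zero]
    | hm a b h3 h4 => intro g hg; rw [mul_assoc]; exact h3 _ (h4 _ hg)
  ext f
  simpa using key f 1 h1

/-! Computations with operators which supercommute up to permuting two elements. -/

lemma sq_mul_of_swap {E : Type*} [Ring E] {u x y : E} (h1 : u * x = 1 - y * u)
    (h2 : u * y = 1 - x * u) : u * u * x = x * (u * u) := by
  rw [mul_assoc, h1, mul_sub, ← mul_assoc, h2]; noncomm_ring

lemma sq_mul_of_anti {E : Type*} [Ring E] {u x : E} (h1 : u * x = -(x * u)) :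
    u * u * x = x * (u * u) := by
  rw [mul_assoc, h1, mul_neg, ← mul_assoc, h1, neg_mul, neg_neg, mul_assoc]

lemma add_mul_of_swap {E : Type*} [Ring E] {u v x y : E} (h1 : u * x = 1 - y * u)
    (h2 : v * x = -(x * v)) (h3 : v * y = -(y * v)) :
    (u * v + v * u) * x = y * (u * v + v * u) := by
  rw [add_mul, mul_assoc, mul_assoc, h1, h2, mul_neg, ← mul_assoc, h1, mul_sub, ← mul_assoc v, h3]
  noncomm_ring

lemma add_mul_of_anti {E : Type*} [Ring E] {u v x : E} (h1 : u * x = -(x * u))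
    (h2 : v * x = -(x * v)) : (u * v + v * u) * x = x * (u * v + v * u) := by
  rw [add_mul, mul_assoc, mul_assoc, h1, h2, mul_neg, ← mul_assoc, h1, mul_neg, ← mul_assoc v, h2]
  noncomm_ring

lemma braid_mul_of_anti {E : Type*} [Ring E] {u v x : E} (h1 : u * x = -(x * u))
    (h2 : v * x = -(x * v)) : (u * v * u - v * u * v) * x = -x * (u * v * u - v * u * v) := by
  have e3 : ∀ {u v : E}, u * x = -(x * u) → v * x = -(x * v) →
      u * v * u * x = -(x * (u * v * u)) := by
    intro u v h h'
    rw [mul_assoc, h, mul_neg, ← mul_assoc, mul_assoc u, h', mul_neg, ← mul_assoc, h]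
    noncomm_ring
  rw [sub_mul, e3 h1 h2, e3 h2 h1]
  noncomm_ring

section ops

variable (h1 : 1 ≤ i) (h2 : i < k)
include h1 h2

lemma dv_lm_X (h3 : 1 ≤ j) (h4 : j ≤ k) : dv i * lm (X j : OPolA K n k)
    = (if j = i ∨ j = i + 1 then 1 else 0)
      - lm (X (if j = i then i + 1 else if j = i + 1 then i else j)) * dv i := by
  ext f
  simp only [Module.End.mul_apply, LinearMap.mulLeft_apply, LinearMap.sub_apply,
    dv_mul h1 h2, dv_X h1 h2 h3 h4, sw_X h1 h2 h3 h4, neg_mul]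
  split_ifs <;> simp [sub_eq_add_neg]

lemma dv_x : dv i * lm (X i : OPolA K n k) = 1 - lm (X (i + 1)) * dv i := by
  rw [dv_lm_X h1 h2 h1 h2.le]; simp

lemma dv_xs : dv i * lm (X (i + 1) : OPolA K n k) = 1 - lm (X i) * dv i := by
  rw [dv_lm_X h1 h2 ω h2]; simp

lemma dv_xfar (h3 : 1 ≤ j) (h4 : j ≤ k) (h5 : j ≠ i) (h6 : j ≠ i + 1) :
    dv i * lm (X j : OPolA K n k) = -(lm (X j) * dv i) := by
  rw [dv_lm_X h1 h2 h3 h4]; simp [h5, h6]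

lemma dv_lm_chi (j : ℕ) : dv i * lm (chi K n k j) = lm (chi K n k j) * dv i := by
  ext f
  simp [Module.End.mul_apply, dv_mul h1 h2, dv_chi h1 h2, sw_chi h1 h2]

lemma dv_lm_D : dv i * lm (D : OPolA K n k) = -(lm D * dv i) := by
  ext f
  simp [Module.End.mul_apply, dv_mul h1 h2, dv_D h1 h2, sw_D h1 h2]

lemma dv_sq : dv i * dv i = (0 : Module.End K (OPolA K n k)) := by
  refine op_eq_zero ?_ (fun j h3 h4 => ?_) (fun j _ _ => ?_) ?_
  · rw [Module.End.mul_apply, dv_one h1 h2, map_zero]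
  · by_cases c1 : j = i
    · subst c1
      exact ⟨_, sq_mul_of_swap (dv_x h1 h2) (dv_xs h1 h2)⟩
    by_cases c2 : j = i + 1
    · subst c2
      exact ⟨_, sq_mul_of_swap (dv_xs h1 h2) (dv_x h1 h2)⟩
    · exact ⟨_, sq_mul_of_anti (dv_xfar h1 h2 h3 h4 c1 c2)⟩
  · have c : Commute (dv i) (lm (chi K n k j)) := dv_lm_chi h1 h2 j
    exact ⟨_, (c.mul_left c).eq⟩
  · exact ⟨_, sq_mul_of_anti (dv_lm_D h1 h2)⟩

end ops

lemma dv_far (h1 : 1 ≤ i) (h2 : i < k) (h3 : 1 ≤ j) (h4 : j < k)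
    (h : i + 1 < j ∨ j + 1 < i) :
    dv i * dv j + dv j * dv i = (0 : Module.End K (OPolA K n k)) := by
  refine op_eq_zero ?_ (fun l h5 h6 => ?_) (fun l _ _ => ?_) ?_
  · simp [Module.End.mul_apply, dv_one h1 h2, dv_one h3 h4]
  · by_cases c1 : l = i
    · subst c1
      exact ⟨_, add_mul_of_swap (dv_x h1 h2) (dv_xfar h3 h4 h5 h6 ω ω)
        (dv_xfar h3 h4 ω ω ω ω)⟩
    by_cases c2 : l = i + 1
    · subst c2
      exact ⟨_, add_mul_of_swap (dv_xs h1 h2) (dv_xfar h3 h4 h5 h6 ω ω)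
        (dv_xfar h3 h4 ω ω ω ω)⟩
    by_cases c3 : l = j
    · subst c3
      rw [add_comm]
      exact ⟨_, add_mul_of_swap (dv_x h3 h4) (dv_xfar h1 h2 h5 h6 ω ω)
        (dv_xfar h1 h2 ω ω ω ω)⟩
    by_cases c4 : l = j + 1
    · subst c4
      rw [add_comm]
      exact ⟨_, add_mul_of_swap (dv_xs h3 h4) (dv_xfar h1 h2 h5 h6 ω ω)
        (dv_xfar h1 h2 ω ω ω ω)⟩
    exact ⟨_, add_mul_of_anti (dv_xfar h1 h2 h5 h6 c1 c2) (dv_xfar h3 h4 h5 h6 c3 c4)⟩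
  · have c1 : Commute (dv i) (lm (chi K n k l)) := dv_lm_chi h1 h2 l
    have c2 : Commute (dv j) (lm (chi K n k l)) := dv_lm_chi h3 h4 l
    exact ⟨_, ((c1.mul_left c2).add_left (c2.mul_left c1)).eq⟩
  · exact ⟨_, add_mul_of_anti (dv_lm_D h1 h2) (dv_lm_D h3 h4)⟩

lemma braid_aux {E : Type*} [Ring E] {u v x₁ x₂ x₃ : E} (hu : u * u = 0) (hv : v * v = 0)
    (u1 : u * x₁ = 1 - x₂ * u) (u2 : u * x₂ = 1 - x₁ * u) (u3 : u * x₃ = -(x₃ * u))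
    (v1 : v * x₁ = -(x₁ * v)) (v2 : v * x₂ = 1 - x₃ * v) (v3 : v * x₃ = 1 - x₂ * v) :
    (u * v * u - v * u * v) * x₁ = -x₃ * (u * v * u - v * u * v) ∧
    (u * v * u - v * u * v) * x₂ = -x₂ * (u * v * u - v * u * v) ∧
    (u * v * u - v * u * v) * x₃ = -x₁ * (u * v * u - v * u * v) := by
  have a1 : u * v * u * x₁ = u * v - x₃ * (u * v * u) := by
    calc u * v * u * x₁ = u * v * (u * x₁) := by noncomm_ring
      _ = u * v - u * (v * x₂) * u := by rw [u1]; noncomm_ring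
      _ = u * v - u * u + (u * x₃) * v * u := by rw [v2]; noncomm_ring
      _ = _ := by rw [u3, hu]; noncomm_ring
  have b1 : v * u * v * x₁ = u * v - x₃ * (v * u * v) := by
    calc v * u * v * x₁ = v * u * (v * x₁) := by noncomm_ring
      _ = -(v * (u * x₁) * v) := by rw [v1]; noncomm_ring
      _ = -(v * v) + (v * x₂) * u * v := by rw [u1]; noncomm_ring
      _ = _ := by rw [v2, hv]; noncomm_ring
  have a2 : u * v * u * x₂ = u * v + v * u - x₂ * (u * v * u) := by
    calc u * v * u * x₂ = u * v * (u * x₂) := by noncomm_ring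
      _ = u * v - u * (v * x₁) * u := by rw [u2]; noncomm_ring
      _ = u * v + (u * x₁) * v * u := by rw [v1]; noncomm_ring
      _ = _ := by rw [u1]; noncomm_ring
  have b2 : v * u * v * x₂ = u * v + v * u - x₂ * (v * u * v) := by
    calc v * u * v * x₂ = v * u * (v * x₂) := by noncomm_ring
      _ = v * u - v * (u * x₃) * v := by rw [v2]; noncomm_ring
      _ = v * u + (v * x₃) * u * v := by rw [u3]; noncomm_ring
      _ = _ := by rw [v3]; noncomm_ring
  have a3 : u * v * u * x₃ = v * u - x₁ * (u * v * u) := by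
    calc u * v * u * x₃ = u * v * (u * x₃) := by noncomm_ring
      _ = -(u * (v * x₃) * u) := by rw [u3]; noncomm_ring
      _ = -(u * u) + (u * x₂) * v * u := by rw [v3]; noncomm_ring
      _ = _ := by rw [u2, hu]; noncomm_ring
  have b3 : v * u * v * x₃ = v * u - x₁ * (v * u * v) := by
    calc v * u * v * x₃ = v * u * (v * x₃) := by noncomm_ring
      _ = v * u - v * (u * x₂) * v := by rw [v3]; noncomm_ring
      _ = v * u - v * v + (v * x₁) * u * v := by rw [u2]; noncomm_ring
      _ = _ := by rw [v1, hv]; noncomm_ring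
  refine ⟨?_, ?_, ?_⟩
  · rw [sub_mul, a1, b1]; noncomm_ring
  · rw [sub_mul, a2, b2]; noncomm_ring
  · rw [sub_mul, a3, b3]; noncomm_ring

lemma dv_braid (h1 : 1 ≤ i) (h2 : i + 1 < k) :
    dv i * dv (i + 1) * dv i = (dv (i + 1) * dv i * dv (i + 1) : Module.End K (OPolA K n k)) := by
  have h3 : i < k := ω
  have h4 : 1 ≤ i + 1 := ω
  rw [← sub_eq_zero]
  obtain ⟨b1, b2, b3⟩ := braid_aux (dv_sq (K := K) (n := n) h1 h3) (dv_sq h4 h2) (dv_x h1 h3)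
    (dv_xs h1 h3) (dv_xfar h1 h3 (j := i + 2) ω ω ω ω)
    (dv_xfar h4 h2 (j := i) ω ω ω ω) (dv_x h4 h2)
    (dv_xs h4 h2)
  have hneg : ∀ f : OPolA K n k, -lm f = lm (-f) := fun f => by ext; simp
  refine op_eq_zero ?_ (fun l h5 h6 => ?_) (fun l _ _ => ?_) ?_
  · simp [Module.End.mul_apply, dv_one h1 h3, dv_one h4 h2]
  · by_cases c1 : l = i
    · subst c1; exact ⟨_, b1.trans (by rw [hneg])⟩
    by_cases c2 : l = i + 1
    · subst c2; exact ⟨_, b2.trans (by rw [hneg])⟩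
    by_cases c3 : l = i + 2
    · subst c3; exact ⟨_, b3.trans (by rw [hneg])⟩
    exact ⟨_, (braid_mul_of_anti (dv_xfar h1 h3 h5 h6 c1 c2)
      (dv_xfar h4 h2 h5 h6 c2 c3)).trans (by rw [hneg])⟩
  · have c1 : Commute (dv i) (lm (chi K n k l)) := dv_lm_chi h1 h3 l
    have c2 : Commute (dv (i + 1)) (lm (chi K n k l)) := dv_lm_chi h4 h2 l
    exact ⟨_, (((c1.mul_left c2).mul_left c1).sub_left ((c2.mul_left c1).mul_left c2)).eq⟩
  · exact ⟨_, (braid_mul_of_anti (dv_lm_D h1 h3) (dv_lm_D h4 h2)).trans (by rw [hneg])⟩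

lemma sys : Sys n k (fun i => lm (X i : OPolA K n k)) dv (fun i => lm (chi K n k i)) (lm D) := by
  have hm : ∀ f g : OPolA K n k, lm f * lm g = lm (f * g) := fun f g => by
    ext; simp [Module.End.mul_apply]
  have hneg : ∀ f : OPolA K n k, -lm f = lm (-f) := fun f => by ext; simp
  have hz : lm (0 : OPolA K n k) = 0 := by ext; simp
  have P := psys (K := K) (n := n) (k := k)
  exact
  { chi_zero := by rw [chi_zero]; ext; simp
    tau_sq := fun i h1 h2 => dv_sq h1 h2
    braid := fun i h1 h2 => dv_braid h1 h2
    x_tau := fun i h1 h2 => by rw [dv_xs h1 h2]; abel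
    tau_x := fun i h1 h2 => by rw [dv_x h1 h2]; abel
    x_x := fun i j h1 h2 h3 h4 h => by
      rw [hm, hm, P.x_x i j h1 h2 h3 h4 h, ← hneg, neg_add_cancel]
    tau_tau := fun i j h1 h2 h3 h4 h => dv_far h1 h2 h3 h4 h
    x_tau_far := fun i j h1 h2 h3 h4 h h' => by rw [dv_xfar h3 h4 h1 h2 h h', add_neg_cancel]
    d_sq := by rw [hm, P.d_sq, hz]
    d_chi_top := fun h => by rw [hm, P.d_chi_top h, hz]
    chi_chi := fun i j h1 h2 h3 h4 => by rw [hm, hm, P.chi_chi i j h1 h2 h3 h4]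
    chi_d := fun i h1 h2 => by rw [hm, hm, P.chi_d i h1 h2]
    x_chi := fun i j h1 h2 h3 h4 => by rw [hm, hm, P.x_chi i j h1 h2 h3 h4]
    tau_chi := fun i j h1 h2 h3 h4 => (dv_lm_chi h1 h2 j).symm
    x_d := fun i h1 h2 => by rw [hm, hm, P.x_d i h1 h2, hneg]
    tau_d := fun i h1 h2 => by rw [dv_lm_D h1 h2, neg_neg] }

end OPolA

variable {f : OPolA K n k} {h : ONH K n n}

/-- Linear endomorphisms of the skew polynomial algebra. -/
abbrev EndP (K : Type u) [CommRing K] (n k : ℕ) := Module.End K (OPolA K n k)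

/-- Subspaces of the skew polynomial algebra. -/
abbrev PSub (K : Type u) [CommRing K] (n k : ℕ) := Submodule K (OPolA K n k)

section aOf

variable {E : Type*} [Ring E] {χ : ℕ → E} {d : E}

lemma aOf_comm {x y : E} (hx : y * x = -(x * y)) (hd : y * d = -(d * y))
    (hχ : ∀ i, i ≤ n / 2 → y * χ i = χ i * y) :
    y * aOf n χ d x = (-1) ^ n * (aOf n χ d x * y) := by
  have hc : ∀ r, r ≤ n → y * cOf χ d r = (-1) ^ r * (cOf χ d r * y) := by
    intro r hr
    have h := hχ (r / 2) ω
    unfold cOf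
    split_ifs with he
    · rw [he.neg_one_pow, one_mul, h]
    · rw [(Nat.not_even_iff_odd.1 he).neg_one_pow, ← mul_assoc, hd, neg_mul, mul_assoc, h]
      noncomm_ring
  have hp : ∀ l, y * x ^ l = (-1) ^ l * (x ^ l * y) := fun l => by
    have := ONH.sc_pow (p := 1) (y := y) (z := x) (by rw [pow_one, hx]; noncomm_ring) l
    rwa [one_mul] at this
  unfold aOf
  rw [mul_sum, sum_mul, mul_sum]
  refine sum_congr rfl fun l hl => ?_
  rw [mem_range] at hl
  have := ONH.sc_mul (hp l) (hc (n - l) ω)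
  rw [show l + (n - l) = n by omega] at this
  rw [mul_assoc, ← mul_assoc y, ((Commute.neg_one_right y).pow_right l).eq, mul_assoc, this]
  simp only [← mul_assoc]
  rw [← pow_add, ← pow_add, add_comm l n]

lemma PSys.aOf_mul_x {x : ℕ → E} (H : PSys n k x χ d) (hk : 1 ≤ k) :
    aOf n χ d (x 1) * x 1 = (x 1 + 2 * (-1) ^ n * d) * aOf n χ d (x 1) := by
  have hχ : ∀ i, i ≤ n / 2 → Commute (χ i) (x 1) := fun i hi => by
    rcases Nat.eq_zero_or_pos i with rfl | h
    · rw [H.chi_zero]; exact Commute.one_left _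
    · exact H.x_chi 1 i le_rfl hk h hi
  have hdx := H.x_d 1 le_rfl hk
  have hd : ∀ l, d * x 1 ^ l = (-1) ^ l * (x 1 ^ l * d) := fun l => by
    have := ONH.sc_pow (p := 1) (y := d) (z := x 1) (by rw [pow_one, hdx]; noncomm_ring) l
    rwa [one_mul] at this
  have hs : ∀ (l : ℕ) (z : E), Commute ((-1 : E) ^ l) z :=
    fun l z => (Commute.neg_one_left z).pow_left l
  have h2 : ∀ z : E, Commute (2 : E) z := fun z => Nat.cast_ofNat (R := E) (n := 2) ▸
    Nat.cast_commute 2 z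
  let B : ℕ → E := fun l => if Even (n - l) then 2 * (-1) ^ n * (x 1 ^ l * (d * χ ((n - l) / 2)))
    else 0
  let A : ℕ → E := fun l => if Even (n - l) then 0 else
    2 * (-1) ^ n * (x 1 ^ (l + 1) * (d * χ ((n - l) / 2)))
  have h1 : ∀ l ∈ range (n + 1), (-1) ^ l * x 1 ^ l * cOf χ d (n - l) * x 1
      = x 1 * ((-1) ^ l * x 1 ^ l * cOf χ d (n - l)) + A l := by
    intro l hl
    rw [mem_range] at hl
    have hc := hχ ((n - l) / 2) ω
    have hl' : x 1 * ((-1) ^ l * x 1 ^ l) = (-1) ^ l * (x 1 ^ l * x 1) := by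
      rw [← mul_assoc, ← (hs l _).eq, mul_assoc, ← pow_succ', ← pow_succ]
    by_cases he : Even (n - l)
    · simp only [A, cOf, if_pos he, add_zero]
      rw [mul_assoc, hc.eq, ← mul_assoc, ← mul_assoc, hl', mul_assoc ((-1) ^ l)]
    · simp only [A, cOf, if_neg he]
      have h3 : (-1 : E) ^ n = -(-1) ^ l := by
        have : n = l + (n - l) := ω
        rw [this, pow_add, (Nat.not_even_iff_odd.1 he).neg_one_pow, mul_neg_one]
      rw [mul_assoc, mul_assoc d, hc.eq, ← mul_assoc d, hdx, ← mul_assoc (x 1), hl', h3, pow_succ]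
      generalize x 1 ^ l = z, (-1 : E) ^ l = w at *
      noncomm_ring
  have h3 : ∀ l ∈ range (n + 1),
      2 * (-1) ^ n * d * ((-1) ^ l * x 1 ^ l * cOf χ d (n - l)) = B l := by
    intro l hl
    have h4 : d * ((-1) ^ l * x 1 ^ l * cOf χ d (n - l)) = x 1 ^ l * (d * cOf χ d (n - l)) := by
      rw [mul_assoc, ← mul_assoc d, ← (hs l d).eq, mul_assoc, ← mul_assoc d, hd, ← mul_assoc,
        ← mul_assoc, ← pow_add, Even.neg_one_pow ⟨l, rfl⟩, one_mul, mul_assoc]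
    rw [mul_assoc, h4]
    by_cases he : Even (n - l)
    · simp only [B, cOf, if_pos he]
    · simp only [B, cOf, if_neg he]
      rw [← mul_assoc d, H.d_sq]; simp
  unfold aOf
  rw [sum_mul, sum_congr rfl h1, Finset.sum_add_distrib, add_mul, ← mul_sum,
    mul_sum _ _ (2 * (-1) ^ n * d), sum_congr rfl h3]
  congr 1
  rw [sum_range_succ, sum_range_succ']
  have hA : A n = 0 := by simp [A]
  have hB : B 0 = 0 := by
    simp only [B, Nat.sub_zero]
    split_ifs with h
    · rw [H.d_chi_top h]; simp
    · rfl
  change _ = _ + B 0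
  rw [hA, hB]
  congr 1
  refine sum_congr rfl fun l hl => ?_
  rw [mem_range] at hl
  simp only [A]
  by_cases he : Even (n - l)
  · have : ¬ Even (n - (l + 1)) := by
      rcases he with ⟨r, hr⟩; rintro ⟨r', hr'⟩; omega
    rw [if_pos he, if_neg this]
  · have h5 := Nat.not_even_iff_odd.1 he
    rcases h5 with ⟨r, hr⟩
    have : Even (n - (l + 1)) := ⟨r, ω⟩
    rw [if_neg he, if_pos this, show (n - l) / 2 = (n - (l + 1)) / 2 by omega]

end aOf

namespace OPolA

/-! ### Subalgebras on some of the variables -/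

/-- The subalgebra generated by the `x_i` with `i ∈ S`, and by `A_n`. -/
def poly (S : Set ℕ) : Subalgebra K (OPolA K n k) :=
  Algebra.adjoin K ({y | ∃ i ∈ S, 1 ≤ i ∧ i ≤ k ∧ y = X i} ∪ Set.range (chi K n k) ∪ {D})

lemma X_mem_poly (h : i ∈ S) : (X i : OPolA K n k) ∈ poly S := by
  by_cases h' : 1 ≤ i ∧ i ≤ k
  · exact Algebra.subset_adjoin (.inl (.inl ⟨i, h, h'.1, h'.2, rfl⟩))
  · rw [X, dif_neg h']; exact zero_mem _

lemma chi_mem_poly (i : ℕ) : chi K n k i ∈ poly S :=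
  Algebra.subset_adjoin (.inl (.inr ⟨i, rfl⟩))

lemma D_mem_poly : (D : OPolA K n k) ∈ poly S := Algebra.subset_adjoin (.inr rfl)

lemma c_mem_poly (r : ℕ) : cOf (chi K n k) D r ∈ poly S := by
  unfold cOf
  split_ifs
  · exact chi_mem_poly _
  · exact mul_mem D_mem_poly (chi_mem_poly _)

lemma poly_mono {S T : Set ℕ} (h : S ⊆ T) :
    (poly S : Subalgebra K (OPolA K n k)) ≤ poly T := by
  refine Algebra.adjoin_mono ?_
  refine Set.union_subset_union_left _ (Set.union_subset_union_left _ ?_)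
  rintro y ⟨i, h1, h2⟩
  exact ⟨i, h h1, h2⟩

lemma poly_induction {p : (a : OPolA K n k) → a ∈ poly S → Prop}
    (hc : ∀ r, p (algebraMap K _ r) (Subalgebra.algebraMap_mem _ r))
    (hx : ∀ i, (h : i ∈ S) → 1 ≤ i → i ≤ k → p (X i) (X_mem_poly h))
    (hχ : ∀ i, p (chi K n k i) (chi_mem_poly i)) (hd : p D D_mem_poly)
    (ha : ∀ a b h h', p a h → p b h' → p (a + b) (add_mem h h'))
    (hm : ∀ a b h h', p a h → p b h' → p (a * b) (mul_mem h h'))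
    {a : OPolA K n k} (h : a ∈ poly S) : p a h := by
  induction h using Algebra.adjoin_induction with
  | mem y hy =>
    rcases hy with (⟨i, h1, h2, h3, rfl⟩ | ⟨i, rfl⟩) | rfl
    · exact hx i h1 h2 h3
    · exact hχ i
    · exact hd
  | algebraMap r => exact hc r
  | add a b _ _ h1 h2 => exact ha _ _ _ _ h1 h2
  | mul a b h3 h4 h1 h2 => exact hm _ _ h3 h4 h1 h2

section

variable (h1 : 1 ≤ i) (h2 : i < k) {S : Set ℕ}
include h1 h2

lemma dv_of_mem_poly (h3 : i ∉ S) (h4 : i + 1 ∉ S) (hf : f ∈ poly S) :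
    dv i f = 0 := by
  induction hf using poly_induction with
  | hc r => exact dv_algebraMap h1 h2 r
  | hx j hj h5 h6 =>
    rw [dv_X h1 h2 h5 h6, if_neg]
    rintro (rfl | rfl) <;> contradiction
  | hχ j => exact dv_chi h1 h2 j
  | hd => exact dv_D h1 h2
  | ha a b _ _ h5 h6 => rw [map_add, h5, h6, add_zero]
  | hm a b _ _ h5 h6 => rw [dv_mul h1 h2, h5, h6, zero_mul, mul_zero, add_zero]

lemma sw_mem_poly (h : i ∈ S ↔ i + 1 ∈ S) (hf : f ∈ poly S) :
    sw i f ∈ poly S := by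
  induction hf using poly_induction with
  | hc r => rw [sw_algebraMap h1 h2 r]; exact Subalgebra.algebraMap_mem _ _
  | hx j hj h5 h6 =>
    rw [sw_X h1 h2 h5 h6]
    refine neg_mem (X_mem_poly ?_)
    split_ifs with c1 c2
    · subst c1; exact h.1 hj
    · subst c2; exact h.2 hj
    · exact hj
  | hχ j => rw [sw_chi h1 h2 j]; exact chi_mem_poly _
  | hd => rw [sw_D h1 h2]; exact neg_mem D_mem_poly
  | ha a b _ _ h5 h6 => rw [map_add]; exact add_mem h5 h6
  | hm a b _ _ h5 h6 => rw [sw_mul h1 h2]; exact mul_mem h5 h6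

lemma dv_mem_poly (h : i ∈ S ↔ i + 1 ∈ S) (hf : f ∈ poly S) :
    dv i f ∈ poly S := by
  induction hf using poly_induction with
  | hc r => rw [dv_algebraMap h1 h2 r]; exact zero_mem _
  | hx j hj h5 h6 =>
    rw [dv_X h1 h2 h5 h6]
    split_ifs
    · exact one_mem _
    · exact zero_mem _
  | hχ j => rw [dv_chi h1 h2 j]; exact zero_mem _
  | hd => rw [dv_D h1 h2]; exact zero_mem _
  | ha a b _ _ h5 h6 => rw [map_add]; exact add_mem h5 h6
  | hm a b h3 h4 h5 h6 =>
    rw [dv_mul h1 h2]; exact add_mem (mul_mem h5 h4) (mul_mem (sw_mem_poly h1 h2 h h3) h6)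

end

lemma X_mul_chi (i j : ℕ) : X i * chi K n k j = chi K n k j * X i := by
  by_cases h : 1 ≤ i ∧ i ≤ k
  · rcases Nat.eq_zero_or_pos j with rfl | h3
    · simp [chi_zero]
    by_cases h4 : j ≤ n / 2
    · exact (psys.x_chi i j h.1 h.2 h3 h4).symm
    · rw [chi, if_neg ω, dif_neg ω]; simp
  · rw [X, dif_neg h]; simp

lemma X_mul_poly (h1 : 1 ≤ j) (h2 : j ≤ k) (hj : j ∉ S) {u : OPolA K n k}
    (hu : u ∈ poly S) (s : ℕ) :
    ∃ u' ∈ (poly S : Subalgebra K (OPolA K n k)), X j ^ s * u = u' * X j ^ s := by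
  have key : ∀ {u : OPolA K n k}, u ∈ poly S →
      ∃ u' ∈ (poly S : Subalgebra K (OPolA K n k)), X j * u = u' * X j := by
    intro u hu
    induction hu using poly_induction with
    | hc r => exact ⟨_, Subalgebra.algebraMap_mem _ r, (Algebra.commutes _ _).symm⟩
    | hx i hi h5 h6 =>
      refine ⟨-X i, neg_mem (X_mem_poly hi), ?_⟩
      rw [neg_mul, psys.x_x j i h1 h2 h5 h6 (by rintro rfl; contradiction)]
    | hχ i => exact ⟨_, chi_mem_poly i, X_mul_chi _ _⟩
    | hd => exact ⟨-D, neg_mem D_mem_poly, by rw [neg_mul, psys.x_d j h1 h2, neg_neg]⟩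
    | ha a b _ _ h5 h6 =>
      obtain ⟨a', ha, ha'⟩ := h5
      obtain ⟨b', hb, hb'⟩ := h6
      exact ⟨a' + b', add_mem ha hb, by rw [mul_add, add_mul, ha', hb']⟩
    | hm a b _ _ h5 h6 =>
      obtain ⟨a', ha, ha'⟩ := h5
      obtain ⟨b', hb, hb'⟩ := h6
      exact ⟨a' * b', mul_mem ha hb, by rw [← mul_assoc, ha', mul_assoc, hb', mul_assoc]⟩
  induction s generalizing u with
  | zero => exact ⟨u, hu, by simp⟩
  | succ s ih =>
    obtain ⟨v, hv, e1⟩ := key hu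
    obtain ⟨w, hw, e2⟩ := ih hv
    exact ⟨w, hw, by rw [pow_succ, mul_assoc, e1, ← mul_assoc, e2, mul_assoc]⟩

/-! ### Coefficients in one variable -/

/-- The combinations of `x_j^s`, `s < N`, with coefficients not involving `x_j`, on the left. -/
def low (S : Set ℕ) (j N : ℕ) : PSub K n k :=
  span K {y | ∃ u ∈ (poly S : Subalgebra K (OPolA K n k)), ∃ s < N, y = u * X j ^ s}

lemma mem_low {u : OPolA K n k} (hu : u ∈ poly S) (hs : s < N) :
    u * X j ^ s ∈ low S j N := subset_span ⟨u, hu, s, hs, rfl⟩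

lemma low_mono {M : ℕ} {S T : Set ℕ} (h : S ⊆ T) (h' : N ≤ M) :
    (low S j N : PSub K n k) ≤ low T j M := by
  refine span_mono ?_
  rintro y ⟨u, hu, s, hs, rfl⟩
  exact ⟨u, poly_mono h hu, s, ω, rfl⟩

lemma map_mem_of_mem_low (T : EndP K n k)
    {P : PSub K n k} (h : ∀ u ∈ poly S, ∀ s < N, T (u * X j ^ s) ∈ P)
    (hf : f ∈ low S j N) : T f ∈ P :=
  (span_le (p := P.comap T)).2 (by rintro _ ⟨u, hu, s, hs, rfl⟩; exact h u hu s hs) hf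

lemma mul_mem_low {v f : OPolA K n k} (hv : v ∈ poly S)
    (hf : f ∈ low S j N) : v * f ∈ low S j N :=
  map_mem_of_mem_low (LinearMap.mulLeft K v) (fun u hu s hs => by
    rw [LinearMap.mulLeft_apply, ← mul_assoc]; exact mem_low (mul_mem hv hu) hs) hf

lemma low_mul (h1 : 1 ≤ j) (h2 : j ≤ k) (hj : j ∉ S) {v f : OPolA K n k}
    (hv : v ∈ poly S) (hf : f ∈ low S j N) : f * v ∈ low S j N :=
  map_mem_of_mem_low (LinearMap.mulRight K v) (fun u hu s hs => by
    obtain ⟨w, hw, e⟩ := X_mul_poly h1 h2 hj hv s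
    rw [LinearMap.mulRight_apply, mul_assoc, e, ← mul_assoc]; exact mem_low (mul_mem hu hw) hs) hf

lemma exists_mem_low (h1 : 1 ≤ j) (h2 : j ≤ k) (g : OPolA K n k) :
    ∃ N, g ∈ low {j}ᶜ j N := by
  have aux : ∀ v, (v : OPolA K n k) ∈ poly {j}ᶜ → ∃ N, v ∈ low {j}ᶜ j N := fun v hv =>
    ⟨1, by simpa using mem_low (j := j) (s := 0) hv (N := 1) ω⟩
  have key : ∀ g : OPolA K n k, ∀ f, (∃ N, f ∈ low {j}ᶜ j N) → ∃ N, g * f ∈ low {j}ᶜ j N := by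
    intro g
    have aux' : ∀ v, (v : OPolA K n k) ∈ poly {j}ᶜ →
        ∀ f, (∃ N, f ∈ low {j}ᶜ j N) → ∃ N, v * f ∈ low {j}ᶜ j N := by
      rintro v hv f ⟨N, hf⟩; exact ⟨N, mul_mem_low hv hf⟩
    induction g using OPolA.induction with
    | hc r => exact aux' _ (Subalgebra.algebraMap_mem _ r)
    | hχ i => exact aux' _ (chi_mem_poly i)
    | hd => exact aux' _ D_mem_poly
    | ha a b h3 h4 =>
      intro f hf
      obtain ⟨N, hN⟩ := h3 f hf
      obtain ⟨M, hM⟩ := h4 f hf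
      exact ⟨max N M, by
        rw [add_mul]
        exact add_mem (low_mono le_rfl (le_max_left _ _) hN) (low_mono le_rfl (le_max_right _ _) hM)⟩
    | hm a b h3 h4 => intro f hf; rw [mul_assoc]; exact h3 _ (h4 _ hf)
    | hx i h3 h4 =>
      by_cases hij : i = j
      · subst hij
        rintro f ⟨N, hf⟩
        refine ⟨N + 1, map_mem_of_mem_low (LinearMap.mulLeft K _) (fun u hu s hs => ?_) hf⟩
        obtain ⟨w, hw, e⟩ := X_mul_poly h1 h2 (by simp) hu 1
        rw [pow_one] at e
        rw [LinearMap.mulLeft_apply, ← mul_assoc, e, mul_assoc, ← pow_succ']; exact mem_low hw ω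
      · exact aux' _ (X_mem_poly (by simpa using hij))
  simpa using key g 1 (aux 1 (one_mem _))

open Polynomial in
/-- Images of the generators under `splitHom`. -/
def splitX (j i : ℕ) : Matrix (Fin 2) (Fin 2) (OPolA K n k)[X] :=
  if i = j then !![Polynomial.X, 0; 0, -Polynomial.X] else !![0, C (X i); C (X i), 0]

open Polynomial in
lemma split_psys (j : ℕ) : PSys n k (splitX (K := K) (n := n) (k := k) j)
    (fun i => !![C (chi K n k i), 0; 0, C (chi K n k i)]) !![0, C D; C D, 0] := by
  have P := psys (K := K) (n := n) (k := k)
  constructor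
  · rw [P.chi_zero]; ext a b; fin_cases a <;> fin_cases b <;> simp
  · intro a b h1 h2 h3 h4 h
    have := congrArg C (P.x_x a b h1 h2 h3 h4 h)
    rw [C_mul, C_neg, C_mul] at this
    unfold splitX
    split_ifs with c1 c2 c2
    · omega
    all_goals ext i j; fin_cases i <;> fin_cases j <;> simp [Matrix.mul_apply, X_mul_C, this]
  · have := congrArg C P.d_sq
    rw [C_mul, C_0] at this
    ext i j; fin_cases i <;> fin_cases j <;> simp [Matrix.mul_apply, this]
  · intro h
    have := congrArg C (P.d_chi_top h)
    rw [C_mul, C_0] at this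
    ext i j; fin_cases i <;> fin_cases j <;> simp [Matrix.mul_apply, this]
  · intro a b h1 h2 h3 h4
    have := congrArg C (P.chi_chi a b h1 h2 h3 h4)
    rw [C_mul, C_mul] at this
    ext i j; fin_cases i <;> fin_cases j <;> simp [Matrix.mul_apply, this]
  · intro a h1 h2
    have := congrArg C (P.chi_d a h1 h2)
    rw [C_mul, C_mul] at this
    ext i j; fin_cases i <;> fin_cases j <;> simp [Matrix.mul_apply, this]
  · intro a b h1 h2 h3 h4
    have := congrArg C (P.x_chi a b h1 h2 h3 h4)
    rw [C_mul, C_mul] at this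
    unfold splitX
    split_ifs
    all_goals ext i j; fin_cases i <;> fin_cases j <;> simp [Matrix.mul_apply, X_mul_C, this]
  · intro a h1 h2
    have := congrArg C (P.x_d a h1 h2)
    rw [C_mul, C_neg, C_mul] at this
    unfold splitX
    split_ifs
    all_goals ext i j; fin_cases i <;> fin_cases j <;> simp [Matrix.mul_apply, X_mul_C, this]

/-- The expansion of an element in powers of `x_j`, with coefficients on the left. -/
def expand (j : ℕ) (g : OPolA K n k) : Polynomial (OPolA K n k) :=
  lift (split_psys j) g 0 0 + lift (split_psys j) g 1 0

lemma expand_add (j : ℕ) (f g : OPolA K n k) : expand j (f + g) = expand j f + expand j g := by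
  simp only [expand, map_add, Matrix.add_apply]; abel

lemma expand_zero (j : ℕ) : expand j (0 : OPolA K n k) = 0 := by simp [expand]

lemma expand_smul (j : ℕ) (r : K) (f : OPolA K n k) : expand j (r • f) = r • expand j f := by
  simp only [expand, map_smul, Matrix.smul_apply, smul_add]

lemma expand_mul_X (h1 : 1 ≤ j) (h2 : j ≤ k) (g : OPolA K n k) :
    expand j (g * X j) = expand j g * Polynomial.X := by
  simp only [expand, map_mul, lift_X _ h1 h2, Matrix.mul_apply, Fin.sum_univ_two, splitX, if_pos]
  simp [add_mul]

open Polynomial in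
lemma expand_poly {u : OPolA K n k} (hu : u ∈ poly {j}ᶜ) :
    expand j u = C u := by
  have key : ∃ p q : OPolA K n k, lift (split_psys j) u = !![C p, C q; C q, C p] ∧ p + q = u := by
    induction hu using poly_induction with
    | hc r =>
      refine ⟨algebraMap K _ r, 0, ?_, by simp⟩
      rw [AlgHom.commutes]
      ext i j; fin_cases i <;> fin_cases j <;>
        simp [Matrix.algebraMap_matrix_apply, Polynomial.algebraMap_apply]
    | hx i hi h5 h6 =>
      refine ⟨0, X i, ?_, by simp⟩
      rw [lift_X _ h5 h6, splitX, if_neg (by simpa using hi), C_0]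
    | hχ i =>
      refine ⟨chi K n k i, 0, ?_, by simp⟩
      by_cases hi : i ≤ n / 2
      · rw [lift_chi _ hi, C_0]
      · rw [chi, if_neg ω, dif_neg ω]
        ext i j; fin_cases i <;> fin_cases j <;> simp
    | hd => exact ⟨0, D, by rw [lift_D, C_0], by simp⟩
    | ha a b _ _ h5 h6 =>
      obtain ⟨p, q, e, rfl⟩ := h5
      obtain ⟨p', q', e', rfl⟩ := h6
      refine ⟨p + p', q + q', ?_, by abel⟩
      rw [map_add, e, e']
      ext i j; fin_cases i <;> fin_cases j <;> simp
    | hm a b _ _ h5 h6 =>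
      obtain ⟨p, q, e, rfl⟩ := h5
      obtain ⟨p', q', e', rfl⟩ := h6
      refine ⟨p * p' + q * q', p * q' + q * p', ?_, by noncomm_ring⟩
      rw [map_mul, e, e']
      ext i j; fin_cases i <;> fin_cases j <;> simp [Matrix.mul_apply] <;> abel
  obtain ⟨p, q, e, rfl⟩ := key
  simp [expand, e]

lemma expand_mul_pow (h1 : 1 ≤ j) (h2 : j ≤ k) (g : OPolA K n k) (s : ℕ) :
    expand j (g * X j ^ s) = expand j g * Polynomial.X ^ s := by
  induction s with
  | zero => simp
  | succ s ih => rw [pow_succ, ← mul_assoc, expand_mul_X h1 h2, ih, pow_succ, mul_assoc]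

lemma coeff_expand_of_mem_low (h1 : 1 ≤ j) (h2 : j ≤ k) {g : OPolA K n k}
    (hg : g ∈ low {j}ᶜ j N) (hs : N ≤ s) : (expand j g).coeff s = 0 := by
  induction hg using span_induction with
  | mem y hy =>
    obtain ⟨u, hu, t, ht, rfl⟩ := hy
    rw [expand_mul_pow h1 h2, expand_poly hu, Polynomial.coeff_C_mul, Polynomial.coeff_X_pow,
      if_neg ω, mul_zero]
  | zero => rw [expand_zero, Polynomial.coeff_zero]
  | add a b _ _ h1 h2 => rw [expand_add, Polynomial.coeff_add, h1, h2, add_zero]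
  | smul r a _ h => rw [expand_smul, Polynomial.coeff_smul, h, smul_zero]

end OPolA

/-- The longest word in the `τ` of `ONH_k^n`. -/
notation:max "tω" k:max => tl ONH.tau 1 (k - 1)

lemma PM.map_linear {R E F : Type*} [CommRing R] [Ring E] [Ring F] [Module R E] [Module R F]
    (f : E →ₗ[R] F) {a b : E} (h : PM a b) : PM (f a) (f b) := by
  rcases h with rfl | rfl <;> simp [PM]

namespace OPolA

/-! ### The ideal generated by the divided differences of `a^n(x_1)` -/

lemma dv_desc_succ (j : ℕ) (f : OPolA K n k) :
    desc dv 1 (j + 1) f = dv (j + 1) (desc dv 1 j f) := by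
  rw [desc_succ, add_comm 1 j]; rfl

/-- The iterated divided differences `∂_j ⋯ ∂_1 (a^n(x_1))`. -/
def cyc (j : ℕ) : OPolA K n k := desc dv 1 j (aOf n (chi K n k) D (X 1))

lemma cyc_zero : (cyc 0 : OPolA K n k) = aOf n (chi K n k) D (X 1) := by simp [cyc]

lemma cyc_succ (j : ℕ) : (cyc (j + 1) : OPolA K n k) = dv (j + 1) (cyc j) := dv_desc_succ _ _

lemma aOf_mem_poly (h : 1 ∈ S) :
    aOf n (chi K n k) D (X 1) ∈ (poly S : Subalgebra K (OPolA K n k)) :=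
  sum_mem fun _ _ => mul_mem (mul_mem (pow_mem (neg_mem (one_mem _)) _)
    (pow_mem (X_mem_poly h) _)) (c_mem_poly _)

lemma cyc_mem_poly (hj : j < k) : (cyc j : OPolA K n k) ∈ poly (Set.Iic (j + 1)) := by
  induction j with
  | zero => rw [cyc_zero]; exact aOf_mem_poly (by simp)
  | succ j ih =>
    rw [cyc_succ]
    exact dv_mem_poly ω hj (by simp) (poly_mono (by simp) (ih ω))

lemma dv_desc {v : OPolA K n k} (hv : v ∈ poly (K := K) (n := n) (k := k) {1}) {i j : ℕ}
    (h1 : 1 ≤ i) (h2 : i < k) (hj : j < k) (h : i ≤ j) : dv i (desc dv 1 j v) = 0 := by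
  rcases h.lt_or_eq with h3 | rfl
  · have := sys.nilCox.desc_T (T := fun i => sq (dv i : EndP K n k)) (l := 1)
      (N := j) (i := i) le_rfl ω h1 ω
    rw [← map_desc (fun i => dv i) 1 j sq, ← map_mul, ← map_mul, sq_eq] at this
    have h4 : (desc dv 1 j * dv (i + 1) : EndP K n k) v = 0 := by
      rw [Module.End.mul_apply, dv_of_mem_poly ω ω (by simp; omega) (by simp) hv, map_zero]
    change (dv i * desc dv 1 j : EndP K n k) v = 0
    rcases this with h | h
    · rw [← h, h4]
    · rw [← neg_eq_zero, ← LinearMap.neg_apply, ← h, h4]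
  · obtain ⟨i, rfl⟩ := Nat.exists_eq_add_of_le' h1
    rw [dv_desc_succ, ← Module.End.mul_apply, dv_sq h1 h2]; rfl

lemma dv_cyc (h1 : 1 ≤ i) (h2 : i < k) (hj : j < k) (h : i ≠ j + 1) :
    dv i (cyc j : OPolA K n k) = 0 := by
  rcases le_or_gt i j with h3 | h3
  · exact dv_desc (aOf_mem_poly rfl) h1 h2 hj h3
  · exact dv_of_mem_poly h1 h2 (by simp; omega) (by simp; omega) (cyc_mem_poly hj)

lemma cyc_comm_X (hj : j < k) (h1 : j + 1 < i) (h2 : i ≤ k) :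
    PM (X i * cyc j : OPolA K n k) (cyc j * X i) := by
  induction j with
  | zero =>
    rw [cyc_zero, aOf_comm (psys.x_x i 1 ω h2 le_rfl ω ω)
      (by rw [psys.x_d i ω h2, neg_neg]) (fun j _ => X_mul_chi _ _)]
    exact PM.unit_mul _ _
  | succ j ih =>
    have h3 : 1 ≤ j + 1 := ω
    have e1 := dv_mul h3 hj (X i) (cyc j : OPolA K n k)
    have e2 := dv_mul h3 hj (cyc j : OPolA K n k) (X i)
    rw [dv_X h3 hj ω h2, if_neg ω, zero_mul, zero_add,
      sw_X h3 hj ω h2, if_neg ω, if_neg ω, ← cyc_succ] at e1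
    rw [dv_X h3 hj ω h2, if_neg ω, mul_zero, add_zero, ← cyc_succ] at e2
    rw [← e2, ← neg_neg (X i * cyc (j + 1)), ← neg_mul, ← e1]
    exact ((ih ω ω).map_linear (dv (j + 1))).neg

lemma exists_aOf_mul (hk : 1 ≤ k) (g : OPolA K n k) :
    (∃ g', aOf n (chi K n k) D (X 1) * g = g' * aOf n (chi K n k) D (X 1)) ∧
      ∃ g', g * aOf n (chi K n k) D (X 1) = aOf n (chi K n k) D (X 1) * g' := by
  have aux : ∀ f : OPolA K n k, PM (f * aOf n (chi K n k) D (X 1)) (aOf n (chi K n k) D (X 1) * f) →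
      (∃ g', aOf n (chi K n k) D (X 1) * f = g' * aOf n (chi K n k) D (X 1)) ∧
      ∃ g', f * aOf n (chi K n k) D (X 1) = aOf n (chi K n k) D (X 1) * g' := by
    rintro f (h | h)
    · exact ⟨⟨f, h.symm⟩, f, h⟩
    · exact ⟨⟨-f, by rw [neg_mul, h, neg_neg]⟩, -f, by rw [mul_neg, h]⟩
  have hχ : ∀ i j : ℕ, i ≤ n / 2 → j ≤ n / 2 → Commute (chi K n k i) (chi K n k j) := by
    intro i j hi hj
    rcases Nat.eq_zero_or_pos i with rfl | h
    · rw [chi_zero]; exact Commute.one_left _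
    rcases Nat.eq_zero_or_pos j with rfl | h'
    · rw [chi_zero]; exact Commute.one_right _
    exact psys.chi_chi i j h hi h' hj
  have hd : ∀ i : ℕ, i ≤ n / 2 → Commute (chi K n k i) D := by
    intro i hi
    rcases Nat.eq_zero_or_pos i with rfl | h
    · rw [chi_zero]; exact Commute.one_left _
    exact psys.chi_d i h hi
  have hD : PM (D * aOf n (chi K n k) D (X 1) : OPolA K n k) (aOf n (chi K n k) D (X 1) * D) := by
    rw [aOf_comm (psys.x_d 1 le_rfl hk) (by rw [psys.d_sq, neg_zero]) (fun j hj => (hd j hj).symm.eq)]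
    exact PM.unit_mul _ _
  induction g using OPolA.induction with
  | hc r => exact ⟨⟨_, (Algebra.commutes _ _).symm⟩, _, Algebra.commutes _ _⟩
  | hx i h1 h2 =>
    by_cases h : i = 1
    · subst h
      have h := psys.aOf_mul_x (x := (X : ℕ → OPolA K n k)) hk
      refine ⟨⟨_, h⟩, ?_⟩
      obtain ⟨-, g', hg⟩ := aux _ hD
      refine ⟨X 1 - 2 * (-1) ^ n * g', ?_⟩
      have hc : Commute (aOf n (chi K n k) D (X 1)) (2 * (-1) ^ n : OPolA K n k) :=
        (Commute.ofNat_right _ 2).mul_right ((Commute.neg_one_right _).pow_right n)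
      rw [mul_sub, ← mul_assoc _ _ g', hc.eq, mul_assoc _ _ g', ← hg, h, add_mul, mul_assoc _ D,
        add_sub_cancel_right]
    · refine aux _ ?_
      have := cyc_comm_X (K := K) (n := n) (i := i) (j := 0) hk ω h2
      rwa [cyc_zero] at this
  | hχ i h1 h2 =>
    refine aux _ (.inl ?_)
    change Commute _ _
    refine Commute.sum_right _ _ _ fun l hl => ?_
    refine Commute.mul_right (Commute.mul_right ((Commute.neg_one_right _).pow_right _)
      (Commute.pow_right (X_mul_chi _ _).symm _)) ?_
    unfold cOf
    split_ifs
    · exact hχ _ _ h2 ω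
    · exact (hd _ h2).mul_right (hχ _ _ h2 ω)
  | hd => exact aux _ hD
  | ha a b h1 h2 =>
    obtain ⟨⟨a', ha⟩, a'', ha'⟩ := h1
    obtain ⟨⟨b', hb⟩, b'', hb'⟩ := h2
    exact ⟨⟨a' + b', by rw [mul_add, add_mul, ha, hb]⟩, a'' + b'', by rw [mul_add, add_mul, ha', hb']⟩
  | hm a b h1 h2 =>
    obtain ⟨⟨a', ha⟩, a'', ha'⟩ := h1
    obtain ⟨⟨b', hb⟩, b'', hb'⟩ := h2
    exact ⟨⟨a' * b', by rw [← mul_assoc, ha, mul_assoc, hb, mul_assoc]⟩,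
      a'' * b'', by rw [mul_assoc, hb', ← mul_assoc, ha', mul_assoc]⟩

/-- The left ideal generated by the first `i` iterated divided differences of `a^n(x_1)`. -/
def cycIdeal (i : ℕ) : Ideal (OPolA K n k) := Ideal.span {y | ∃ l < i, y = cyc l}

lemma cyc_mem_cycIdeal (h : l < i) : (cyc l : OPolA K n k) ∈ cycIdeal i :=
  Ideal.subset_span ⟨l, h, rfl⟩

lemma cycIdeal_mono (h : i ≤ j) : (cycIdeal i : Ideal (OPolA K n k)) ≤ cycIdeal j := by
  refine Ideal.span_mono ?_
  rintro y ⟨l, hl, rfl⟩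
  exact ⟨l, ω, rfl⟩

lemma cycIdeal_induction {p : OPolA K n k → Prop} (h0 : p 0)
    (ha : ∀ a b, p a → p b → p (a + b)) (hm : ∀ g l, l < i → p (g * cyc l))
    (hf : f ∈ cycIdeal i) : p f := by
  have key : ∀ g : OPolA K n k, p (g * f) := by
    induction hf using span_induction with
    | mem y hy => obtain ⟨l, hl, rfl⟩ := hy; exact fun g => hm g l hl
    | zero => simpa using h0
    | add a b _ _ h1 h2 => intro g; rw [mul_add]; exact ha _ _ (h1 g) (h2 g)
    | smul r a _ h => intro g; rw [smul_eq_mul, ← mul_assoc]; exact h _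
  simpa using key 1

lemma dv_mem_cycIdeal (h1 : 1 ≤ l) (h2 : l < i) (h3 : i ≤ k)
    (hf : f ∈ cycIdeal i) : dv l f ∈ cycIdeal i := by
  refine cycIdeal_induction (p := fun f => dv l f ∈ cycIdeal i) ?_ ?_ ?_ hf
  · rw [map_zero]; exact zero_mem _
  · intro a b h h'; rw [map_add]; exact add_mem h h'
  · intro g p hp
    rw [dv_mul h1 ω]
    refine add_mem (Ideal.mul_mem_left _ _ (cyc_mem_cycIdeal hp)) (Ideal.mul_mem_left _ _ ?_)
    by_cases h : l = p + 1
    · subst h; rw [← cyc_succ]; exact cyc_mem_cycIdeal h2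
    · rw [dv_cyc h1 ω ω h]; exact zero_mem _

lemma cyc_mul_cyc_mem (h : p < q) (hq : q < k) :
    (cyc p * cyc q : OPolA K n k) ∈ cycIdeal (p + 1) := by
  have key : ∀ i, i ≤ p → (cyc i * cyc q : OPolA K n k) ∈ cycIdeal (p + 1) := by
    intro i hi
    induction i with
    | zero =>
      rw [cyc_zero]
      obtain ⟨⟨g', hg⟩, -⟩ := exists_aOf_mul (K := K) (n := n) (k := k) ω (cyc q)
      rw [hg, ← cyc_zero]
      exact Ideal.mul_mem_left _ _ (cyc_mem_cycIdeal ω)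
    | succ i ih =>
      have := dv_mul ω ω (cyc i : OPolA K n k) (cyc q) (i := i + 1)
      rw [dv_cyc ω ω hq ω, mul_zero, add_zero, ← cyc_succ] at this
      rw [← this]
      exact dv_mem_cycIdeal ω ω ω (ih ω)
  exact key p le_rfl

lemma mul_cyc_mem (h : i ≤ q) (hq : q < k) (hf : f ∈ cycIdeal i) :
    f * cyc q ∈ cycIdeal i := by
  refine cycIdeal_induction (p := fun f => f * cyc q ∈ cycIdeal i) ?_ ?_ ?_ hf
  · rw [zero_mul]; exact zero_mem _
  · intro a b h h'; rw [add_mul]; exact add_mem h h'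
  · intro g l hl
    rw [mul_assoc]
    exact Ideal.mul_mem_left _ _ (cycIdeal_mono ω (cyc_mul_cyc_mem ω hq))

lemma cyc_comm_X_pow (hj : j < k) (h1 : j + 1 < i) (h2 : i ≤ k) (s : ℕ) :
    PM (X i ^ s * cyc j : OPolA K n k) (cyc j * X i ^ s) := ((cyc_comm_X hj h1 h2).symm.mul_pow).symm

lemma mul_pow_mem_cycIdeal (h : i < j) (hj : j ≤ k)
    (hf : f ∈ cycIdeal i) : f * X j ^ s ∈ cycIdeal i := by
  refine cycIdeal_induction (p := fun f => f * X j ^ s ∈ cycIdeal i) ?_ ?_ ?_ hf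
  · rw [zero_mul]; exact zero_mem _
  · intro a b h h'; rw [add_mul]; exact add_mem h h'
  · intro g l hl
    rw [mul_assoc]
    refine Ideal.mul_mem_left _ _ ?_
    exact (cyc_comm_X_pow ω ω hj s).symm.mem
      (Ideal.mul_mem_left _ _ (cyc_mem_cycIdeal hl))

lemma coeff_expand_mem_cycIdeal (h : i < j) (hj : j ≤ k)
    (hf : f ∈ cycIdeal i) : (expand j f).coeff s ∈ cycIdeal i := by
  refine cycIdeal_induction (p := fun f => (expand j f).coeff s ∈ cycIdeal i) ?_ ?_ ?_ hf
  · rw [expand_zero, Polynomial.coeff_zero]; exact zero_mem _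
  · intro a b h h'; rw [expand_add, Polynomial.coeff_add]; exact add_mem h h'
  · intro g l hl
    obtain ⟨N, hg⟩ := exists_mem_low ω hj g
    induction hg using span_induction with
    | mem y hy =>
      obtain ⟨u, hu, t, ht, rfl⟩ := hy
      have hl' : (cyc l : OPolA K n k) ∈ poly {j}ᶜ :=
        poly_mono (by intro a ha; simp at ha ⊢; omega) (cyc_mem_poly ω)
      have key : (expand j (u * (cyc l * X j ^ t))).coeff s ∈ cycIdeal i := by
        rw [← mul_assoc, expand_mul_pow ω hj, expand_poly (mul_mem hu hl'),
          Polynomial.coeff_C_mul, Polynomial.coeff_X_pow]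
        split_ifs
        · rw [mul_one]; exact Ideal.mul_mem_left _ _ (cyc_mem_cycIdeal hl)
        · rw [mul_zero]; exact zero_mem _
      rw [mul_assoc]
      rcases cyc_comm_X_pow (K := K) (n := n) (show l < k by omega) (show l + 1 < j by omega) hj t
        with e | e
      · rw [e]; exact key
      · have : expand j (u * (X j ^ t * cyc l)) = -expand j (u * (cyc l * X j ^ t)) := by
          rw [e, mul_neg, eq_neg_iff_add_eq_zero, ← expand_add, neg_add_cancel, expand_zero]
        rw [this, Polynomial.coeff_neg]; exact neg_mem key
    | zero => rw [zero_mul, expand_zero, Polynomial.coeff_zero]; exact zero_mem _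
    | add a b _ _ h1 h2 => rw [add_mul, expand_add, Polynomial.coeff_add]; exact add_mem h1 h2
    | smul r a _ h =>
      rw [smul_mul_assoc, expand_smul, Polynomial.coeff_smul, Algebra.smul_def]
      exact Ideal.mul_mem_left _ _ h

lemma dv_X_pow (h1 : 1 ≤ j) (h2 : j < k) (s : ℕ) :
    ∃ w ∈ (low (Set.Iic j) (j + 1) s : PSub K n k), ∃ ε : ℕ,
      dv j (X j ^ (s + 1)) = (-1) ^ ε * X (j + 1) ^ s + w := by
  have e0 : sw j (X j : OPolA K n k) = -X (j + 1) := by rw [sw_X h1 h2 h1 h2.le, if_pos rfl]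
  have e1 : dv j (X j : OPolA K n k) = 1 := by rw [dv_X h1 h2 h1 h2.le, if_pos (.inl rfl)]
  have e2 : ∀ t, sw j (X j ^ t : OPolA K n k) = (-X (j + 1)) ^ t := fun t => by
    induction t with
    | zero => rw [pow_zero, pow_zero, sw_one h1 h2]
    | succ t ih => rw [pow_succ, sw_mul h1 h2, ih, e0, pow_succ]
  have hX : ∀ s', ∀ w ∈ (low (Set.Iic j) (j + 1) s' : PSub K n k),
      w * X j ∈ (low (Set.Iic j) (j + 1) s' : PSub K n k) :=
    fun s' w hw => low_mul ω ω (by simp) (X_mem_poly (by simp)) hw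
  induction s with
  | zero => exact ⟨0, zero_mem _, 0, by simp [e1]⟩
  | succ s ih =>
    obtain ⟨w, hw, ε, e⟩ := ih
    refine ⟨((-1) ^ ε * X (j + 1) ^ s + w) * X j, hX _ _ (add_mem ?_ (low_mono le_rfl ω hw)),
      s + 1, ?_⟩
    · exact mem_low (pow_mem (neg_mem (one_mem _)) _) ω
    · rw [pow_succ (X j) (s + 1), dv_mul h1 h2, e, e1, e2, mul_one, add_comm, neg_pow (X (j + 1))]

lemma cyc_eq (hj : j < k) (hk : k ≤ n) :
    ∃ w ∈ (low (Set.Iic j) (j + 1) (n - j) : PSub K n k), ∃ ε : ℕ,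
      cyc j = (-1) ^ ε * X (j + 1) ^ (n - j) + w := by
  induction j with
  | zero =>
    refine ⟨∑ l ∈ range n, (-1) ^ l * X 1 ^ l * cOf (chi K n k) D (n - l),
      sum_mem fun l hl => ?_, n, ?_⟩
    · rw [mem_range] at hl
      refine low_mul ω ω (by simp) (c_mem_poly _) ?_
      exact mem_low (pow_mem (neg_mem (one_mem _)) _) ω
    · rw [cyc_zero, aOf, sum_range_succ, add_comm]
      simp [cOf, chi_zero]
  | succ j ih =>
    obtain ⟨w, hw, ε, e⟩ := ih ω
    have h1 : 1 ≤ j + 1 := ω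
    have key : ∀ y ∈ (low (Set.Iic j) (j + 1) (n - j) : PSub K n k),
        dv (j + 1) y ∈ (low (Set.Iic (j + 1)) (j + 1 + 1) (n - (j + 1)) :
          PSub K n k) := by
      refine fun y => map_mem_of_mem_low _ fun u hu s hs => ?_
      · rw [dv_mul h1 hj, dv_of_mem_poly h1 hj (by simp) (by simp) hu, zero_mul, zero_add]
        refine mul_mem_low (poly_mono (by simp) (sw_mem_poly h1 hj (by simp) hu)) ?_
        rcases s with _ | s
        · rw [pow_zero, dv_one h1 hj]; exact zero_mem _
        · obtain ⟨v, hv, ε', e'⟩ := dv_X_pow (K := K) (n := n) h1 hj s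
          rw [e']
          exact add_mem (mem_low (pow_mem (neg_mem (one_mem _)) _) ω)
            (low_mono le_rfl ω hv)
    obtain ⟨v, hv, ε', e'⟩ := dv_X_pow (K := K) (n := n) h1 hj (n - (j + 1))
    rw [show n - (j + 1) + 1 = n - j by omega] at e'
    have hs : ∀ y : OPolA K n k, dv (j + 1) ((-1) ^ ε * y) = (-1) ^ ε * dv (j + 1) y := by
      intro y
      rcases neg_one_pow_eq_or (OPolA K n k) ε with h | h <;> rw [h] <;> simp
    refine ⟨(-1) ^ ε * v + dv (j + 1) w, add_mem (mul_mem_low (pow_mem (neg_mem (one_mem _)) _) hv)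
      (key w hw), ε + ε', ?_⟩
    rw [cyc_succ, e, map_add, hs, e', mul_add, pow_add, mul_assoc, add_assoc]

lemma mem_cycIdeal_of_succ (hi : i < k) (hk : k ≤ n) {b : OPolA K n k}
    (hb : b ∈ poly (Set.Iic i)) (hb' : b ∈ cycIdeal (i + 1)) : b ∈ cycIdeal i := by
  obtain ⟨w, hw, ε, hcyc⟩ := cyc_eq (K := K) (n := n) hi hk
  have hj1 : 1 ≤ i + 1 := ω
  have hsub : Set.Iic i ⊆ ({i + 1}ᶜ : Set ℕ) := by intro a ha; simp at ha ⊢; omega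
  have hw' := low_mono hsub le_rfl hw
  have hXw : ∀ s, X (i + 1) ^ s * w ∈ (low {i + 1}ᶜ (i + 1) (s + (n - i)) :
      PSub K n k) := by
    intro s
    refine map_mem_of_mem_low (LinearMap.mulLeft K _) (fun v hv t ht => ?_) hw'
    obtain ⟨v', hv', e⟩ := X_mul_poly hj1 hi (by simp) hv s
    rw [LinearMap.mulLeft_apply, ← mul_assoc, e, mul_assoc, ← pow_add]
    exact mem_low hv' ω
  have hmul : ∀ (u : OPolA K n k) s, u * X (i + 1) ^ s * cyc i
      = (-1) ^ ε * u * X (i + 1) ^ (s + (n - i)) + u * (X (i + 1) ^ s * w) := by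
    intro u s
    rw [hcyc, mul_add, mul_assoc u _ w, ← mul_assoc (u * X (i + 1) ^ s),
      ((Commute.neg_one_right (u * X (i + 1) ^ s)).pow_right ε).eq, pow_add]
    simp only [mul_assoc]
  have hlow : ∀ N, ∀ g ∈ (low {i + 1}ᶜ (i + 1) N : PSub K n k),
      g * cyc i ∈ (low {i + 1}ᶜ (i + 1) (N + (n - i)) : PSub K n k) := by
    refine fun N g => map_mem_of_mem_low (LinearMap.mulRight K _) fun u hu s hs => ?_
    rw [LinearMap.mulRight_apply, hmul]
    refine add_mem ?_ (mul_mem_low hu (low_mono le_rfl ω (hXw s)))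
    exact mem_low (mul_mem (pow_mem (neg_mem (one_mem _)) _) hu) ω
  have hsucc : ∀ N, ∀ g ∈ (low {i + 1}ᶜ (i + 1) (N + 1) : PSub K n k),
      ∃ u ∈ (poly {i + 1}ᶜ : Subalgebra K (OPolA K n k)),
      ∃ g' ∈ (low {i + 1}ᶜ (i + 1) N : PSub K n k), g = u * X (i + 1) ^ N + g' := by
    intro N g hg
    induction hg using span_induction with
    | mem y hy =>
      obtain ⟨u, hu, s, hs, rfl⟩ := hy
      rcases Nat.lt_succ_iff_lt_or_eq.1 hs with h | rfl
      · exact ⟨0, zero_mem _, _, mem_low hu h, by rw [zero_mul, zero_add]⟩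
      · exact ⟨u, hu, 0, zero_mem _, by rw [add_zero]⟩
    | zero => exact ⟨0, zero_mem _, 0, zero_mem _, by simp⟩
    | add a b _ _ h1 h2 =>
      obtain ⟨u, hu, g, hg, rfl⟩ := h1
      obtain ⟨u', hu', g', hg', rfl⟩ := h2
      exact ⟨u + u', add_mem hu hu', g + g', add_mem hg hg', by rw [add_mul]; abel⟩
    | smul r a _ h =>
      obtain ⟨u, hu, g, hg, rfl⟩ := h
      exact ⟨r • u, Subalgebra.smul_mem _ hu r, r • g, smul_mem _ r hg, by
        rw [smul_add, smul_mul_assoc]⟩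
  have key : ∀ N, ∀ g ∈ (low {i + 1}ᶜ (i + 1) N : PSub K n k),
      ∀ c ∈ cycIdeal i, b = g * cyc i + c → b ∈ cycIdeal i := by
    intro N
    induction N with
    | zero =>
      intro g hg c hc e
      have : g = 0 := by
        have h0 : (low {i + 1}ᶜ (i + 1) 0 : PSub K n k) = ⊥ := by
          rw [low, Submodule.span_eq_bot]
          rintro y ⟨u, _, s, hs, _⟩
          omega
        rwa [h0, mem_bot] at hg
      rw [e, this, zero_mul, zero_add]; exact hc
    | succ N ih =>
      intro g hg c hc e
      obtain ⟨u, hu, g', hg', rfl⟩ := hsucc N g hg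
      have e1 := congrArg (fun y => (expand (i + 1) y).coeff (N + (n - i))) e
      simp only [expand_add, Polynomial.coeff_add, add_mul, hmul] at e1
      rw [expand_poly (poly_mono hsub hb), Polynomial.coeff_C, if_neg ω,
        coeff_expand_of_mem_low hj1 hi (hlow N g' hg') le_rfl,
        coeff_expand_of_mem_low hj1 hi (mul_mem_low hu (hXw N)) le_rfl,
        expand_mul_pow hj1 hi, expand_poly (mul_mem (pow_mem (neg_mem (one_mem _)) _) hu),
        Polynomial.coeff_C_mul, Polynomial.coeff_X_pow, if_pos rfl, mul_one, add_zero, add_zero] at e1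
      have h2 := coeff_expand_mem_cycIdeal (s := N + (n - i)) (show i < i + 1 by omega) hi hc
      have h3 : (-1) ^ ε * u ∈ (cycIdeal i : Ideal (OPolA K n k)) := by
        rw [eq_neg_of_add_eq_zero_left e1.symm]; exact neg_mem h2
      have h4 : u ∈ (cycIdeal i : Ideal (OPolA K n k)) := (PM.unit_mul ε u).symm.mem h3
      refine ih g' hg' (u * X (i + 1) ^ N * cyc i + c) (add_mem (mul_cyc_mem le_rfl hi
        (mul_pow_mem_cycIdeal ω hi h4)) hc) ?_
      rw [e]; noncomm_ring
  have hex : ∃ g, b - g * cyc i ∈ cycIdeal i := by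
    refine cycIdeal_induction (p := fun b => ∃ g, b - g * cyc i ∈ cycIdeal i) ?_ ?_ ?_ hb'
    · exact ⟨0, by simp⟩
    · rintro a b ⟨g, hg⟩ ⟨g', hg'⟩
      exact ⟨g + g', by rw [add_mul, add_sub_add_comm]; exact add_mem hg hg'⟩
    · intro g l hl
      rcases Nat.lt_succ_iff_lt_or_eq.1 hl with h | rfl
      · exact ⟨0, by rw [zero_mul, sub_zero]; exact Ideal.mul_mem_left _ _ (cyc_mem_cycIdeal h)⟩
      · exact ⟨g, by simp⟩
  obtain ⟨g, hg⟩ := hex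
  obtain ⟨N, hN⟩ := exists_mem_low hj1 hi g
  exact key N g hN _ hg (by abel)

lemma eq_zero_of_mem_cycIdeal (hi : i ≤ k) (hk : k ≤ n) {b : OPolA K n k}
    (hb : b ∈ poly (Set.Iic 0)) (hb' : b ∈ cycIdeal i) : b = 0 := by
  induction i with
  | zero =>
    have : (cycIdeal 0 : Ideal (OPolA K n k)) = ⊥ := by
      rw [cycIdeal, Ideal.span_eq_bot]
      rintro y ⟨l, hl, _⟩
      omega
    rwa [this, Ideal.mem_bot] at hb'
  | succ i ih =>
    exact ih ω (mem_cycIdeal_of_succ ω hk (poly_mono (by simp) hb) hb')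

/-! ### A faithful action of the coefficients -/

/-- The operators which preserve `cycIdeal k`. -/
def stab (K : Type u) [CommRing K] (n k : ℕ) :
    Subalgebra K (EndP K n k) where
  carrier := {f | ∀ v ∈ (cycIdeal k : Ideal (OPolA K n k)), f v ∈ cycIdeal k}
  mul_mem' hf hg v hv := hf _ (hg _ hv)
  add_mem' hf hg v hv := add_mem (hf _ hv) (hg _ hv)
  algebraMap_mem' r v hv := by
    rw [Module.algebraMap_end_apply, Algebra.smul_def]
    exact Ideal.mul_mem_left _ _ hv

/-- `cycIdeal k` as a space. -/
def cycSpace (K : Type u) [CommRing K] (n k : ℕ) : PSub K n k :=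
  (cycIdeal k : Ideal (OPolA K n k)).restrictScalars K

/-- The action on the quotient by `cycIdeal k`. -/
def stabHom (K : Type u) [CommRing K] (n k : ℕ) :
    stab K n k →ₐ[K] Module.End K (OPolA K n k ⧸ cycSpace K n k) := AlgHom.ofLinearMap
    { toFun := fun f => (cycSpace K n k).mapQ (cycSpace K n k) f.1 fun v hv => f.2 v hv
      map_add' := fun f g => by ext; rfl
      map_smul' := fun r f => by ext; rfl }
    (by ext; rfl) (fun f g => by ext; rfl)

lemma stabHom_mk (f : stab K n k) (v : OPolA K n k) :
    stabHom K n k f (Submodule.Quotient.mk v) = Submodule.Quotient.mk (f.1 v) := rfl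

/-- `x_i` as an element of `stab`. -/
def stabMul (f : OPolA K n k) : stab K n k := ⟨lm f, fun _ hv => Ideal.mul_mem_left _ _ hv⟩

open Classical in
/-- `∂_i` as an element of `stab`. -/
def stabDv (i : ℕ) : stab K n k :=
  if h : 1 ≤ i ∧ i < k then ⟨dv i, fun _ hv => dv_mem_cycIdeal h.1 h.2 le_rfl hv⟩ else 0

lemma stabDv_val (i : ℕ) : (stabDv i : stab K n k).1 = dv i := by
  unfold stabDv
  split_ifs with h
  · rfl
  · rw [dv, dif_neg h]; rfl

end OPolA

lemma Sys.of_injective {E F : Type*} [Ring E] [Ring F] {x τ χ : ℕ → E} {d : E}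
    (f : E →+* F) (hf : Function.Injective f)
    (H : Sys n k (fun i => f (x i)) (fun i => f (τ i)) (fun i => f (χ i)) (f d)) :
    Sys n k x τ χ d where
  chi_zero := hf (by simpa using H.chi_zero)
  tau_sq i h1 h2 := hf (by simpa using H.tau_sq i h1 h2)
  braid i h1 h2 := hf (by simpa using H.braid i h1 h2)
  x_tau i h1 h2 := hf (by simpa using H.x_tau i h1 h2)
  tau_x i h1 h2 := hf (by simpa using H.tau_x i h1 h2)
  x_x i j h1 h2 h3 h4 h := hf (by simpa using H.x_x i j h1 h2 h3 h4 h)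
  tau_tau i j h1 h2 h3 h4 h := hf (by simpa using H.tau_tau i j h1 h2 h3 h4 h)
  x_tau_far i j h1 h2 h3 h4 h h' := hf (by simpa using H.x_tau_far i j h1 h2 h3 h4 h h')
  d_sq := hf (by simpa using H.d_sq)
  d_chi_top h := hf (by simpa using H.d_chi_top h)
  chi_chi i j h1 h2 h3 h4 := hf (by simpa using H.chi_chi i j h1 h2 h3 h4)
  chi_d i h1 h2 := hf (by simpa using H.chi_d i h1 h2)
  x_chi i j h1 h2 h3 h4 := hf (by simpa using H.x_chi i j h1 h2 h3 h4)
  tau_chi i j h1 h2 h3 h4 := hf (by simpa using H.tau_chi i j h1 h2 h3 h4)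
  x_d i h1 h2 := hf (by simpa using H.x_d i h1 h2)
  tau_d i h1 h2 := hf (by simpa using H.tau_d i h1 h2)

lemma map_aOf {E F : Type*} [Ring E] [Ring F] (f : E →+* F) (n : ℕ) (χ : ℕ → E) (d y : E) :
    f (aOf n χ d y) = aOf n (fun i => f (χ i)) (f d) (f y) := by
  have hc : ∀ r, f (cOf χ d r) = cOf (fun i => f (χ i)) (f d) r := fun r => by
    unfold cOf; split_ifs <;> simp
  simp [aOf, map_sum, hc]

namespace OPolA

lemma stab_sys : Sys n k (fun i => stabMul (X i : OPolA K n k)) stabDv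
    (fun i => stabMul (chi K n k i)) (stabMul D) := by
  refine Sys.of_injective (stab K n k).val.toRingHom Subtype.val_injective ?_
  have : (fun i => (stab K n k).val.toRingHom (stabDv i)) = dv := funext stabDv_val
  rw [this]
  exact sys

/-- The action of `ONH_k^n` on the quotient by `cycIdeal k`. -/
def act (K : Type u) [CommRing K] (n k : ℕ) :
    ONH K n k →ₐ[K] Module.End K (OPolA K n k ⧸ cycSpace K n k) :=
  ONH.lift (stab_sys.map (stabHom K n k).toRingHom) fun hk => by
    have h := map_aOf (stabHom K n k).toRingHom n (fun i => stabMul (chi K n k i)) (stabMul D)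
      (stabMul (X 1))
    rw [← h]
    have h1 : aOf n (fun i => stabMul (chi K n k i)) (stabMul D) (stabMul (X 1))
        = stabMul (aOf n (chi K n k) D (X 1)) := by
      have hm : Function.Injective (stab K n k).val.toRingHom := Subtype.val_injective
      refine hm ((map_aOf (stab K n k).val.toRingHom n (fun i => stabMul (chi K n k i))
        (stabMul D) (stabMul (X 1))).trans ?_)
      exact (map_aOf (Algebra.lmul K (OPolA K n k)).toRingHom n (chi K n k) D (X 1)).symm
    rw [h1]
    ext v
    obtain ⟨⟨g', hg'⟩, -⟩ := exists_aOf_mul hk v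
    change Submodule.Quotient.mk (aOf n (chi K n k) D (X 1) * v) = 0
    rw [hg', Submodule.Quotient.mk_eq_zero, ← cyc_zero]
    exact (Ideal.mul_mem_left _ _ (cyc_mem_cycIdeal hk) : _ ∈ (cycIdeal k : Ideal (OPolA K n k)))

/-- The inclusion of the coefficients. -/
def ofCoef (K : Type u) [CommRing K] (n k : ℕ) : Coef K n →ₐ[K] OPolA K n k :=
  Coef.lift (X := fun _ => 0) (T := fun _ => 0) (χ := chi K n k) (D := D)
    { chi_zero := chi_zero
      tau_sq := fun i h1 h2 => ω
      braid := fun i h1 h2 => ω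
      x_tau := fun i h1 h2 => ω
      tau_x := fun i h1 h2 => ω
      x_x := fun i j h1 h2 => ω
      tau_tau := fun i j h1 h2 => ω
      x_tau_far := fun i j h1 h2 => ω
      d_sq := psys.d_sq
      d_chi_top := psys.d_chi_top
      chi_chi := psys.chi_chi
      chi_d := psys.chi_d
      x_chi := fun i j h1 h2 => ω
      tau_chi := fun i j h1 h2 => ω
      x_d := fun i h1 h2 => ω
      tau_d := fun i h1 h2 => ω }

/-- Setting all variables to zero. -/
def toCoef (K : Type u) [CommRing K] (n k : ℕ) : OPolA K n k →ₐ[K] Coef K n :=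
  lift (x := fun _ => 0) (χ := Coef.chi) (d := Coef.d)
    { chi_zero := Coef.chi_zero
      x_x := by simp
      d_sq := Coef.sys.d_sq
      d_chi_top := Coef.sys.d_chi_top
      chi_chi := Coef.sys.chi_chi
      chi_d := Coef.sys.chi_d
      x_chi := by simp
      x_d := by simp }

lemma toCoef_ofCoef (z : Coef K n) : toCoef K n k (ofCoef K n k z) = z := by
  induction z using Coef.induction with
  | hc r => simp
  | hχ i h1 h2 => rw [ofCoef, Coef.lift_chi _ h2, toCoef, lift_chi _ h2]
  | hd => rw [ofCoef, Coef.lift_d, toCoef, lift_D]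
  | ha a b h1 h2 => simp [h1, h2]
  | hm a b h1 h2 => simp [h1, h2]

lemma ofCoef_mem_poly (z : Coef K n) (S : Set ℕ) : ofCoef K n k z ∈ poly S := by
  induction z using Coef.induction with
  | hc r => rw [AlgHom.commutes]; exact Subalgebra.algebraMap_mem _ _
  | hχ i h1 h2 => rw [ofCoef, Coef.lift_chi _ h2]; exact chi_mem_poly _
  | hd => rw [ofCoef, Coef.lift_d]; exact D_mem_poly
  | ha a b h1 h2 => rw [map_add]; exact add_mem h1 h2
  | hm a b h1 h2 => rw [map_mul]; exact mul_mem h1 h2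

lemma act_cf (z : Coef K n) (v : OPolA K n k) :
    act K n k (ONH.cf k z) (Submodule.Quotient.mk v)
      = Submodule.Quotient.mk (ofCoef K n k z * v) := by
  induction z using Coef.induction generalizing v with
  | hc r =>
    rw [AlgHom.commutes, AlgHom.commutes, AlgHom.commutes, ← Algebra.smul_def]; rfl
  | hχ i h1 h2 =>
    rw [ONH.cf_chi, act, ONH.lift_chi _ _ h2, ofCoef, Coef.lift_chi _ h2]; rfl
  | hd => rw [ONH.cf_d, act, ONH.lift_d, ofCoef, Coef.lift_d]; rfl
  | ha a b h1 h2 =>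
    rw [map_add, map_add, map_add, LinearMap.add_apply, h1, h2, add_mul, Submodule.Quotient.mk_add]
  | hm a b h1 h2 =>
    rw [map_mul, map_mul, map_mul, Module.End.mul_apply, h2, h1, mul_assoc]

lemma act_tl (l N : ℕ) (v : OPolA K n k) :
    act K n k (tl ONH.tau l N) (Submodule.Quotient.mk v)
      = Submodule.Quotient.mk (tl dv l N v) := by
  have h1 : (fun i => act K n k (ONH.tau i)) = fun i => stabHom K n k (stabDv i) := by
    funext i
    by_cases h : 1 ≤ i ∧ i < k
    · rw [act, ONH.lift_tau _ _ h.1 h.2]; rfl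
    · rw [ONH.tau, ftau, dif_neg ω, stabDv, dif_neg h]; simp
  have h2 := map_tl (stabDv : ℕ → stab K n k) l N (stab K n k).val.toMonoidHom
  have h3 : (fun i => (stab K n k).val.toMonoidHom (stabDv i)) = dv := funext stabDv_val
  rw [h3] at h2
  have h4 := map_tl (ONH.tau : ℕ → ONH K n k) l N (act K n k).toMonoidHom
  have h5 := map_tl (stabDv : ℕ → stab K n k) l N (stabHom K n k).toMonoidHom
  have h6 : act K n k (tl ONH.tau l N) = stabHom K n k (tl stabDv l N) :=
    h4.trans ((congrArg (fun f => tl f l N) h1).trans h5.symm)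
  rw [h6, stabHom_mk, ← h2]; rfl

lemma exists_tl_eq_one : ∃ f : OPolA K n k, PM (tl dv 1 (k - 1) f) 1 := by
  have H := sys (K := K) (n := n) (k := k)
  let g : EndP K n k := (ofCoef K n k).toLinearMap ∘ₗ (toCoef K n k).toLinearMap
  have h1 := H.tl_xup_mul (l := 1) (M := k) le_rfl ω (g := g) (by
      intro i h1 h2
      ext f
      exact dv_of_mem_poly h1 ω (S := ∅) (by simp) (by simp) (ofCoef_mem_poly _ _))
  have hg1 : g 1 = 1 := by simp [g]
  have h3 : ∀ y : EndP K n k, (y * g) 1 = y 1 := fun y => by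
    rw [Module.End.mul_apply, hg1]
  refine ⟨xup (fun i => lm (X i : OPolA K n k)) 1 k 1, ?_⟩
  have h4 := h3 (tl dv 1 (k - 1) * xup (fun i => lm (X i : OPolA K n k)) 1 k)
  rcases h1 with h1 | h1
  · left; rw [h1, hg1] at h4; exact h4.symm
  · right; rw [h1, LinearMap.neg_apply, hg1] at h4; exact h4.symm

end OPolA

namespace ONH

lemma cf_mul_tl_eq_zero (hk : k ≤ n) {z : Coef K n}
    (h : cf k z * tω k = (0 : ONH K n k)) : z = 0 := by
  obtain ⟨f, h2⟩ := OPolA.exists_tl_eq_one (K := K) (n := n) (k := k)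
  have h3 := congrArg (fun y => OPolA.act K n k y (Submodule.Quotient.mk f)) h
  simp only [map_mul, Module.End.mul_apply, OPolA.act_tl, OPolA.act_cf, map_zero,
    LinearMap.zero_apply] at h3
  rw [Submodule.Quotient.mk_eq_zero] at h3
  have h4 : OPolA.ofCoef K n k z ∈ OPolA.cycSpace K n k := by
    refine PM.mem (PM.symm ?_) h3
    simpa using h2.mul_left (OPolA.ofCoef K n k z)
  have h5 := OPolA.eq_zero_of_mem_cycIdeal le_rfl hk (OPolA.ofCoef_mem_poly z _) h4
  rw [← OPolA.toCoef_ofCoef (k := k) z, h5, map_zero]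

end ONH

/-! ## Rank -/

lemma linearIndependent_of_span_eq_top {R V ι ι' : Type*} [CommRing R] [AddCommGroup V] [Module R V]
    [Fintype ι] [Fintype ι'] (hc : Fintype.card ι ≤ Fintype.card ι') {v : ι' → V}
    (hv : LinearIndependent R v) (hv' : span R (Set.range v) = ⊤) {u : ι → V}
    (hu : span R (Set.range u) = ⊤) : LinearIndependent R u := by
  let b := Module.Basis.mk hv hv'.ge
  obtain ⟨f⟩ := Function.Embedding.nonempty_of_card_le hc
  have h1 : Function.Surjective (Fintype.linearCombination R u) := by
    rw [← LinearMap.range_eq_top, Fintype.range_linearCombination, hu]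
  have h2 : Function.Injective (b.equivFun.toLinearMap ∘ₗ Fintype.linearCombination R u) :=
    OrzechProperty.injective_of_surjective_of_injective
      (Function.ExtendByZero.linearMap R f) _ (fun g g' h => funext fun i => by
        have h' : Function.extend f g 0 (f i) = Function.extend f g' 0 (f i) := congrFun h (f i)
        rwa [f.injective.extend_apply, f.injective.extend_apply] at h')
      (b.equivFun.surjective.comp h1)
  rw [Fintype.linearIndependent_iff]
  intro g hg
  have h3 : g = 0 := h2 (by
    simp only [LinearMap.comp_apply, Fintype.linearCombination_apply, hg, map_zero])
  exact fun i => congrFun h3 i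

section

variable {E : Type*} [Ring E] {x τ χ : ℕ → E} {d : E}

lemma xdown_succ (x : ℕ → E) (l M : ℕ) : xdown x l (M + 1) = xdown x (l + 1) M * x l ^ M := by
  simp only [xdown, List.range_succ, List.map_append, List.prod_append, List.map_cons,
    List.map_nil, List.prod_cons, List.prod_nil, mul_one]
  congr 2
  · refine List.map_congr_left fun s hs => ?_
    rw [List.mem_range] at hs
    congr 2; omega
  · congr 1; omega

lemma Sys.mw_xdown {M : ℕ} (H : Sys n k x τ χ d) (hl : 1 ≤ l) (hM : l + M ≤ k + 1)
    (hα : ∀ i, l ≤ i → i < l + M → α i + i + 1 = l + M) :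
    PM (wd x (mw α l M)) (xdown x l M) := by
  induction M generalizing l with
  | zero => simp [mw, xdown, PM]
  | succ M ih =>
    rw [xdown_succ, mw, wd_append, wd_replicate]
    have h1 := hα l le_rfl ω
    rw [show α l = M by omega]
    refine PM.trans ?_ ((ih (l := l + 1) ω ω
      (fun i h2 h3 => by have := hα i ω ω; omega)).mul_right _)
    refine PM.symm (PM.mul_pow ?_)
    refine (H.pm_x_wd_x ω fun i hi => ?_).symm
    have := mem_mw hi
    omega

lemma Sys.wd_normal_desc (H : Sys n k x τ χ d) (hk : 1 ≤ k) (w : List ℕ)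
    (hw : ∀ i ∈ w, 1 ≤ i ∧ i < k) : wd τ w = 0 ∨ ∃ w' M, (∀ i ∈ w', 1 ≤ i ∧ i + 1 < k) ∧ M < k ∧
      PM (wd τ w) (wd τ w' * desc τ (k - M) M) := by
  have h1 := H.flip.nilCox.wd_normal (l := 1) (N := k - 1) le_rfl ω (w.map (k - ·)) (by
    intro i hi
    rw [List.mem_map] at hi
    obtain ⟨j, hj, rfl⟩ := hi
    have := hw j hj; omega)
  have h2 : ∀ w : List ℕ, (∀ i ∈ w, 1 ≤ i ∧ i < k) →
      wd (fun i => sq (τ (k - i))) (w.map (k - ·)) = sq (wd τ w) := by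
    intro w hw
    rw [map_wd, wd, wd, List.map_map]
    congr 1
    refine List.map_congr_left fun i hi => ?_
    have := hw i hi
    simp only [Function.comp]
    congr 2; omega
  have h3 : ∀ M, M < k → asc (fun i => sq (τ (k - i))) 1 M = sq (desc τ (k - M) M) := by
    intro M hM
    rw [map_desc]
    induction M with
    | zero => simp
    | succ M ih =>
      rw [asc_succ, ih ω, desc_succ', show k - (M + 1) + 1 = k - M by omega]
      congr 2; congr 1; omega
  rw [h2 w hw] at h1
  rcases h1 with h1 | ⟨w', M, hw', hM, e, -⟩
  · left; rw [sq_eq, PM.zero_iff] at h1; exact h1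
  · right
    refine ⟨w'.map (k - ·), M, ?_, ω, ?_⟩
    · intro i hi
      rw [List.mem_map] at hi
      obtain ⟨j, hj, rfl⟩ := hi
      have := hw' j hj; omega
    · rw [← sq_eq, e, map_mul, h3 M ω, ← h2 (w'.map (k - ·)), List.map_map]
      · congr 2
        conv_lhs => rw [← List.map_id w']
        refine List.map_congr_left fun i hi => ?_
        have := hw' i hi
        simp only [Function.comp, id]; omega
      · intro i hi
        rw [List.mem_map] at hi
        obtain ⟨j, hj, rfl⟩ := hi
        have := hw' j hj; omega

end

namespace ONH

lemma twist_tl (hl : 1 ≤ l) (hN : N = 0 ∨ l + N ≤ m) : Twist (tl tau l N : ONH K n m) := by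
  refine Twist.list fun t ht => ?_
  rw [List.mem_range] at ht
  rw [asc_eq_wd]
  refine twist_wd_tau fun i hi => ?_
  rw [List.mem_range'_1] at hi
  omega

lemma cf_wd_x (hv : ∀ i ∈ v, 1 ≤ i ∧ i ≤ m) (a : Coef K n) :
    wd x v * cf m a = (cf m (Coef.parity^[v.length] a) * wd x v : ONH K n m) := by
  induction v generalizing a with
  | nil => simp
  | cons i v ih =>
    have hi := hv i (by simp)
    rw [wd_cons, mul_assoc, ih (fun j hj => hv j (by simp [hj])), ← mul_assoc, x_cf hi.1 hi.2,
      mul_assoc, List.length_cons, Function.iterate_succ_apply']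

lemma parity_iterate (N : ℕ) (a : Coef K n) : Coef.parity^[N] (Coef.parity^[N] a) = a := by
  rw [← Function.iterate_add_apply, ← two_mul, Function.iterate_mul]
  have : (Coef.parity : Coef K n → Coef K n)^[2] = id := by
    funext a; simp [Coef.parity_parity]
  rw [this]; simp

lemma parity_iterate_zero (N : ℕ) : (Coef.parity : Coef K n → Coef K n)^[N] 0 = 0 :=
  Function.iterate_fixed (map_zero _) N

lemma tl_mul_mul_tl (h : ONH K n n) :
    ∃ a : Coef K n, tω n * h * tω n = cf n a * tω n := by
  rcases Nat.eq_zero_or_pos n with rfl | hn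
  · refine ⟨(h : ONH K 0 0), ?_⟩
    simp only [Nat.zero_sub, tl_zero, one_mul, mul_one]
    exact (incl_refl h).symm
  have H := sysOf K n n
  have htw : Twist (tω n : ONH K n n) := twist_tl le_rfl ω
  let P : CSub K n n :=
    { carrier := {h | ∃ a : Coef K n, tω n * h * tω n
        = cf n a * tω n}
      add_mem' := by
        rintro h h' ⟨a, ha⟩ ⟨b, hb⟩
        exact ⟨a + b, by rw [mul_add, add_mul, ha, hb, map_add, add_mul]⟩
      zero_mem' := ⟨0, by simp⟩
      smul_mem' := by
        rintro r h ⟨a, ha⟩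
        obtain ⟨r', hr⟩ := htw r
        exact ⟨r' * a, by rw [smul_def, ← mul_assoc, hr, mul_assoc, mul_assoc, ← mul_assoc (tl _ _ _),
          ha, ← mul_assoc, map_mul]⟩ }
  have hP : P = ⊤ := by
    refine eq_top_of_mon (a := 0) (b := 0) le_rfl ω ω ?_ ?_ ?_
    · intro i h1 h2 h
      exact ⟨0, by rw [← mul_assoc, H.tl_tau le_rfl ω ω ω]; simp⟩
    · intro i h1 h2 h
      exact ⟨0, by rw [mul_assoc, mul_assoc, H.tau_tl le_rfl ω ω ω]; simp⟩
    · intro z hz _ α hα hdec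
      simp only [wordList, List.mem_singleton] at hz
      subst hz
      have h1 : ∀ j, j < n → j ≤ α (n - j) := by
        intro j
        induction j with
        | zero => simp
        | succ j ih =>
          intro hj
          have := ih ω
          have h2 := hdec (n - (j + 1)) (by simp; omega) ω
          rw [show n - (j + 1) + 1 = n - j by omega] at h2
          omega
      have h2 : PM (mon α : ONH K n n) (xdown x 1 n) := by
        refine H.mw_xdown le_rfl ω fun i h3 h4 => ?_
        have h5 := h1 (n - i) ω
        rw [show n - (n - i) = i by omega] at h5
        have := hα i h3 ω
        omega
      have h3 := ((h2.mul_left tω n).mul_right tω n).trans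
        (H.tl_xdown_tl le_rfl ω)
      simp only [wd_nil, mul_one]
      rcases h3 with h3 | h3
      · exact ⟨1, by simp [h3]⟩
      · exact ⟨-1, by simp [h3]⟩
  have : h ∈ P := by rw [hP]; trivial
  exact this

lemma exists_basis_top (K : Type u) [CommRing K] (n : ℕ) :
    ∃ (ι : Type) (_ : Fintype ι) (u : ι → ONH K n n), Fintype.card ι = n.factorial * n.factorial ∧
      LinearIndependent (Coef K n) u ∧ span (Coef K n) (Set.range u) = ⊤ := by
  rcases Nat.eq_zero_or_pos n with rfl | hn
  · refine ⟨Unit, inferInstance, fun _ => 1, by simp, ?_, ?_⟩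
    · rw [Fintype.linearIndependent_iff]
      intro g hg i
      simp only [Finset.univ_unique, Finset.sum_singleton, smul_def, mul_one, cf] at hg
      exact (incl_refl (g () : ONH K 0 0)).symm.trans hg
    · rw [eq_top_iff]
      intro h _
      let a : Coef K 0 := h
      have h1 : h = a • (1 : ONH K 0 0) := by
        rw [smul_def, mul_one]; exact (incl_refl h).symm
      rw [h1]
      exact smul_mem _ _ (subset_span ⟨(), rfl⟩)
  have H := sysOf K n n
  have htw : Twist (tω n : ONH K n n) := twist_tl le_rfl ω
  obtain ⟨ι, _, κ, hc, hκ, hs, hi⟩ := H.exists_full_family (l := 1) (N := n - 1) le_rfl ω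
  obtain ⟨ι', _, κ', hc', hκ', hs', hi'⟩ :=
    H.exists_full_family_right (l := 1) (N := n - 1) le_rfl ω
  rw [show n - 1 + 1 = n by omega] at hc hc'
  refine ⟨ι × ι', inferInstance, fun p => κ p.1 * (tω n * κ' p.2),
    by rw [Fintype.card_prod, hc, hc'], ?_, ?_⟩
  · rw [Fintype.linearIndependent_iff]
    intro g hg
    choose v hv hκv using hκ
    have hv' : ∀ i, ∀ j ∈ v i, 1 ≤ j ∧ j ≤ n := fun i j hj => by have := hv i j hj; omega
    have h1 : ∑ i, κ i * ∑ j, cf n (Coef.parity^[(v i).length] (g (i, j)))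
        * (tω n * κ' j) = 0 := by
      rw [← hg, Fintype.sum_prod_type]
      refine sum_congr rfl fun i _ => ?_
      rw [mul_sum]
      refine sum_congr rfl fun j _ => ?_
      rw [← mul_assoc, hκv, cf_wd_x (hv' i), parity_iterate, smul_def, mul_assoc]
    have h2 := hi _ (fun i j h3 h4 => by
      rw [mul_sum]
      refine sum_eq_zero fun l _ => ?_
      rw [← mul_assoc, tau_cf h3 ω, mul_assoc, ← mul_assoc (tau j), H.tau_tl le_rfl ω h3 ω]
      simp) h1
    rintro ⟨i, j⟩
    have h3 := hi' (fun j => cf n (Coef.parity^[(v i).length] (g (i, j))) * tω n)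
      (fun j l h4 h5 => by
        rw [mul_assoc, H.tl_tau le_rfl ω h4 ω, mul_zero])
      (by simpa only [mul_assoc] using h2 i) j
    have h4 := cf_mul_tl_eq_zero le_rfl h3
    rw [← parity_iterate (v i).length (g (i, j)), h4, parity_iterate_zero]
  · rw [eq_top_iff]
    intro h _
    obtain ⟨r, hr⟩ := hs h
    rw [hr]
    refine sum_mem fun i _ => ?_
    obtain ⟨r', hr'⟩ := hs' (r i)
    rw [hr', mul_sum, mul_sum]
    refine sum_mem fun j _ => ?_
    obtain ⟨a, ha⟩ := tl_mul_mul_tl (r' j)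
    obtain ⟨v, hv, e⟩ := hκ i
    rw [← mul_assoc (tl _ _ _), ← mul_assoc (tl _ _ _), ha, ← mul_assoc, ← mul_assoc, e,
      cf_wd_x (fun j hj => by have := hv j hj; omega), mul_assoc, mul_assoc, ← smul_def, ← e]
    exact smul_mem _ _ (subset_span ⟨(i, j), rfl⟩)

lemma span_incl_mul (hm : m + 1 ≤ n) {X : Set (ONH K n m)}
    (hX : span (Coef K n) X = ⊤) :
    span (Coef K n) {y : ONH K n (m + 1) | ∃ u ∈ X, ∃ i < n - m, ∃ s < m + 1,
      y = incl (Nat.le_succ m) u * (x (m + 1) ^ i * desc tau (m + 1 - s) s)} = ⊤ := by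
  have H := sysOf K n (m + 1)
  rw [eq_top_iff, ← bdW_top hm, bdW, span_le]
  rintro _ ⟨α, w, hα, hw, rfl⟩
  rcases H.wd_normal_desc ω w hw with h0 | ⟨w', s, hw', hs, e⟩
  · rw [h0, mul_zero]; exact zero_mem _
  have hw'' : ∀ i ∈ w', 1 ≤ i ∧ i < m := fun i hi => by have := hw' i hi; omega
  have h1 : PM (wd x (mw α 1 (m + 1)) * wd tau w : ONH K n (m + 1))
      (incl (Nat.le_succ m) (wd x (mw α 1 m) * wd tau w') *
        (x (m + 1) ^ α (m + 1) * desc tau (m + 1 - s) s)) := by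
    have h2 : PM (x (m + 1) ^ α (m + 1) * wd tau w' : ONH K n (m + 1))
        (wd tau w' * x (m + 1) ^ α (m + 1)) := by
      refine (PM.mul_pow (PM.symm (PM.mul_wd fun i hi => ?_))).symm
      have := hw'' i hi
      exact PM.of_add (H.x_tau_far _ _ ω le_rfl this.1 ω ω ω)
    have h3 : wd x (mw α 1 (m + 1)) = (wd x (mw α 1 m) * x (m + 1) ^ α (m + 1) : ONH K n (m + 1)) := by
      rw [mw_add, wd_append, add_comm 1 m]; simp [mw]
    rw [map_mul, incl_wd_x _ (fun i hi => by have := mem_mw hi; omega), incl_wd_tau _ hw'', h3]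
    have h4 := (e.mul_left (wd x (mw α 1 m) * x (m + 1) ^ α (m + 1)))
    have h5 := (h2.mul_left (wd x (mw α 1 m))).mul_right (desc tau (m + 1 - s) s)
    simp only [mul_assoc] at h4 h5 ⊢
    exact h4.trans h5
  refine PM.mem h1 ?_
  refine mem_mul (g := x (m + 1) ^ α (m + 1) * desc tau (m + 1 - s) s)
    (X := incl (Nat.le_succ m) '' X) ?_ ?_
  · rintro _ ⟨u, hu, rfl⟩
    exact subset_span ⟨u, hu, α (m + 1), by have := hα (m + 1) ω le_rfl; omega, s, hs, rfl⟩
  · have h6 : (wd x (mw α 1 m) * wd tau w' : ONH K n m) ∈ span (Coef K n) X := by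
      rw [hX]; trivial
    generalize (wd x (mw α 1 m) * wd tau w' : ONH K n m) = z at h6
    induction h6 using span_induction with
    | mem y hy => exact subset_span ⟨y, hy, rfl⟩
    | zero => rw [map_zero]; exact zero_mem _
    | add a b _ _ h1 h2 => rw [map_add]; exact add_mem h1 h2
    | smul a b _ h => rw [incl_smul]; exact smul_mem _ _ h

/-- `incl`, as a map of modules over the coefficients. -/
def inclₗ {m' : ℕ} (h : m ≤ m') : ONH K n m →ₗ[Coef K n] ONH K n m' where
  toFun := incl h
  map_add' := map_add _
  map_smul' a g := incl_smul h a g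

lemma linearIndependent_of_card (hm : m ≤ n) {ι : Type} [Fintype ι] {u : ι → ONH K n m}
    (hc : Fintype.card ι ≤ m.factorial * n.descFactorial m)
    (hu : span (Coef K n) (Set.range u) = ⊤) : LinearIndependent (Coef K n) u := by
  suffices key : ∀ j m, m + j = n → ∀ (ι : Type) [Fintype ι] (u : ι → ONH K n m),
      Fintype.card ι ≤ m.factorial * n.descFactorial m →
      span (Coef K n) (Set.range u) = ⊤ → LinearIndependent (Coef K n) u from
    key (n - m) m ω ι u hc hu
  clear hc hu u hm
  intro j
  induction j with
  | zero =>
    intro m hm ι _ u hc hu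
    obtain rfl : m = n := ω
    obtain ⟨ι', _, v, hc', hv, hv'⟩ := exists_basis_top K m
    exact linearIndependent_of_span_eq_top (by rw [hc']; simpa [Nat.descFactorial_self] using hc) hv hv' hu
  | succ j ih =>
    intro m hm ι _ u hc hu
    let v : ι × Fin (n - m) × Fin (m + 1) → ONH K n (m + 1) := fun p =>
      incl (Nat.le_succ m) (u p.1) *
        (x (m + 1) ^ (p.2.1 : ℕ) * desc tau (m + 1 - p.2.2) (p.2.2 : ℕ))
    have hv := ih (m + 1) ω _ v (by
      rw [Fintype.card_prod, Fintype.card_prod, Fintype.card_fin, Fintype.card_fin,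
        Nat.factorial_succ, Nat.descFactorial_succ]
      calc _ ≤ m.factorial * n.descFactorial m * ((n - m) * (m + 1)) := Nat.mul_le_mul_right _ hc
        _ = _ := by ring) (by
      rw [eq_top_iff, ← span_incl_mul ω hu]
      refine span_mono ?_
      rintro _ ⟨_, ⟨p, rfl⟩, i, hi, s, hs, rfl⟩
      exact ⟨(p, ⟨i, hi⟩, ⟨s, hs⟩), rfl⟩)
    have h1 := hv.comp (fun p => (p, ⟨0, ω⟩, ⟨0, ω⟩))
      (fun p q h => (Prod.mk.inj h).1)
    refine LinearIndependent.of_comp (inclₗ (Nat.le_succ m)) ?_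
    convert h1 using 1
    funext p
    simp [v, inclₗ]

end ONH

/-! ## Generators of the terms of the complexes -/

/-- Bounded exponents which decrease after the position `p`. -/
def decSet (n M p : ℕ) : Set (ℕ → ℕ) :=
  {α | ONH.Bdd n M α ∧ (∀ i, i < 1 ∨ M < i → α i = 0) ∧ ∀ i, p < i → i < M → α (i + 1) < α i}

lemma decSet_lt {M : ℕ} (h : α ∈ decSet n M p) (hi : p < i) (hij : i < j)
    (hj : j ≤ M) : α j < α i := by
  induction j with
  | zero => omega
  | succ j ih =>
    have h1 := h.2.2 j ω ω
    rcases Nat.lt_succ_iff_lt_or_eq.1 hij with h2 | rfl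
    · exact h1.trans (ih h2 ω)
    · exact h1

/-- The data which determine an element of `decSet`. -/
def decData (M p : ℕ) (α : ℕ → ℕ) : (Fin p → ℕ) × Finset ℕ :=
  (fun j => α (j + 1), Finset.univ.image fun s : Fin (M - p) => α (M - s))

lemma decSet_strictMono {M : ℕ} (h : α ∈ decSet n M p) :
    StrictMono fun s : Fin (M - p) => α (M - s) := fun s t hst =>
  decSet_lt h ω (by have : (s : ℕ) < t := hst; omega) ω

lemma decData_injOn (n M p : ℕ) : Set.InjOn (decData M p) (decSet n M p) := by
  intro α hα β hβ h
  rw [decData, decData, Prod.mk.injEq] at h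
  obtain ⟨h1, h2⟩ := h
  have h3 : (fun s : Fin (M - p) => α (M - s)) = fun s : Fin (M - p) => β (M - s) := by
    rw [← (decSet_strictMono hα).range_inj (decSet_strictMono hβ)]
    simpa using congrArg (fun s : Finset ℕ => (s : Set ℕ)) h2
  funext i
  by_cases hi : i < 1 ∨ M < i
  · rw [hα.2.1 i hi, hβ.2.1 i hi]
  push Not at hi
  by_cases hp : i ≤ p
  · have := congrFun h1 ⟨i - 1, ω⟩
    simpa [show i - 1 + 1 = i by omega] using this
  · have := congrFun h3 ⟨M - i, ω⟩
    simpa [show M - (M - i) = i by omega] using this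

lemma decData_mapsTo {M : ℕ} (hp : p ≤ M) : Set.MapsTo (decData M p) (decSet n M p)
    ((Fintype.piFinset fun j : Fin p => range (n - j)) ×ˢ
      Finset.powersetCard (M - p) (range (n - p)) : Finset _) := by
  intro α hα
  simp only [decData, Finset.coe_product, Set.mem_prod, Finset.mem_coe, Fintype.mem_piFinset,
    mem_range, Finset.mem_powersetCard]
  refine ⟨fun j => ?_, ?_, ?_⟩
  · have := hα.1 (j + 1) ω ω; omega
  · intro y hy
    simp only [Finset.mem_image, Finset.mem_univ, true_and] at hy
    obtain ⟨s, rfl⟩ := hy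
    rw [mem_range]
    have := hα.1 (M - s) ω ω; omega
  · rw [Finset.card_image_of_injective _ (decSet_strictMono hα).injective, Finset.card_univ,
      Fintype.card_fin]

lemma decSet_finite {M : ℕ} (hp : p ≤ M) : (decSet n M p).Finite :=
  Set.Finite.of_injOn (decData_mapsTo hp) (decData_injOn n M p) (Finset.finite_toSet _)

open Classical in
/-- `decSet` as a finite set. -/
def decFin (n M p : ℕ) : Finset (ℕ → ℕ) :=
  if hp : p ≤ M then (decSet_finite (n := n) hp).toFinset else ∅

lemma mem_decFin {M : ℕ} : α ∈ decFin n M p ↔ p ≤ M ∧ α ∈ decSet n M p := by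
  unfold decFin
  split_ifs with h <;> simp [h]

/-- The bound for the number of elements of `decFin`. -/
def decCount (n M p : ℕ) : ℕ := if p ≤ M then n.descFactorial p * (n - p).choose (M - p) else 0

lemma card_decFin (n M p : ℕ) : (decFin n M p).card ≤ decCount n M p := by
  unfold decCount
  split_ifs with h
  · have h1 := Finset.card_le_card_of_injOn (decData M p)
      (s := decFin n M p) (t := (Fintype.piFinset fun j : Fin p => range (n - j)) ×ˢ
      Finset.powersetCard (M - p) (range (n - p)))
      (fun α hα => decData_mapsTo h (mem_decFin.1 hα).2)
      (fun α hα β hβ => decData_injOn n M p (mem_decFin.1 hα).2 (mem_decFin.1 hβ).2)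
    rw [Finset.card_product, Fintype.card_piFinset, Finset.card_powersetCard, Finset.card_range] at h1
    simp only [Finset.card_range] at h1
    rwa [Fin.prod_univ_eq_prod_range (fun j => n - j), ← Nat.descFactorial_eq_prod_range] at h1
  · rw [decFin, dif_neg h]; simp

lemma decCount_mul {M : ℕ} (h : p ≤ M) :
    decCount n M p * (M - p).factorial = n.descFactorial M := by
  rw [decCount, if_pos h, ← Nat.descFactorial_mul_descFactorial h,
    Nat.descFactorial_eq_factorial_mul_choose (n - p)]
  ring

/-- The indices of the generators of the terms of the complexes. -/
def idx (n M a b : ℕ) : Finset (Σ _ : ℕ × List ℕ, (ℕ → ℕ)) :=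
  (wordList a 0 b []).toFinset.sigma fun z => decFin n M z.1

lemma mem_idx {M : ℕ} {z : Σ _ : ℕ × List ℕ, (ℕ → ℕ)} : z ∈ idx n M a b ↔
    z.1 ∈ wordList a 0 b [] ∧ z.1.1 ≤ M ∧ z.2 ∈ decSet n M z.1.1 := by
  rw [idx, Finset.mem_sigma, mem_decFin, List.mem_toFinset]

lemma sum_toFinset_le {ι : Type*} [DecidableEq ι] (f : ι → ℕ) (l : List ι) :
    ∑ i ∈ l.toFinset, f i ≤ (l.map f).sum := by
  induction l with
  | nil => simp
  | cons i l ih =>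
    rw [List.toFinset_cons, List.map_cons, List.sum_cons]
    by_cases h : i ∈ l.toFinset
    · rw [Finset.insert_eq_of_mem h]; omega
    · rw [Finset.sum_insert h]; omega

lemma card_idx_le (n M a b : ℕ) :
    (idx n M a b).card ≤ ((wordList a 0 b []).map fun z => decCount n M z.1).sum := by
  rw [idx, Finset.card_sigma]
  refine le_trans (Finset.sum_le_sum fun z _ => card_decFin n M z.1) (sum_toFinset_le _ _)

lemma le_of_mem_wordList {B : ℕ} {z : ℕ × List ℕ} (hz : z ∈ wordList s q B v) :
    B ≤ z.1 := by
  induction s generalizing q B v with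
  | zero =>
    simp only [wordList, List.mem_singleton] at hz
    subst hz; exact le_rfl
  | succ s ih =>
    rw [wordList, List.mem_append, List.mem_flatMap] at hz
    rcases hz with ⟨j, -, hz⟩ | hz
    · exact ih hz
    · exact (Nat.le_succ B).trans (ih hz)

lemma wordList_count {M B : ℕ} (hq : q ≤ B) (hs : q + s ≤ M) (hB : B ≤ M) :
    ((wordList s q B v).map fun z => decCount n M z.1).sum * ((M - q - s).factorial *
      (M - B).factorial) = (M - q).factorial * n.descFactorial M := by
  induction s generalizing q B v with
  | zero =>
    simp only [wordList, List.map_cons, List.map_nil, List.sum_cons, List.sum_nil, add_zero]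
    rw [← decCount_mul hB, Nat.sub_zero]; ring
  | succ s ih =>
    obtain ⟨r, hr⟩ : ∃ r, M - q = r + 1 := ⟨M - q - 1, ω⟩
    have e1 : M - q - (s + 1) = M - (q + 1) - s := ω
    have e2 : M - (q + 1) = r := ω
    have h1 : ∀ L : List ℕ, (∀ j ∈ L, j < B - q) →
        ((L.flatMap fun j => wordList s (q + 1) B (List.range' (q + 1) j ++ v)).map
          fun z => decCount n M z.1).sum * ((M - q - (s + 1)).factorial * (M - B).factorial)
          = L.length * (r.factorial * n.descFactorial M) := by
      intro L hL
      induction L with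
      | nil => simp
      | cons j L ihL =>
        have := hL j (by simp)
        rw [List.flatMap_cons, List.map_append, List.sum_append, add_mul,
          ihL fun i hi => hL i (by simp [hi]), e1, ih ω ω hB, e2, List.length_cons]
        ring
    have h2 : ((wordList s (q + 1) (B + 1) (List.range' (q + 1) (B - q) ++ v)).map
        fun z => decCount n M z.1).sum * ((M - q - (s + 1)).factorial * (M - B).factorial)
        = (M - B) * (r.factorial * n.descFactorial M) := by
      rcases hB.eq_or_lt with rfl | hB
      · rw [List.sum_eq_zero, Nat.sub_self, zero_mul, zero_mul]
        intro y hy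
        rw [List.mem_map] at hy
        obtain ⟨z, hz, rfl⟩ := hy
        have := le_of_mem_wordList hz
        rw [decCount, if_neg ω]
      · have := ih (q := q + 1) (B := B + 1) (v := List.range' (q + 1) (B - q) ++ v) ω
          ω hB
        obtain ⟨r', hr'⟩ : ∃ r', M - B = r' + 1 := ⟨M - B - 1, ω⟩
        rw [← e1, e2, show M - (B + 1) = r' by omega] at this
        rw [hr', Nat.factorial_succ, ← this]
        ring
    rw [wordList, List.map_append, List.sum_append, add_mul, h1 _ (fun j hj => List.mem_range.1 hj),
      h2, List.length_range, ← add_mul, show B - q + (M - B) = r + 1 by omega, hr,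
      Nat.factorial_succ, mul_assoc]

lemma exists_wd_tl {Q : Type*} [Monoid Q] (T : ℕ → Q) (l N : ℕ) :
    ∃ w : List ℕ, (∀ i ∈ w, l ≤ i ∧ i < l + N) ∧ tl T l N = wd T w := by
  induction N with
  | zero => exact ⟨[], by simp⟩
  | succ N ih =>
    obtain ⟨w, h1, h2⟩ := ih
    refine ⟨List.range' l (N + 1) ++ w, fun i hi => ?_, by
      rw [tl_succ, wd_append, asc_eq_wd, h2]⟩
    rw [List.mem_append, List.mem_range'_1] at hi
    rcases hi with hi | hi
    · omega
    · have := h1 i hi; omega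

namespace ONH

lemma cf_wd_tau (hv : ∀ i ∈ v, 1 ≤ i ∧ i < m) (a : Coef K n) :
    wd tau v * cf m a = (cf m (Coef.parity^[v.length] a) * wd tau v : ONH K n m) := by
  induction v generalizing a with
  | nil => simp
  | cons i v ih =>
    have hi := hv i (by simp)
    rw [wd_cons, mul_assoc, ih (fun j hj => hv j (by simp [hj])), ← mul_assoc, tau_cf hi.1 hi.2,
      mul_assoc, List.length_cons, Function.iterate_succ_apply']

lemma exists_cf_tl (hl : 1 ≤ l) (hN : N = 0 ∨ l + N ≤ m) : ∃ L, ∀ a : Coef K n,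
    tl tau l N * cf m a = (cf m (Coef.parity^[L] a) * tl tau l N : ONH K n m) := by
  obtain ⟨w, h1, h2⟩ := exists_wd_tl (tau : ℕ → ONH K n m) l N
  refine ⟨w.length, fun a => ?_⟩
  rw [h2]
  exact cf_wd_tau (fun i hi => by have := h1 i hi; omega) a

/-- The element with index `z`. -/
def idxElt (z : Σ _ : ℕ × List ℕ, (ℕ → ℕ)) : ONH K n m := mon z.2 * wd tau z.1.2

lemma eq_top_of_idx {P : CSub K n m} (hm : m ≤ n) (ham : a ≤ m) (hbm : b ≤ m)
    (hPl : ∀ i, a < i → i < m → ∀ h, tau i * h ∈ P)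
    (hPr : ∀ i, b < i → i < m → ∀ h, h * tau i ∈ P)
    (H : ∀ z ∈ idx n m a b, idxElt z ∈ P) : P = ⊤ := by
  refine eq_top_of_mon hm ham hbm hPl hPr fun z hz hzm α hα hdec => ?_
  let β : ℕ → ℕ := fun i => if i < 1 ∨ m < i then 0 else α i
  have hβ : ∀ i, 1 ≤ i → i ≤ m → β i = α i := fun i h1 h2 => if_neg ω
  have h1 : (mon α : ONH K n m) = mon β := by
    rw [mon, mon, mw_congr fun i h1 h2 => (hβ i h1 ω).symm]
  rw [h1]
  refine H ⟨z, β⟩ (mem_idx.2 ⟨hz, hzm, fun i h1 h2 => ?_, fun i hi => if_pos hi, fun i h1 h2 => ?_⟩)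
  · change β i + i ≤ n
    rw [hβ i h1 h2]; exact hα i h1 h2
  · change i < m at h2
    change z.1 < i at h1
    change β (i + 1) < β i
    rw [hβ i ω ω, hβ (i + 1) ω ω]
    exact hdec i h1 h2

lemma eq_zero_of_sum_idx (hm : m ≤ n) (ha : a ≤ m) (hb : b ≤ m)
    {c : (Σ _ : ℕ × List ℕ, (ℕ → ℕ)) → Coef K n}
    (h : ∑ z ∈ idx n m a b, tl tau (a + 1) (m - (a + 1)) * (c z • idxElt z * tl tau (b + 1) (m - (b + 1)))
      = (0 : ONH K n m)) {z} (hz : z ∈ idx n m a b) : c z = 0 := by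
  have H := sysOf K n m
  set ta : ONH K n m := tl tau (a + 1) (m - (a + 1)) with hta
  set tb : ONH K n m := tl tau (b + 1) (m - (b + 1)) with htb
  have twa : Twist ta := twist_tl ω ω
  obtain ⟨L, hL⟩ := exists_cf_tl (K := K) (n := n) (m := m) (l := a + 1) (N := m - (a + 1))
    ω ω
  obtain ⟨ι, _, κ, hc, hκ, hs, hi⟩ := H.exists_full_family (l := a + 1) (N := m - (a + 1)) ω
    ω
  obtain ⟨ι', _, κ', hc', hκ', hs', hi'⟩ :=
    H.exists_full_family_right (l := b + 1) (N := m - (b + 1)) ω ω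
  choose v hv hκv using hκ
  have hv' : ∀ i, ∀ j ∈ v i, 1 ≤ j ∧ j ≤ m := fun i j hj => by have := hv i j hj; omega
  have hcut : ∀ h : ONH K n m, ta * (h * tb) ∈ span (Coef K n)
      {y | ∃ z ∈ idx n m a b, y = ta * (idxElt z * tb)} := by
    let P : CSub K n m :=
      { carrier := {h | ta * (h * tb) ∈ span (Coef K n)
          {y | ∃ z ∈ idx n m a b, y = ta * (idxElt z * tb)}}
        add_mem' := by
          intro h h' h1 h2
          change ta * ((h + h') * tb) ∈ span _ _
          rw [add_mul, mul_add]; exact add_mem h1 h2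
        zero_mem' := by simp
        smul_mem' := by
          intro r h h1
          obtain ⟨r', hr⟩ := twa.mul_smul r (h * tb)
          change ta * (r • h * tb) ∈ span _ _
          rw [smul_mul_assoc, hr]; exact smul_mem _ _ h1 }
    have hP : P = ⊤ := by
      refine eq_top_of_idx (a := a) (b := b) hm ω ω ?_ ?_ ?_
      · intro i h1 h2 h
        change ta * (tau i * h * tb) ∈ span _ _
        rw [mul_assoc, ← mul_assoc, H.tl_tau ω ω ω ω, zero_mul]
        exact zero_mem _
      · intro i h1 h2 h
        change ta * (h * tau i * tb) ∈ span _ _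
        rw [mul_assoc h, H.tau_tl ω ω ω ω, mul_zero, mul_zero]
        exact zero_mem _
      · intro z hz
        exact subset_span ⟨z, hz, rfl⟩
    intro h
    have : h ∈ P := by rw [hP]; trivial
    exact this
  let u : ι × (idx n m a b) × ι' → ONH K n m :=
    fun p => κ p.1 * (ta * (idxElt p.2.1.1 * tb) * κ' p.2.2)
  have hu : span (Coef K n) (Set.range u) = ⊤ := by
    rw [eq_top_iff]
    intro h _
    obtain ⟨r, hr⟩ := hs h
    rw [hr]
    refine sum_mem fun i _ => ?_
    obtain ⟨r', hr'⟩ := hs' (r i)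
    rw [hr', mul_sum, mul_sum]
    refine sum_mem fun j _ => ?_
    have h1 : κ i * (ta * (r' j * tb * κ' j)) = κ i * (ta * (r' j * tb) * κ' j) := by
      simp only [mul_assoc]
    rw [h1]
    have h2 : Twist (κ i) := by rw [hκv]; exact twist_wd_x (hv' i)
    refine h2.mul_mem (X := {y | ∃ z ∈ idx n m a b, y = ta * (idxElt z * tb) * κ' j}) ?_
      (mem_mul ?_ (hcut (r' j)))
    · rintro _ ⟨z, hz, rfl⟩
      exact subset_span ⟨(i, ⟨z, hz⟩, j), rfl⟩
    · rintro _ ⟨z, hz, rfl⟩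
      exact subset_span ⟨z, hz, rfl⟩
  have hcard : Fintype.card (ι × (idx n m a b) × ι')
      ≤ m.factorial * n.descFactorial m := by
    have h1 := wordList_count (n := n) (M := m) (q := 0) (s := a) (B := b) (v := []) ω
      ω ω
    have h2 := card_idx_le n m a b
    have e : ∀ c, (m - (c + 1) + 1).factorial = (m - c).factorial := fun c => by
      rcases Nat.lt_or_ge c m with h | h
      · congr 1; omega
      · rw [show m - (c + 1) + 1 = 1 by omega, show m - c = 0 by omega]; rfl
    rw [Nat.sub_zero] at h1
    rw [Fintype.card_prod, Fintype.card_prod, hc, hc', e, e, Fintype.card_coe, ← h1]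
    calc _ = (idx n m a b).card * ((m - a).factorial * (m - b).factorial) := by ring
      _ ≤ _ := Nat.mul_le_mul_right _ h2
  have hne : ∀ N : ℕ, 0 < (N + 1).factorial := fun N => Nat.factorial_pos _
  obtain ⟨i₀⟩ : Nonempty ι := Fintype.card_pos_iff.1 (by rw [hc]; exact hne _)
  obtain ⟨j₀⟩ : Nonempty ι' := Fintype.card_pos_iff.1 (by rw [hc']; exact hne _)
  have h1 := (linearIndependent_of_card hm hcard hu).comp
    (fun z : idx n m a b => (i₀, z, j₀)) (fun p q h => (Prod.mk.inj (Prod.mk.inj h).2).1)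
  rw [Fintype.linearIndependent_iff] at h1
  have h2 := h1 (fun z => Coef.parity^[(v i₀).length] (Coef.parity^[L] (c z.1))) (by
    have h3 := congrArg (fun y => κ i₀ * (y * κ' j₀)) h
    simp only [zero_mul, mul_zero, sum_mul, mul_sum] at h3
    rw [← h3, ← Finset.sum_coe_sort (idx n m a b)]
    refine sum_congr (by congr!) fun z _ => ?_
    rw [smul_def, smul_def, mul_assoc (cf _ _), ← mul_assoc ta, hL, mul_assoc (cf _ _),
      mul_assoc (cf _ _), ← mul_assoc (κ i₀), hκv, cf_wd_x (hv' i₀), ← hκv, mul_assoc (cf _ _)]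
    rfl) ⟨z, hz⟩
  rw [← parity_iterate L (c z), ← parity_iterate (v i₀).length (Coef.parity^[L] (c z)), h2,
    parity_iterate_zero, parity_iterate_zero]

end ONH

section

variable {Q R : Type*} [Monoid Q] [Monoid R] {T T' : ℕ → Q} {l N : ℕ}

lemma asc_congr (h : ∀ i, l ≤ i → i < l + N → T i = T' i) : asc T l N = asc T' l N := by
  unfold asc
  congr 1
  refine List.map_congr_left fun s hs => ?_
  rw [List.mem_range] at hs
  exact h _ ω ω

lemma tl_congr (h : ∀ i, l ≤ i → i < l + N → T i = T' i) : tl T l N = tl T' l N := by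
  unfold tl
  congr 1
  exact List.map_congr_left fun s hs => asc_congr fun i h1 h2 => h i h1 ω

lemma xup_congr (h : ∀ i, l ≤ i → i < l + N → T i = T' i) : xup T l N = xup T' l N := by
  unfold xup
  congr 1
  refine List.map_congr_left fun s hs => ?_
  rw [List.mem_range] at hs
  rw [h _ ω ω]

lemma xdown_congr (h : ∀ i, l ≤ i → i < l + N → T i = T' i) : xdown T l N = xdown T' l N := by
  unfold xdown
  congr 1
  refine List.map_congr_left fun s hs => ?_
  rw [List.mem_range] at hs
  rw [h _ ω ω]

lemma map_xup (f : Q →* R) : f (xup T l N) = xup (fun i => f (T i)) l N := by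
  simp [xup, map_list_prod, Function.comp_def]

lemma map_xdown (f : Q →* R) : f (xdown T l N) = xdown (fun i => f (T i)) l N := by
  simp [xdown, map_list_prod, Function.comp_def]

end

namespace ONH

lemma incl_tl (h : m ≤ k) (hl : 1 ≤ l) (hN : N = 0 ∨ l + N ≤ m) :
    incl h (tl tau l N : ONH K n m) = tl tau l N :=
  (map_tl tau l N (incl h : ONH K n m →ₐ[K] ONH K n k).toRingHom.toMonoidHom).trans
    (tl_congr fun i h1 h2 => incl_tau h ω ω)

lemma incl_xup (h : m ≤ k) (hl : 1 ≤ l) (hN : l + N ≤ m + 1) :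
    incl h (xup x l N : ONH K n m) = xup x l N :=
  (map_xup (T := x) (l := l) (N := N) (incl h : ONH K n m →ₐ[K] ONH K n k).toRingHom.toMonoidHom).trans
    (xup_congr fun i h1 h2 => incl_x h ω ω)

lemma incl_xdown (h : m ≤ k) (hl : 1 ≤ l) (hN : l + N ≤ m + 1) :
    incl h (xdown x l N : ONH K n m) = xdown x l N :=
  (map_xdown (T := x) (l := l) (N := N) (incl h : ONH K n m →ₐ[K] ONH K n k).toRingHom.toMonoidHom).trans
    (xdown_congr fun i h1 h2 => incl_x h ω ω)

lemma pm_e' (l m : ℕ) : PM (e' l m : ONH K n k) (xup x l (m + 1 - l) * tl tau l (m - l)) :=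
  PM.unit_mul _ _

lemma pm_e (h : l ≤ m + 1) : PM (e l m : ONH K n k) (tl tau l (m - l) * xdown x l (m + 1 - l)) := by
  have h1 : (xDown l m : ONH K n k) = xdown x l (m + 1 - l) := by
    unfold xDown xdown
    congr 1
    refine List.map_congr_left fun s _ => ?_
    congr 2; omega
  rw [e, h1]
  exact PM.unit_mul _ _

lemma e'_eq_one (h : m ≤ l) : (e' l m : ONH K n k) = 1 := by
  rcases h.eq_or_lt with rfl | h
  · simp [e', xUp, tauLong, show Nat.choose 1 3 = 0 from rfl]
  · simp [e', xUp, tauLong, show m + 1 - l = 0 by omega, show m - l = 0 by omega]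

lemma e_eq_one (h : m ≤ l) : (e l m : ONH K n k) = 1 := by
  rcases h.eq_or_lt with rfl | h
  · simp [e, xDown, tauLong, show Nat.choose 1 3 = 0 from rfl]
  · simp [e, xDown, tauLong, show m + 1 - l = 0 by omega, show m - l = 0 by omega]

lemma e'_tau (hl : 1 ≤ l) (hm : m ≤ k) (h1 : l ≤ i) (h2 : i < m) :
    e' l m * tau i = (0 : ONH K n k) := by
  refine ((pm_e' l m).mul_right _).eq_zero ?_
  rw [mul_assoc, sys.tl_tau hl ω h1 ω, mul_zero]

lemma tau_e (hl : 1 ≤ l) (hm : m ≤ k) (h1 : l ≤ i) (h2 : i < m) :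
    tau i * e l m = (0 : ONH K n k) := by
  refine ((pm_e ω).mul_left _).eq_zero ?_
  rw [← mul_assoc, sys.tau_tl hl ω h1 ω, zero_mul]

lemma tl_mul_e' (hl : 1 ≤ l) (hlm : l ≤ m + 1) (hm : m ≤ k) :
    PM (tl tau l (m - l) * e' l m : ONH K n k) (tl tau l (m - l)) := by
  rcases hlm.eq_or_lt with rfl | hlm
  · simp [e'_eq_one (Nat.le_succ m), PM]
  refine ((pm_e' l m).mul_left _).trans ?_
  have := (sysOf K n k).tl_xup_tl (l := l) (M := m + 1 - l) hl ω
  rwa [show m + 1 - l - 1 = m - l by omega, mul_assoc] at this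

lemma e_mul_tl (hl : 1 ≤ l) (hlm : l ≤ m + 1) (hm : m ≤ k) :
    PM (e l m * tl tau l (m - l) : ONH K n k) (tl tau l (m - l)) := by
  rcases hlm.eq_or_lt with rfl | hlm
  · simp [e_eq_one (Nat.le_succ m), PM]
  refine ((pm_e ω).mul_right _).trans ?_
  have := (sysOf K n k).tl_xdown_tl (l := l) (M := m + 1 - l) hl ω
  rwa [show m + 1 - l - 1 = m - l by omega] at this

lemma pm_e'_incl (hl : 1 ≤ l) (h : l ≤ m + 1) :
    PM (e' l (m + 1) * incl (Nat.le_succ m) (e' l m) : ONH K n (m + 1)) (e' l (m + 1)) := by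
  rcases h.eq_or_lt with rfl | h
  · rw [e'_eq_one (Nat.le_succ m), map_one, mul_one]
  have h1 : tl tau l (m + 1 - l) = (asc tau l (m - l + 1) * tl tau l (m - l) : ONH K n (m + 1)) := by
    rw [← tl_succ]; congr 1; omega
  have h2 : PM (incl (Nat.le_succ m) (e' l m)) (xup x l (m + 1 - l) * tl tau l (m - l) :
      ONH K n (m + 1)) := by
    have := (pm_e' (K := K) (n := n) (k := m) l m).map (incl (Nat.le_succ m) :
      ONH K n m →ₐ[K] ONH K n (m + 1)).toRingHom
    change PM (incl _ _) (incl _ _) at this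
    rwa [map_mul, incl_xup _ hl ω, incl_tl _ hl ω] at this
  have h3 := (sysOf K n (m + 1)).tl_xup_tl (l := l) (M := m + 1 - l) hl ω
  rw [show m + 1 - l - 1 = m - l by omega] at h3
  refine ((pm_e' l (m + 1)).mul h2).trans (PM.trans ?_ (pm_e' l (m + 1)).symm)
  rw [h1]
  have := h3.mul_left (xup x l (m + 1 + 1 - l) * asc tau l (m - l + 1))
  simpa only [mul_assoc] using this

lemma pm_incl_e (hl : 1 ≤ l) (h : l ≤ m + 1) :
    PM (incl (Nat.le_succ m) (e l m) * e l (m + 1) : ONH K n (m + 1)) (e l (m + 1)) := by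
  rcases h.eq_or_lt with rfl | h
  · rw [e_eq_one (Nat.le_succ m), map_one, one_mul]
  have H := sysOf K n (m + 1)
  have h1 := H.tl_right_desc (l := l) (N := m - l) hl ω
  rw [show m - l + 1 = m + 1 - l by omega] at h1
  have h2 : PM (incl (Nat.le_succ m) (e l m)) (tl tau l (m - l) * xdown x l (m + 1 - l) :
      ONH K n (m + 1)) := by
    have := (pm_e (K := K) (n := n) (k := m) (l := l) (m := m) ω).map
      (incl (Nat.le_succ m) : ONH K n m →ₐ[K] ONH K n (m + 1)).toRingHom
    change PM (incl _ _) (incl _ _) at this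
    rwa [map_mul, incl_xdown _ hl ω, incl_tl _ hl ω] at this
  have h3 := H.tl_xdown_tl (l := l) (M := m + 1 - l) hl ω
  rw [show m + 1 - l - 1 = m - l by omega] at h3
  have h4 : PM (e l (m + 1)) (tl tau l (m - l) * (desc tau l (m + 1 - l) *
      xdown x l (m + 1 + 1 - l)) : ONH K n (m + 1)) := by
    refine (pm_e ω).trans ?_
    rw [← mul_assoc]
    exact h1.mul_right _
  refine (h2.mul h4).trans (PM.trans ?_ h4.symm)
  have := h3.mul_right (desc tau l (m + 1 - l) * xdown x l (m + 1 + 1 - l))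
  simpa only [mul_assoc] using this

lemma cf_e' (h : a ≤ m) (c : Coef K n) : e' (a + 1) m * cf m c = cf m c * e' (a + 1) m := by
  have := (commute_incl h (cf a c)).2.eq
  rw [incl_cf] at this
  exact this.symm

/-- The cut of an element by the idempotents. -/
def cut (a b m : ℕ) (h : ONH K n m) : ONH K n m := e' (a + 1) m * (h * e (b + 1) m)

lemma cut_add (g h : ONH K n m) : cut a b m (g + h) = cut a b m g + cut a b m h := by
  rw [cut, add_mul, mul_add]; rfl

lemma cut_smul (ha : a ≤ m) (c : Coef K n) (h : ONH K n m) :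
    cut a b m (c • h) = c • cut a b m h := by
  rw [cut, smul_mul_assoc, smul_def, ← mul_assoc, cf_e' ha, mul_assoc]; rfl

lemma cut_zero : cut a b m (0 : ONH K n m) = 0 := by simp [cut]

lemma cut_sum {ι : Type*} (s : Finset ι) (f : ι → ONH K n m) :
    cut a b m (∑ i ∈ s, f i) = ∑ i ∈ s, cut a b m (f i) := by
  simp [cut, sum_mul, mul_sum]

lemma pm_cut_incl (ha : a ≤ m) (hb : b ≤ m) (h : ONH K n m) :
    PM (cut a b (m + 1) (incl (Nat.le_succ m) (cut a b m h)))
      (cut a b (m + 1) (incl (Nat.le_succ m) h)) := by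
  have h1 := pm_e'_incl (K := K) (n := n) (l := a + 1) (m := m) ω ω
  have h2 := pm_incl_e (K := K) (n := n) (l := b + 1) (m := m) ω ω
  have h3 := h1.mul (h2.mul_left (incl (Nat.le_succ m) h))
  rw [cut, cut, map_mul, map_mul]
  simpa only [cut, mul_assoc] using h3

lemma tau_incl (h : m + 2 ≤ k) (g : ONH K n m) :
    ∃ g' : ONH K n m, tau (m + 1) * incl (ω : m ≤ k) g = incl ω g' * tau (m + 1) := by
  have H := sysOf K n k
  induction g using ONH.induction with
  | hc r => exact ⟨algebraMap K _ r, by simp only [AlgHom.commutes]; exact (Algebra.commutes _ _).symm⟩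
  | hg g =>
    suffices PM (tau (m + 1) * incl (ω : m ≤ k) (gen g)) (incl ω (gen g) * tau (m + 1)) by
      rcases this with h1 | h1
      · exact ⟨_, h1⟩
      · exact ⟨-gen g, by rw [map_neg, neg_mul]; exact h1⟩
    rw [incl_gen]
    cases g with
    | x i => exact H.pm_taux ω ω ω ω
    | tau i => exact PM.of_add (H.tau_tau _ _ ω ω ω ω ω)
    | chi i => exact .inl (H.tau_chi _ _ ω ω ω ω).symm
    | d => exact .inr (by rw [inclGen, H.tau_d _ ω ω, neg_neg])
  | ha a b h1 h2 =>
    obtain ⟨a', h1⟩ := h1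
    obtain ⟨b', h2⟩ := h2
    exact ⟨a' + b', by rw [map_add, mul_add, h1, h2, map_add, add_mul]⟩
  | hm a b h1 h2 =>
    obtain ⟨a', h1⟩ := h1
    obtain ⟨b', h2⟩ := h2
    exact ⟨a' * b', by rw [map_mul, ← mul_assoc, h1, mul_assoc, h2, map_mul, mul_assoc]⟩

lemma cut_incl_incl (ha : a ≤ m) (hb : b ≤ m) (g : ONH K n m) :
    cut a b (m + 2) (incl (Nat.le_add_right m 2) g) = 0 := by
  have H := sysOf K n (m + 2)
  have h1 : PM (e' (a + 1) (m + 2) : ONH K n (m + 2)) (xup x (a + 1) (m + 2 + 1 - (a + 1)) *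
      (tl tau (a + 1 + 1) (m - a) * asc tau (a + 1) (m - a)) * tau (m + 1)) := by
    refine (pm_e' (a + 1) (m + 2)).trans ?_
    have := (H.tl_right_asc (l := a + 1) (N := m - a) ω ω).mul_left
      (xup x (a + 1) (m + 2 + 1 - (a + 1)))
    rw [asc_succ, show a + 1 + (m - a) = m + 1 by omega] at this
    rw [show m + 2 - (a + 1) = m - a + 1 by omega]
    simpa only [mul_assoc] using this
  obtain ⟨g', hg⟩ := tau_incl (le_refl (m + 2)) g
  refine (h1.mul_right _).eq_zero ?_
  rw [mul_assoc _ (tau (m + 1)), ← mul_assoc (tau (m + 1)), hg, mul_assoc (incl _ g'),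
    tau_e ω le_rfl ω ω, mul_zero, mul_zero]

lemma mem_T (ha : a ≤ m) (hb : b ≤ m) (hm : m ≤ n) {h : ONH K n m} :
    h ∈ T K n a b m ↔ ∃ g, h = cut a b m g := by
  rw [T, if_pos ⟨ha, hb, hm⟩]
  exact ⟨fun ⟨g, hg⟩ => ⟨g, hg.symm⟩, fun ⟨g, hg⟩ => ⟨g, hg.symm⟩⟩

lemma pm_diff (ha : a ≤ m) (hb : b ≤ m) (hm : m + 1 ≤ n) (c : T K n a b m) {g : ONH K n m}
    (hc : (c : ONH K n m) = cut a b m g) :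
    PM (diff K n a b m c : ONH K n (m + 1)) (cut a b (m + 1) (incl (Nat.le_succ m) g)) := by
  rw [diff_coe K n ⟨ha, hb, hm⟩, hc]
  exact pm_cut_incl ha hb g

lemma bdry_le_ker (a b m : ℕ) : bdry K n a b m ≤ LinearMap.ker (diff K n a b m) := by
  cases m with
  | zero => exact bot_le
  | succ m =>
    rintro _ ⟨c, rfl⟩
    rw [LinearMap.mem_ker]
    by_cases h : a ≤ m ∧ b ≤ m ∧ m + 1 ≤ n
    swap
    · rw [diff_zero K n h]; simp
    by_cases h' : m + 2 ≤ n
    swap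
    · rw [diff_zero K n ω]; simp
    obtain ⟨g, hg⟩ := (mem_T h.1 h.2.1 ω).1 c.2
    have h1 : ((diff K n a b m c : T K n a b (m + 1)) : ONH K n (m + 1))
        = cut a b (m + 1) (incl (Nat.le_succ m) (c : ONH K n m)) := diff_coe K n h c
    have h2 := pm_diff ω ω h' _ h1
    rw [incl_incl] at h2
    exact Subtype.ext (h2.eq_zero (cut_incl_incl h.1 h.2.1 _))

lemma incl_idxElt_of_idx {z} (hz : z ∈ idx n m a b) :
    incl (Nat.le_succ m) (idxElt z : ONH K n m) = (idxElt z : ONH K n (m + 1)) := by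
  have h1 := mem_idx.1 hz
  have h2 := mem_wordList (Nat.zero_le b) (by simp) h1.1
  rw [idxElt, idxElt, map_mul, incl_wd_tau _ (fun i hi => by have := h2.2.2 i hi; omega), mon, mon,
    incl_wd_x _ (fun i hi => by have := mem_mw hi; omega), mw_add, wd_append,
    show mw z.2 (1 + m) 1 = [] by simp [mw, h1.2.2.2.1 (1 + m) ω], wd_nil, mul_one]

lemma mem_idx_succ {z} (hz : z ∈ idx n m a b) (hm : m + 1 ≤ n) (h : z.1.1 = m ∨ 0 < z.2 m) :
    z ∈ idx n (m + 1) a b := by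
  have h1 := mem_idx.1 hz
  have h0 : z.2 (m + 1) = 0 := h1.2.2.2.1 _ ω
  refine mem_idx.2 ⟨h1.1, ω, fun i h2 h3 => ?_, fun i h2 => h1.2.2.2.1 i ω, fun i h2 h3 => ?_⟩
  · rcases h3.lt_or_eq with h3 | rfl
    · exact h1.2.2.1 i h2 ω
    · rw [h0]; omega
  · rcases (Nat.lt_succ_iff.1 h3).lt_or_eq with h3 | rfl
    · exact h1.2.2.2.2 i h2 h3
    · rw [h0]; omega

lemma exists_incl_idxElt {z} (hz : z ∈ idx n (m + 1) a b) (h1 : z.1.1 ≠ m + 1) (h2 : z.2 (m + 1) = 0) :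
    ∃ h : ONH K n m, (idxElt z : ONH K n (m + 1)) = incl (Nat.le_succ m) h := by
  have h3 := mem_idx.1 hz
  have h4 := mem_wordList (Nat.zero_le b) (by simp) h3.1
  refine ⟨mon z.2 * wd tau z.1.2, ?_⟩
  rw [idxElt, map_mul, incl_wd_tau _ (fun i hi => by have := h4.2.2 i hi; omega), mon, mon,
    incl_wd_x _ (fun i hi => by have := mem_mw hi; omega), mw_add, wd_append,
    show mw z.2 (1 + m) 1 = [] by simp [mw, add_comm 1 m, h2], wd_nil, mul_one]

lemma exists_cut_eq_sum (hm : m ≤ n) (ha : a ≤ m) (hb : b ≤ m) (g : ONH K n m) :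
    ∃ co : (Σ _ : ℕ × List ℕ, (ℕ → ℕ)) → Coef K n,
      cut a b m g = ∑ z ∈ idx n m a b, co z • cut a b m (idxElt z) := by
  let P : CSub K n m :=
    { carrier := {g | ∃ co : (Σ _ : ℕ × List ℕ, (ℕ → ℕ)) → Coef K n,
        cut a b m g = ∑ z ∈ idx n m a b, co z • cut a b m (idxElt z)}
      add_mem' := by
        rintro g g' ⟨co, h1⟩ ⟨co', h2⟩
        exact ⟨co + co', by simp only [cut_add, h1, h2, Pi.add_apply, add_smul,
          Finset.sum_add_distrib]⟩
      zero_mem' := ⟨0, by simp [cut_zero]⟩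
      smul_mem' := by
        rintro r g ⟨co, h1⟩
        exact ⟨r • co, by simp only [cut_smul ha, h1, Pi.smul_apply, Finset.smul_sum, smul_smul,
          smul_eq_mul]⟩ }
  have hP : P = ⊤ := by
    refine eq_top_of_idx hm ha hb ?_ ?_ ?_
    · intro i h1 h2 h
      exact ⟨0, by simp [cut, ← mul_assoc, e'_tau (Nat.le_add_left 1 a) le_rfl h1 h2]⟩
    · intro i h1 h2 h
      exact ⟨0, by simp [cut, mul_assoc, tau_e (Nat.le_add_left 1 b) le_rfl h1 h2]⟩
    · intro z hz
      classical
      refine ⟨Pi.single z 1, ?_⟩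
      rw [Finset.sum_eq_single z]
      · simp
      · intro y _ hy; simp [Pi.single_eq_of_ne hy]
      · exact fun h => absurd hz h
  have hgP : g ∈ P := by rw [hP]; trivial
  exact hgP

lemma pm_tl_cut (ha : a ≤ m) (hb : b ≤ m) : ∃ s : ℕ, ∀ y : ONH K n m,
    tl tau (a + 1) (m - (a + 1)) * (cut a b m y * tl tau (b + 1) (m - (b + 1)))
      = (-1) ^ s * (tl tau (a + 1) (m - (a + 1)) * (y * tl tau (b + 1) (m - (b + 1)))) := by
  obtain ⟨s1, e1⟩ := (tl_mul_e' (K := K) (n := n) (k := m) (l := a + 1) (m := m) ω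
    ω le_rfl).exists_sign
  obtain ⟨s2, e2⟩ := (e_mul_tl (K := K) (n := n) (k := m) (l := b + 1) (m := m) ω
    ω le_rfl).exists_sign
  refine ⟨s1 + s2, fun y => ?_⟩
  rw [cut, mul_assoc, mul_assoc y, e2, ← mul_assoc, e1, pow_add]
  rcases neg_one_pow_eq_or (ONH K n m) s1 with h | h <;>
  rcases neg_one_pow_eq_or (ONH K n m) s2 with h' | h' <;> rw [h, h'] <;> simp

lemma eq_zero_of_sum_cut (hm : m ≤ n) (ha : a ≤ m) (hb : b ≤ m)
    {c : (Σ _ : ℕ × List ℕ, (ℕ → ℕ)) → Coef K n}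
    (h : ∑ z ∈ idx n m a b, c z • cut a b m (idxElt z) = (0 : ONH K n m)) {z}
    (hz : z ∈ idx n m a b) : c z = 0 := by
  refine eq_zero_of_sum_idx hm ha hb ?_ hz
  have h4 := congrArg (fun y => tl tau (a + 1) (m - (a + 1)) * (y * tl tau (b + 1) (m - (b + 1)))) h
  obtain ⟨s, hs⟩ := pm_tl_cut (K := K) (n := n) ha hb
  simp only [zero_mul, mul_zero, sum_mul, mul_sum, ← cut_smul ha, hs] at h4
  rw [← mul_sum] at h4
  rcases neg_one_pow_eq_or (ONH K n m) s with h | h <;> rw [h] at h4 <;> simpa using h4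

open Classical in
lemma cut_incl_eq_sum (hm : m + 1 ≤ n) (ha : a ≤ m) (hb : b ≤ m) {g : ONH K n m}
    {co : (Σ _ : ℕ × List ℕ, (ℕ → ℕ)) → Coef K n}
    (hg : cut a b m g = ∑ z ∈ idx n m a b, co z • cut a b m (idxElt z)) :
    cut a b (m + 1) (incl (Nat.le_succ m) g) = ∑ z ∈ idx n (m + 1) a b,
      (if z ∈ idx n m a b then co z else 0) • cut a b (m + 1) (idxElt z) := by
  have h1 : cut a b (m + 1) (incl (Nat.le_succ m) g)
      = ∑ z ∈ idx n m a b, co z • cut a b (m + 1) (idxElt z) := by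
    have hco : cut a b m (g - ∑ z ∈ idx n m a b, co z • idxElt z) = 0 := by
      rw [sub_eq_add_neg, ← neg_one_smul (Coef K n) (∑ z ∈ _, _), cut_add, cut_smul ha, cut_sum, hg]
      simp [cut_smul ha]
    have h2 := pm_cut_incl ha hb (g - ∑ z ∈ idx n m a b, co z • idxElt z)
    rw [hco, map_zero, cut_zero] at h2
    have h3 := PM.zero_iff.1 h2.symm
    rw [map_sub, sub_eq_add_neg, ← neg_one_smul (Coef K n) (incl _ (∑ z ∈ _, _)), cut_add,
      cut_smul ω, neg_one_smul, ← sub_eq_add_neg, sub_eq_zero] at h3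
    rw [h3, map_sum, cut_sum]
    refine sum_congr rfl fun z hz => ?_
    rw [incl_smul, cut_smul ω, incl_idxElt_of_idx hz]
  simp only [ite_smul, zero_smul]
  rw [← Finset.sum_filter, h1]
  symm
  refine Finset.sum_subset (fun z hz => (Finset.mem_filter.1 hz).2) fun y hy hy' => ?_
  have h2 := mem_idx.1 hy
  have h3 := mem_wordList (Nat.zero_le b) (by simp) h2.1
  have h4 : y ∉ idx n (m + 1) a b := fun h => hy' (Finset.mem_filter.2 ⟨h, hy⟩)
  have h5 : ¬ (y.1.1 = m ∨ 0 < y.2 m) := fun h => h4 (mem_idx_succ hy hm h)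
  obtain ⟨m, rfl⟩ : ∃ m', m = m' + 1 := ⟨m - 1, ω⟩
  obtain ⟨h', hh⟩ := exists_incl_idxElt (K := K) hy ω ω
  rw [← incl_idxElt_of_idx hy, hh, incl_incl, cut_incl_incl ω ω, smul_zero]

theorem ker_diff (a b m : ℕ) (hmn : m ≠ n) :
    LinearMap.ker (diff K n a b m) = bdry K n a b m := by
  refine le_antisymm ?_ (bdry_le_ker a b m)
  intro c hc
  by_cases h : a ≤ m ∧ b ≤ m ∧ m ≤ n
  swap
  · have : (c : ONH K n m) = 0 := by
      have h1 : T K n a b m = ⊥ := if_neg h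
      exact (mem_bot K).1 (h1.le c.2)
    rw [show c = 0 from Subtype.ext this]
    exact zero_mem _
  obtain ⟨ha, hb, hm⟩ := h
  have hm' : m + 1 ≤ n := ω
  obtain ⟨g, hg⟩ := (mem_T ha hb hm).1 c.2
  have h0 : cut a b (m + 1) (incl (Nat.le_succ m) g) = 0 :=
    (pm_diff ha hb hm' c hg).symm.eq_zero (by rw [LinearMap.mem_ker.1 hc]; rfl)
  obtain ⟨co, hg1⟩ := exists_cut_eq_sum hm ha hb g
  classical
  let good : (Σ _ : ℕ × List ℕ, (ℕ → ℕ)) → Prop := fun z => z ∈ idx n (m + 1) a b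
  have hbad : ∀ z ∈ idx n m a b, ¬ good z → 1 ≤ m ∧ a + 1 ≤ m ∧ b + 1 ≤ m ∧
      z.1.1 ≠ m ∧ z.2 m = 0 := by
    intro z hz hgz
    have h1 := mem_idx.1 hz
    have h2 := mem_wordList (Nat.zero_le b) (by simp) h1.1
    have h3 : ¬ (z.1.1 = m ∨ 0 < z.2 m) := fun h => hgz (mem_idx_succ hz hm' h)
    omega
  have hgood : ∀ z ∈ idx n m a b, good z → co z = 0 := by
    intro z hz hgz
    have h3 := eq_zero_of_sum_cut hm' ω ω
      ((cut_incl_eq_sum hm' ha hb hg1).symm.trans h0) hgz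
    simpa [hz] using h3
  have h2 : (c : ONH K n m) = ∑ z ∈ idx n m a b with ¬ good z, co z • cut a b m (idxElt z) := by
    rw [hg, hg1, Finset.sum_filter]
    refine sum_congr rfl fun z hz => ?_
    by_cases h : good z
    · rw [hgood z hz h, zero_smul, if_neg (not_not.2 h)]
    · rw [if_pos h]
  by_cases hE : ∃ z ∈ idx n m a b, ¬ good z
  swap
  · push Not at hE
    rw [Finset.filter_false_of_mem (fun z hz => not_not.2 (hE z hz)), Finset.sum_empty] at h2
    rw [show c = 0 from Subtype.ext h2]
    exact zero_mem _
  obtain ⟨z₀, hz₀, hgz₀⟩ := hE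
  obtain ⟨h3, h4, h5, -, -⟩ := hbad z₀ hz₀ hgz₀
  obtain ⟨m, rfl⟩ : ∃ m', m = m' + 1 := ⟨m - 1, ω⟩
  have h6 : ∃ h : ONH K n m, (c : ONH K n (m + 1)) = cut a b (m + 1) (incl (Nat.le_succ m) h) := by
    have h7 : ∀ z, ∃ h : ONH K n m, z ∈ idx n (m + 1) a b → ¬ good z →
        idxElt z = incl (Nat.le_succ m) h := by
      intro z
      by_cases h8 : z ∈ idx n (m + 1) a b ∧ ¬ good z
      · obtain ⟨-, -, -, h9, h10⟩ := hbad z h8.1 h8.2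
        obtain ⟨h, hh⟩ := exists_incl_idxElt (K := K) h8.1 h9 h10
        exact ⟨h, fun _ _ => hh⟩
      · exact ⟨0, fun h h' => absurd ⟨h, h'⟩ h8⟩
    choose f hf using h7
    refine ⟨∑ z ∈ idx n (m + 1) a b with ¬ good z, co z • f z, ?_⟩
    rw [h2, map_sum, cut_sum]
    refine sum_congr rfl fun z hz => ?_
    rw [Finset.mem_filter] at hz
    rw [incl_smul, cut_smul ha, hf z hz.1 hz.2]
  obtain ⟨h, hh⟩ := h6
  let c' : T K n a b m := ⟨cut a b m h, (mem_T ω ω ω).2 ⟨h, rfl⟩⟩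
  rcases pm_diff ω ω hm c' (g := h) rfl with h7 | h7
  · exact ⟨c', Subtype.ext (by rw [h7, hh])⟩
  · exact ⟨-c', Subtype.ext (by rw [map_neg, Submodule.coe_neg, h7, neg_neg, hh])⟩

end ONH

/-! ## Gradings -/

section Gradings

variable {K ι V W : Type*} [CommRing K] [DecidableEq ι] [AddCommGroup V] [Module K V]
  [AddCommGroup W] [Module K W] {gV : ι → Submodule K V} {π : ι → V →ₗ[K] V}

/-- `π` are the projections to the components of the grading `gV`. -/
structure GrProj (gV : ι → Submodule K V) (π : ι → V →ₗ[K] V) : Prop where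
  self : ∀ g v, v ∈ gV g → π g v = v
  other : ∀ g h v, g ≠ h → v ∈ gV h → π g v = 0
  top : iSup gV = ⊤

lemma GrProj.induction (H : iSup gV = ⊤) {p : V → Prop} (hm : ∀ g, ∀ v ∈ gV g, p v) (h0 : p 0)
    (ha : ∀ v w, p v → p w → p (v + w)) (v : V) : p v := by
  have hv : v ∈ iSup gV := by rw [H]; trivial
  exact Submodule.iSup_induction gV (motive := p) hv hm h0 ha

lemma GrProj.mem (H : GrProj gV π) (g : ι) (v : V) : π g v ∈ gV g := by
  induction v using GrProj.induction H.top with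
  | hm h v hv =>
    by_cases e : g = h
    · subst e; rw [H.self g v hv]; exact hv
    · rw [H.other g h v e hv]; exact zero_mem _
  | h0 => rw [map_zero]; exact zero_mem _
  | ha v w h1 h2 => rw [map_add]; exact add_mem h1 h2

lemma GrProj.exists_sum (H : GrProj gV π) (v : V) : ∃ s : Finset ι, v = ∑ g ∈ s, π g v := by
  suffices ∃ s : Finset ι, ∀ t, s ⊆ t → v = ∑ g ∈ t, π g v from
    this.imp fun s hs => hs s subset_rfl
  induction v using GrProj.induction H.top with
  | hm h v hv =>
    refine ⟨{h}, fun t ht => ?_⟩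
    rw [Finset.sum_eq_single h, H.self h v hv]
    · exact fun g _ hg => H.other g h v hg hv
    · exact fun h' => absurd (ht (Finset.mem_singleton_self h)) h'
  | h0 => exact ⟨∅, fun t _ => by simp⟩
  | ha v w h1 h2 =>
    obtain ⟨s, hs⟩ := h1
    obtain ⟨s', hs'⟩ := h2
    refine ⟨s ∪ s', fun t ht => ?_⟩
    simp only [map_add, Finset.sum_add_distrib]
    rw [← hs t (Finset.union_subset_left ht), ← hs' t (Finset.union_subset_right ht)]

lemma GrProj.ker (H : GrProj gV π) {g : ι} {v : V} (hv : v ∈ ⨆ (h) (_ : h ≠ g), gV h) :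
    π g v = 0 := by
  have : (⨆ (h) (_ : h ≠ g), gV h) ≤ LinearMap.ker (π g) :=
    iSup_le fun h => iSup_le fun hne => fun w hw => H.other g h w hne.symm hw
  exact this hv

lemma GrProj.internal (H : GrProj gV π) : DirectSum.IsInternal gV := by
  rw [DirectSum.isInternal_submodule_iff_iSupIndep_and_iSup_eq_top]
  refine ⟨fun g => ?_, H.top⟩
  rw [Submodule.disjoint_def]
  exact fun v h1 h2 => by rw [← H.self g v h1, H.ker h2]

lemma exists_grProj (H : DirectSum.IsInternal gV) : ∃ π, GrProj gV π := by
  let := H.chooseDecomposition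
  refine ⟨fun g => (gV g).subtype ∘ₗ DirectSum.component K ι (fun i => gV i) g ∘ₗ
    (DirectSum.decomposeLinearEquiv gV).toLinearMap, fun g v hv => ?_, fun g h v hne hv => ?_,
    H.submodule_iSup_eq_top⟩
  · exact DirectSum.decompose_of_mem_same gV hv
  · exact DirectSum.decompose_of_mem_ne gV hv hne.symm

lemma GrProj.comm (H : GrProj gV π) {gW : ι → Submodule K W} {π' : ι → W →ₗ[K] W}
    (H' : GrProj gW π') (f : V →+ W) {σ : ι → ι} (hσ : σ.Injective)
    (hf : ∀ g, ∀ v ∈ gV g, f v ∈ gW (σ g)) (g : ι) (v : V) : π' (σ g) (f v) = f (π g v) := by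
  induction v using GrProj.induction H.top with
  | hm h v hv =>
    by_cases e : g = h
    · subst e; rw [H.self _ _ hv, H'.self _ _ (hf _ _ hv)]
    · rw [H.other _ _ _ e hv, map_zero, H'.other _ _ _ (fun h' => e (hσ h')) (hf _ _ hv)]
  | h0 => simp
  | ha v w h1 h2 => simp only [map_add, h1, h2]

lemma GrProj.map (H : GrProj gV π) (f : V →ₗ[K] W) (hf : Function.Surjective f)
    (hk : ∀ g v, f v = 0 → f (π g v) = 0) :
    ∃ π', GrProj (fun g => (gV g).map f) π' ∧ ∀ g v, π' g (f v) = f (π g v) := by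
  let E := f.quotKerEquivOfSurjective hf
  let π' : ι → W →ₗ[K] W := fun g => E.toLinearMap ∘ₗ
    (LinearMap.ker f).mapQ (LinearMap.ker f) (π g) (fun v hv => hk g v hv) ∘ₗ E.symm.toLinearMap
  have hE : ∀ v, E (Submodule.Quotient.mk v) = f v := fun v => rfl
  have h1 : ∀ g v, π' g (f v) = f (π g v) := by
    intro g v
    have : E.symm (f v) = Submodule.Quotient.mk v := by rw [← hE, E.symm_apply_apply]
    simp only [π', LinearMap.comp_apply, LinearEquiv.coe_coe, this]
    rfl
  refine ⟨π', ⟨?_, ?_, ?_⟩, h1⟩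
  · rintro g _ ⟨v, hv, rfl⟩; rw [h1, H.self g v hv]
  · rintro g h _ hne ⟨v, hv, rfl⟩; rw [h1, H.other g h v hne hv, map_zero]
  · rw [← Submodule.map_iSup, H.top, Submodule.map_top, LinearMap.range_eq_top.2 hf]

lemma GrProj.comap (H : GrProj gV π) (U : Submodule K V) (hU : ∀ g, ∀ u ∈ U, π g u ∈ U) :
    DirectSum.IsInternal fun g => (gV g).comap U.subtype := by
  refine GrProj.internal (π := fun g => (π g).restrict (hU g)) ⟨fun g v hv => ?_,
    fun g h v hne hv => ?_, ?_⟩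
  · exact Subtype.ext (H.self g v hv)
  · exact Subtype.ext (H.other g h v hne hv)
  · rw [eq_top_iff]
    rintro u -
    obtain ⟨s, hs⟩ := H.exists_sum (u : V)
    have : u = ∑ g ∈ s, ⟨π g u, hU g u u.2⟩ := Subtype.ext (by simpa using hs)
    rw [this]
    exact sum_mem fun g _ => mem_iSup_of_mem g (H.mem g _)

lemma internal_of_injective {gW : ι → Submodule K W} (H : DirectSum.IsInternal gV)
    (f : W →ₗ[K] V) (hf : Function.Injective f) (hg : ∀ g, ∀ w ∈ gW g, f w ∈ gV g)
    (ht : iSup gW = ⊤) : DirectSum.IsInternal gW := by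
  obtain ⟨π, hπ⟩ := exists_grProj H
  rw [DirectSum.isInternal_submodule_iff_iSupIndep_and_iSup_eq_top]
  refine ⟨fun g => ?_, ht⟩
  rw [Submodule.disjoint_def]
  intro w h1 h2
  refine hf ?_
  rw [map_zero, ← hπ.self g _ (hg g w h1)]
  have : (⨆ (h) (_ : h ≠ g), gW h) ≤ (LinearMap.ker (π g)).comap f :=
    iSup_le fun h => iSup_le fun hne => fun w hw => hπ.other g h _ hne.symm (hg h w hw)
  exact this h2

end Gradings

lemma mul_mem_iSup {A : Type*} [Ring A] [Algebra K A] {g : ℤ × ZMod 2 → Submodule K A}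
    (h : ∀ {i j a b}, a ∈ g i → b ∈ g j → a * b ∈ g (i + j)) {a b : A} (ha : a ∈ ⨆ i, g i)
    (hb : b ∈ ⨆ i, g i) : a * b ∈ ⨆ i, g i := by
  have := Submodule.mul_mem_mul ha hb
  rw [Submodule.iSup_mul] at this
  refine (iSup_le fun i => ?_ : _ ≤ ⨆ i, g i) this
  rw [Submodule.mul_iSup]
  exact iSup_le fun j => (Submodule.mul_le.2 fun a ha b hb => h ha hb).trans (le_iSup g (i + j))

namespace ONH

lemma homog_mul {g h : ℤ × ZMod 2} {y z : ONH K n m} (hy : y ∈ homog K n m g)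
    (hz : z ∈ homog K n m h) : y * z ∈ homog K n m (g + h) := by
  have h1 : homog K n m g * homog K n m h ≤ homog K n m (g + h) := by
    rw [homog, homog, Submodule.span_mul_span]
    refine span_mono ?_
    rintro _ ⟨_, ⟨v, hv, rfl⟩, _, ⟨w, hw, rfl⟩, rfl⟩
    exact ⟨v ++ w, by simp [hv, hw], by simp⟩
  exact h1 (Submodule.mul_mem_mul hy hz)

lemma one_mem_homog : (1 : ONH K n m) ∈ homog K n m 0 := subset_span ⟨[], by simp⟩

lemma gen_mem_homog (g : Gen n m) : (gen g : ONH K n m) ∈ homog K n m g.deg :=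
  subset_span ⟨[g], by simp⟩

lemma iSup_homog : (⨆ g, homog K n m g) = ⊤ := by
  rw [eq_top_iff]
  rintro h -
  induction h using ONH.induction with
  | hc r =>
    rw [Algebra.algebraMap_eq_smul_one]
    exact mem_iSup_of_mem 0 (smul_mem _ _ one_mem_homog)
  | hg g => exact mem_iSup_of_mem _ (gen_mem_homog g)
  | ha a b h1 h2 => exact add_mem h1 h2
  | hm a b h1 h2 => exact mul_mem_iSup (g := homog K n m) homog_mul h1 h2

open AddMonoidAlgebra in
lemma coact_sys : Sys n m (fun i => single (2, 1) (x i : ONH K n m) : ℕ → AddMonoidAlgebra _ (ℤ × ZMod 2))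
    (fun i => single (-2, 1) (tau i)) (fun i => single (4 * (i : ℤ), 0) (chi i))
    (single (2, 1) d) := by
  have H := sysOf K n m
  have sm := @single_mul_single (ONH K n m) (ℤ × ZMod 2) _ _
  have hz : ((2, 1) + (-2, 1) : ℤ × ZMod 2) = 0 := by decide
  have hz' : ((-2, 1) + (2, 1) : ℤ × ZMod 2) = 0 := by decide
  constructor
  · simp only [H.chi_zero]; rfl
  · intro i h1 h2
    rw [sm, H.tau_sq i h1 h2, single_zero]
  · intro i h1 h2
    rw [sm, sm, sm, sm, H.braid i h1 h2]
  · intro i h1 h2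
    rw [sm, sm, hz, hz', ← single_add, H.x_tau i h1 h2]; rfl
  · intro i h1 h2
    rw [sm, sm, hz, hz', ← single_add, H.tau_x i h1 h2]; rfl
  · intro i j h1 h2 h3 h4 h
    rw [sm, sm, ← single_add, H.x_x i j h1 h2 h3 h4 h, single_zero]
  · intro i j h1 h2 h3 h4 h
    rw [sm, sm, ← single_add, H.tau_tau i j h1 h2 h3 h4 h, single_zero]
  · intro i j h1 h2 h3 h4 h h'
    rw [sm, sm, hz, hz', ← single_add,
      H.x_tau_far i j h1 h2 h3 h4 h h', single_zero]
  · rw [sm, H.d_sq, single_zero]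
  · intro h
    rw [sm, H.d_chi_top h, single_zero]
  · intro i j h1 h2 h3 h4
    rw [sm, sm, H.chi_chi i j h1 h2 h3 h4, add_comm]
  · intro i h1 h2
    rw [sm, sm, H.chi_d i h1 h2, add_comm]
  · intro i j h1 h2 h3 h4
    rw [sm, sm, H.x_chi i j h1 h2 h3 h4, add_comm]
  · intro i j h1 h2 h3 h4
    rw [sm, sm, H.tau_chi i j h1 h2 h3 h4, add_comm]
  · intro i h1 h2
    rw [sm, sm, H.x_d i h1 h2, single_neg]
  · intro i h1 h2
    rw [sm, sm, H.tau_d i h1 h2, single_neg, add_comm]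

open AddMonoidAlgebra in
/-- The coaction which encodes the grading. -/
def coact : ONH K n m →ₐ[K] AddMonoidAlgebra (ONH K n m) (ℤ × ZMod 2) := lift coact_sys fun hm => by
    have hc : ∀ r, cOf (fun i => single (4 * (i : ℤ), 0) (chi i) : ℕ → AddMonoidAlgebra (ONH K n m)
        (ℤ × ZMod 2)) (single (2, 1) d) r = single (2 * (r : ℤ), (r : ZMod 2)) (cOf chi d r) := by
      intro r
      unfold cOf
      split_ifs with h
      · obtain ⟨s, rfl⟩ := h
        have : (s + s) / 2 = s := ω
        have e : ((4 * (s : ℤ), 0) : ℤ × ZMod 2) = (2 * ((s + s : ℕ) : ℤ), ((s + s : ℕ) : ZMod 2)) := by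
          ext
          · simp; ring
          · simpa using (CharTwo.add_self_eq_zero (s : ZMod 2)).symm
        rw [this, ← e]
      · obtain ⟨s, rfl⟩ := Nat.not_even_iff_odd.1 h
        rw [single_mul_single]
        have : (2 * s + 1) / 2 = s := ω
        rw [this]
        congr 1
        ext
        · simp; ring
        · have h2 : (2 : ZMod 2) = 0 := rfl
          simp [h2]
    have h1 : aOf n (fun i => single (4 * (i : ℤ), 0) (chi i)) (single (2, 1) d)
        (single (2, 1) (x 1) : AddMonoidAlgebra (ONH K n m) (ℤ × ZMod 2))
        = single (2 * (n : ℤ), (n : ZMod 2)) (aOf n chi d (x 1)) := by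
      have hs : ∀ s : Finset ℕ, ∀ f : ℕ → ONH K n m, ∑ l ∈ s, single (2 * (n : ℤ), (n : ZMod 2)) (f l)
          = single (2 * (n : ℤ), (n : ZMod 2)) (∑ l ∈ s, f l) := fun s f =>
        (map_sum (singleAddHom (2 * (n : ℤ), (n : ZMod 2))) f s).symm
      rw [aOf, aOf, ← hs]
      refine sum_congr rfl fun l hl => ?_
      rw [mem_range] at hl
      rw [hc, single_pow, mul_assoc, single_mul_single, mul_assoc]
      have e : l • ((2, 1) : ℤ × ZMod 2) + (2 * ((n - l : ℕ) : ℤ), ((n - l : ℕ) : ZMod 2))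
          = (2 * (n : ℤ), (n : ZMod 2)) := by
        have e1 : ((n - l : ℕ) : ℤ) = n - l := by push_cast [show l ≤ n by omega]; ring
        have e2 : ((n - l : ℕ) : ZMod 2) = n - l := by
          rw [Nat.cast_sub ω]
        rw [e1, e2]
        ext
        · simp; ring
        · simp
      rw [e]
      rcases Nat.even_or_odd l with h | h
      · rw [h.neg_one_pow, h.neg_one_pow, one_mul, one_mul]
      · rw [h.neg_one_pow, h.neg_one_pow, neg_mul, one_mul, neg_mul, one_mul, single_neg]
    rw [h1, aOf_x_one hm, single_zero]

open AddMonoidAlgebra in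
lemma coact_of_mem {h : ONH K n m} (hh : h ∈ homog K n m g) :
    coact h = single g h := by
  induction hh using span_induction with
  | mem y hy =>
    obtain ⟨w, hw, rfl⟩ := hy
    rw [← hw]
    clear hw
    induction w with
    | nil => simp [one_def]
    | cons a w ih =>
      simp only [List.map_cons, List.prod_cons, List.sum_cons, map_mul, ih]
      have : coact (gen a : ONH K n m) = single a.deg (gen a) := by
        rw [coact, lift_gen]
        cases a with
        | x i => rw [gen_x]; rfl
        | tau i => rw [gen_tau]; rfl
        | chi i => rw [gen_chi, liftGen, Gen.deg]; push_cast; rfl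
        | d => rfl
      rw [this, single_mul_single]
  | zero => simp
  | add a b _ _ h1 h2 => rw [map_add, h1, h2, single_add]
  | smul r a _ h => rw [map_smul, h, smul_single]

/-- The projections to the homogeneous components. -/
def proj (g : ℤ × ZMod 2) : ONH K n m →ₗ[K] ONH K n m where
  toFun h := (coact h).coeff g
  map_add' a b := by rw [map_add]; rfl
  map_smul' r a := by rw [map_smul]; rfl

lemma grProj : GrProj (homog K n m) proj where
  self g v hv := by
    change (coact v).coeff g = v
    rw [coact_of_mem hv]; exact Finsupp.single_eq_same
  other g h v hne hv := by
    change (coact v).coeff g = 0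
    rw [coact_of_mem hv]; exact Finsupp.single_eq_of_ne hne
  top := iSup_homog

end ONH

/-! ## A criterion for invertibility -/

section Morita

section BalancedEquiv

variable {S R P Q : Type u} [Ring S] [Algebra K S] [Ring R]
  [AddCommGroup P] [Module K P] [Module S P] [Module Rᵐᵒᵖ P] [IsScalarTower K S P]
  [AddCommGroup Q] [Module K Q] [Module R Q] [Module Sᵐᵒᵖ Q]

lemma exists_balancedEquiv (F : P →ₗ[K] Q →ₗ[K] S) (G : Q → P → R)
    (hb : ∀ p (r : R) q, F (op r • p) q = F p (r • q))
    (hs : ∀ (s : S) p q, F (s • p) q = s * F p q)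
    (h1 : ∀ p q p', F p q • p' = op (G q p') • p)
    (h2 : ∀ p q q', G q p • q' = op (F p q') • q)
    (hF : (1 : S) ∈ LinearMap.range (TensorProduct.lift F)) :
    ∃ f : BalancedTensor K R P Q ≃ₗ[K] S, ∀ p q, f (btmul R p q) = F p q := by
  obtain ⟨u, hu⟩ := hF
  let f : BalancedTensor K R P Q →ₗ[K] S := (balancedRel K R P Q).liftQ (TensorProduct.lift F) (by
    rw [balancedRel, span_le]
    rintro _ ⟨p, r, q, rfl⟩
    simp [hb])
  have hf : ∀ p q, f (btmul R p q) = F p q := fun p q => rfl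
  let L : S →ₗ[K] P ⊗[K] Q →ₗ[K] P ⊗[K] Q :=
    LinearMap.rTensorHom Q ∘ₗ (Algebra.lsmul K K P : S →ₐ[K] Module.End K P).toLinearMap
  let inv : S →ₗ[K] BalancedTensor K R P Q := (balancedRel K R P Q).mkQ ∘ₗ L.flip u
  have key : ∀ p q (v : P ⊗[K] Q), (balancedRel K R P Q).mkQ (L (F p q) v)
      = btmul R p (op (TensorProduct.lift F v) • q) := by
    intro p q v
    induction v with
    | zero => simp [btmul]
    | add v w h1 h2 =>
      rw [map_add, map_add, h1, h2, map_add, op_add, add_smul]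
      simp only [btmul, TensorProduct.tmul_add, map_add]
    | tmul p' q' =>
      have : L (F p q) (p' ⊗ₜ q') = (F p q • p') ⊗ₜ q' := rfl
      rw [this, h1, TensorProduct.lift.tmul, ← h2, btmul, ← sub_eq_zero, ← map_sub]
      exact (Submodule.Quotient.mk_eq_zero _).2 (subset_span ⟨p, _, q', rfl⟩)
  have key' : ∀ s (v : P ⊗[K] Q), TensorProduct.lift F (L s v) = s * TensorProduct.lift F v := by
    intro s v
    induction v with
    | zero => simp
    | add v w h1 h2 => simp only [map_add, h1, h2, mul_add]
    | tmul p q => exact hs s p q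
  refine ⟨LinearEquiv.ofLinearMap f inv ?_ ?_, hf⟩
  · refine LinearMap.ext fun s => ?_
    have : f (inv s) = TensorProduct.lift F (L s u) := rfl
    simp [this, key', hu]
  · refine Submodule.linearMap_qext _ (TensorProduct.ext' fun p q => ?_)
    have : inv (F p q) = btmul R p q := by
      have := key p q u
      rw [hu, op_one, one_smul] at this
      exact this
    exact (congrArg inv (hf p q)).trans this

end BalancedEquiv

section Dual

variable {S R P : Type u} [Ring S] [Algebra K S] [Ring R] [Algebra K R]
  [AddCommGroup P] [Module K P] [Module S P] [Module Rᵐᵒᵖ P]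
  {gS : ℤ × ZMod 2 → Submodule K S} {gR : ℤ × ZMod 2 → Submodule K R}
  {gP : ℤ × ZMod 2 → Submodule K P}

/-- The left action of `R` on the dual of an `(S, R)`-bimodule. -/
@[reducible] def dualModule [SMulCommClass Rᵐᵒᵖ S P] : Module R (P →ₗ[S] S) where
  smul r φ := φ ∘ₗ DistribSMul.toLinearMap S P (op r)
  one_smul φ := by ext p; exact congrArg φ (one_smul _ p)
  mul_smul r r' φ := by ext p; exact congrArg φ (mul_smul (op r') (op r) p)
  smul_zero r := rfl
  smul_add r φ φ' := rfl
  add_smul r r' φ := by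
    ext p; exact (congrArg φ (add_smul (op r) (op r') p)).trans (map_add φ _ _)
  zero_smul φ := by ext p; exact (congrArg φ (zero_smul Rᵐᵒᵖ p)).trans (map_zero φ)

attribute [local instance] dualModule

theorem isInvertible_of_generator (hP : IsGradedBimodule gS gR gP)
    (hS : DirectSum.IsInternal gS) (hR : DirectSum.IsInternal gR)
    (mS : ∀ g h, ∀ s ∈ gS g, ∀ t ∈ gS h, s * t ∈ gS (g + h))
    {e' : S} {e : R} {c : P} {γ : ℤ × ZMod 2} (he' : e' ∈ gS 0) (he : e ∈ gR 0) (hc : c ∈ gP γ)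
    (ee' : e' * e' = e') (ee : e * e = e)
    (full' : (1 : S) ∈ span K {s | ∃ y z, s = y * e' * z})
    (full : (1 : R) ∈ span K {s | ∃ y z, s = y * e * z})
    (e'c : e' • c = c) (ce : op e • c = c)
    (gen : ∀ p : P, ∃ s : S, op e • p = s • c)
    (gen' : ∀ p : P, ∃ r : R, e' • p = op r • c)
    (ann : ∀ s : S, s • c = 0 → s * e' = 0)
    (ann' : ∀ r : R, op r • c = 0 → e * r = 0) : IsInvertible gS gR gP := by
  refine ⟨hP, ?_⟩
  have : IsScalarTower K S P := .of_algebraMap_smul hP.algebraMap_smul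
  have : IsScalarTower K Rᵐᵒᵖ P := .of_algebraMap_smul hP.algebraMap_op_smul
  have : SMulCommClass S Rᵐᵒᵖ P := ⟨fun s r p => hP.smul_op_smul s r.unop p⟩
  have : SMulCommClass Rᵐᵒᵖ S P := .symm _ _ _
  obtain ⟨πS, HS⟩ := exists_grProj hS
  obtain ⟨πR, HR⟩ := exists_grProj hR
  obtain ⟨πP, HP⟩ := exists_grProj hP.isInternal
  choose s hs using gen
  choose r hr using gen'
  -- the dual generators
  have es : ∀ {y z : S}, y • c = z • c → y * e' = z * e' := fun {y z} h => by
    rw [← sub_eq_zero, ← sub_mul]; exact ann _ (by rw [sub_smul, h, sub_self])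
  have er : ∀ {y z : R}, op y • c = op z • c → e * y = e * z := fun {y z} h => by
      rw [← sub_eq_zero, ← mul_sub]
      exact ann' _ (by rw [op_sub, sub_smul, h, sub_self])
  let δ : P →ₗ[S] S :=
    { toFun := fun p => s p * e'
      map_add' := fun p q => by rw [← add_mul]; exact es (by rw [add_smul, ← hs, ← hs, ← hs, smul_add])
      map_smul' := fun y p => by
        rw [RingHom.id_apply, smul_eq_mul, ← mul_assoc]
        exact es (by rw [mul_smul, ← hs, ← hs, smul_comm]) }
  let ε : P → R := fun p => e * r p
  have δc : ∀ p, δ p • c = op e • p := fun p => by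
    change (s p * e') • c = _
    rw [mul_smul, e'c, hs]
  have δe : ∀ p, δ p * e' = δ p := fun p => by
    change s p * e' * e' = s p * e'
    rw [mul_assoc, ee']
  have εc : ∀ p, op (ε p) • c = e' • p := fun p => by
    change op (e * r p) • c = _
    rw [op_mul, mul_smul, ce, hr]
  have eε : ∀ p, e * ε p = ε p := fun p => by
    change e * (e * r p) = _
    rw [← mul_assoc, ee]
  have δ1 : δ c = e' := by
    change s c * e' = e'
    rw [es (z := 1) (by rw [← hs, ce, one_smul]), one_mul]
  -- homogeneity of the dual generators
  have δg : ∀ g p, p ∈ gP (g + γ) → δ p ∈ gS g := by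
    intro g p hp
    have h0 : op e • p ∈ gP (g + γ) := by
      simpa using hP.op_smul_mem _ _ _ _ hp he
    have h2 : ∀ y, πP (g + γ) (y • c) = πS g y • c :=
      HS.comm HP ((smulAddHom S P).flip c) (add_left_injective γ)
        (fun _ _ hy => hP.smul_mem _ _ _ _ hy hc) g
    have h1 : δ p = πS g (s p) * e' := by
      refine es ?_
      rw [← h2, ← hs, HP.self _ _ h0]
    rw [h1]
    simpa using mS _ _ _ (HS.mem g (s p)) _ he'
  let gQ : ℤ × ZMod 2 → Submodule K (P →ₗ[S] S) := fun g =>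
    { carrier := {φ | ∀ h, ∀ p ∈ gP h, φ p ∈ gS (g + h)}
      add_mem' := fun h1 h2 h p hp => add_mem (h1 h p hp) (h2 h p hp)
      zero_mem' := fun h p hp => zero_mem _
      smul_mem' := fun k φ h1 h p hp => smul_mem _ k (h1 h p hp) }
  have Rs : ∀ (y : R) (φ : P →ₗ[S] S) p, (y • φ) p = φ (op y • p) := fun _ _ _ => rfl
  have Ss : ∀ (y : S) (φ : P →ₗ[S] S) p, (op y • φ) p = φ p * y := fun _ _ _ => rfl
  have δQ : δ ∈ gQ (-γ) := fun h p hp => δg _ _ (by rwa [add_comm (-γ) h, neg_add_cancel_right])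
  have RQ : ∀ g h, ∀ y ∈ gR g, ∀ φ ∈ gQ h, y • φ ∈ gQ (g + h) := by
    intro g h y hy φ hφ j p hp
    have := hφ _ _ (hP.op_smul_mem _ _ _ _ hp hy)
    rwa [show h + (j + g) = g + h + j by abel] at this
  have SQ : ∀ g h, ∀ φ ∈ gQ g, ∀ y ∈ gS h, op y • φ ∈ gQ (g + h) := by
    intro g h φ hφ y hy j p hp
    have := mS _ _ _ (hφ _ _ hp) _ hy
    rwa [show g + j + h = g + h + j by abel] at this
  -- the dual is generated by `δ`
  have hgen : ∀ (p : (P →ₗ[S] S) → Prop), (∀ (y : R) (z : S), p (y • op z • δ)) →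
      p 0 → (∀ φ φ', p φ → p φ' → p (φ + φ')) → (∀ (k : K) φ, p φ → p (k • φ)) → ∀ φ, p φ := by
    intro p hm h0 ha hk φ
    suffices ∀ w ∈ span K {s | ∃ y z, s = y * e * z}, p ((w : R) • φ) by
      simpa using this 1 full
    intro w hw
    induction hw using span_induction with
    | mem w hw =>
      obtain ⟨y, z, rfl⟩ := hw
      convert hm y (φ (op z • c)) using 1
      ext q
      have h1 : δ (op y • q) * φ (op z • c)
          = φ (δ (op y • q) • op z • c) := (map_smul φ _ _).symm
      rw [Rs, Rs, Ss, h1, smul_comm, δc, ← mul_smul, ← mul_smul, ← op_mul, ← op_mul, mul_assoc]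
    | zero => simpa using h0
    | add v w _ _ h1 h2 => rw [add_smul]; exact ha _ _ h1 h2
    | smul k w _ h =>
      convert hk k _ h using 1
      ext q
      simp only [Rs, op_smul, smul_assoc, LinearMap.smul_apply]
      rw [← hP.algebraMap_smul, map_smul, smul_eq_mul, ← Algebra.smul_def]
  have hQ : IsGradedBimodule gR gS gQ := by
    refine ⟨?_, fun g h y φ => fun h1 h2 => RQ g h y h1 φ h2,
      fun g h y φ => fun h1 h2 => SQ g h φ h1 y h2, fun y z φ => rfl, fun k φ => ?_, fun k φ => ?_⟩
    · rw [DirectSum.isInternal_submodule_iff_iSupIndep_and_iSup_eq_top]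
      constructor
      · intro g
        rw [Submodule.disjoint_def]
        intro φ h1 h2
        ext p
        induction p using GrProj.induction HP.top with
        | hm j p hp =>
          have h3 : (⨆ (h) (_ : h ≠ g), gQ h) ≤
              LinearMap.ker (πS (g + j) ∘ₗ (LinearMap.applyₗ' K p : (P →ₗ[S] S) →ₗ[K] S)) :=
            iSup_le fun h => iSup_le fun hne => fun φ' hφ' =>
              HS.other _ _ _ (fun e => hne (add_right_cancel e).symm) (hφ' j p hp)
          have h4 : πS (g + j) (φ p) = 0 := h3 h2
          rw [← HS.self _ _ (h1 j p hp), h4]; rfl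
        | h0 => simp
        | ha p q h1 h2 => rw [map_add, map_add, h1, h2]
      · rw [eq_top_iff]
        rintro φ -
        refine hgen (fun φ => φ ∈ iSup gQ) (fun y z => ?_) (zero_mem _) (fun _ _ => add_mem)
          (fun k _ => smul_mem _ k) φ
        induction y using GrProj.induction HR.top with
        | hm g y hy =>
          induction z using GrProj.induction HS.top with
          | hm h z hz => exact mem_iSup_of_mem _ (RQ _ _ _ hy _ (SQ _ _ _ δQ _ hz))
          | h0 => rw [op_zero, zero_smul, smul_zero]; exact zero_mem _
          | ha v w h1 h2 => rw [op_add, add_smul, smul_add]; exact add_mem h1 h2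
        | h0 => rw [zero_smul]; exact zero_mem _
        | ha v w h1 h2 => rw [add_smul]; exact add_mem h1 h2
    · ext p
      rw [Rs, hP.algebraMap_op_smul, ← hP.algebraMap_smul, map_smul, smul_eq_mul,
        ← Algebra.smul_def]; rfl
    · ext p
      rw [Ss, ← Algebra.commutes, ← Algebra.smul_def]; rfl
  -- the second pairing
  have uniq : ∀ y z : R, (∀ p : P, op y • p = op z • p) → y = z := by
    intro y z h
    suffices ∀ w ∈ span K {s | ∃ y z, s = y * e * z}, (w : R) * (y - z) = 0 by
      simpa [sub_eq_zero] using this 1 full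
    intro w hw
    induction hw using span_induction with
    | mem w hw =>
      obtain ⟨a, b, rfl⟩ := hw
      have h1 : e * (b * y) = e * (b * z) := er (by
        rw [op_mul, mul_smul, h, op_mul, mul_smul])
      rw [mul_assoc, mul_assoc, mul_sub b, mul_sub e, h1, sub_self, mul_zero]
    | zero => simp
    | add v w _ _ h1 h2 => rw [add_mul, h1, h2, add_zero]
    | smul k w _ h => rw [smul_mul_assoc, h, smul_zero]
  have ex : ∀ (φ : P →ₗ[S] S) (p : P), ∃ y : R, ∀ p', φ p' • p = op y • p' := by
    intro φ p
    refine hgen (fun φ => ∃ y : R, ∀ p', φ p' • p = op y • p') (fun y z => ?_)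
      ⟨0, fun p' => by simp⟩ (fun φ φ' h h' => ?_) (fun k φ h => ?_) φ
    · refine ⟨y * ε (z • p), fun p' => ?_⟩
      have h1 : op (ε (z • p)) • δ (op y • p') • c
          = δ (op y • p') • op (ε (z • p)) • c := smul_comm _ _ _
      rw [Rs, Ss, mul_smul, ← eε, op_mul, op_mul, mul_smul, mul_smul, ← δc,
        h1, εc, ← mul_smul (δ _) e', δe]
    · obtain ⟨y, hy⟩ := h
      obtain ⟨y', hy'⟩ := h'
      exact ⟨y + y', fun p' => by
        rw [LinearMap.add_apply, add_smul, hy, hy', op_add, add_smul]⟩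
    · obtain ⟨y, hy⟩ := h
      exact ⟨k • y, fun p' => by
        rw [LinearMap.smul_apply, smul_assoc, hy, op_smul, smul_assoc]⟩
  choose G0 hG0 using ex
  have hk : ∀ (s : S) (k : K) (p : P), s • k • p = k • s • p := fun s k p => by
    rw [← hP.algebraMap_smul, ← hP.algebraMap_smul, ← mul_smul, ← mul_smul, Algebra.commutes]
  let G : (P →ₗ[S] S) →ₗ[K] P →ₗ[K] R := LinearMap.mk₂ K G0
    (fun φ φ' p => uniq _ _ fun p' => by
      rw [← hG0, op_add, add_smul, ← hG0, ← hG0, LinearMap.add_apply, add_smul])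
    (fun k φ p => uniq _ _ fun p' => by
      rw [← hG0, op_smul, smul_assoc, ← hG0, LinearMap.smul_apply, smul_assoc])
    (fun φ p q => uniq _ _ fun p' => by
      rw [← hG0, op_add, add_smul, ← hG0, ← hG0, smul_add])
    (fun k φ p => uniq _ _ fun p' => by
      rw [← hG0, op_smul, smul_assoc, ← hG0, hk])
  have hG : ∀ φ p p', φ p' • p = op (G φ p) • p' := hG0
  let F : P →ₗ[K] (P →ₗ[S] S) →ₗ[K] S := LinearMap.mk₂ K (fun p φ => φ p)
    (fun p q φ => map_add φ p q)
    (fun k p φ => by rw [← hP.algebraMap_smul, map_smul, smul_eq_mul, ← Algebra.smul_def])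
    (fun p φ φ' => rfl) (fun k p φ => rfl)
  have hFa : ∀ p φ, F p φ = φ p := fun _ _ => rfl
  have Gy : ∀ (y : R) φ p, G (y • φ) p = y * G φ p := fun y φ p => uniq _ _ fun p' => by
    rw [← hG, Rs, hG, op_mul, mul_smul]
  have Gz : ∀ φ p (y : R), G φ (op y • p) = G φ p * y := fun φ p y =>
    uniq _ _ fun p' => by rw [← hG, smul_comm, hG, op_mul, mul_smul]
  have assoc : ∀ p φ φ', G φ p • φ' = op (F p φ') • φ := fun p φ φ' => by
    ext p'
    rw [Rs, Ss, ← hG, map_smul, hFa, smul_eq_mul]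
  have hFr : (1 : S) ∈ LinearMap.range (TensorProduct.lift F) := by
    refine span_le.2 ?_ full'
    rintro _ ⟨y, z, rfl⟩
    exact ⟨(y • c) ⊗ₜ (op z • δ), by
      rw [TensorProduct.lift.tmul, hFa, Ss, map_smul, δ1, smul_eq_mul]⟩
  have hGr : (1 : R) ∈ LinearMap.range (TensorProduct.lift G) := by
    refine span_le.2 ?_ full
    rintro _ ⟨y, z, rfl⟩
    refine ⟨(y • δ) ⊗ₜ (op z • c), ?_⟩
    rw [TensorProduct.lift.tmul, Gy, Gz, mul_assoc, uniq (G δ c) e fun p' => ?_]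
    rw [← hG, δc]
  obtain ⟨f, hf⟩ := exists_balancedEquiv F (fun φ p => G φ p) (fun _ _ _ => rfl)
    (fun y p φ => map_smul φ y p) (fun p φ p' => hG φ p' p) assoc hFr
  have : IsScalarTower K R (P →ₗ[S] S) := .of_algebraMap_smul hQ.algebraMap_smul
  obtain ⟨g, hg⟩ := exists_balancedEquiv G (fun p φ => F p φ)
    (fun φ y p => uniq _ _ fun p' => by rw [← hG, ← hG, Ss, mul_smul])
    (fun y φ p => Gy y φ p) (fun φ p φ' => assoc p φ φ') (fun φ p p' => hG φ p' p) hGr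
  refine ⟨P →ₗ[S] S, inferInstance, inferInstance, inferInstance, inferInstance, gQ, hQ,
    ⟨f, ⟨fun y p φ => ?_, fun y p φ => ?_, fun g h p φ hp hφ => ?_⟩⟩,
    ⟨g, ⟨fun y φ p => ?_, fun y φ p => ?_, fun i j φ p hφ hp => ?_⟩⟩⟩
  · rw [hf, hf, hFa, map_smul, smul_eq_mul, hFa]
  · rw [hf, hf, hFa, Ss, hFa]
  · rw [hf, hFa, add_comm]; exact hφ g p hp
  · rw [hg, hg, Gy]
  · rw [hg, hg, Gz]
  · rw [hg]
    have h1 : ∀ l k y p', p' ∈ gP l → πP (l + k) (op y • p')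
        = op (πR k y) • p' := by
      intro l k y p' hp'
      exact HR.comm HP (AddMonoidHom.mk' (fun y => op y • p') fun y z => by rw [op_add, add_smul])
        (add_right_injective l) (fun _ _ hy => hP.op_smul_mem _ _ _ _ hp' hy) k y
    have h2 : G φ p = πR (i + j) (G φ p) := uniq _ _ fun p' => by
      induction p' using GrProj.induction HP.top with
      | hm l p' hp' =>
        rw [← h1 _ _ _ _ hp', ← hG, HP.self]
        have := hP.smul_mem _ _ _ _ (hφ l p' hp') hp
        rwa [show i + l + j = l + (i + j) by abel] at this
      | h0 => simp
      | ha y z h1 h2 => simp only [smul_add, h1, h2]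
    rw [h2]
    exact HR.mem _ _

end Dual

end Morita

/-! ## The top cohomology -/

lemma wordList_le {B : ℕ} {z : ℕ × List ℕ} (hz : z ∈ wordList s q B v) :
    z.1 ≤ B + s := by
  induction s generalizing q B v with
  | zero =>
    simp only [wordList, List.mem_singleton] at hz
    subst hz; exact le_rfl
  | succ s ih =>
    rw [wordList, List.mem_append, List.mem_flatMap] at hz
    rcases hz with ⟨j, -, hz⟩ | hz
    · have := ih hz; omega
    · have := ih hz; omega

lemma wordList_top {Q : Type*} [Monoid Q] {T : ℕ → Q} {z : ℕ × List ℕ}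
    (hz : z ∈ wordList s q (q + b) v) (hs : z.1 = q + b + s) (hv : wd T v = crossing T b q) :
    wd T z.2 = crossing T b (q + s) := by
  induction s generalizing q v with
  | zero =>
    simp only [wordList, List.mem_singleton] at hz
    subst hz; exact hv
  | succ s ih =>
    rw [wordList, List.mem_append, List.mem_flatMap] at hz
    rcases hz with ⟨j, -, hz⟩ | hz
    · have := wordList_le hz; omega
    · rw [show q + b + 1 = q + 1 + b by omega, show q + b - q = b by omega] at hz
      rw [ih hz ω (by rw [wd_append, ← asc_eq_wd, hv]; rfl)]
      congr 1; omega

lemma exists_wordList_top (s q b : ℕ) (v : List ℕ) : ∃ w, (q + b + s, w) ∈ wordList s q (q + b) v := by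
  induction s generalizing q v with
  | zero => exact ⟨v, by simp [wordList]⟩
  | succ s ih =>
    obtain ⟨w, hw⟩ := ih (q + 1) (List.range' (q + 1) b ++ v)
    refine ⟨w, ?_⟩
    rw [wordList, List.mem_append, show q + b - q = b by omega]
    right
    rwa [show q + 1 + b + s = q + b + (s + 1) by omega, show q + 1 + b = q + b + 1 by omega] at hw

section

variable {E : Type*} [Ring E] {x τ χ : ℕ → E} {d : E} (H : Sys n k x τ χ d)
include H

lemma Sys.sq_crossing (b a : ℕ) : sq (crossing τ b a) = crossing (fun i => sq (τ i)) b a :=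
  map_crossing (T := τ) sq a b

lemma Sys.tau_crossing (hk : a + b ≤ k) (h1 : 1 ≤ j) (h2 : j < b) :
    PM (τ (a + j) * crossing τ b a) (crossing τ b a * τ j) := by
  rw [← sq_eq, map_mul, map_mul, H.sq_crossing]
  exact H.nilCox.T_crossing hk h1 h2

lemma Sys.crossing_tau (hk : a + b ≤ k) (h1 : 1 ≤ i) (h2 : i < a) :
    PM (crossing τ b a * τ (b + i)) (τ i * crossing τ b a) := by
  rw [← sq_eq, map_mul, map_mul, H.sq_crossing]
  exact H.nilCox.crossing_T hk h1 h2

lemma Sys.tl_crossing (hk : a + b ≤ k) (hl : 1 ≤ l) (hN : N = 0 ∨ l + N ≤ b) :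
    PM (tl τ (a + l) N * crossing τ b a) (crossing τ b a * tl τ l N) := by
  rw [← sq_eq, map_mul, map_mul, sq_tl, sq_tl, H.sq_crossing]
  have key : ∀ l N, 1 ≤ l → l + N ≤ b → asc (fun i => sq (τ i)) (a + l) N *
      crossing (fun i => sq (τ i)) b a = crossing (fun i => sq (τ i)) b a *
        asc (fun i => sq (τ i)) l N := by
    intro l N hl hN
    induction N with
    | zero => simp
    | succ N ih =>
      rw [asc_succ, asc_succ, mul_assoc, add_assoc,
        H.nilCox.T_crossing hk ω ω, ← mul_assoc, ih ω, mul_assoc]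
  induction N with
  | zero => simp
  | succ N ih =>
    rw [tl_succ, tl_succ, mul_assoc, ih ω, ← mul_assoc, key l (N + 1) hl ω, mul_assoc]

lemma Sys.crossing_tl (hk : a + b ≤ k) (hl : 1 ≤ l) (hN : N = 0 ∨ l + N ≤ a) :
    PM (crossing τ b a * tl τ (b + l) N) (tl τ l N * crossing τ b a) := by
  rw [← sq_eq, map_mul, map_mul, sq_tl, sq_tl, H.sq_crossing]
  have key : ∀ l N, 1 ≤ l → l + N ≤ a → crossing (fun i => sq (τ i)) b a *
      asc (fun i => sq (τ i)) (b + l) N = asc (fun i => sq (τ i)) l N *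
        crossing (fun i => sq (τ i)) b a := by
    intro l N hl hN
    induction N with
    | zero => simp
    | succ N ih =>
      rw [asc_succ, asc_succ, ← mul_assoc, ih ω, mul_assoc, add_assoc,
        H.nilCox.crossing_T hk ω ω, mul_assoc]
  induction N with
  | zero => simp
  | succ N ih =>
    rw [tl_succ, tl_succ, ← mul_assoc, key l (N + 1) hl ω, mul_assoc, ih ω, mul_assoc]

lemma Sys.crossing_op (hk : a + b ≤ k) :
    PM (crossing (fun i => op (τ i)) a b) (op (crossing τ b a)) := by
  induction b with
  | zero =>
    have : ∀ a, crossing τ 0 a = 1 := fun a => by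
      induction a with
      | zero => rfl
      | succ a ih => rw [crossing, ih, asc_zero, mul_one]
    rw [this]; exact .inl rfl
  | succ b ih =>
    have h1 : PM (crossing τ (b + 1) a) (crossing τ b a * desc τ (b + 1) a) := by
      rw [← sq_eq, map_mul, H.sq_crossing, H.sq_crossing, sq_desc]
      exact H.nilCox.crossing_succ ω
    rw [crossing, asc_op]
    refine ((ih ω).mul_left _).trans ?_
    rw [← op_mul]
    rcases h1 with h | h
    · exact .inl (by rw [h])
    · exact .inr (by rw [h, op_neg, neg_neg])

end

namespace ONH

/-- The elements of `ONH_n^n` which come from `ONH_{n-1}^n`, if they contribute. -/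
def prev (a b : ℕ) : (n : ℕ) → CSub K n n
  | 0 => ⊥
  | n + 1 => if a ≤ n ∧ b ≤ n then LinearMap.range (inclₗ (Nat.le_succ n)) else ⊥

/-- The elements of `ONH_n^n` whose class in the top cohomology is zero. -/
def null (K : Type u) [CommRing K] (n a b : ℕ) : CSub K n n where
  carrier := {h | ∃ g ∈ prev a b n,
    tl tau (a + 1) (n - (a + 1)) * ((h - g) * tl tau (b + 1) (n - (b + 1))) = 0}
  add_mem' := by
    rintro h h' ⟨g, h1, h2⟩ ⟨g', h3, h4⟩
    refine ⟨g + g', add_mem h1 h3, ?_⟩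
    rw [add_sub_add_comm, add_mul, mul_add, h2, h4, add_zero]
  zero_mem' := ⟨0, zero_mem _, by simp⟩
  smul_mem' := by
    rintro r h ⟨g, h1, h2⟩
    refine ⟨r • g, smul_mem _ r h1, ?_⟩
    obtain ⟨r', hr⟩ := (twist_tl (K := K) (n := n) (m := n) (l := a + 1) (N := n - (a + 1))
      ω ω).mul_smul r ((h - g) * tl tau (b + 1) (n - (b + 1)))
    rw [← smul_sub, smul_mul_assoc, hr, h2, smul_zero]

lemma prev_le_null (hh : h ∈ prev a b n) : h ∈ null K n a b := ⟨h, hh, by simp⟩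

lemma mem_null_of_cut
    (hh : tl tau (a + 1) (n - (a + 1)) * (h * tl tau (b + 1) (n - (b + 1))) = 0) :
    h ∈ null K n a b := ⟨0, zero_mem _, by simpa using hh⟩

lemma tau_mul_mem_null (h1 : a < i) (h2 : i < n) (h : ONH K n n) :
    tau i * h ∈ null K n a b := mem_null_of_cut (by
  rw [mul_assoc, ← mul_assoc, sys.tl_tau ω ω ω ω, zero_mul])

lemma mul_tau_mem_null (h1 : b < i) (h2 : i < n) (h : ONH K n n) :
    h * tau i ∈ null K n a b := mem_null_of_cut (by
  rw [mul_assoc h, sys.tau_tl ω ω ω ω, mul_zero, mul_zero])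

lemma tl_mul_cut (ha : a ≤ n) (hb : b ≤ n) : cut a b n h = 0 ↔
    tl tau (a + 1) (n - (a + 1)) * (h * tl tau (b + 1) (n - (b + 1))) = 0 := by
  obtain ⟨s, hs⟩ := pm_tl_cut (K := K) (n := n) ha hb
  constructor
  · intro h0
    have := hs h
    rw [h0, zero_mul, mul_zero] at this
    rcases neg_one_pow_eq_or (ONH K n n) s with h | h <;> rw [h] at this <;> simpa using this.symm
  · intro h0
    have h1 := (pm_e' (K := K) (n := n) (k := n) (a + 1) n).mul
      ((pm_e (K := K) (n := n) (k := n) (l := b + 1) (m := n) ω).mul_left h)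
    refine h1.eq_zero ?_
    rw [mul_assoc, ← mul_assoc h, ← mul_assoc (tl _ _ _) (h * _), h0, zero_mul, mul_zero]

lemma rev_x (h1 : 1 ≤ i) (h2 : i ≤ k) : rev (x i : ONH K n k) = op (x i) := lift_x _ _ h1 h2

lemma rev_tau (h1 : 1 ≤ i) (h2 : i < k) :
    rev (tau i : ONH K n k) = op (tau i) := lift_tau _ _ h1 h2

end ONH

lemma wordList_zero {z : ℕ × List ℕ} (hz : z ∈ wordList s q q v) :
    z = (q + s, v) := by
  induction s generalizing q with
  | zero => simpa [wordList] using hz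
  | succ s ih =>
    rw [wordList] at hz
    simp only [Nat.sub_self, List.range_zero, List.flatMap_nil, List.nil_append, List.range'_zero]
      at hz
    rw [ih hz]
    congr 1; omega

namespace ONH

lemma rev_incl (h : m ≤ k) (g : ONH K n m) :
    rev (incl h g) = op (incl h (rev g).unop) := by
  have : (rev : ONH K n k →ₐ[K] _).comp (incl h) = (AlgHom.op (incl h)).comp rev := by
    refine algHom_ext fun u => ?_
    cases u with
    | x i =>
      rw [gen_x]
      simp only [AlgHom.comp_apply, incl_x h (Nat.le_add_left 1 i) (ω : (i : ℕ) + 1 ≤ m),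
        rev_x (Nat.le_add_left 1 (i : ℕ)) (ω : (i : ℕ) + 1 ≤ m),
        rev_x (Nat.le_add_left 1 (i : ℕ)) (ω : (i : ℕ) + 1 ≤ k)]
      exact congrArg op (incl_x h ω ω).symm
    | tau i =>
      rw [gen_tau]
      simp only [AlgHom.comp_apply, incl_tau h (Nat.le_add_left 1 i) (ω : (i : ℕ) + 1 < m),
        rev_tau (Nat.le_add_left 1 (i : ℕ)) (ω : (i : ℕ) + 1 < m),
        rev_tau (Nat.le_add_left 1 (i : ℕ)) (ω : (i : ℕ) + 1 < k)]
      exact congrArg op (incl_tau h ω ω).symm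
    | chi i =>
      rw [gen_chi]
      simp only [AlgHom.comp_apply, incl_chi, rev, lift_chi _ _ (ω : (i : ℕ) + 1 ≤ n / 2)]
      exact congrArg op (incl_chi h _).symm
    | d =>
      rw [gen_d]
      simp only [AlgHom.comp_apply, incl_d, rev, lift_d, map_mul, map_pow, map_neg, map_one]
      congr 1
      exact congrArg op (incl_d h).symm
  exact DFunLike.congr_fun this g

lemma rev_tl (hl : 1 ≤ l) (hN : N = 0 ∨ l + N ≤ m) :
    PM (rev (tl tau l N : ONH K n m)) (op (tl tau l N)) := by
  refine PM.trans (.inl ?_) (sys.tl_op hl hN)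
  refine (map_tl tau l N (rev : ONH K n m →ₐ[K] _).toRingHom.toMonoidHom).trans
    (tl_congr fun i h1 h2 => rev_tau ω ω)

lemma rev_crossing (h : a + b ≤ m) :
    PM (rev (crossing tau a b : ONH K n m)) (op (crossing tau b a)) := by
  refine PM.trans (.inl ?_) (sys.crossing_op h)
  have key : ∀ b, a + b ≤ m → rev (crossing tau a b : ONH K n m)
      = crossing (fun i => op (tau i)) a b := by
    intro b hb
    induction b with
    | zero => exact map_one _
    | succ b ih =>
      rw [crossing, crossing, map_mul, ih ω]
      congr 1
      exact (map_asc tau _ _ (rev : ONH K n m →ₐ[K] _).toRingHom.toMonoidHom).trans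
        (asc_congr fun i h1 h2 => rev_tau ω ω)
  exact key b h

lemma rev_mem_null (hh : h ∈ null K n b a) :
    (rev h).unop ∈ null K n a b := by
  obtain ⟨g, h1, h2⟩ := hh
  refine ⟨(rev g).unop, ?_, ?_⟩
  · cases n with
    | zero =>
      rw [prev, mem_bot] at h1
      rw [h1]; simp
    | succ n =>
      rw [prev] at h1 ⊢
      by_cases hc : b ≤ n ∧ a ≤ n
      · rw [if_pos hc] at h1
        rw [if_pos hc.symm]
        obtain ⟨g, rfl⟩ := h1
        exact ⟨(rev g).unop, (congrArg unop (rev_incl (Nat.le_succ n) g)).symm⟩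
      · rw [if_neg hc, mem_bot] at h1
        rw [h1]; simp
  · have h3 := congrArg rev h2
    rw [map_mul, map_mul, map_zero, map_sub] at h3
    have h4 := ((rev_tl (K := K) (n := n) (m := n) (l := b + 1) (N := n - (b + 1)) ω
      ω).mul ((rev_tl (K := K) (n := n) (m := n) (l := a + 1) (N := n - (a + 1)) ω
      ω).mul_left (rev h - rev g))).symm
    have h5 := congrArg unop (h4.eq_zero h3)
    simpa [mul_assoc] using h5

lemma exists_cut_prev (ha : a ≤ n) (hb : b ≤ n) {p : ONH K n n} (hp : p ∈ prev a b n) :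
    ∃ c : (Σ _ : ℕ × List ℕ, (ℕ → ℕ)) → Coef K n, (∀ z, z.1.1 = n → c z = 0) ∧
      cut a b n p = ∑ z ∈ idx n n a b, c z • cut a b n (idxElt z) := by
  have h0 : p = 0 → ∃ c : (Σ _ : ℕ × List ℕ, (ℕ → ℕ)) → Coef K n, (∀ z, z.1.1 = n → c z = 0) ∧
      cut a b n p = ∑ z ∈ idx n n a b, c z • cut a b n (idxElt z) := fun h =>
    ⟨0, fun _ _ => rfl, by simp [h, cut_zero]⟩
  cases n with
  | zero => exact h0 hp
  | succ n =>
    rw [prev] at hp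
    split_ifs at hp with hc
    · obtain ⟨g, rfl⟩ := hp
      obtain ⟨co, hco⟩ := exists_cut_eq_sum (Nat.le_succ n) hc.1 hc.2 g
      classical
      refine ⟨_, fun z hz => ?_, cut_incl_eq_sum le_rfl hc.1 hc.2 hco⟩
      rw [if_neg]
      intro h
      have := (mem_idx.1 h).2.1
      omega
    · exact h0 hp

lemma incl_mon (h : m ≤ n) (hα : ∀ i, m < i → α i = 0) :
    incl h (mon α : ONH K n m) = mon α := by
  obtain ⟨b, rfl⟩ := Nat.exists_eq_add_of_le h
  have h1 : mw α (1 + m) b = [] := by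
    clear h
    induction b generalizing m with
    | zero => rfl
    | succ b ih =>
      rw [mw, hα _ ω, add_assoc 1 m 1, ih fun i hi => hα i ω]; rfl
  rw [mon, mon, incl_wd_x _ (fun i hi => by have := mem_mw hi; omega), mw_add, wd_append, h1,
    wd_nil, mul_one]

lemma mul_tl_eq_zero (hab : a + b = n) (ha : a ≤ n) {g : ONH K n a}
    (hg : incl ha g * crossing tau b a ∈ null K n a b) : g * tω a = 0 := by
  have H := sysOf K n n
  have hb : b ≤ n := ω
  have hcut : ∀ g : ONH K n a, cut a 0 a g = 0 → g * tω a = 0 := by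
    intro g h
    rw [cut, e'_eq_one (Nat.le_succ a), one_mul, zero_add] at h
    refine ((e_mul_tl (K := K) (n := n) (k := a) (l := 1) (m := a) le_rfl ω
      le_rfl).symm.mul_left g).eq_zero ?_
    rw [← mul_assoc, h, zero_mul]
  have hF : ∀ g : ONH K n a, cut a 0 a g = 0 → cut a b n (incl ha g * crossing tau b a) = 0 := by
    intro g h
    rw [tl_mul_cut ha hb]
    have h1 := H.crossing_tl (a := a) (b := b) (l := 1) (N := a - 1) ω le_rfl ω
    have h2 : incl ha g * tω a = 0 := by
      rcases Nat.eq_zero_or_pos a with rfl | h'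
      · have := congrArg (incl ha) (hcut g h)
        simpa using this
      · rw [← incl_tl ha le_rfl ω, ← map_mul, hcut g h, map_zero]
    rw [show n - (b + 1) = a - 1 by omega, mul_assoc]
    refine ((h1.mul_left _).mul_left _).eq_zero ?_
    rw [← mul_assoc (incl ha g), h2, zero_mul, mul_zero]
  obtain ⟨co, hco⟩ := exists_cut_eq_sum ha le_rfl (Nat.zero_le a) g
  obtain ⟨p, hp, hgp⟩ := hg
  obtain ⟨c', hc', hcp⟩ := exists_cut_prev ha hb hp
  obtain ⟨w, hw⟩ := exists_wordList_top a 0 b []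
  have hwd := wordList_top (T := (tau : ℕ → ONH K n n)) hw rfl (by rw [wd_nil]; rfl)
  simp only [zero_add] at hw hwd
  rw [show b + a = n by omega] at hw
  have h1 : cut a b n (incl ha g * crossing tau b a)
      = ∑ z ∈ idx n a a 0, co z • cut a b n (idxElt ⟨(n, w), z.2⟩) := by
    have h2 := hF (g - ∑ z ∈ idx n a a 0, co z • idxElt z) (by
      rw [sub_eq_add_neg, ← neg_one_smul (Coef K n) (∑ z ∈ _, _), cut_add, cut_smul le_rfl,
        cut_sum, hco]
      simp [cut_smul])
    rw [map_sub, sub_mul, sub_eq_add_neg, ← neg_one_smul (Coef K n) (_ * _), cut_add, cut_smul ha,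
      neg_one_smul, ← sub_eq_add_neg, sub_eq_zero, map_sum, sum_mul, cut_sum] at h2
    rw [h2]
    refine sum_congr rfl fun z hz => ?_
    have h3 := mem_idx.1 hz
    rw [incl_smul, smul_mul_assoc, cut_smul ha, idxElt, idxElt, wordList_zero h3.1, wd_nil, mul_one,
      hwd, incl_mon ha fun i hi => h3.2.2.2.1 i (.inr hi)]
  have h2 : cut a b n (incl ha g * crossing tau b a) = cut a b n p := by
    have := (tl_mul_cut ha hb).2 hgp
    rwa [sub_eq_add_neg, ← neg_one_smul (Coef K n) p, cut_add, cut_smul ha,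
      neg_one_smul, ← sub_eq_add_neg, sub_eq_zero] at this
  rw [h1, hcp] at h2
  classical
  let c1 : (Σ _ : ℕ × List ℕ, (ℕ → ℕ)) → Coef K n := fun z =>
    ∑ y ∈ idx n a a 0, if (⟨(n, w), y.2⟩ : Σ _ : ℕ × List ℕ, (ℕ → ℕ)) = z then co y else 0
  have hmem : ∀ y ∈ idx n a a 0, (⟨(n, w), y.2⟩ : Σ _ : ℕ × List ℕ, (ℕ → ℕ)) ∈ idx n n a b := by
    intro y hy
    have h3 := mem_idx.1 hy
    refine mem_idx.2 ⟨hw, le_rfl, fun i h4 h5 => ?_, fun i hi => ?_, fun i h4 h5 => ?_⟩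
    · by_cases h6 : i ≤ a
      · exact h3.2.2.1 i h4 h6
      · change y.2 i + i ≤ n
        rw [h3.2.2.2.1 i ω]; omega
    · exact h3.2.2.2.1 i ω
    · change n < i at h4; omega
  have h3 : ∑ z ∈ idx n n a b, (c1 z - c' z) • cut a b n (idxElt z) = (0 : ONH K n n) := by
    simp only [sub_smul, Finset.sum_sub_distrib]
    rw [← h2, sub_eq_zero]
    simp only [c1, Finset.sum_smul]
    rw [Finset.sum_comm]
    refine sum_congr rfl fun y hy => ?_
    rw [Finset.sum_eq_single _ (fun z _ hz => by rw [if_neg hz.symm, zero_smul])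
      (fun h => absurd (hmem y hy) h), if_pos rfl]
  refine hcut g (hco.trans (sum_eq_zero fun y hy => ?_))
  have h4 := eq_zero_of_sum_cut le_rfl ha hb h3 (hmem y hy)
  rw [hc' _ rfl, sub_zero] at h4
  have h5 : c1 ⟨(n, w), y.2⟩ = co y := by
    refine (Finset.sum_eq_single y (fun z hz hzy => if_neg fun h => hzy ?_)
      (fun h => absurd hy h)).trans (if_pos rfl)
    obtain ⟨z1, z2⟩ := z
    obtain ⟨y1, y2⟩ := y
    have h6 := wordList_zero (mem_idx.1 hz).1
    have h7 := wordList_zero (mem_idx.1 hy).1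
    simp only at h6 h7
    subst h6 h7
    simpa using h
  rw [← h5, h4, zero_smul]

lemma exists_sub_mem_null (hab : a + b = n) (ha : a ≤ n) (h : ONH K n n) :
    ∃ g : ONH K n a, h * tω b - incl ha g * crossing tau b a ∈ null K n a b := by
  have H := sysOf K n n
  let P (y : ONH K n n) : CSub K n n :=
    { carrier := {h | ∃ g : ONH K n a, h * y - incl ha g * crossing tau b a ∈ null K n a b}
      add_mem' := by
        rintro h h' ⟨g, h1⟩ ⟨g', h2⟩
        refine ⟨g + g', ?_⟩
        rw [map_add, add_mul, add_mul, add_sub_add_comm]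
        exact add_mem h1 h2
      zero_mem' := ⟨0, by simp⟩
      smul_mem' := by
        rintro r h ⟨g, h1⟩
        refine ⟨r • g, ?_⟩
        rw [incl_smul, smul_mul_assoc, smul_mul_assoc, ← smul_sub]
        exact smul_mem _ r h1 }
  have hP : ∀ {y h}, h * y ∈ null K n a b → h ∈ P y := fun h => ⟨0, by simpa using h⟩
  have key : ∀ α, Bdd n n α → mon α ∈ P (crossing tau b a * tω b) := by
    intro α hα
    have := mon_mem_of_decreasing (P := P (crossing tau b a * tω b)) (p := a) (y := [])
      (fun i h1 h2 h => hP (by rw [mul_assoc]; exact tau_mul_mem_null h1 h2 _))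
      (fun i h1 h2 h => hP ?_) (by simp) (fun α hα hdec => ?_) hα
    · simpa using this
    · convert zero_mem (null K n a b)
      obtain ⟨j, rfl⟩ := Nat.exists_eq_add_of_lt h1
      rw [mul_assoc, ← mul_assoc (tau _)]
      refine (((H.tau_crossing (a := a) (b := b) (j := j + 1) ω ω
        ω).mul_right _).mul_left _).eq_zero ?_
      rw [mul_assoc (crossing _ _ _), H.tau_tl le_rfl ω ω ω, mul_zero, mul_zero]
    · have hα' : ∀ j, a + 1 ≤ n - j → α (n - j) = j := by
        intro j hj
        apply le_antisymm
        · have := hα (n - j) ω ω; omega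
        · induction j with
          | zero => omega
          | succ j ih =>
            have := ih ω
            have h2 := hdec (n - (j + 1)) ω ω
            rw [show n - (j + 1) + 1 = n - j by omega] at h2
            omega
      have h1 : PM (mon α) (wd x (mw α 1 a) * xdown x (a + 1) b : ONH K n n) := by
        rw [mon, show mw α 1 n = mw α 1 (a + b) by rw [hab], mw_add, wd_append, add_comm 1 a]
        refine (H.mw_xdown ω ω fun i h1 h2 => ?_).mul_left _
        have := hα' (n - i) ω
        rw [show n - (n - i) = i by omega] at this
        omega
      have h2 := H.tl_crossing (a := a) (b := b) (l := 1) (N := b - 1) ω le_rfl ω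
      set A : ONH K n n := wd x (mw α 1 a)
      set t : ONH K n n := tl tau (a + 1) (b - 1) with ht
      obtain ⟨s, hs⟩ := (h1.mul h2.symm).exists_sign
      have h3 : PM (t * A) (A * t) := (Sys.pm_tl fun i h4 h5 =>
        (H.pm_tau_wd_x ω (fun j hj => by have := mem_mw hj; omega)
          (fun j hj => by have := mem_mw hj; omega)).symm).symm
      obtain ⟨s', hs'⟩ := (H.tl_xdown_tl (l := a + 1) (M := b) ω ω).exists_sign
      refine ⟨(-1) ^ s * ((-1) ^ s' * wd x (mw α 1 a)), ?_⟩
      have h4 : t * (A * xdown x (a + 1) b * (t * crossing tau b a))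
          = (-1) ^ s' * (t * (A * crossing tau b a)) := by
        have h5 : A * (t * xdown x (a + 1) b * t) = (-1) ^ s' * (A * t) := by
          rw [hs', ← ht]
          rcases neg_one_pow_eq_or (ONH K n n) s' with h | h <;> simp [h]
        have h6 : ∀ u, t * (A * u) = t * A * u := fun u => (mul_assoc t A u).symm
        have h7 : A * t * xdown x (a + 1) b * (t * crossing tau b a)
            = (-1) ^ s' * (A * t) * crossing tau b a := by
          rw [← h5]; simp only [mul_assoc]
        rw [mul_assoc A, h6, h6]
        rcases h3 with h | h <;> rw [h]
        · rw [← mul_assoc, h7, mul_assoc ((-1) ^ s')]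
        · rw [neg_mul, neg_mul, ← mul_assoc, h7, mul_assoc ((-1) ^ s'), mul_neg]
      refine mem_null_of_cut ?_
      rw [wd_nil, mul_one, hs, map_mul, map_mul, map_pow, map_pow, map_neg, map_one,
        incl_wd_x _ (fun i hi => by have := mem_mw hi; omega), ← mul_assoc (tl _ _ _),
        show n - (a + 1) = b - 1 by omega, ← ht]
      rw [show (-1) ^ s * (A * xdown x (a + 1) b * (t * crossing tau b a)) -
          (-1) ^ s * ((-1) ^ s' * A) * crossing tau b a = (-1) ^ s * (A * xdown x (a + 1) b *
          (t * crossing tau b a) - (-1) ^ s' * (A * crossing tau b a)) by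
        rw [mul_sub]; simp only [mul_assoc]]
      have h5 : t * (A * xdown x (a + 1) b * (t * crossing tau b a) -
          (-1) ^ s' * (A * crossing tau b a)) = 0 := by
        rw [mul_sub, h4]
        rcases neg_one_pow_eq_or (ONH K n n) s' with h | h <;> simp [h]
      have h6 : ∀ u v : ONH K n n, t * u = 0 → t * ((-1) ^ s * u) * v = 0 := fun u v h => by
        rcases neg_one_pow_eq_or (ONH K n n) s with h' | h' <;> simp [h', h]
      exact h6 _ _ h5
  have htop : P tω b = ⊤ := by
    refine eq_top_of_mon (a := a) (b := b) le_rfl ha ω (fun i h1 h2 h => hP ?_)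
      (fun i h1 h2 h => hP ?_) (fun z hz hzn α hα _ => ?_)
    · rw [mul_assoc]; exact tau_mul_mem_null h1 h2 _
    · have h3 : PM (tau i * tω b) (tω b * tau i : ONH K n n) :=
        Sys.pm_tl fun j h3 h4 => PM.of_add (H.tau_tau _ _ ω ω h3 ω ω)
      rw [mul_assoc]
      refine (h3.mul_left h).mem ?_
      rw [← mul_assoc]
      exact mul_tau_mem_null h1 h2 _
    · have h4 := mem_wordList (Nat.zero_le b) (by simp) hz
      rcases hzn.eq_or_lt with hzn | hzn
      · have hwd := wordList_top (T := (tau : ℕ → ONH K n n)) (q := 0) (b := b) (by simpa using hz)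
          ω (by rw [wd_nil]; rfl)
        obtain ⟨g, hg⟩ := key α hα
        refine ⟨g, ?_⟩
        rwa [hwd, zero_add, mul_assoc]
      · refine hP (prev_le_null ?_)
        cases n with
        | zero => omega
        | succ n =>
          rw [prev, if_pos ω]
          refine ⟨mon α * (wd tau z.2 * tω b), ?_⟩
          change incl _ _ = _
          have hα0 : α (n + 1) = 0 := by have := hα (n + 1) ω le_rfl; omega
          rw [map_mul, map_mul, incl_tl _ le_rfl ω, incl_wd_tau _ (fun i hi => by
            have := h4.2.2 i hi; omega), mul_assoc, mon, mon, incl_wd_x _ (fun i hi => by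
            have := mem_mw hi; omega), mw_add, wd_append,
            show mw α (1 + n) 1 = [] by simp [mw, add_comm 1 n, hα0], wd_nil, mul_one]
  have : h ∈ P tω b := by rw [htop]; trivial
  exact this

lemma rev_rev (h : ONH K n m) : rev (rev h).unop = op h := by
  induction h using ONH.induction with
  | hc r => simp
  | hg g =>
    cases g with
    | x i =>
      rw [gen_x, rev_x ω ω, unop_op, rev_x ω ω]
    | tau i =>
      rw [gen_tau, rev_tau ω ω, unop_op, rev_tau ω ω]
    | chi i =>
      have h1 : rev (chi ((i : ℕ) + 1) : ONH K n m) = op (chi ((i : ℕ) + 1)) := lift_chi _ _ ω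
      rw [gen_chi, h1, unop_op, h1]
    | d =>
      have h1 : rev (d : ONH K n m) = (-1) ^ (n + 1) * op d := lift_d _ _
      rcases neg_one_pow_eq_or (ONH K n m)ᵐᵒᵖ (n + 1) with h | h <;> rw [h] at h1 <;>
        simp [gen_d, h1]
  | ha a b h1 h2 => simp [h1, h2]
  | hm a b h1 h2 => simp [h1, h2]

lemma exists_sub_mem_null_right (hab : a + b = n) (hb : b ≤ n) (h : ONH K n n) :
    ∃ g : ONH K n b, tω a * h - crossing tau b a * incl hb g ∈ null K n a b := by
  obtain ⟨g, hg⟩ := exists_sub_mem_null (a := b) (b := a) ω hb (rev h).unop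
  have h1 := rev_mem_null hg
  have h2 := rev_tl (K := K) (n := n) (m := n) (l := 1) (N := a - 1) le_rfl ω
  have h3 := rev_crossing (K := K) (n := n) (m := n) (a := a) (b := b) ω
  rw [map_sub, map_mul, map_mul, rev_rev, rev_incl] at h1
  rcases h2 with h2 | h2 <;> rcases h3 with h3 | h3 <;> rw [h2, h3] at h1
  · exact ⟨(rev g).unop, by simpa using h1⟩
  · exact ⟨-(rev g).unop, by simpa using h1⟩
  · exact ⟨-(rev g).unop, by have := neg_mem h1; simpa [add_comm] using this⟩
  · exact ⟨(rev g).unop, by have := neg_mem h1; simpa [sub_eq_add_neg, add_comm] using this⟩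

lemma tl_mul_eq_zero (hab : a + b = n) (hb : b ≤ n) {g : ONH K n b}
    (hg : crossing tau b a * incl hb g ∈ null K n a b) : tω b * g = 0 := by
  have h1 := rev_mem_null hg
  have h2 : incl hb (rev g).unop * crossing tau a b ∈ null K n b a := by
    rw [map_mul, rev_incl, unop_mul] at h1
    refine PM.mem (PM.mul_left _ ?_) h1
    rcases rev_crossing (K := K) (n := n) (m := n) (a := b) (b := a) ω with h | h
    · exact .inl (by rw [h]; rfl)
    · exact .inr (by rw [h]; simp)
  have h3 := congrArg rev (mul_tl_eq_zero (a := b) (b := a) ω hb h2)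
  rw [map_mul, rev_rev, map_zero] at h3
  have h4 := ((rev_tl (K := K) (n := n) (m := b) (l := 1) (N := b - 1) le_rfl
    ω).symm.mul_left (op g)).eq_zero h3
  simpa using congrArg unop h4

end ONH

/-! ## The grading of the top cohomology -/

namespace ONH

lemma x_mem_homog (i : ℕ) : (x i : ONH K n m) ∈ homog K n m (2, 1) := by
  unfold x fx
  split_ifs with h
  · exact gen_mem_homog (Gen.x _)
  · rw [map_zero]; exact zero_mem _

lemma tau_mem_homog (i : ℕ) : (tau i : ONH K n m) ∈ homog K n m (-2, 1) := by
  unfold tau ftau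
  split_ifs with h
  · exact gen_mem_homog (Gen.tau _)
  · rw [map_zero]; exact zero_mem _

lemma inclGen_mem_homog (g : Gen n a) : (inclGen a b g : ONH K n b) ∈ homog K n b g.deg := by
  cases g with
  | x i => exact x_mem_homog _
  | tau i => exact tau_mem_homog _
  | chi i =>
    simp only [inclGen, chi, fchi]
    rw [if_neg ω, dif_pos ω]
    exact gen_mem_homog (Gen.chi i)
  | d => exact gen_mem_homog Gen.d

lemma list_prod_mem_homog {ι : Type*} (L : List ι) {f : ι → ONH K n m} {δ : ι → ℤ × ZMod 2}
    (h : ∀ t ∈ L, f t ∈ homog K n m (δ t)) : (L.map f).prod ∈ homog K n m (L.map δ).sum := by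
  induction L with
  | nil => exact one_mem_homog
  | cons t L ih =>
    simp only [List.map_cons, List.prod_cons, List.sum_cons]
    exact homog_mul (h t (by simp)) (ih fun u hu => h u (by simp [hu]))

lemma pow_mem_homog {δ : ℤ × ZMod 2} {y : ONH K n m} (hy : y ∈ homog K n m δ) (s : ℕ) :
    y ^ s ∈ homog K n m (s • δ) := by
  induction s with
  | zero => simpa using one_mem_homog
  | succ s ih => rw [pow_succ, succ_nsmul]; exact homog_mul ih hy

lemma incl_mem_homog (h : a ≤ b) {y : ONH K n a} (hy : y ∈ homog K n a g) :
    incl h y ∈ homog K n b g := by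
  refine (span_le (p := (homog K n b g).comap (incl h).toLinearMap)).2 ?_ hy
  rintro _ ⟨w, rfl, rfl⟩
  change incl h _ ∈ homog K n b _
  rw [map_list_prod, List.map_map]
  exact list_prod_mem_homog w fun g _ => by
    rw [Function.comp_apply, incl_gen]; exact inclGen_mem_homog g

lemma asc_mem_homog (l N : ℕ) : (asc tau l N : ONH K n m) ∈ homog K n m (N • (-2, 1)) := by
  induction N with
  | zero => simpa using one_mem_homog
  | succ N ih => rw [asc_succ, succ_nsmul]; exact homog_mul ih (tau_mem_homog _)

lemma exists_tl_mem_homog (l N : ℕ) : ∃ δ, (tl tau l N : ONH K n m) ∈ homog K n m δ := by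
  induction N with
  | zero => exact ⟨0, by simpa using one_mem_homog⟩
  | succ N ih =>
    obtain ⟨δ, h⟩ := ih
    rw [tl_succ]
    exact ⟨_, homog_mul (asc_mem_homog _ _) h⟩

lemma exists_crossing_mem_homog (b a : ℕ) :
    ∃ δ, (crossing tau b a : ONH K n m) ∈ homog K n m δ := by
  induction a with
  | zero => exact ⟨0, one_mem_homog⟩
  | succ a ih =>
    obtain ⟨δ, h⟩ := ih
    rw [crossing]
    exact ⟨_, homog_mul (asc_mem_homog _ _) h⟩

lemma exists_xup_mem_homog (l M : ℕ) : ∃ δ, (xup x l M : ONH K n m) ∈ homog K n m δ :=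
  ⟨_, list_prod_mem_homog _ fun t _ => pow_mem_homog (x_mem_homog _) t⟩

lemma exists_xdown_mem_homog (l M : ℕ) : ∃ δ, (xdown x l M : ONH K n m) ∈ homog K n m δ :=
  ⟨_, list_prod_mem_homog _ fun t _ => pow_mem_homog (x_mem_homog _) t⟩

lemma neg_one_pow_mul_mem_homog {y : ONH K n m} (hy : y ∈ homog K n m g) (s : ℕ) :
    (-1) ^ s * y ∈ homog K n m g := by
  rcases neg_one_pow_eq_or (ONH K n m) s with h | h <;> rw [h]
  · rwa [one_mul]
  · rw [neg_one_mul]; exact neg_mem hy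

lemma tauLong_mem_homog (l r : ℕ) : (tauLong l r : ONH K n m) ∈
    homog K n m ((∑ t ∈ range (r + 1 - l), t) • (-2, 1)) := by
  have h := list_prod_mem_homog (K := K) (n := n) (m := m) (List.range (r - l))
    (f := fun t => ((List.range (r - l - t)).map fun s => (tau (l + s) : ONH K n m)).prod)
    (δ := fun t => (r - l - t) • (-2, 1)) fun t _ => by
      have := list_prod_mem_homog (K := K) (n := n) (m := m) (List.range (r - l - t))
        (f := fun s => tau (l + s)) (δ := fun _ => (-2, 1)) fun s _ => tau_mem_homog _
      simpa using this
  have h1 := sum_parity 1 l r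
  simp only [one_mul] at h1
  rw [h1, ← sum_range_list, List.sum_smul, List.map_map]
  exact h

lemma x_list_mem_homog (N : ℕ) (f : ℕ → ℕ) :
    ((List.range N).map fun s => (x (f s) : ONH K n m) ^ s).prod ∈
    homog K n m ((∑ t ∈ range N, t) • (2, 1)) := by
  have h := list_prod_mem_homog (K := K) (n := n) (m := m) (List.range N)
    (f := fun s => x (f s) ^ s) (δ := fun t => t • (2, 1)) fun t _ => pow_mem_homog (x_mem_homog _) t
  rw [← sum_range_list, List.sum_smul, List.map_map]
  exact h

lemma smul_add_smul_eq_zero (N : ℕ) : N • ((2, 1) : ℤ × ZMod 2) + N • (-2, 1) = 0 := by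
  rw [← smul_add, show ((2, 1) : ℤ × ZMod 2) + (-2, 1) = 0 by decide, smul_zero]

lemma e'_mem_homog (l r : ℕ) : (e' l r : ONH K n m) ∈ homog K n m 0 := by
  refine neg_one_pow_mul_mem_homog ?_ _
  rw [← smul_add_smul_eq_zero]
  exact homog_mul (x_list_mem_homog _ _) (tauLong_mem_homog _ _)

lemma e_mem_homog (l r : ℕ) : (e l r : ONH K n m) ∈ homog K n m 0 := by
  refine neg_one_pow_mul_mem_homog ?_ _
  rw [← smul_add_smul_eq_zero, add_comm]
  exact homog_mul (tauLong_mem_homog _ _) (x_list_mem_homog _ _)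

lemma proj_mul_left {δ : ℤ × ZMod 2} {z : ONH K n m} (hz : z ∈ homog K n m δ) (g : ℤ × ZMod 2)
    (y : ONH K n m) : proj (δ + g) (z * y) = z * proj g y :=
  grProj.comm grProj (AddMonoidHom.mulLeft z) (add_right_injective δ)
    (fun _ _ h => homog_mul hz h) g y

lemma proj_mul_right {δ : ℤ × ZMod 2} {z : ONH K n m} (hz : z ∈ homog K n m δ) (g : ℤ × ZMod 2)
    (y : ONH K n m) : proj (g + δ) (y * z) = proj g y * z :=
  grProj.comm grProj (AddMonoidHom.mulRight z) (add_left_injective δ)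
    (fun _ _ h => homog_mul h hz) g y

lemma proj_incl (h : a ≤ b) (g : ℤ × ZMod 2) (y : ONH K n a) :
    proj g (incl h y) = incl h (proj g y) :=
  grProj.comm grProj (incl h).toAddMonoidHom Function.injective_id
    (fun _ _ hv => incl_mem_homog h hv) g y

lemma proj_mem_null (hh : h ∈ null K n a b) (g : ℤ × ZMod 2) :
    proj g h ∈ null K n a b := by
  obtain ⟨p, h1, h2⟩ := hh
  obtain ⟨δ, hδ⟩ := exists_tl_mem_homog (K := K) (n := n) (m := n) (a + 1) (n - (a + 1))
  obtain ⟨ε, hε⟩ := exists_tl_mem_homog (K := K) (n := n) (m := n) (b + 1) (n - (b + 1))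
  refine ⟨proj g p, ?_, ?_⟩
  · cases n with
    | zero =>
      rw [prev, mem_bot] at h1
      rw [h1, map_zero]; exact zero_mem _
    | succ n =>
      rw [prev] at h1 ⊢
      split_ifs at h1 ⊢
      · obtain ⟨q, rfl⟩ := h1
        exact ⟨proj g q, (proj_incl (Nat.le_succ n) g q).symm⟩
      · rw [mem_bot] at h1
        rw [h1, map_zero]; exact zero_mem _
  · rw [← map_sub, ← proj_mul_right hε, ← proj_mul_left hδ, h2, map_zero]

/-! ## The top cohomology as a quotient of `ONH_n^n` -/

lemma mem_bdry_top (ha : a ≤ n) (hb : b ≤ n) (c : T K n a b n) :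
    c ∈ bdry K n a b n ↔ ∃ p ∈ prev (K := K) a b n, (c : ONH K n n) = cut a b n p := by
  cases n with
  | zero =>
    rw [bdry, mem_bot]
    constructor
    · rintro rfl
      exact ⟨0, zero_mem _, cut_zero.symm⟩
    · rintro ⟨p, hp, h⟩
      rw [prev, mem_bot] at hp
      exact Subtype.ext (by rw [h, hp, cut_zero]; rfl)
  | succ n =>
    rw [bdry, prev]
    by_cases hab : a ≤ n ∧ b ≤ n
    · rw [if_pos hab]
      constructor
      · rintro ⟨c, rfl⟩
        obtain ⟨g, hg⟩ := (mem_T hab.1 hab.2 (Nat.le_succ n)).1 c.2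
        rcases pm_diff hab.1 hab.2 le_rfl c hg with h | h
        · exact ⟨_, ⟨g, rfl⟩, h⟩
        · refine ⟨_, ⟨-g, rfl⟩, h.trans ?_⟩
          change _ = cut _ _ _ (incl _ (-g))
          rw [map_neg, cut, cut, neg_mul, mul_neg]
      · rintro ⟨_, ⟨g, rfl⟩, h⟩
        have hc := (mem_T (K := K) hab.1 hab.2 (Nat.le_succ n)).2 ⟨g, rfl⟩
        rcases pm_diff hab.1 hab.2 le_rfl ⟨_, hc⟩ rfl with h' | h'
        · exact ⟨⟨_, hc⟩, Subtype.ext (h'.trans h.symm)⟩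
        · refine ⟨-⟨_, hc⟩, Subtype.ext ?_⟩
          rw [map_neg, Submodule.coe_neg, h', neg_neg]
          exact h.symm
    · rw [if_neg hab, diff_zero K _ (fun h => hab ⟨h.1, h.2.1⟩), LinearMap.range_zero, mem_bot]
      constructor
      · rintro rfl
        exact ⟨0, zero_mem _, cut_zero.symm⟩
      · rintro ⟨p, hp, h⟩
        rw [mem_bot] at hp
        exact Subtype.ext (by rw [h, hp, cut_zero]; rfl)

variable (K n) in
/-- The class in `C_{n,k}` of the image of an element of `ONH_n^n`. -/
def pr (k : Fin (n + 1)) : ONH K n n →ₗ[K] C K n k :=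
  toC K n k ∘ₗ LinearMap.codRestrict (T K n (n - k) k n)
    (sandwich K (e' (n - k + 1) n) (e (k + 1) n))
    fun h => (mem_T (Nat.sub_le n k) (Nat.lt_succ_iff.mp k.2) le_rfl).2 ⟨h, rfl⟩

variable {k : Fin (n + 1)}

lemma pr_eq_toC {c : T K n (n - k) k n}
    (hc : (c : ONH K n n) = cut (n - k) k n h) : pr K n k h = toC K n k c :=
  congrArg (toC K n k) (Subtype.ext hc.symm)

lemma pr_surjective : Function.Surjective (pr K n k) := by
  intro c
  obtain ⟨c, rfl⟩ := Submodule.mkQ_surjective _ c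
  obtain ⟨h, hh⟩ := (mem_T (Nat.sub_le n k) (Nat.lt_succ_iff.mp k.2) le_rfl).1 c.2
  exact ⟨h, pr_eq_toC hh⟩

lemma pr_eq_zero : pr K n k h = 0 ↔ h ∈ null K n (n - k) k := by
  have ha := Nat.sub_le n k
  have hb := Nat.lt_succ_iff.mp k.2
  have hc := (mem_T (K := K) ha hb le_rfl).2 ⟨h, rfl⟩
  rw [pr_eq_toC (c := ⟨_, hc⟩) rfl]
  refine (Submodule.Quotient.mk_eq_zero _).trans ((mem_bdry_top ha hb _).trans ?_)
  change _ ↔ ∃ g ∈ _, _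
  refine exists_congr fun p => and_congr_right fun _ => ?_
  rw [← tl_mul_cut ha hb]
  change cut _ _ _ h = _ ↔ _
  rw [← sub_eq_zero, cut, cut, cut, ← mul_sub, ← sub_mul]

lemma pr_eq_pr {h g : ONH K n n} : pr K n k h = pr K n k g ↔ h - g ∈ null K n (n - k) k := by
  rw [← pr_eq_zero, map_sub, sub_eq_zero]

lemma smul_pr (s : ONH K n (n - k)) (h : ONH K n n) :
    s • pr K n k h = pr K n k (incl (Nat.sub_le n k) s * h) := by
  refine congrArg (toC K n k) (Subtype.ext ?_)
  change incl _ s * (e' _ _ * (h * e _ _)) = e' _ _ * (incl _ s * h * e _ _)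
  rw [← mul_assoc, (commute_incl (Nat.sub_le n k) s).2.eq]
  simp only [mul_assoc]

lemma op_smul_pr (r : ONH K n k) (h : ONH K n n) :
    op r • pr K n k h = pr K n k (h * incl (Nat.lt_succ_iff.mp k.2) r) := by
  refine congrArg (toC K n k) (Subtype.ext ?_)
  change e' _ _ * (h * e _ _) * incl _ r = e' _ _ * (h * incl _ r * e _ _)
  rw [mul_assoc, mul_assoc, mul_assoc, (commute_incl (Nat.lt_succ_iff.mp k.2) r).1.eq]

lemma cut_cut (ha : a ≤ n) (hb : b ≤ n) : ∃ s : ℕ, ∀ h : ONH K n n,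
    cut a b n (cut a b n h) = (-1) ^ s * cut a b n h := by
  have h1 : PM (e' (a + 1) n * e' (a + 1) n : ONH K n n) (e' (a + 1) n) := by
    refine ((pm_e' (a + 1) n).mul_right _).trans (PM.trans ?_ (pm_e' (a + 1) n).symm)
    rw [mul_assoc]
    exact (tl_mul_e' ω ω le_rfl).mul_left _
  have h2 : PM (e (b + 1) n * e (b + 1) n : ONH K n n) (e (b + 1) n) := by
    refine ((pm_e (l := b + 1) (m := n) ω).mul_left _).trans
      (PM.trans ?_ (pm_e (l := b + 1) (m := n) ω).symm)
    rw [← mul_assoc]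
    exact (e_mul_tl ω ω le_rfl).mul_right _
  obtain ⟨s1, e1⟩ := h1.exists_sign
  obtain ⟨s2, e2⟩ := h2.exists_sign
  refine ⟨s1 + s2, fun h => ?_⟩
  have e3 : cut a b n (cut a b n h)
      = (e' (a + 1) n * e' (a + 1) n) * (h * (e (b + 1) n * e (b + 1) n)) := by
    simp only [cut, mul_assoc]
  rw [e3, e1, e2, cut, pow_add]
  rcases neg_one_pow_eq_or (ONH K n n) s1 with h | h <;>
  rcases neg_one_pow_eq_or (ONH K n n) s2 with h' | h' <;> simp [h, h']

lemma gradC_eq (g : ℤ × ZMod 2) : gradC K n k g = (homog K n n g).map (pr K n k) := by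
  have ha := Nat.sub_le n k
  have hb := Nat.lt_succ_iff.mp k.2
  apply le_antisymm
  · rintro _ ⟨c, hc, rfl⟩
    obtain ⟨h, hh⟩ := (mem_T ha hb le_rfl).1 c.2
    obtain ⟨s, hs⟩ := cut_cut (K := K) ha hb
    have h1 : cut (n - k) k n ((-1) ^ s * (c : ONH K n n)) = c := by
      rw [hh]
      have := hs h
      rcases neg_one_pow_eq_or (ONH K n n) s with h' | h' <;> rw [h'] at this ⊢
      · simpa using this
      · rw [neg_one_mul] at this ⊢
        rw [cut, neg_mul, mul_neg]
        exact neg_eq_iff_eq_neg.2 this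
    exact ⟨_, neg_one_pow_mul_mem_homog hc s, pr_eq_toC h1.symm⟩
  · rintro _ ⟨h, hh, rfl⟩
    refine ⟨_, ?_, rfl⟩
    have := homog_mul (e'_mem_homog (n - k + 1) n) (homog_mul hh (e_mem_homog (k + 1) n))
    rwa [zero_add, add_zero] at this

lemma pr_mem_gradC (hh : h ∈ homog K n n g) :
    pr K n k h ∈ gradC K n k g := by
  rw [gradC_eq]; exact ⟨h, hh, rfl⟩

lemma exists_grProj_gradC : ∃ π, GrProj (gradC K n k) π ∧ ∀ g v, π g (pr K n k v)
    = pr K n k (proj g v) := by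
  have := grProj.map (pr K n k) pr_surjective fun g v hv => by
    rw [pr_eq_zero] at hv ⊢
    exact proj_mem_null hv g
  simpa only [← gradC_eq] using this

lemma isGradedBimodule (k : Fin (n + 1)) :
    IsGradedBimodule (homog K n (n - k)) (homog K n k) (gradC K n k) where
  isInternal := by
    obtain ⟨π, hπ, -⟩ := exists_grProj_gradC (K := K) (k := k)
    exact hπ.internal
  smul_mem g h s p hs hp := by
    rw [gradC_eq] at hp
    obtain ⟨p, hp, rfl⟩ := hp
    rw [smul_pr]
    exact pr_mem_gradC (homog_mul (incl_mem_homog _ hs) hp)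
  op_smul_mem g h r p hp hr := by
    rw [gradC_eq] at hp
    obtain ⟨p, hp, rfl⟩ := hp
    rw [op_smul_pr]
    exact pr_mem_gradC (homog_mul hp (incl_mem_homog _ hr))
  smul_op_smul s r p := by
    obtain ⟨p, rfl⟩ := pr_surjective p
    rw [op_smul_pr, smul_pr, smul_pr, op_smul_pr, mul_assoc]
  algebraMap_smul c p := by
    obtain ⟨p, rfl⟩ := pr_surjective p
    rw [smul_pr, AlgHom.commutes, ← Algebra.smul_def, map_smul]
  algebraMap_op_smul c p := by
    obtain ⟨p, rfl⟩ := pr_surjective p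
    rw [op_smul_pr, AlgHom.commutes, ← Algebra.commutes, ← Algebra.smul_def, map_smul]

end ONH

/-! ## Invertibility of the top cohomology -/

section Morita

variable {S R P : Type u} [Ring S] [Algebra K S] [Ring R] [Algebra K R]
  [AddCommGroup P] [Module K P] [Module S P] [Module Rᵐᵒᵖ P]
  {gS : ℤ × ZMod 2 → Submodule K S} {gR : ℤ × ZMod 2 → Submodule K R}
  {gP : ℤ × ZMod 2 → Submodule K P}

theorem exists_generator (hP : IsGradedBimodule gS gR gP) {t X : S} {t' Y : R} {c₀ : P}
    {ε ε' : K} (hε : ε * ε = 1) (hε' : ε' * ε' = 1) {δX δY δ : ℤ × ZMod 2}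
    (hX : X ∈ gS δX) (hY : Y ∈ gR δY) (hc : c₀ ∈ gP δ)
    (F : t • X • c₀ = ε • c₀) (F' : op t' • op Y • c₀ = ε' • c₀)
    (gen : ∀ p : P, ∃ s : S, op t' • p = s • c₀)
    (gen' : ∀ p : P, ∃ r : R, t • p = op r • c₀)
    (ann : ∀ s : S, s • c₀ = 0 → s * t = 0)
    (ann' : ∀ r : R, op r • c₀ = 0 → t' * r = 0) :
    ∃ (c : P) (γ : ℤ × ZMod 2), c ∈ gP γ ∧ (ε • (X * t)) • c = c ∧ op (ε' • (t' * Y)) • c = c ∧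
      (∀ p : P, ∃ s : S, op (ε' • (t' * Y)) • p = s • c) ∧
      (∀ p : P, ∃ r : R, (ε • (X * t)) • p = op r • c) ∧
      (∀ s : S, s • c = 0 → s * (ε • (X * t)) = 0) ∧
      (∀ r : R, op r • c = 0 → (ε' • (t' * Y)) * r = 0) := by
  have : IsScalarTower K S P := .of_algebraMap_smul hP.algebraMap_smul
  have : IsScalarTower K Rᵐᵒᵖ P := .of_algebraMap_smul hP.algebraMap_op_smul
  have : SMulCommClass S Rᵐᵒᵖ P := ⟨fun s r p => hP.smul_op_smul s r.unop p⟩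
  have : SMulCommClass Rᵐᵒᵖ S P := .symm _ _ _
  have : SMulCommClass K S P := IsScalarTower.to_smulCommClass
  have : SMulCommClass K Rᵐᵒᵖ P := IsScalarTower.to_smulCommClass
  have : SMulCommClass S K P := .symm _ _ _
  have : SMulCommClass Rᵐᵒᵖ K P := .symm _ _ _
  refine ⟨X • op Y • c₀, δX + (δ + δY), hP.smul_mem _ _ _ _ hX
    (hP.op_smul_mem _ _ _ _ hc hY), ?_, ?_, ?_, ?_, ?_, ?_⟩
  · rw [smul_assoc, mul_smul, smul_comm X (op Y), smul_comm t (op Y), F,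
      smul_comm _ ε, smul_comm X ε, smul_smul, hε, one_smul, smul_comm]
  · rw [op_smul, op_mul, smul_assoc, mul_smul,
      smul_comm (op t') X, F', smul_comm X ε', smul_comm _ ε', smul_smul, hε', one_smul, smul_comm]
  · intro p
    obtain ⟨s, hs⟩ := gen p
    refine ⟨(ε' * ε) • (s * t), ?_⟩
    rw [op_smul, op_mul, smul_assoc, mul_smul, hs, smul_assoc, mul_smul,
      mul_smul, smul_comm X (op Y), smul_comm t (op Y), F, smul_comm _ ε c₀,
      smul_comm s ε, smul_smul ε ε, hε, one_smul, smul_comm s]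
  · intro p
    obtain ⟨r, hr⟩ := gen' p
    refine ⟨(ε * ε') • (t' * r), ?_⟩
    rw [op_smul, op_mul, smul_assoc, mul_smul, hr, smul_assoc, mul_smul,
      mul_smul, smul_comm (op t') X, F', smul_comm X ε', smul_comm _ ε' (X • c₀),
      smul_smul ε' ε', hε', one_smul, smul_comm X]
  · intro s hs
    have h := congrArg (op t' • ·) hs
    simp only [smul_zero] at h
    rw [smul_comm _ s, smul_comm _ X, F', smul_comm X, smul_comm s] at h
    have h2 := congrArg (ε' • ·) h
    simp only [smul_zero] at h2
    rw [smul_smul, hε', one_smul, ← mul_smul] at h2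
    rw [mul_smul_comm, ← mul_assoc, ann _ h2, smul_zero]
  · intro r hr
    have h := congrArg (t • ·) hr
    simp only [smul_zero] at h
    rw [smul_comm t, smul_comm X, smul_comm t, F, smul_comm _ ε, smul_comm _ ε] at h
    have h2 := congrArg (ε • ·) h
    simp only [smul_zero] at h2
    rw [smul_smul, hε, one_smul, ← mul_smul, ← op_mul] at h2
    rw [smul_mul_assoc, mul_assoc, ann' _ h2, smul_zero]

end Morita

lemma Sys.mul_xdown_tl {M : ℕ} {E : Type*} [Ring E] {x τ χ : ℕ → E} {d : E}
    (H : Sys n k x τ χ d) (hl : 1 ≤ l) (hM : l + M ≤ k + 1) {g : E}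
    (hg : ∀ i, l ≤ i → i + 1 < l + M → g * τ i = 0) :
    PM (g * xdown x l M * tl τ l (M - 1)) g := by
  obtain ⟨ρ, hρ⟩ : ∃ ρ, PM (g * ρ * tl τ l (M - 1)) g := by
    refine ⟨(xup (fun i => op (x i)) l M).unop, ?_⟩
    have h1 := H.opp.tl_xup_mul hl hM (g := op g) fun i h1 h2 => by
      rw [← op_mul, hg i h1 h2, op_zero]
    have h2 := H.tl_op (l := l) (N := M - 1) hl ω
    have h3 := ((h2.mul_right _).mul_right _).symm.trans h1
    rcases h3 with h | h
    · exact .inl (by simpa [mul_assoc] using congrArg unop h)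
    · exact .inr (by simpa [mul_assoc] using congrArg unop h)
  have h1 := (H.tl_xdown_tl hl hM).mul_left (g * ρ)
  have h2 := ((hρ.mul_right (xdown x l M)).mul_right (tl τ l (M - 1))).symm.trans
    (PM.trans (.inl (by simp only [mul_assoc])) h1)
  exact h2.trans hρ

namespace ONH

variable {k : Fin (n + 1)}

lemma _root_.OddCR.PM.exists_smul {E : Type*} [Ring E] [Algebra K E] {y z : E} (h : PM y z) :
    ∃ ε : K, ε * ε = 1 ∧ y = ε • z := by
  rcases h with h | h
  · exact ⟨1, by simp, by simpa using h⟩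
  · exact ⟨-1, by simp, by simpa using h⟩

lemma pr_eq_of_mul_right {h g : ONH K n n}
    (e : h * tl tau (k + 1) (n - (k + 1)) = g * tl tau (k + 1) (n - (k + 1))) :
    pr K n k h = pr K n k g := by
  rw [pr_eq_pr]
  refine mem_null_of_cut ?_
  rw [sub_mul, e, sub_self, mul_zero]

lemma pr_eq_of_mul_left {h g : ONH K n n}
    (e : tl tau (n - k + 1) (n - (n - k + 1)) * h = tl tau (n - k + 1) (n - (n - k + 1)) * g) :
    pr K n k h = pr K n k g := by
  rw [pr_eq_pr]
  refine mem_null_of_cut ?_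
  rw [← mul_assoc, mul_sub, e, sub_self, zero_mul]

theorem exists_generator (K : Type u) [CommRing K] (k : Fin (n + 1)) :
    ∃ (ε ε' : K), ε * ε = 1 ∧ ε' * ε' = 1 ∧
    (∃ (c : C K n k) (γ : ℤ × ZMod 2), c ∈ gradC K n k γ ∧ (ε • e' 1 (n - k) : ONH K n (n - k)) • c = c ∧
      op (ε' • e 1 k : ONH K n k) • c = c ∧
      (∀ p, ∃ s : ONH K n (n - k), op (ε' • e 1 k : ONH K n k) • p = s • c) ∧
      (∀ p, ∃ r : ONH K n k, (ε • e' 1 (n - k) : ONH K n (n - k)) • p = op r • c) ∧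
      (∀ s : ONH K n (n - k), s • c = 0 → s * (ε • e' 1 (n - k)) = 0) ∧
      (∀ r : ONH K n k, op r • c = 0 → (ε' • e 1 k) * r = 0)) := by
  have ha := Nat.sub_le n k
  have hb := Nat.lt_succ_iff.mp k.2
  have hab : n - k + k = n := ω
  have H := sysOf K n n
  obtain ⟨δX, hX⟩ := exists_xup_mem_homog (K := K) (n := n) (m := n - k) 1 (n - k)
  obtain ⟨δY, hY⟩ := exists_xdown_mem_homog (K := K) (n := n) (m := k) 1 k
  obtain ⟨δ, hδ⟩ := exists_crossing_mem_homog (K := K) (n := n) (m := n) k (n - k)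
  obtain ⟨ε, hε, e1⟩ := (H.tl_xup_mul (l := 1) (M := n - k)
    (g := crossing tau k (n - k) * tl tau (k + 1) (n - (k + 1))) le_rfl ω
    fun i h1 h2 => by
      rw [← mul_assoc]
      refine ((H.crossing_tau (a := n - k) (b := k) ω h1 ω).symm.mul_right
        _).eq_zero ?_
      rw [mul_assoc, H.tau_tl ω ω ω ω, mul_zero]).exists_smul
        (K := K)
  obtain ⟨ε', hε', e2⟩ := (H.mul_xdown_tl (l := 1) (M := k)
    (g := tl tau (n - k + 1) (n - (n - k + 1)) * crossing tau k (n - k)) le_rfl ω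
    fun i h1 h2 => by
      rw [mul_assoc]
      refine ((H.tau_crossing (a := n - k) (b := k) ω h1 ω).symm.mul_left
        _).eq_zero ?_
      rw [← mul_assoc, H.tl_tau ω ω ω ω, zero_mul]).exists_smul
        (K := K)
  obtain ⟨c, γ, h1, h2, h3, h4, h5, h6, h7⟩ := OddCR.exists_generator (isGradedBimodule k) (t := tl tau 1 (n - k - 1))
    (t' := tω k) hε hε' hX hY (pr_mem_gradC hδ)
    (by
      rw [smul_pr, smul_pr, ← map_smul, incl_tl ha le_rfl ω, incl_xup ha le_rfl ω]
      refine pr_eq_of_mul_right ?_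
      rw [smul_mul_assoc, ← e1]
      simp only [mul_assoc])
    (by
      rw [op_smul_pr, op_smul_pr, ← map_smul, incl_tl hb le_rfl ω, incl_xdown hb le_rfl ω]
      refine pr_eq_of_mul_left ?_
      rw [mul_smul_comm, ← e2]
      simp only [mul_assoc])
    (fun p => by
      obtain ⟨p, rfl⟩ := pr_surjective p
      obtain ⟨g, hg⟩ := exists_sub_mem_null hab ha p
      refine ⟨g, ?_⟩
      rw [op_smul_pr, smul_pr, incl_tl hb le_rfl ω]
      exact pr_eq_pr.2 hg)
    (fun p => by
      obtain ⟨p, rfl⟩ := pr_surjective p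
      obtain ⟨g, hg⟩ := exists_sub_mem_null_right hab hb p
      refine ⟨g, ?_⟩
      rw [op_smul_pr, smul_pr, incl_tl ha le_rfl ω]
      exact pr_eq_pr.2 hg)
    (fun s hs => by
      rw [smul_pr, pr_eq_zero] at hs
      exact mul_tl_eq_zero hab ha hs)
    (fun r hr => by
      rw [op_smul_pr, pr_eq_zero] at hr
      exact tl_mul_eq_zero hab hb hr)
  obtain ⟨η, hη, h8⟩ := (pm_e' (K := K) (n := n) (k := n - k) 1 (n - k)).symm.exists_smul (K := K)
  obtain ⟨η', hη', h9⟩ := (pm_e (K := K) (n := n) (k := k) (l := 1) (m := k) ω).symm.exists_smul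
    (K := K)
  rw [Nat.add_sub_cancel] at h8 h9
  rw [h8, smul_smul] at h2
  rw [h9, smul_smul] at h3
  simp only [h8, h9, smul_smul] at h4 h5 h6 h7
  exact ⟨ε * η, ε' * η', by rw [mul_mul_mul_comm, hε, hη, one_mul],
    by rw [mul_mul_mul_comm, hε', hη', one_mul], c, γ, h1, h2, h3, h4, h5, h6, h7⟩

lemma one_mem_span_e' : (1 : ONH K n m) ∈ span K {s | ∃ y z, s = y * e' 1 m * z} := by
  obtain ⟨ι, _, κ, -, -, h, -⟩ := (sysOf K n m).exists_full_family (l := 1)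
    (N := m - 1) le_rfl ω
  obtain ⟨r, hr⟩ := h 1
  rw [hr]
  refine sum_mem fun i _ => ?_
  refine PM.mem ?_ (subset_span ⟨κ i * tω m, r i, rfl⟩)
  rw [mul_assoc (κ i), ← mul_assoc (κ i)]
  exact ((tl_mul_e' le_rfl ω le_rfl).symm.mul_left (κ i)).mul_right (r i)

lemma one_mem_span_e : (1 : ONH K n m) ∈ span K {s | ∃ y z, s = y * e 1 m * z} := by
  obtain ⟨ι, _, κ, -, -, h, -⟩ := (sysOf K n m).exists_full_family_right (l := 1)
    (N := m - 1) le_rfl ω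
  obtain ⟨r, hr⟩ := h 1
  rw [hr]
  refine sum_mem fun i _ => ?_
  refine PM.mem ?_ (subset_span ⟨r i, tω m * κ i, rfl⟩)
  rw [← mul_assoc, mul_assoc (r i) (e 1 m)]
  exact ((e_mul_tl le_rfl ω le_rfl).symm.mul_left (r i)).mul_right (κ i)

end ONH

section Corner

variable {S R P A B : Type u} [Ring S] [Algebra K S] [Ring R]
  [Algebra K R] [AddCommGroup P] [Module K P] [Module S P] [Module Rᵐᵒᵖ P]
  [Ring A] [Algebra K A] [Ring B] [Algebra K B]
  {gS : ℤ × ZMod 2 → Submodule K S} {gR : ℤ × ZMod 2 → Submodule K R}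
  {gP : ℤ × ZMod 2 → Submodule K P} {gA : ℤ × ZMod 2 → Submodule K A}
  {gB : ℤ × ZMod 2 → Submodule K B}

lemma map_one_of_range {e : S} (ee : e * e = e) (φ : A →ₙₐ[K] S)
    (hφ : Set.range φ = {z | ∃ h, z = e * h * e}) : φ 1 = e := by
  obtain ⟨w, hw⟩ : e ∈ Set.range φ := by rw [hφ]; exact ⟨e, by rw [ee, ee]⟩
  obtain ⟨h, hh⟩ : φ 1 ∈ {z | ∃ h, z = e * h * e} := by rw [← hφ]; exact ⟨1, rfl⟩
  calc φ 1 = φ 1 * e := by rw [hh, mul_assoc _ e e, ee]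
    _ = φ (1 * w) := by rw [map_mul, hw]
    _ = e := by rw [one_mul, hw]

theorem isInvertible_corner (hP : IsGradedBimodule gS gR gP)
    (hA : DirectSum.IsInternal gA) (hB : DirectSum.IsInternal gB)
    (mA : ∀ g h, ∀ s ∈ gA g, ∀ t ∈ gA h, s * t ∈ gA (g + h))
    (oA : 1 ∈ gA 0) (oB : 1 ∈ gB 0) {e' : S} {e : R} {c : P} {γ : ℤ × ZMod 2}
    (he' : e' ∈ gS 0) (he : e ∈ gR 0) (hc : c ∈ gP γ)
    (ee' : e' * e' = e') (ee : e * e = e) (e'c : e' • c = c) (ce : op e • c = c)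
    (gen : ∀ p : P, ∃ s : S, op e • p = s • c)
    (gen' : ∀ p : P, ∃ r : R, e' • p = op r • c)
    (ann : ∀ s : S, s • c = 0 → s * e' = 0)
    (ann' : ∀ r : R, op r • c = 0 → e * r = 0)
    (φ : A →ₙₐ[K] S) (ψ : B →ₙₐ[K] R) (iφ : Function.Injective φ) (iψ : Function.Injective ψ)
    (rφ : Set.range φ = {z | ∃ h, z = e' * h * e'}) (rψ : Set.range ψ = {z | ∃ h, z = e * h * e})
    (dφ : ∀ g, ∀ y ∈ gA g, φ y ∈ gS g) (dψ : ∀ g, ∀ y ∈ gB g, ψ y ∈ gR g)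
    (U : Submodule K P) (hU : ∀ p, p ∈ U ↔ e' • p = p ∧ op e • p = p) :
    ∃ (_ : Module A U) (_ : Module Bᵐᵒᵖ U), (∀ (y : A) (u : U), ((y • u : U) : P) = φ y • (u : P)) ∧
      (∀ (y : B) (u : U), ((op y • u : U) : P) = op (ψ y) • (u : P)) ∧
      IsInvertible gA gB fun g => (gP g).comap U.subtype := by
  have : IsScalarTower K S P := .of_algebraMap_smul hP.algebraMap_smul
  have : IsScalarTower K Rᵐᵒᵖ P := .of_algebraMap_smul hP.algebraMap_op_smul
  have : SMulCommClass S Rᵐᵒᵖ P := ⟨fun s r p => hP.smul_op_smul s r.unop p⟩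
  have φ1 := map_one_of_range ee' φ rφ
  have ψ1 := map_one_of_range ee ψ rψ
  have eφ : ∀ y, e' * φ y = φ y := fun y => by rw [← φ1, ← map_mul, one_mul]
  have φe : ∀ y, φ y * e' = φ y := fun y => by rw [← φ1, ← map_mul, mul_one]
  have eψ : ∀ y, e * ψ y = ψ y := fun y => by rw [← ψ1, ← map_mul, one_mul]
  have ψe : ∀ y, ψ y * e = ψ y := fun y => by rw [← ψ1, ← map_mul, mul_one]
  have m1 : ∀ y, ∀ p ∈ U, φ y • p ∈ U := fun y p hp => by
    rw [hU] at hp ⊢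
    rw [← mul_smul, eφ, ← smul_comm, hp.2]
    exact ⟨rfl, rfl⟩
  have m2 : ∀ y, ∀ p ∈ U, op (ψ y) • p ∈ U := fun y p hp => by
    rw [hU] at hp ⊢
    rw [← mul_smul, ← op_mul, ψe, smul_comm, hp.1]
    exact ⟨rfl, rfl⟩
  let MA : Module A U :=
    { smul := fun y u => ⟨φ y • (u : P), m1 y u u.2⟩
      one_smul := fun u => Subtype.ext (by
        change φ 1 • (u : P) = u
        rw [φ1]; exact ((hU u).1 u.2).1)
      mul_smul := fun y z u => Subtype.ext (by
        change φ (y * z) • (u : P) = φ y • φ z • (u : P)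
        rw [map_mul, mul_smul])
      smul_zero := fun y => Subtype.ext (smul_zero (φ y))
      smul_add := fun y u v => Subtype.ext (smul_add (φ y) (u : P) v)
      add_smul := fun y z u => Subtype.ext (by
        change φ (y + z) • (u : P) = φ y • (u : P) + φ z • (u : P)
        rw [map_add, add_smul])
      zero_smul := fun u => Subtype.ext (by
        change φ 0 • (u : P) = 0
        rw [map_zero, zero_smul]) }
  let MB : Module Bᵐᵒᵖ U :=
    { smul := fun y u => ⟨op (ψ y.unop) • (u : P), m2 _ u u.2⟩
      one_smul := fun u => Subtype.ext (by
        change op (ψ 1) • (u : P) = u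
        rw [ψ1]; exact ((hU u).1 u.2).2)
      mul_smul := fun y z u => Subtype.ext (by
        change op (ψ (z.unop * y.unop)) • (u : P)
          = op (ψ y.unop) • op (ψ z.unop) • (u : P)
        rw [map_mul, op_mul, mul_smul])
      smul_zero := fun y => Subtype.ext (smul_zero (op (ψ y.unop)))
      smul_add := fun y u v => Subtype.ext (smul_add (op (ψ y.unop)) (u : P) v)
      add_smul := fun y z u => Subtype.ext (by
        change op (ψ (y.unop + z.unop)) • (u : P)
          = op (ψ y.unop) • (u : P) + op (ψ z.unop) • (u : P)
        rw [map_add, op_add, add_smul])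
      zero_smul := fun u => Subtype.ext (by
        change op (ψ 0) • (u : P) = 0
        rw [map_zero, op_zero, zero_smul]) }
  have sA : ∀ (y : A) (u : U), ((y • u : U) : P) = φ y • (u : P) := fun _ _ => rfl
  have sB : ∀ (y : B) (u : U), ((op y • u : U) : P) = op (ψ y) • (u : P) := fun _ _ => rfl
  obtain ⟨π, hπ⟩ := exists_grProj hP.isInternal
  have π1 : ∀ g p, π g (e' • p) = e' • π g p :=
    hπ.comm hπ (DistribSMul.toAddMonoidHom P e') Function.injective_id fun g v hv => by
      simpa using hP.smul_mem _ _ _ _ he' hv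
  have π2 : ∀ g p, π g (op e • p) = op e • π g p :=
    hπ.comm hπ (DistribSMul.toAddMonoidHom P (op e)) Function.injective_id fun g v hv => by
      simpa using hP.op_smul_mem _ _ _ _ hv he
  have hbi : IsGradedBimodule (P := U) gA gB fun g => (gP g).comap U.subtype :=
    { isInternal := hπ.comap U fun g u hu => by
        rw [hU] at hu ⊢
        rw [← π1, ← π2, hu.1, hu.2]
        exact ⟨rfl, rfl⟩
      smul_mem := fun g h s p hs hp => hP.smul_mem _ _ _ _ (dφ _ _ hs) hp
      op_smul_mem := fun g h r p hp hr => hP.op_smul_mem _ _ _ _ hp (dψ _ _ hr)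
      smul_op_smul := fun s r p => Subtype.ext (hP.smul_op_smul _ _ _)
      algebraMap_smul := fun r p => Subtype.ext (by
        rw [sA, Algebra.algebraMap_eq_smul_one, map_smul, φ1, smul_assoc, ((hU p).1 p.2).1]
        rfl)
      algebraMap_op_smul := fun r p => Subtype.ext (by
        rw [sB, Algebra.algebraMap_eq_smul_one, map_smul, ψ1, op_smul, smul_assoc, ((hU p).1 p.2).2]
        rfl) }
  have hcU : c ∈ U := (hU c).2 ⟨e'c, ce⟩
  refine ⟨MA, MB, sA, sB, isInvertible_of_generator hbi hA hB mA oA oB (c := ⟨c, hcU⟩) hc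
    (one_mul 1) (one_mul 1) (subset_span ⟨1, 1, by simp⟩)
    (subset_span ⟨1, 1, by simp⟩) (one_smul _ _) (one_smul _ _) ?_ ?_ ?_ ?_⟩
  · intro p
    obtain ⟨s, hs⟩ := gen p
    obtain ⟨y, hy⟩ : e' * s * e' ∈ Set.range φ := by rw [rφ]; exact ⟨s, rfl⟩
    refine ⟨y, (one_smul _ _).trans (Subtype.ext ?_)⟩
    rw [sA, hy, mul_smul, e'c, mul_smul, ← hs, ((hU p).1 p.2).2, ((hU p).1 p.2).1]
  · intro p
    obtain ⟨r, hr⟩ := gen' p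
    obtain ⟨y, hy⟩ : e * r * e ∈ Set.range ψ := by rw [rψ]; exact ⟨r, rfl⟩
    refine ⟨y, (one_smul _ _).trans (Subtype.ext ?_)⟩
    rw [sB, hy, op_mul, op_mul, mul_smul, mul_smul, ce, ← hr, ((hU p).1 p.2).1, ((hU p).1 p.2).2]
  · intro y hy
    have := ann (φ y) (congrArg Subtype.val hy)
    rw [φe] at this
    rw [mul_one]
    exact iφ (by rw [this, map_zero])
  · intro y hy
    have := ann' (ψ y) (congrArg Subtype.val hy)
    rw [eψ] at this
    rw [one_mul]
    exact iψ (by rw [this, map_zero])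

end Corner

namespace ONH

variable (K : Type u) [CommRing K] (k : Fin (n + 1))

theorem isInvertible_gradC :
    IsInvertible (homog K n (n - k)) (homog K n k) (gradC K n k) := by
  obtain ⟨ε, ε', hε, hε', c, γ, h1, h2, h3, h4, h5, h6, h7⟩ := exists_generator K k
  have ee' := h6 (1 - ε • e' 1 (n - k)) (by rw [sub_smul, one_smul, h2, sub_self])
  have ee := h7 (1 - ε' • e 1 k) (by
    rw [op_sub, op_one, sub_smul, one_smul, h3, sub_self])
  rw [sub_mul, one_mul, sub_eq_zero] at ee'
  rw [mul_sub, mul_one, sub_eq_zero] at ee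
  have hs : ∀ {A : Type u} [Ring A] [Algebra K A] (η : K) (y : A), η * η = 1 →
      (1 : A) ∈ span K {s | ∃ z w, s = z * y * w} →
      (1 : A) ∈ span K {s | ∃ z w, s = z * (η • y) * w} := by
    intro A _ _ η y hη h
    refine span_mono ?_ h
    rintro _ ⟨z, w, rfl⟩
    exact ⟨η • z, w, by rw [smul_mul_smul_comm, hη, one_smul]⟩
  exact isInvertible_of_generator (isGradedBimodule k) grProj.internal grProj.internal
    (fun g h s hs t ht => homog_mul hs ht) (smul_mem _ _ (e'_mem_homog _ _))
    (smul_mem _ _ (e_mem_homog _ _)) h1 ee'.symm ee.symm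
    (hs _ _ hε one_mem_span_e') (hs _ _ hε' one_mem_span_e) h2 h3 h4 h5 h6 h7

theorem isInvertible_gradCutC {A B : Type u} [Ring A] [Algebra K A] [Ring B] [Algebra K B]
    {gA : ℤ × ZMod 2 → Submodule K A} {gB : ℤ × ZMod 2 → Submodule K B}
    (hA : DirectSum.IsInternal gA) (hB : DirectSum.IsInternal gB)
    (mA : ∀ g h, ∀ s ∈ gA g, ∀ t ∈ gA h, s * t ∈ gA (g + h)) (oA : 1 ∈ gA 0) (oB : 1 ∈ gB 0)
    (φ : A →ₙₐ[K] ONH K n (n - k)) (ψ : B →ₙₐ[K] ONH K n k)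
    (iφ : Function.Injective φ) (iψ : Function.Injective ψ)
    (rφ : Set.range φ = {z | ∃ h : ONH K n (n - k), z = e' 1 (n - k) * h * e' 1 (n - k)})
    (rψ : Set.range ψ = {z | ∃ h : ONH K n k, z = e 1 k * h * e 1 k})
    (dφ : ∀ g, ∀ y ∈ gA g, φ y ∈ homog K n (n - k) g) (dψ : ∀ g, ∀ y ∈ gB g, ψ y ∈ homog K n k g) :
    ∃ (_ : Module A (cutC K n k)) (_ : Module Bᵐᵒᵖ (cutC K n k)),
      (∀ (y : A) (c : cutC K n k), ((y • c : cutC K n k) : C K n k) = φ y • (c : C K n k)) ∧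
      (∀ (y : B) (c : cutC K n k), ((op y • c : cutC K n k) : C K n k)
        = op (ψ y) • (c : C K n k)) ∧ IsInvertible gA gB (gradCutC K n k) := by
  obtain ⟨ε, ε', hε, hε', c, γ, h1, h2, h3, h4, h5, h6, h7⟩ := exists_generator K k
  have ee' := h6 (1 - ε • e' 1 (n - k)) (by rw [sub_smul, one_smul, h2, sub_self])
  have ee := h7 (1 - ε' • e 1 k) (by
    rw [op_sub, op_one, sub_smul, one_smul, h3, sub_self])
  rw [sub_mul, one_mul, sub_eq_zero] at ee'
  rw [mul_sub, mul_one, sub_eq_zero] at ee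
  have hP := isGradedBimodule (K := K) k
  have : IsScalarTower K (ONH K n (n - k)) (C K n k) := .of_algebraMap_smul hP.algebraMap_smul
  have : IsScalarTower K (ONH K n k)ᵐᵒᵖ (C K n k) := .of_algebraMap_smul hP.algebraMap_op_smul
  have : SMulCommClass (ONH K n (n - k)) (ONH K n k)ᵐᵒᵖ (C K n k) :=
    ⟨fun s r p => hP.smul_op_smul s r.unop p⟩
  have hs : ∀ {A : Type u} [Ring A] [Algebra K A] (η : K) (y h : A), η * η = 1 →
      y * h * y = (η • y) * h * (η • y) := by
    intro A _ _ η y h hη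
    rw [smul_mul_assoc, smul_mul_smul_comm, hη, one_smul]
  refine isInvertible_corner hP hA hB mA oA oB
    (smul_mem _ _ (e'_mem_homog _ _))
    (smul_mem _ _ (e_mem_homog _ _)) h1 ee'.symm ee.symm h2 h3 h4 h5 h6 h7 φ ψ iφ iψ
    (by simpa only [← hs _ _ _ hε] using rφ) (by simpa only [← hs _ _ _ hε'] using rψ) dφ dψ
    (cutC K n k) fun p => ⟨?_, fun hp => ?_⟩
  · rintro ⟨q, rfl⟩
    change (ε • e' 1 (n - k) : ONH K n (n - k)) • (e' 1 (n - k) : ONH K n (n - k)) •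
        op (e 1 k : ONH K n k) • q
        = (e' 1 (n - k) : ONH K n (n - k)) • op (e 1 k : ONH K n k) • q ∧
      op (ε' • e 1 k : ONH K n k) • (e' 1 (n - k) : ONH K n (n - k)) • op (e 1 k : ONH K n k) • q
        = (e' 1 (n - k) : ONH K n (n - k)) • op (e 1 k : ONH K n k) • q
    have f1 : (ε • e' 1 (n - k) : ONH K n (n - k)) * e' 1 (n - k) = e' 1 (n - k) := by
      have := congrArg (ε • ·) ee'
      simp only [mul_smul_comm, smul_smul, hε, one_smul] at this
      exact this.symm
    have f2 : (e 1 k : ONH K n k) * (ε' • e 1 k) = e 1 k := by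
      have := congrArg (ε' • ·) ee
      simp only [smul_mul_assoc, smul_smul, hε', one_smul] at this
      exact this.symm
    constructor
    · rw [← mul_smul, f1]
    · rw [← smul_comm (e' 1 (n - k) : ONH K n (n - k)), ← mul_smul (op _), ← op_mul, f2]
  · refine ⟨(ε * ε') • p, ?_⟩
    change (e' 1 (n - k) : ONH K n (n - k)) • op (e 1 k : ONH K n k) • (ε * ε') • p = p
    obtain ⟨q1, q2⟩ := hp
    have : op (e 1 k : ONH K n k) • (ε * ε') • p = ε • p := by
      conv_rhs => rw [← q2]
      rw [op_smul, smul_assoc, smul_smul]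
      exact smul_comm _ _ _
    rw [this]
    conv_rhs => rw [← q1]
    rw [smul_assoc]
    exact smul_comm _ _ _

end ONH

section

variable {Q : Type*} [Monoid Q] {S : Submonoid Q} {T : ℕ → Q}

lemma asc_mem (h : ∀ i, T i ∈ S) (l N : ℕ) : asc T l N ∈ S := by
  induction N with
  | zero => rw [asc_zero]; exact one_mem S
  | succ N ih => rw [asc_succ]; exact mul_mem ih (h _)

lemma desc_mem (h : ∀ i, T i ∈ S) (l N : ℕ) : desc T l N ∈ S := by
  induction N with
  | zero => rw [desc_zero]; exact one_mem S
  | succ N ih => rw [desc_succ]; exact mul_mem (h _) ih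

lemma tl_mem (h : ∀ i, T i ∈ S) (l N : ℕ) : tl T l N ∈ S := by
  induction N with
  | zero => rw [tl_zero]; exact one_mem S
  | succ N ih => rw [tl_succ]; exact mul_mem (asc_mem h _ _) ih

end

namespace OPolA

/-! ### Odd symmetric polynomials -/

lemma mem_OSymA :
    f ∈ OSymA K n k ↔ ∀ i, dv i f = 0 := by
  constructor
  · intro h i
    by_cases hi : 1 ≤ i ∧ i < k
    · rw [dv_eq hi.1 hi.2]
      exact h _ _ (Nat.sub_add_cancel hi.1)
    · rw [dv, dif_neg hi]; rfl
  · intro h p q hpq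
    have hq : 1 ≤ (q : ℕ) := ω
    have hp : p = ⟨(q : ℕ) - 1, (Nat.sub_le _ _).trans_lt q.2⟩ := Fin.ext (by simp only; omega)
    have := h q
    rw [dv_eq hq q.2] at this
    rw [divDiff, hp]
    exact this

lemma D_mem_OSymA : (D : OPolA K n k) ∈ OSymA K n k := mem_OSymA.2 fun i => by
  by_cases hi : 1 ≤ i ∧ i < k
  · exact dv_D hi.1 hi.2
  · rw [dv, dif_neg hi]; rfl

lemma chi_mem_OSymA (j : ℕ) : chi K n k j ∈ OSymA K n k := mem_OSymA.2 fun i => by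
  by_cases hi : 1 ≤ i ∧ i < k
  · exact dv_chi hi.1 hi.2 j
  · rw [dv, dif_neg hi]; rfl

lemma cOf_mem_OSymA (r : ℕ) : cOf (chi K n k) D r ∈ OSymA K n k := by
  unfold cOf
  split_ifs
  · exact chi_mem_OSymA _
  · exact mul_mem D_mem_OSymA (chi_mem_OSymA _)

/-- The operators which commute with right multiplication by odd symmetric polynomials. -/
def rightLinear (K : Type u) [CommRing K] (n k : ℕ) : Submonoid (EndP K n k) where
  carrier := {T | ∀ f, ∀ g ∈ OSymA K n k, T (f * g) = T f * g}
  mul_mem' {S T} hS hT f g hg := by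
    rw [Module.End.mul_apply, Module.End.mul_apply, hT f g hg, hS _ g hg]
  one_mem' f g _ := rfl

lemma dv_mem_rightLinear (i : ℕ) : dv i ∈ rightLinear K n k := fun f g hg => by
  by_cases hi : 1 ≤ i ∧ i < k
  · rw [dv_mul hi.1 hi.2, mem_OSymA.1 hg, mul_zero, add_zero]
  · rw [dv, dif_neg hi]; simp

lemma tl_mul (l N : ℕ) (f : OPolA K n k) {g : OPolA K n k} (hg : g ∈ OSymA K n k) :
    tl dv l N (f * g) = tl dv l N f * g := tl_mem dv_mem_rightLinear l N f g hg

lemma desc_mul (l N : ℕ) (f : OPolA K n k) {g : OPolA K n k} (hg : g ∈ OSymA K n k) :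
    desc dv l N (f * g) = desc dv l N f * g := desc_mem dv_mem_rightLinear l N f g hg

lemma tl_mem_OSymA (f : OPolA K n k) : tl dv 1 (k - 1) f ∈ OSymA K n k := mem_OSymA.2 fun i => by
  by_cases hi : 1 ≤ i ∧ i < k
  · rw [← Module.End.mul_apply, sys.tau_tl le_rfl ω hi.1 ω]; rfl
  · rw [dv, dif_neg hi]; rfl

lemma exists_tl_eq (hf : f ∈ OSymA K n k) : ∃ g, f = tl dv 1 (k - 1) g := by
  obtain ⟨u, hu⟩ := exists_tl_eq_one (K := K) (n := n) (k := k)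
  rcases hu with hu | hu
  · exact ⟨u * f, by rw [tl_mul _ _ _ hf, hu, one_mul]⟩
  · exact ⟨-(u * f), by rw [map_neg, tl_mul _ _ _ hf, hu, neg_one_mul, neg_neg]⟩

lemma sw_sw (h1 : 1 ≤ i) (h2 : i < k) (f : OPolA K n k) : sw i (sw i f) = f := by
  induction f using OPolA.induction with
  | hc r => rw [sw_algebraMap h1 h2, sw_algebraMap h1 h2]
  | hx j h3 h4 =>
    rw [sw_X h1 h2 h3 h4, map_neg]
    split_ifs with c1 c2
    · rw [sw_X h1 h2 ω ω, if_neg ω, if_pos rfl, neg_neg, c1]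
    · rw [sw_X h1 h2 ω ω, if_pos rfl, neg_neg, c2]
    · rw [sw_X h1 h2 h3 h4, if_neg c1, if_neg c2, neg_neg]
  | hχ j h3 h4 => rw [sw_chi h1 h2, sw_chi h1 h2]
  | hd => rw [sw_D h1 h2, map_neg, sw_D h1 h2, neg_neg]
  | ha f g h3 h4 => rw [map_add, map_add, h3, h4]
  | hm f g h3 h4 => rw [sw_mul h1 h2, sw_mul h1 h2, h3, h4]

/-! ### Reversal of the variables -/

lemma psys_reverse : PSys n k (fun i => (-1) ^ (k - 1) * X (k + 1 - i) : ℕ → OPolA K n k)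
    (chi K n k) D := by
  have P := psys (K := K) (n := n) (k := k)
  have hs : ∀ s : ℕ, ((-1) ^ s = (1 : OPolA K n k)) ∨ ((-1) ^ s = (-1 : OPolA K n k)) :=
    neg_one_pow_eq_or _
  constructor
  · exact P.chi_zero
  · intro i j h1 h2 h3 h4 h5
    have := P.x_x (k + 1 - i) (k + 1 - j) ω ω ω ω ω
    rcases hs (k - 1) with h | h <;> simp only [h] <;> simpa using this
  · exact P.d_sq
  · exact P.d_chi_top
  · exact P.chi_chi
  · exact P.chi_d
  · intro i j h1 h2 h3 h4
    have := P.x_chi (k + 1 - i) j ω ω h3 h4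
    rcases hs (k - 1) with h | h <;> simp only [h] <;> simpa using this
  · intro i h1 h2
    have := P.x_d (k + 1 - i) ω ω
    rcases hs (k - 1) with h | h <;> simp [h, this]

/-- The involution `x_i ↦ (-1)^{k-1} x_{k+1-i}`. -/
def reverse : OPolA K n k →ₐ[K] OPolA K n k := lift psys_reverse

lemma reverse_X (h1 : 1 ≤ i) (h2 : i ≤ k) :
    reverse (X i : OPolA K n k) = (-1) ^ (k - 1) * X (k + 1 - i) := lift_X _ h1 h2

lemma reverse_chi (j : ℕ) : reverse (chi K n k j) = chi K n k j := by
  by_cases h : j ≤ n / 2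
  · exact lift_chi _ h
  · rw [chi, if_neg ω, dif_neg ω, map_zero]

lemma reverse_D : reverse (D : OPolA K n k) = D := lift_D _

lemma reverse_reverse (f : OPolA K n k) : reverse (reverse f) = f := by
  induction f using OPolA.induction with
  | hc r => simp
  | hx i h1 h2 =>
    rw [reverse_X h1 h2, map_mul, map_pow, map_neg, map_one, reverse_X ω ω,
      ← mul_assoc, ← pow_add, Even.neg_one_pow ⟨_, rfl⟩, one_mul]
    congr 1; omega
  | hχ j h3 h4 => rw [reverse_chi, reverse_chi]
  | hd => rw [reverse_D, reverse_D]
  | ha f g h3 h4 => rw [map_add, map_add, h3, h4]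
  | hm f g h3 h4 => rw [map_mul, map_mul, h3, h4]

lemma neg_one_pow_mul_eq_smul (s : ℕ) (f : OPolA K n k) : (-1) ^ s * f = ((-1) ^ s : K) • f := by
  rcases Nat.even_or_odd s with h | h <;> simp [h.neg_one_pow]

lemma dv_reverse (h1 : 1 ≤ i) (h2 : i < k) (f : OPolA K n k) :
    dv i (reverse f) = ((-1) ^ (k - 1) : K) • reverse (dv (k - i) f) ∧
      sw i (reverse f) = reverse (sw (k - i) f) := by
  have h3 : 1 ≤ k - i := ω
  have h4 : k - i < k := ω
  induction f using OPolA.induction with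
  | hc r => simp [dv_algebraMap, sw_algebraMap, h1, h2, h3, h4]
  | hx j h5 h6 =>
    rw [reverse_X h5 h6, neg_one_pow_mul_eq_smul, map_smul, map_smul,
      dv_X h1 h2 ω ω, sw_X h1 h2 ω ω, dv_X h3 h4 h5 h6, sw_X h3 h4 h5 h6]
    constructor
    · congr 1
      by_cases h : j = k - i ∨ j = k - i + 1
      · rw [if_pos h, if_pos ω, map_one]
      · rw [if_neg h, if_neg ω, map_zero]
    · have : ∀ p, 1 ≤ p → p ≤ k → reverse (-X p : OPolA K n k) = ((-1) ^ (k - 1) : K) • -X (k + 1 - p) :=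
        fun p h h' => by rw [map_neg, reverse_X h h', neg_one_pow_mul_eq_smul, smul_neg]
      rw [this _ (by split_ifs <;> omega) (by split_ifs <;> omega)]
      congr 3
      split_ifs <;> omega
  | hχ j h5 h6 => simp [reverse_chi, dv_chi, sw_chi, h1, h2, h3, h4]
  | hd => simp [reverse_D, dv_D, sw_D, h1, h2, h3, h4]
  | ha f g h5 h6 => simp only [map_add, h5.1, h5.2, h6.1, h6.2, smul_add, and_self]
  | hm f g h5 h6 =>
    rw [map_mul, dv_mul h1 h2, sw_mul h1 h2, dv_mul h3 h4, sw_mul h3 h4, h5.1, h5.2, h6.1, h6.2]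
    simp only [map_add, map_mul, smul_add, smul_mul_assoc, mul_smul_comm, and_self]

lemma reverse_mem_OSymA (hf : f ∈ OSymA K n k) : reverse f ∈ OSymA K n k :=
  mem_OSymA.2 fun i => by
    by_cases hi : 1 ≤ i ∧ i < k
    · rw [(dv_reverse hi.1 hi.2 f).1, mem_OSymA.1 hf, map_zero, smul_zero]
    · rw [dv, dif_neg hi]; rfl

end OPolA

namespace OPolA

/-! ### Complete odd symmetric polynomials as divided differences -/

open Classical in
/-- The complete odd symmetric polynomials in the variables after the first `b` ones. -/
def hsFrom (K : Type u) [CommRing K] (n k b m : ℕ) : OPolA K n k :=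
  ∑ f : Fin m → Fin k, if Monotone f ∧ ∀ s, b ≤ (f s : ℕ) then
    (List.ofFn fun s => xt K n k (f s)).prod else 0

lemma hsFrom_zero_left (m : ℕ) : hsFrom K n k 0 m = hsym K n k m := by
  simp [hsFrom, hsym]

lemma hsFrom_zero_right (b : ℕ) : hsFrom K n k b 0 = 1 := by
  simp [hsFrom, Subsingleton.monotone]

lemma monotone_cons (a : Fin k) (g : Fin m → Fin k) :
    Monotone (Fin.cons a g : Fin (m + 1) → Fin k) ↔ Monotone g ∧ ∀ s, a ≤ g s := by
  constructor
  · intro h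
    refine ⟨fun i j hij => ?_, fun s => ?_⟩
    · simpa using h (Fin.succ_le_succ_iff.2 hij)
    · simpa using h (Fin.zero_le s.succ)
  · rintro ⟨h1, h2⟩ i j hij
    induction i using Fin.cases with
    | zero =>
      induction j using Fin.cases with
      | zero => exact le_rfl
      | succ j => simpa using h2 j
    | succ i =>
      induction j using Fin.cases with
      | zero => exact absurd hij (by simp)
      | succ j => simpa using h1 (Fin.succ_le_succ_iff.1 hij)

lemma hsFrom_succ_eq_sum (b m : ℕ) : hsFrom K n k b (m + 1)
    = ∑ a : Fin k, if b ≤ (a : ℕ) then xt K n k a * hsFrom K n k a m else 0 := by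
  rw [hsFrom, ← (Fin.consEquiv fun _ : Fin (m + 1) => Fin k).sum_comp, Fintype.sum_prod_type]
  refine sum_congr rfl fun a _ => ?_
  simp only [Fin.consEquiv_apply, List.ofFn_succ, Fin.cons_zero, Fin.cons_succ,
    List.prod_cons, Fin.forall_fin_succ]
  split_ifs with h
  · rw [hsFrom, mul_sum]
    refine sum_congr rfl fun g _ => ?_
    rw [mul_ite, mul_zero]
    refine if_congr ⟨fun h' => (monotone_cons a g).1 h'.1,
      fun h' => ⟨(monotone_cons a g).2 h', h, fun s => h.trans (h'.2 s)⟩⟩ rfl rfl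
  · exact sum_eq_zero fun g _ => if_neg fun h' => h h'.2.1

lemma hsFrom_succ (hb : b < k) (m : ℕ) : hsFrom K n k b (m + 1)
    = xt K n k ⟨b, hb⟩ * hsFrom K n k b m + hsFrom K n k (b + 1) (m + 1) := by
  rw [hsFrom_succ_eq_sum, hsFrom_succ_eq_sum,
    ← Finset.add_sum_erase _ _ (Finset.mem_univ (⟨b, hb⟩ : Fin k)),
    ← Finset.add_sum_erase _ (fun a : Fin k => if b + 1 ≤ (a : ℕ) then _ else _)
      (Finset.mem_univ (⟨b, hb⟩ : Fin k))]
  rw [if_pos le_rfl, if_neg (by simp), zero_add]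
  congr 1
  refine sum_congr rfl fun a ha => if_congr ?_ rfl rfl
  have : (a : ℕ) ≠ b := fun h => (Finset.mem_erase.1 ha).1 (Fin.ext h)
  omega

/-- The complete symmetric polynomials in the first `j` variables, in the reverse order. -/
def hsTo (K : Type u) [CommRing K] (n k j m : ℕ) : OPolA K n k := reverse (hsFrom K n k (k - j) m)

lemma hsTo_zero_right (j : ℕ) : hsTo K n k j 0 = 1 := by
  rw [hsTo, hsFrom_zero_right, map_one]

lemma hsTo_zero_left (m : ℕ) : hsTo K n k 0 (m + 1) = 0 := by
  rw [hsTo, hsFrom_succ_eq_sum, sum_eq_zero, map_zero]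
  exact fun a _ => if_neg ω

lemma hsTo_succ (h1 : j < k) (m : ℕ) : hsTo K n k (j + 1) (m + 1)
    = ((-1) ^ j : K) • (X (j + 1) * hsTo K n k (j + 1) m) + hsTo K n k j (m + 1) := by
  rw [hsTo, hsFrom_succ (b := k - (j + 1)) ω, map_add, map_mul, xt, gen_x]
  rw [map_mul, map_pow, map_neg, map_one, reverse_X ω (by simp only; omega),
    show k - (j + 1) + 1 = k - j by omega, ← mul_assoc, ← pow_add, neg_one_pow_mul_eq_smul, smul_mul_assoc]
  rw [show k + 1 - (k - j) = j + 1 by omega, show k - (j + 1) + (k - 1) = j + 2 * (k - (j + 1)) by omega,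
    pow_add, pow_mul, neg_one_sq, one_pow, mul_one]
  rfl

lemma hsTo_mem_poly (hj : j ≤ k) (m : ℕ) : hsTo K n k j m ∈ poly (Set.Iic j) := by
  induction j generalizing m with
  | zero =>
    cases m with
    | zero => rw [hsTo_zero_right]; exact one_mem _
    | succ m => rw [hsTo_zero_left]; exact zero_mem _
  | succ j ih =>
    induction m with
    | zero => rw [hsTo_zero_right]; exact one_mem _
    | succ m ih' =>
      rw [hsTo_succ ω]
      exact add_mem (Subalgebra.smul_mem _ (mul_mem (X_mem_poly (by simp)) ih') _)
        (poly_mono (by simp) (ih ω _))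

lemma dv_hsTo (h : j + 1 < k) (m : ℕ) : dv (j + 1) (hsTo K n k (j + 1) (m + 1))
    = ((-1) ^ j : K) • hsTo K n k (j + 2) m := by
  have h1 : 1 ≤ j + 1 := ω
  have key : ∀ m, dv (j + 1) (hsTo K n k (j + 1) (m + 1)) = ((-1) ^ j : K) • (hsTo K n k (j + 1) m
      + -(X (j + 2) * dv (j + 1) (hsTo K n k (j + 1) m))) := by
    intro m
    rw [hsTo_succ ω, map_add, map_smul, dv_mul h1 h, dv_X h1 h h1 h.le, sw_X h1 h h1 h.le,
      if_pos (.inl rfl), if_pos rfl, one_mul, neg_mul,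
      dv_of_mem_poly h1 h (S := Set.Iic j) (by simp) (by simp) (hsTo_mem_poly ω _), add_zero]
  induction m with
  | zero => rw [key, hsTo_zero_right, dv_one h1 h, mul_zero, neg_zero, add_zero, hsTo_zero_right]
  | succ m ih =>
    rw [key, ih, hsTo_succ h, mul_smul_comm, ← neg_smul, pow_succ, mul_neg_one, add_comm]

lemma desc_X_pow (hj : j < k) : (∀ m < j, desc dv 1 j (X 1 ^ m : OPolA K n k) = 0) ∧
    ∃ s : ℕ, ∀ m, desc dv 1 j (X 1 ^ (m + j) : OPolA K n k) = ((-1) ^ s : K) • hsTo K n k (j + 1) m := by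
  induction j with
  | zero =>
    refine ⟨by simp, 0, fun m => ?_⟩
    rw [pow_zero, one_smul, desc_zero, Module.End.one_apply, add_zero]
    induction m with
    | zero => rw [pow_zero, hsTo_zero_right]
    | succ m ih =>
      rw [hsTo_succ hj, hsTo_zero_left, ← ih, pow_succ', pow_zero, one_smul, add_zero]
  | succ j ih =>
    obtain ⟨h1, s, h2⟩ := ih ω
    constructor
    · intro m hm
      rw [dv_desc_succ]
      by_cases h : m < j
      · rw [h1 m h, map_zero]
      · have := h2 0
        rw [zero_add] at this
        rw [show m = j by omega, this, map_smul, hsTo_zero_right, dv_one ω hj, smul_zero]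
    · refine ⟨s + j, fun m => ?_⟩
      rw [dv_desc_succ, show m + (j + 1) = m + 1 + j by omega, h2, map_smul, dv_hsTo hj, smul_smul,
        pow_add]

lemma reverse_hPrime (m : ℕ) : reverse (hPrime K n k m) = ∑ r ∈ range (m + 1),
    (-1) ^ r * hsTo K n k k (m - r) * cOf (chi K n k) D r := by
  have hc : ∀ r, reverse (c K n k r) = cOf (chi K n k) D r := fun r => by
    unfold c cOf
    split_ifs
    · exact reverse_chi _
    · rw [map_mul, reverse_chi]; congr 1; exact reverse_D
  simp only [hPrime, map_sum, map_mul, map_pow, map_neg, map_one, hc, hsTo, Nat.sub_self,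
    hsFrom_zero_left]

lemma desc_X_pow_mul_aOf (hk : k ≤ n) (hi : i < k) : ∃ s : ℕ,
    desc dv 1 (k - 1) (X 1 ^ i * aOf n (chi K n k) D (X 1))
      = ((-1) ^ s : K) • reverse (hPrime K n k (n + 1 - k + i)) := by
  obtain ⟨h1, s, h2⟩ := desc_X_pow (K := K) (n := n) (k := k) (j := k - 1) ω
  rw [show k - 1 + 1 = k by omega] at h2
  refine ⟨s + n, ?_⟩
  rw [reverse_hPrime, aOf, mul_sum, map_sum, ← Finset.sum_range_reflect, Finset.smul_sum,
    ← Finset.sum_subset (Finset.range_subset_range.2 (show n + 1 - k + i + 1 ≤ n + 1 by omega))]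
  · refine sum_congr rfl fun r hr => ?_
    rw [mem_range] at hr
    rw [show n - (n + 1 - 1 - r) = r by omega, ← mul_assoc, desc_mul _ _ _ (cOf_mem_OSymA _),
      neg_one_pow_mul_eq_smul, mul_smul_comm, map_smul, ← pow_add, neg_one_pow_mul_eq_smul,
      show i + (n + 1 - 1 - r) = n + 1 - k + i - r + (k - 1) by omega, h2, smul_mul_assoc, smul_mul_assoc,
      smul_mul_assoc, smul_smul, smul_smul]
    congr 1
    rw [← pow_add, ← pow_add, show s + n + r = n + 1 - 1 - r + s + 2 * r by omega, pow_add _ _ (2 * r), pow_mul,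
      neg_one_sq, one_pow, mul_one]
  · intro r hr hr'
    rw [mem_range] at hr hr'
    rw [← mul_assoc, desc_mul _ _ _ (cOf_mem_OSymA _), neg_one_pow_mul_eq_smul, mul_smul_comm, map_smul,
      ← pow_add, h1 _ ω, smul_zero, zero_mul]

end OPolA

/-! ### The kernel of the quotient map onto `M_k^n` -/

namespace OPolA

/-- The restriction of `reverse` to odd symmetric polynomials. -/
def symReverse (K : Type u) [CommRing K] (n k : ℕ) :
    OSymA K n k →ₐ[K] OSymA K n k :=
  (reverse.comp (OSymA K n k).val).codRestrict (OSymA K n k) fun f => reverse_mem_OSymA f.2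

lemma symReverse_coe (f : OSymA K n k) :
    (symReverse K n k f : OPolA K n k) = reverse (f : OPolA K n k) := rfl

lemma symReverse_symReverse (f : OSymA K n k) : symReverse K n k (symReverse K n k f) = f :=
  Subtype.ext (reverse_reverse _)

end OPolA

open OPolA

/-- The quotient map onto `M_k^n`. -/
def M.mk (K : Type u) [CommRing K] (n k : ℕ) : OSymA K n k →ₐ[K] M K n k :=
  RingQuot.mkAlgHom K (MRel K n k)

lemma M.mk_surjective : Function.Surjective (M.mk K n k) :=
  RingQuot.mkAlgHom_surjective K (MRel K n k)

/-- The quotient map onto `M_k^n`, composed with the reversal of the variables. -/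
def toM (K : Type u) [CommRing K] (n k : ℕ) : OSymA K n k →ₐ[K] M K n k :=
  (M.mk K n k).comp (symReverse K n k)

lemma toM_surjective : Function.Surjective (toM K n k) := fun y => by
  obtain ⟨f, rfl⟩ := M.mk_surjective y
  exact ⟨symReverse K n k f, by rw [toM, AlgHom.comp_apply, symReverse_symReverse]⟩

/-- The odd symmetric polynomials which vanish in `M_k^n` (after reversal of the variables). -/
def symKer (K : Type u) [CommRing K] (n k : ℕ) : PSub K n k :=
  (LinearMap.ker (toM K n k).toLinearMap).map (OSymA K n k).val.toLinearMap

lemma mem_symKer {f : OSymA K n k} : (f : OPolA K n k) ∈ symKer K n k ↔ toM K n k f = 0 := by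
  constructor
  · rintro ⟨g, hg, h⟩
    obtain rfl : g = f := Subtype.ext h
    exact hg
  · exact fun h => ⟨f, h, rfl⟩

lemma mul_mem_symKer {f g : OPolA K n k} (hf : f ∈ symKer K n k) (hg : g ∈ OSymA K n k) :
    f * g ∈ symKer K n k := by
  obtain ⟨f, hf, rfl⟩ := hf
  change toM K n k f = 0 at hf
  refine mem_symKer (f := f * ⟨g, hg⟩) |>.2 ?_
  rw [map_mul, hf, zero_mul]

lemma mul_mem_symKer_left {f g : OPolA K n k} (hf : f ∈ symKer K n k) (hg : g ∈ OSymA K n k) :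
    g * f ∈ symKer K n k := by
  obtain ⟨f, hf, rfl⟩ := hf
  change toM K n k f = 0 at hf
  refine mem_symKer (f := ⟨g, hg⟩ * f) |>.2 ?_
  rw [map_mul, hf, mul_zero]

lemma _root_.OddCR.PM.apply {A : Type*} [Ring A] [Algebra K A] {S T : Module.End K A} (h : PM S T)
    (v : A) : PM (S v) (T v) := by
  rcases h with h | h <;> simp [h, PM]

lemma desc_X_pow_mul_aOf_mem (hk : k ≤ n) (hi : i < k) :
    desc dv 1 (k - 1) (X 1 ^ i * aOf n (chi K n k) D (X 1)) ∈ symKer K n k := by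
  obtain ⟨s, hs⟩ := desc_X_pow_mul_aOf (K := K) hk hi
  have h1 : desc dv 1 (k - 1) (X 1 ^ i * aOf n (chi K n k) D (X 1)) ∈ OSymA K n k := by
    refine mem_OSymA.2 fun j => ?_
    by_cases hj : 1 ≤ j ∧ j < k
    · refine dv_desc (v := X 1 ^ i * aOf n (chi K n k) D (X 1)) ?_ hj.1 hj.2 ω ω
      exact mul_mem (pow_mem (X_mem_poly (Set.mem_singleton 1)) _)
        (aOf_mem_poly (Set.mem_singleton 1))
    · rw [dv, dif_neg hj]; rfl
  have h2 : hPrime K n k (n + 1 - k + i) ∈ OSymA K n k := by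
    have h3 := reverse_mem_OSymA h1
    rw [hs, map_smul, reverse_reverse, ← neg_one_pow_mul_eq_smul] at h3
    exact (PM.unit_mul s _).symm.mem h3
  have h4 : M.mk K n k ⟨_, h2⟩ = 0 :=
    (RingQuot.mkAlgHom_rel K (s := MRel K n k) ⟨rfl, n + 1 - k + i, ω, ω, rfl⟩).trans
      (map_zero _)
  refine (mem_symKer (f := ⟨_, h1⟩)).2 ?_
  rw [toM, AlgHom.comp_apply]
  have h5 : symReverse K n k ⟨_, h1⟩ = ((-1) ^ s : K) • ⟨_, h2⟩ :=
    Subtype.ext ((congrArg reverse hs).trans (by rw [map_smul, reverse_reverse]; rfl))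
  rw [h5, map_smul, h4, smul_zero]

lemma dv_mul_aOf (h1 : 2 ≤ i) (h2 : i < k) :
    PM (lm (aOf n (chi K n k) D (X 1)) * dv i) (dv i * lm (aOf n (chi K n k) D (X 1))) := by
  have e : lm (aOf n (chi K n k) D (X 1)) = aOf n (fun i => lm (chi K n k i)) (lm D) (lm (X 1)) :=
    map_aOf (Algebra.lmul K (OPolA K n k)).toRingHom n (chi K n k) D (X 1)
  rw [e, aOf_comm (dv_xfar ω h2 le_rfl ω ω ω)
    (dv_lm_D ω h2) fun j _ => dv_lm_chi ω h2 j]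
  exact (PM.unit_mul _ _).symm

lemma desc_D_mul (l N : ℕ) (hl : 1 ≤ l) (hN : l + N ≤ k) (f : OPolA K n k) :
    PM (desc dv l N (D * f)) (D * desc dv l N f) := by
  have h := Sys.pm_desc (τ := (dv : ℕ → EndP K n k)) (y := lm D) (l := l) (N := N)
    fun i h1 h2 => .inr (by rw [dv_lm_D ω ω, neg_neg])
  exact h.symm.apply f

lemma desc_aOf_mul_mem (hk : k ≤ n) (hi : i < k) :
    desc dv 1 (k - 1) (aOf n (chi K n k) D (X 1) * X 1 ^ i) ∈ symKer K n k := by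
  have h1 := psys.aOf_mul_x (x := (X : ℕ → OPolA K n k)) (n := n) (k := k) ω
  have h2 : (X 1 + 2 * (-1) ^ n * D : OPolA K n k) * (X 1 + 2 * (-1) ^ n * D) = X 1 ^ 2 := by
    have h3 : (D * X 1 : OPolA K n k) = -(X 1 * D) := psys.x_d 1 le_rfl ω
    have h4 : (D * D : OPolA K n k) = 0 := psys.d_sq
    have hc : Commute (2 * (-1) ^ n : OPolA K n k) (X 1) :=
      (Commute.ofNat_left 2 _).mul_left ((Commute.neg_one_left _).pow_left n)
    have hc' : Commute D (2 * (-1) ^ n : OPolA K n k) :=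
      (Commute.ofNat_right _ 2).mul_right ((Commute.neg_one_right _).pow_right n)
    generalize (2 * (-1) ^ n : OPolA K n k) = c at *
    rw [add_mul, mul_add, mul_add, mul_assoc c D (X 1), h3, ← mul_assoc (X 1), ← hc.eq,
      mul_assoc c D, ← mul_assoc D c, hc'.eq, mul_assoc c D D, h4, mul_assoc c (X 1)]
    noncomm_ring
  have h3 : ∀ q, aOf n (chi K n k) D (X 1) * (X 1 ^ 2) ^ q
      = (X 1 ^ 2) ^ q * aOf n (chi K n k) D (X 1) := fun q => by
    refine Commute.pow_right (?_ : _ = _) q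
    rw [pow_two, ← mul_assoc, h1, mul_assoc, h1, ← mul_assoc, h2, pow_two]
  obtain ⟨q, rfl | rfl⟩ := Nat.even_or_odd' i
  · rw [pow_mul, h3, ← pow_mul]
    exact desc_X_pow_mul_aOf_mem hk hi
  · have h4 : aOf n (chi K n k) D (X 1) * X 1 ^ (2 * q + 1)
        = X 1 ^ (2 * q + 1) * aOf n (chi K n k) D (X 1)
          + (2 * (-1) ^ n : K) • (D * (X 1 ^ (2 * q) * aOf n (chi K n k) D (X 1))) := by
      have h5 : (2 * (-1) ^ n : OPolA K n k) = algebraMap K _ (2 * (-1) ^ n) := by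
        rw [map_mul, map_ofNat, map_pow, map_neg, map_one]
      have h6 : Commute (X 1 ^ 2 : OPolA K n k) D := by
        have h7 : (D * X 1 : OPolA K n k) = -(X 1 * D) := psys.x_d 1 le_rfl ω
        change _ = _
        rw [pow_two, ← mul_assoc D, h7, neg_mul, mul_assoc, mul_assoc, h7, mul_neg, neg_neg]
      rw [pow_succ', ← mul_assoc, h1, add_mul, add_mul, mul_assoc, pow_mul, h3, h5, ← Algebra.smul_def,
        smul_mul_assoc, smul_mul_assoc, mul_assoc D, h3, mul_assoc]
    rw [h4, map_add, map_smul]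
    refine add_mem (desc_X_pow_mul_aOf_mem hk hi) (smul_mem _ _ ?_)
    exact (desc_D_mul _ _ le_rfl ω _).mem
      (mul_mem_symKer_left (desc_X_pow_mul_aOf_mem hk ω) D_mem_OSymA)

lemma exists_tl_aOf_mul (hk : 1 ≤ k) (g : OPolA K n k) :
    ∃ σ : ℕ → OPolA K n k, (∀ i, σ i ∈ OSymA K n k) ∧
      PM ((tl dv 1 (k - 1) : EndP K n k) (aOf n (chi K n k) D (X 1) * g))
        (desc dv 1 (k - 1) (aOf n (chi K n k) D (X 1) * ∑ i ∈ range k, X 1 ^ i * σ i)) := by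
  obtain ⟨J, rfl | rfl⟩ : ∃ J, k = 1 ∨ k = J + 2 := ⟨k - 2, ω⟩
  · refine ⟨fun _ => g, fun _ => mem_OSymA.2 fun j => ?_, .inl (by simp)⟩
    rw [dv, dif_neg ω]; rfl
  · have H := sys (K := K) (n := n) (k := J + 2)
    obtain ⟨r, hr⟩ := H.flip.tl_mem_sum (l := 1) (N := J) le_rfl ω
    have f1 := H.tl_flip (l := 1) (N := J) le_rfl ω
    have f2 := H.tl_flip (l := 1) (N := J + 1) le_rfl ω
    rw [show J + 2 + 1 - 1 - J = 2 by omega, hr] at f1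
    rw [show J + 2 + 1 - 1 - (J + 1) = 1 by omega] at f2
    refine ⟨fun i => tl (fun i => dv (J + 2 - i)) 1 (J + 1) (r i g),
      fun i => (f2.apply (r i g)).mem (tl_mem_OSymA _), ?_⟩
    have h1 := (H.tl_left_desc (l := 1) (N := J) le_rfl ω).apply
      (aOf n (chi K n (J + 2)) D (X 1) * g)
    refine h1.trans (PM.map_linear (desc dv 1 (J + 1)) ?_)
    have h2 := Sys.pm_tl (τ := (dv : ℕ → Module.End K (OPolA K n (J + 2))))
      (y := lm (aOf n (chi K n (J + 2)) D (X 1))) (l := 2) (N := J)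
      fun i h1 h2 => dv_mul_aOf h1 ω
    refine (h2.symm.apply g).trans (PM.mul_left _ ((f1.symm.apply g).trans (.of_eq ?_)))
    rw [LinearMap.sum_apply]
    refine sum_congr rfl fun i _ => ?_
    rw [Module.End.mul_apply, Module.End.mul_apply, show J + 2 + 1 - (1 + J + 1) = 1 by omega, LinearMap.pow_mulLeft]
    rfl

lemma tl_mem_symKer (hk : k ≤ n) (hf : f ∈ cycIdeal k) :
    (tl dv 1 (k - 1) : EndP K n k) f ∈ symKer K n k := by
  have H := sys (K := K) (n := n) (k := k)
  refine cycIdeal_induction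
    (p := fun f => (tl dv 1 (k - 1) : EndP K n k) f ∈ symKer K n k) ?_ ?_ ?_ hf
  · rw [map_zero]; exact zero_mem _
  · intro a b h h'; rw [map_add]; exact add_mem h h'
  · intro g l hl
    induction l generalizing g with
    | succ l ih =>
      have h1 : 1 ≤ l + 1 := ω
      have e1 := dv_mul h1 hl (sw (l + 1) g) (cyc l)
      rw [sw_sw h1 hl, ← cyc_succ] at e1
      have e2 := congrArg (tl dv 1 (k - 1) : EndP K n k) e1
      rw [← Module.End.mul_apply, H.tl_tau le_rfl ω h1 ω, LinearMap.zero_apply, map_add] at e2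
      rw [← neg_eq_of_add_eq_zero_right e2.symm]
      exact neg_mem (ih _ ω)
    | zero =>
      obtain ⟨-, g', hg⟩ := exists_aOf_mul (K := K) (n := n) (k := k) ω g
      rw [cyc_zero, hg]
      obtain ⟨σ, hσ, h⟩ := exists_tl_aOf_mul (K := K) (n := n) (k := k) ω g'
      refine h.mem ?_
      rw [mul_sum, map_sum]
      refine sum_mem fun i hi => ?_
      rw [← mul_assoc, desc_mul _ _ _ (hσ i)]
      exact mul_mem_symKer (desc_aOf_mul_mem hk (mem_range.1 hi)) (hσ i)

open OPolA

namespace ONH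

/-! ### Polynomials in `ONH_k^n` -/

/-- The morphism `OPol_k ⊗ A_n → ONH_k^n`. -/
def ofPol (K : Type u) [CommRing K] (n k : ℕ) : OPolA K n k →ₐ[K] ONH K n k :=
  OPolA.lift (sysOf K n k).psys

lemma ofPol_X (h1 : 1 ≤ i) (h2 : i ≤ k) : ofPol K n k (X i) = x i := OPolA.lift_X _ h1 h2

lemma ofPol_chi (i : ℕ) : ofPol K n k (OPolA.chi K n k i) = chi i := by
  by_cases h : i ≤ n / 2
  · exact OPolA.lift_chi _ h
  · rw [OPolA.chi, chi, fchi, if_neg ω, if_neg ω, dif_neg ω, dif_neg ω, map_zero, map_zero]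

lemma ofPol_D : ofPol K n k D = d := OPolA.lift_D _

lemma tau_ofPol (h1 : 1 ≤ i) (h2 : i < k) (f : OPolA K n k) :
    tau i * ofPol K n k f = ofPol K n k (dv i f) + ofPol K n k (sw i f) * tau i := by
  have H := sysOf K n k
  induction f using OPolA.induction with
  | hc r =>
    rw [dv_algebraMap h1 h2, sw_algebraMap h1 h2, map_zero, zero_add, AlgHom.commutes]
    exact (Algebra.commutes _ _).symm
  | hx j h3 h4 =>
    rw [dv_X h1 h2 h3 h4, sw_X h1 h2 h3 h4, map_neg, ofPol_X h3 h4, neg_mul, ← sub_eq_add_neg,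
      eq_sub_iff_add_eq]
    by_cases c1 : j = i
    · subst c1
      rw [if_pos rfl, if_pos (.inl rfl), ofPol_X ω ω, map_one]
      exact H.tau_x j h1 h2
    by_cases c2 : j = i + 1
    · subst c2
      rw [if_neg c1, if_pos rfl, if_pos (.inr rfl), ofPol_X ω ω, map_one, add_comm]
      exact H.x_tau i h1 h2
    · rw [if_neg c1, if_neg c2, if_neg ω, ofPol_X h3 h4, map_zero, add_comm]
      exact H.x_tau_far j i h3 h4 h1 h2 c1 c2
  | hχ j h3 h4 =>
    rw [dv_chi h1 h2, sw_chi h1 h2, map_zero, zero_add, ofPol_chi]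
    exact (H.tau_chi i j h1 h2 h3 h4).symm
  | hd =>
    rw [dv_D h1 h2, sw_D h1 h2, map_zero, zero_add, map_neg, ofPol_D, neg_mul]
    rw [H.tau_d i h1 h2, neg_neg]
  | ha f g hf hg => simp only [map_add, mul_add, add_mul, hf, hg]; abel
  | hm f g hf hg =>
    rw [dv_mul h1 h2, sw_mul h1 h2, map_mul, map_add, map_mul, map_mul, map_mul, ← mul_assoc, hf,
      add_mul, mul_assoc _ (tau i), hg, mul_add, add_assoc, mul_assoc]

/-- The elements annihilated by all `τ_i` on the left. -/
def tauKer (K : Type u) [CommRing K] (n k : ℕ) : Submodule K (ONH K n k) where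
  carrier := {y | ∀ i, 1 ≤ i → i < k → tau i * y = 0}
  add_mem' hy hz i h1 h2 := by rw [mul_add, hy i h1 h2, hz i h1 h2, add_zero]
  zero_mem' i _ _ := mul_zero _
  smul_mem' r y hy i h1 h2 := by rw [mul_smul_comm, hy i h1 h2, smul_zero]

lemma tl_mul_mem_tauKer (h : ONH K n k) : tω k * h ∈ tauKer K n k := fun i h1 h2 => by
  rw [← mul_assoc, (sys (K := K)).tau_tl le_rfl ω h1 ω, zero_mul]

lemma tl_mem_tauKer : (tω k : ONH K n k) ∈ tauKer K n k := by
  simpa using tl_mul_mem_tauKer (1 : ONH K n k)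

lemma tau_ofPol_mul {y : ONH K n k} (hy : y ∈ tauKer K n k) (i : ℕ) (f : OPolA K n k) :
    tau i * (ofPol K n k f * y) = ofPol K n k (dv i f) * y := by
  by_cases hi : 1 ≤ i ∧ i < k
  · rw [← mul_assoc, tau_ofPol hi.1 hi.2, add_mul, mul_assoc _ (tau i), hy i hi.1 hi.2, mul_zero,
      add_zero]
  · rw [tau, ftau, dif_neg ω, dv, dif_neg hi]; simp

lemma ofPol_mul_mem_tauKer (hf : f ∈ OSymA K n k) {y : ONH K n k}
    (hy : y ∈ tauKer K n k) : ofPol K n k f * y ∈ tauKer K n k := fun i _ _ => by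
  rw [tau_ofPol_mul hy, mem_OSymA.1 hf, map_zero, zero_mul]

/-- Pairs of an element of `ONH_k^n` and an operator on polynomials which agree on `tauKer`. -/
def compat (K : Type u) [CommRing K] (n k : ℕ) :
    Submonoid (ONH K n k × EndP K n k) where
  carrier := {p | ∀ f, ∀ y ∈ tauKer K n k, p.1 * (ofPol K n k f * y) = ofPol K n k (p.2 f) * y}
  mul_mem' {p q} hp hq f y hy := by
    rw [Prod.fst_mul, Prod.snd_mul, Module.End.mul_apply, mul_assoc, hq f y hy, hp _ y hy]
  one_mem' f y _ := one_mul _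

lemma tl_ofPol_mul {y : ONH K n k} (hy : y ∈ tauKer K n k) (l N : ℕ) (f : OPolA K n k) :
    tl tau l N * (ofPol K n k f * y) = ofPol K n k (tl dv l N f) * y := by
  let T : ℕ → ONH K n k × EndP K n k := fun i => (tau i, dv i)
  have h := tl_mem (T := T) (S := compat K n k) (fun i f y hy => tau_ofPol_mul hy i f) l N f y hy
  have h1 := map_tl T l N (MonoidHom.fst _ _)
  have h2 := map_tl T l N (MonoidHom.snd _ _)
  exact h1 ▸ h2 ▸ h

lemma desc_ofPol_mul {y : ONH K n k} (hy : y ∈ tauKer K n k) (l N : ℕ) (f : OPolA K n k) :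
    desc tau l N * (ofPol K n k f * y) = ofPol K n k (desc dv l N f) * y := by
  let T : ℕ → ONH K n k × EndP K n k := fun i => (tau i, dv i)
  have h := desc_mem (T := T) (S := compat K n k) (fun i f y hy => tau_ofPol_mul hy i f) l N f y hy
  have h1 := map_desc T l N (MonoidHom.fst _ _)
  have h2 := map_desc T l N (MonoidHom.snd _ _)
  exact h1 ▸ h2 ▸ h

lemma exists_mul_ofPol (h : ONH K n k) (f : OPolA K n k) :
    ∃ g, ∀ y ∈ tauKer K n k, h * (ofPol K n k f * y) = ofPol K n k g * y := by
  have aux : ∀ g f : OPolA K n k, ∃ g', ∀ y ∈ tauKer K n k,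
      ofPol K n k g * (ofPol K n k f * y) = ofPol K n k g' * y :=
    fun g f => ⟨g * f, fun y _ => by rw [map_mul, mul_assoc]⟩
  induction h using ONH.induction generalizing f with
  | hc r => simpa using aux (algebraMap _ _ r) f
  | hg g =>
    cases g with
    | x i =>
      have := aux (X (i + 1)) f
      rwa [ofPol_X ω ω, x, fx, dif_pos ω] at this
    | tau i =>
      have h1 : (gen (.tau i) : ONH K n k) = tau (i + 1) := by
        rw [tau, ftau, dif_pos ω]; rfl
      rw [h1]
      exact ⟨_, fun y hy => tau_ofPol_mul hy _ f⟩
    | chi i =>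
      have := aux (OPolA.chi K n k (i + 1)) f
      rwa [ofPol_chi, chi, fchi, if_neg ω, dif_pos ω] at this
    | d => have := aux D f; rwa [ofPol_D] at this
  | ha a b h1 h2 =>
    obtain ⟨g, hg⟩ := h1 f
    obtain ⟨g', hg'⟩ := h2 f
    exact ⟨g + g', fun y hy => by rw [add_mul, hg y hy, hg' y hy, map_add, add_mul]⟩
  | hm a b h1 h2 =>
    obtain ⟨g, hg⟩ := h2 f
    obtain ⟨g', hg'⟩ := h1 g
    exact ⟨g', fun y hy => by rw [mul_assoc, hg y hy, hg' y hy]⟩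

lemma exists_tl_mul_tl (h : ONH K n k) : ∃ f ∈ OSymA K n k,
    tω k * h * tω k = ofPol K n k f * tω k := by
  obtain ⟨g, hg⟩ := exists_mul_ofPol h 1
  have h1 := hg _ tl_mem_tauKer
  rw [map_one, one_mul] at h1
  exact ⟨_, tl_mem_OSymA g, by rw [mul_assoc, h1, tl_ofPol_mul tl_mem_tauKer]⟩

lemma act_ofPol (f v : OPolA K n k) :
    act K n k (ofPol K n k f) (Submodule.Quotient.mk v) = Submodule.Quotient.mk (f * v) := by
  induction f using OPolA.induction generalizing v with
  | hc r =>
    rw [AlgHom.commutes, AlgHom.commutes, ← Algebra.smul_def]; rfl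
  | hx i h1 h2 => rw [ofPol_X h1 h2, act, ONH.lift_x _ _ h1 h2]; rfl
  | hχ i h1 h2 => rw [ofPol_chi, act, ONH.lift_chi _ _ h2]; rfl
  | hd => rw [ofPol_D, act, ONH.lift_d]; rfl
  | ha a b h1 h2 =>
    rw [map_add, map_add, LinearMap.add_apply, h1, h2, add_mul, Submodule.Quotient.mk_add]
  | hm a b h1 h2 => rw [map_mul, map_mul, Module.End.mul_apply, h2, h1, mul_assoc]

lemma toM_eq_zero_of_mul_tl (hk : k ≤ n) {f : OSymA K n k}
    (hf : ofPol K n k f * tω k = 0) : toM K n k f = 0 := by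
  obtain ⟨u, hu⟩ := exists_tl_eq_one (K := K) (n := n) (k := k)
  have h1 := congrArg (fun y => act K n k y (Submodule.Quotient.mk u)) hf
  simp only [map_mul, Module.End.mul_apply, act_tl, act_ofPol, map_zero, LinearMap.zero_apply] at h1
  rw [Submodule.Quotient.mk_eq_zero] at h1
  have h2 : (f : OPolA K n k) ∈ cycSpace K n k := by
    refine PM.mem (PM.symm ?_) h1
    simpa using hu.mul_left (f : OPolA K n k)
  have h3 := tl_mem_symKer hk (Ideal.mul_mem_left _ u h2)
  rw [tl_mul _ _ _ f.2] at h3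
  refine mem_symKer.1 (PM.mem ?_ h3)
  simpa using (hu.mul_right (f : OPolA K n k)).symm

/-- Odd symmetric polynomials act on `tauKer`. -/
def symMul (K : Type u) [CommRing K] (n k : ℕ) :
    OSymA K n k →ₐ[K] Module.End K (tauKer K n k) := AlgHom.ofLinearMap
    { toFun := fun f => (LinearMap.mulLeft K (ofPol K n k f)).restrict
        fun _ hy => ofPol_mul_mem_tauKer f.2 hy
      map_add' := fun f g => LinearMap.ext fun y => Subtype.ext <| by
        change ofPol K n k (f + g) * y.1 = _
        rw [map_add, add_mul]; rfl
      map_smul' := fun r f => LinearMap.ext fun y => Subtype.ext <| by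
        change ofPol K n k (r • f) * y.1 = _
        rw [map_smul, smul_mul_assoc]; rfl }
    (LinearMap.ext fun y => Subtype.ext <| by
      change ofPol K n k 1 * y.1 = _
      rw [map_one, one_mul]; rfl)
    (fun f g => LinearMap.ext fun y => Subtype.ext <| by
      change ofPol K n k (f * g) * y.1 = _
      rw [map_mul, mul_assoc]; rfl)

lemma symMul_coe (f : OSymA K n k) (y : tauKer K n k) :
    (symMul K n k f y : ONH K n k) = ofPol K n k f * y := rfl

lemma symMul_symReverse_hPrime (hk : k ≤ n) {f g : OSymA K n k} (h : MRel K n k f g) :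
    symMul K n k (symReverse K n k f) = symMul K n k (symReverse K n k g) := by
  obtain ⟨rfl, m, h1, h2, h3⟩ := h
  rw [map_zero, map_zero]
  refine LinearMap.ext fun y => Subtype.ext ?_
  rw [symMul_coe, symReverse_coe, h3]
  obtain ⟨i, rfl⟩ : ∃ i, m = n + 1 - k + i := ⟨m - (n + 1 - k), ω⟩
  obtain ⟨s, hs⟩ := desc_X_pow_mul_aOf (K := K) hk (i := i) ω
  have h4 := desc_ofPol_mul y.2 1 (k - 1) (X 1 ^ i * aOf n (OPolA.chi K n k) D (X 1))
  have h5 : ofPol K n k (aOf n (OPolA.chi K n k) D (X 1)) = 0 := by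
    have h6 := map_aOf (ofPol K n k).toRingHom n (OPolA.chi K n k) D (X 1)
    refine h6.trans ?_
    change aOf n (fun i => ofPol K n k _) (ofPol K n k _) (ofPol K n k _) = 0
    simp only [ofPol_chi, ofPol_D, ofPol_X le_rfl (show 1 ≤ k by omega)]
    exact aOf_x_one ω
  rw [map_mul, h5, mul_zero, zero_mul, mul_zero, hs, ← neg_one_pow_mul_eq_smul, map_mul,
    map_pow, map_neg, map_one, mul_assoc] at h4
  exact (PM.unit_mul s _).symm.eq_zero h4.symm

/-- The action of `M_k^n` on `tauKer`. -/
def MMul (hk : k ≤ n) : M K n k →ₐ[K] Module.End K (tauKer K n k) :=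
  RingQuot.liftAlgHom K ⟨(symMul K n k).comp (symReverse K n k), fun _ _ h =>
    symMul_symReverse_hPrime hk h⟩

lemma MMul_toM (hk : k ≤ n) (f : OSymA K n k) (y : tauKer K n k) :
    (MMul hk (toM K n k f) y : ONH K n k) = ofPol K n k f * y := by
  have h : MMul hk (toM K n k f) = symMul K n k f :=
    (RingQuot.liftAlgHom_mkAlgHom_apply K _ _ _).trans (congrArg (symMul K n k) (symReverse_symReverse f))
  rw [h, symMul_coe]

end ONH

open OPolA

/-! ### The gradings -/

section homog

namespace OPolA

lemma gen_mem_homog (g : PGen n k) : gen K n k g ∈ homog K n k g.deg :=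
  subset_span ⟨[g], by simp, by simp⟩

lemma one_mem_homog : (1 : OPolA K n k) ∈ homog K n k 0 := subset_span ⟨[], by simp⟩

lemma homog_mul {g h : ℤ × ZMod 2} {y z : OPolA K n k} (hy : y ∈ homog K n k g)
    (hz : z ∈ homog K n k h) : y * z ∈ homog K n k (g + h) := by
  have := Submodule.mul_mem_mul hy hz
  rw [homog, homog, Submodule.span_mul_span] at this
  refine span_mono ?_ this
  rintro _ ⟨_, ⟨w, rfl, rfl⟩, _, ⟨w', rfl, rfl⟩, rfl⟩
  exact ⟨w ++ w', by simp, by simp⟩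

lemma homog_induction {p : ℤ × ZMod 2 → OPolA K n k → Prop} (h0 : ∀ g, p g 0)
    (ha : ∀ g a b, p g a → p g b → p g (a + b)) (hs : ∀ g (r : K) a, p g a → p g (r • a))
    (h1 : p 0 1) (hm : ∀ a g f, f ∈ homog K n k g → p g f → p (a.deg + g) (gen K n k a * f))
    (hf : f ∈ homog K n k g) : p g f := by
  induction hf using span_induction with
  | mem y hy =>
    obtain ⟨w, rfl, rfl⟩ := hy
    induction w with
    | nil => exact h1
    | cons a w ih =>
      simp only [List.map_cons, List.sum_cons, List.prod_cons]
      exact hm _ _ _ (subset_span ⟨w, rfl, rfl⟩) ih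
  | zero => exact h0 g
  | add a b _ _ h h' => exact ha g a b h h'
  | smul r a _ h => exact hs g r a h

lemma iSup_homog : (⨆ g, homog K n k g) = ⊤ := by
  refine eq_top_iff.2 fun f _ => ?_
  have hgen : ∀ a, gen K n k a ∈ ⨆ g, homog K n k g := fun a =>
    mem_iSup_of_mem _ (gen_mem_homog a)
  induction f using OPolA.induction with
  | hc r =>
    rw [Algebra.algebraMap_eq_smul_one]
    exact mem_iSup_of_mem 0 (smul_mem _ _ one_mem_homog)
  | hx i h1 h2 => rw [X_eq h1 h2]; exact hgen _
  | hχ i h1 h2 => rw [chi_eq h1 h2]; exact hgen _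
  | hd => exact hgen _
  | ha a b h1 h2 => exact add_mem (h1 trivial) (h2 trivial)
  | hm a b h1 h2 => exact mul_mem_iSup (g := homog K n k) homog_mul (h1 trivial) (h2 trivial)

lemma gen_x_mem_homog (j : Fin k) : gen K n k (.x j) ∈ homog K n k (2, 1) :=
  gen_mem_homog (PGen.x j)

lemma X_mem_homog (i : ℕ) : (X i : OPolA K n k) ∈ homog K n k (2, 1) := by
  by_cases h : 1 ≤ i ∧ i ≤ k
  · rw [X_eq h.1 h.2]; exact gen_x_mem_homog _
  · rw [X, dif_neg h]; exact zero_mem _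

lemma sw_gen_mem_homog (i : ℕ) (a : PGen n k) : sw i (gen K n k a) ∈ homog K n k a.deg := by
  by_cases hi : 1 ≤ i ∧ i < k
  · rw [sw_eq hi.1 hi.2, divMat_gen]
    cases a with
    | x j =>
      change -gen K n k (.x _) ∈ _
      exact neg_mem (gen_x_mem_homog _)
    | chi j => exact gen_mem_homog _
    | d => exact neg_mem (gen_mem_homog PGen.d)
  · rw [sw, dif_neg hi]; exact zero_mem _

lemma dv_gen_mem_homog (i : ℕ) (a : PGen n k) :
    dv i (gen K n k a) ∈ homog K n k (a.deg + (-2, 1)) := by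
  by_cases hi : 1 ≤ i ∧ i < k
  · rw [dv_eq hi.1 hi.2, divMat_gen]
    cases a with
    | x j =>
      change delta K n k _ _ _ ∈ _
      rw [show (PGen.x j : PGen n k).deg + (-2, 1) = 0 from by simp only [PGen.deg]; decide]
      unfold delta
      split_ifs
      · exact one_mem_homog
      · exact zero_mem _
    | chi j => exact zero_mem _
    | d => exact zero_mem _
  · rw [dv, dif_neg hi]; exact zero_mem _

lemma dv_mem_homog (i : ℕ) (hf : f ∈ homog K n k g) :
    dv i f ∈ homog K n k (g + (-2, 1)) := by
  refine homog_induction (p := fun g f => dv i f ∈ homog K n k (g + (-2, 1))) ?_ ?_ ?_ ?_ ?_ hf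
  · intro g; rw [map_zero]; exact zero_mem _
  · intro g a b h h'; rw [map_add]; exact add_mem h h'
  · intro g r a h; rw [map_smul]; exact smul_mem _ _ h
  · by_cases hi : 1 ≤ i ∧ i < k
    · rw [dv_one hi.1 hi.2]; exact zero_mem _
    · rw [dv, dif_neg hi]; exact zero_mem _
  · intro a g f hf h
    by_cases hi : 1 ≤ i ∧ i < k
    · rw [dv_mul hi.1 hi.2]
      refine add_mem ?_ ?_
      · rw [add_right_comm]
        exact homog_mul (dv_gen_mem_homog i a) hf
      · rw [add_assoc]
        exact homog_mul (sw_gen_mem_homog i a) h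
    · rw [dv, dif_neg hi]; exact zero_mem _

/-- The operators which are homogeneous of some degree. -/
def homogOp (K : Type u) [CommRing K] (n k : ℕ) :
    Submonoid (EndP K n k) where
  carrier := {T | ∃ δ, ∀ g, ∀ f ∈ homog K n k g, T f ∈ homog K n k (g + δ)}
  mul_mem' {S T} := fun ⟨δ, h⟩ ⟨δ', h'⟩ => ⟨δ' + δ, fun g f hf => by
    rw [← add_assoc]; exact h _ _ (h' _ _ hf)⟩
  one_mem' := ⟨0, fun g f hf => by rwa [add_zero]⟩

lemma reverse_mem_homog (hf : f ∈ homog K n k g) :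
    reverse f ∈ homog K n k g := by
  refine homog_induction (p := fun g f => reverse f ∈ homog K n k g) ?_ ?_ ?_ ?_ ?_ hf
  · intro g; rw [map_zero]; exact zero_mem _
  · intro g a b h h'; rw [map_add]; exact add_mem h h'
  · intro g r a h; rw [map_smul]; exact smul_mem _ _ h
  · rw [map_one]; exact one_mem_homog
  · intro a g f _ h
    rw [map_mul]
    refine homog_mul ?_ h
    rw [reverse, lift_gen]
    cases a with
    | x i => exact (PM.unit_mul _ _).mem (X_mem_homog _)
    | chi i =>
      change OPolA.chi K n k (i + 1) ∈ _
      rw [chi_eq ω ω]; exact gen_mem_homog (PGen.chi _)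
    | d => exact gen_mem_homog PGen.d

end OPolA

lemma ONH.ofPol_mem_homog (hf : f ∈ OPolA.homog K n k g) :
    ofPol K n k f ∈ ONH.homog K n k g := by
  refine homog_induction (p := fun g f => ofPol K n k f ∈ ONH.homog K n k g) ?_ ?_ ?_ ?_ ?_ hf
  · intro g; rw [map_zero]; exact zero_mem _
  · intro g a b h h'; rw [map_add]; exact add_mem h h'
  · intro g r a h; rw [map_smul]; exact smul_mem _ _ h
  · rw [map_one]; exact one_mem_homog
  · intro a g f _ h
    rw [map_mul]
    refine ONH.homog_mul ?_ h
    rw [ofPol, OPolA.lift_gen]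
    cases a with
    | x i => exact inclGen_mem_homog (a := k) (Gen.x i)
    | chi i => exact inclGen_mem_homog (a := k) (Gen.chi i)
    | d => exact inclGen_mem_homog (a := k) Gen.d

namespace M

lemma mul_mem_homog (g h : ℤ × ZMod 2) : ∀ s ∈ M.homog K n k g, ∀ t ∈ M.homog K n k h,
    s * t ∈ M.homog K n k (g + h) := by
  rintro _ ⟨s, hs, rfl⟩ _ ⟨t, ht, rfl⟩
  exact ⟨s * t, OPolA.homog_mul hs ht, map_mul (M.mk K n k) s t⟩

lemma one_mem_homog : (1 : M K n k) ∈ M.homog K n k 0 :=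
  ⟨1, OPolA.one_mem_homog, map_one (M.mk K n k)⟩

lemma iSup_homog : (⨆ g, M.homog K n k g) = ⊤ := by
  refine eq_top_iff.2 fun y _ => ?_
  obtain ⟨f, rfl⟩ := M.mk_surjective y
  obtain ⟨u, hu⟩ := exists_tl_eq f.2
  obtain ⟨δ, hδ⟩ := tl_mem (S := homogOp K n k) (fun i => ⟨_, fun g f hf => dv_mem_homog i hf⟩) 1 (k - 1)
  let F : OPolA K n k →ₗ[K] M K n k := (M.mk K n k).toLinearMap ∘ₗ
    (tl dv 1 (k - 1) : EndP K n k).codRestrict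
      (Subalgebra.toSubmodule (OSymA K n k)) fun u => tl_mem_OSymA u
  have h1 : M.mk K n k f = F u := congrArg (M.mk K n k) (Subtype.ext hu)
  rw [h1]
  have h2 : (⨆ g, OPolA.homog K n k g) ≤ (⨆ g, M.homog K n k g).comap F :=
    iSup_le fun g u hu => mem_iSup_of_mem (g + δ) ⟨⟨_, tl_mem_OSymA u⟩, hδ g u hu, rfl⟩
  rw [OPolA.iSup_homog] at h2
  exact h2 trivial

end M

end homog

open OPolA

namespace ONH

/-! ### The idempotent truncations of `ONH_k^n` -/

lemma exists_ofPol_tl_eq (hf : f ∈ OSymA K n k) :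
    ∃ h, ofPol K n k f * tω k = tω k * h := by
  obtain ⟨u, rfl⟩ := exists_tl_eq hf
  exact ⟨_, (tl_ofPol_mul tl_mem_tauKer _ _ u).symm⟩

/-- The morphism to a corner of `ONH_k^n` which sends the class of an odd symmetric polynomial `f`
to `ε p f τ_{ω₀} q`. -/
def cornerHom (hk : k ≤ n) (ε : K) (p q : ONH K n k)
    (hε : ε * ε = 1) (H : ∀ f ∈ OSymA K n k, tω k * (q * p) *
      (ofPol K n k f * tω k) = ε • (ofPol K n k f * tω k)) :
    M K n k →ₙₐ[K] ONH K n k where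
  toFun y := ε • (p * (MMul hk y ⟨_, tl_mem_tauKer⟩ : ONH K n k) * q)
  map_smul' r y := by
    rw [map_smul, LinearMap.smul_apply, Submodule.coe_smul, mul_smul_comm, smul_mul_assoc,
      smul_comm]; rfl
  map_zero' := by simp
  map_add' y z := by
    rw [map_add, LinearMap.add_apply, Submodule.coe_add, mul_add, add_mul, smul_add]
  map_mul' y z := by
    obtain ⟨f, rfl⟩ := toM_surjective y
    obtain ⟨g, rfl⟩ := toM_surjective z
    rw [← map_mul, MMul_toM, MMul_toM, MMul_toM]
    have h1 : p * (ofPol K n k f * tω k) * q *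
        (p * (ofPol K n k g * tω k) * q) =
        p * (ofPol K n k f * (tω k * (q * p) *
          (ofPol K n k g * tω k))) * q := by
      simp only [mul_assoc]
    rw [smul_mul_smul_comm, h1, H g g.2, hε, one_smul, mul_smul_comm, mul_smul_comm,
      smul_mul_assoc, ← mul_assoc (ofPol K n k f), ← map_mul]
    rfl

section cornerHom

variable {hk : k ≤ n} {ε : K} {p q : ONH K n k} {hε : ε * ε = 1}
  {H : ∀ f ∈ OSymA K n k, tω k * (q * p) *
    (ofPol K n k f * tω k) = ε • (ofPol K n k f * tω k)}

lemma cornerHom_toM (f : OSymA K n k) : cornerHom hk ε p q hε H (toM K n k f)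
    = ε • (p * (ofPol K n k f * tω k) * q) := by
  change ε • (p * (MMul hk (toM K n k f) ⟨_, tl_mem_tauKer⟩ : ONH K n k) * q) = _
  rw [MMul_toM]

lemma smul_smul_self {E : Type*} [AddCommGroup E] [Module K E] (hε : ε * ε = 1) (y : E) :
    ε • ε • y = y := by rw [smul_smul, hε, one_smul]

lemma tl_mul_tl_eq (H : ∀ f ∈ OSymA K n k, tω k * (q * p) *
    (ofPol K n k f * tω k) = ε • (ofPol K n k f * tω k)) :
    tω k * (q * p) * tω k = ε • (tω k : ONH K n k) := by
  simpa using H 1 (one_mem _)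

lemma cornerHom_injective : Function.Injective (cornerHom hk ε p q hε H) := by
  refine (injective_iff_map_eq_zero _).2 fun y hy => ?_
  obtain ⟨f, rfl⟩ := toM_surjective y
  rw [cornerHom_toM] at hy
  refine toM_eq_zero_of_mul_tl hk ?_
  have h1 := congrArg (fun z => tω k * q * (ε • z) * p * tω k) hy
  simp only [smul_smul_self hε, smul_zero, mul_zero, zero_mul] at h1
  have h2 : tω k * q * (p * (ofPol K n k f * tω k) * q) * p *
      tω k = (tω k * (q * p) * (ofPol K n k f * tω k)) *
        (q * p) * tω k := by simp only [mul_assoc]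
  rw [h2, H f f.2, smul_mul_assoc, smul_mul_assoc, mul_assoc (ofPol K n k f),
    mul_assoc (ofPol K n k f), tl_mul_tl_eq H, mul_smul_comm, smul_smul_self hε] at h1
  exact h1

lemma range_cornerHom : Set.range (cornerHom hk ε p q hε H)
    = {z | ∃ h, z = (p * tω k * q) * h * (p * tω k * q)} := by
  ext z
  rw [Set.mem_ofPred_eq]
  constructor
  · rintro ⟨y, rfl⟩
    obtain ⟨f, rfl⟩ := toM_surjective y
    rw [cornerHom_toM]
    refine ⟨ε • (p * (ofPol K n k f * tω k) * q), ?_⟩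
    have h2 : (p * tω k * q) * (p * (ofPol K n k f * tω k) * q) *
        (p * tω k * q) = p * ((tω k * (q * p) *
          (ofPol K n k f * tω k)) * (q * p) * tω k) * q := by
      simp only [mul_assoc]
    rw [mul_smul_comm, smul_mul_assoc, h2, H f f.2, smul_mul_assoc, smul_mul_assoc,
      mul_assoc (ofPol K n k f), mul_assoc (ofPol K n k f), tl_mul_tl_eq H]
    simp only [mul_smul_comm, smul_smul_self hε]
  · rintro ⟨h, rfl⟩
    obtain ⟨f, hf, h1⟩ := exists_tl_mul_tl (q * h * p)
    refine ⟨ε • toM K n k ⟨f, hf⟩, ?_⟩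
    rw [map_smul, cornerHom_toM, smul_smul_self hε, ← h1]
    simp only [mul_assoc]

lemma cornerHom_mem_homog {α β γ : ℤ × ZMod 2} (hp : p ∈ homog K n k α) (hq : q ∈ homog K n k γ)
    (ht : (tω k : ONH K n k) ∈ homog K n k β) (h0 : α + β + γ = 0)
    (g : ℤ × ZMod 2) : ∀ y ∈ M.homog K n k g, cornerHom hk ε p q hε H y ∈ homog K n k g := by
  rintro _ ⟨f, hf, rfl⟩
  have h1 : M.mk K n k f = toM K n k (symReverse K n k f) :=
    congrArg (M.mk K n k) (symReverse_symReverse f).symm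
  change cornerHom hk ε p q hε H (M.mk K n k f) ∈ _
  have h2 : α + (g + β) + γ = g := by
    rw [show α + (g + β) + γ = g + (α + β + γ) by abel, h0, add_zero]
  rw [h1, cornerHom_toM, ← h2]
  exact smul_mem _ _ (homog_mul (homog_mul hp
    (homog_mul (ofPol_mem_homog (reverse_mem_homog hf)) ht)) hq)

end cornerHom

theorem exists_hom_e' (hk : k ≤ n) : ∃ φ : M K n k →ₙₐ[K] ONH K n k, Function.Injective φ ∧
    Set.range φ = {z | ∃ h : ONH K n k, z = e' 1 k * h * e' 1 k} ∧
    ∀ g, ∀ y ∈ M.homog K n k g, φ y ∈ homog K n k g := by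
  have H := sysOf K n k
  obtain ⟨ε, hε, h1⟩ := (H.tl_xup_tl (l := 1) (M := k) le_rfl ω).exists_smul (K := K)
  have h2 : ∀ f ∈ OSymA K n k, tω k * (1 * xup x 1 k) *
      (ofPol K n k f * tω k) = ε • (ofPol K n k f * tω k) := fun f hf => by
    obtain ⟨h, hh⟩ := exists_ofPol_tl_eq hf
    rw [hh, one_mul, ← mul_assoc, h1, smul_mul_assoc]
  refine ⟨cornerHom hk ε (xup x 1 k) 1 hε h2, cornerHom_injective, ?_, ?_⟩
  · obtain ⟨η, hη, h3⟩ := (pm_e' (K := K) (n := n) (k := k) 1 k).exists_smul (K := K)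
    rw [range_cornerHom, h3, Nat.add_sub_cancel]
    simp only [mul_one, smul_mul_assoc, mul_smul_comm, smul_smul_self hη]
  · refine fun g => cornerHom_mem_homog (x_list_mem_homog _ _) one_mem_homog
      (tauLong_mem_homog 1 k) ?_ g
    rw [add_zero, Nat.add_sub_cancel]
    exact smul_add_smul_eq_zero _

theorem exists_hom_e (hk : k ≤ n) : ∃ ψ : M K n k →ₙₐ[K] ONH K n k, Function.Injective ψ ∧
    Set.range ψ = {z | ∃ h : ONH K n k, z = e 1 k * h * e 1 k} ∧
    ∀ g, ∀ y ∈ M.homog K n k g, ψ y ∈ homog K n k g := by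
  have H := sysOf K n k
  obtain ⟨ε, hε, h1⟩ := (H.tl_xdown_tl (l := 1) (M := k) le_rfl ω).exists_smul (K := K)
  have h2 : ∀ f ∈ OSymA K n k, tω k * (xdown x 1 k * 1) *
      (ofPol K n k f * tω k) = ε • (ofPol K n k f * tω k) := fun f hf => by
    obtain ⟨h, hh⟩ := exists_ofPol_tl_eq hf
    rw [hh, mul_one, ← mul_assoc, h1, smul_mul_assoc]
  refine ⟨cornerHom hk ε 1 (xdown x 1 k) hε h2, cornerHom_injective, ?_, ?_⟩
  · obtain ⟨η, hη, h3⟩ := (pm_e (K := K) (n := n) (k := k) (l := 1) (m := k) ω).exists_smul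
      (K := K)
    rw [range_cornerHom, h3, Nat.add_sub_cancel]
    simp only [one_mul, smul_mul_assoc, mul_smul_comm, smul_smul_self hη]
  · refine fun g => cornerHom_mem_homog one_mem_homog (x_list_mem_homog _ _)
      (tauLong_mem_homog 1 k) ?_ g
    rw [zero_add, Nat.add_sub_cancel, add_comm]
    exact smul_add_smul_eq_zero _

lemma _root_.OddCR.M.isInternal (hk : k ≤ n) : DirectSum.IsInternal (M.homog K n k) := by
  obtain ⟨φ, h1, -, h3⟩ := exists_hom_e' (K := K) hk
  exact internal_of_injective grProj.internal (φ : M K n k →ₗ[K] ONH K n k) h1 h3 M.iSup_homog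

end ONH

end OddCR

end

theorem mainTheorem12 (𝕜 : Type u) [CommRing 𝕜] (n : ℕ) :
    (∀ a b m : ℕ, m ≠ n →
      LinearMap.ker (OddCR.ONH.diff 𝕜 n a b m) = OddCR.ONH.bdry 𝕜 n a b m) ∧
    (∀ k : Fin (n + 1),
      OddCR.IsInvertible (OddCR.ONH.homog 𝕜 n (n - k)) (OddCR.ONH.homog 𝕜 n k)
        (OddCR.ONH.gradC 𝕜 n k)) ∧
    (∀ k : Fin (n + 1),
      ∃ (φ : OddCR.M 𝕜 n (n - k) →ₙₐ[𝕜] OddCR.ONH 𝕜 n (n - k))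
        (ψ : OddCR.M 𝕜 n k →ₙₐ[𝕜] OddCR.ONH 𝕜 n k)
        (_ : Module (OddCR.M 𝕜 n (n - k)) (OddCR.ONH.cutC 𝕜 n k))
        (_ : Module (OddCR.M 𝕜 n k)ᵐᵒᵖ (OddCR.ONH.cutC 𝕜 n k)),
        Function.Injective φ ∧
        Set.range φ = {z | ∃ h : OddCR.ONH 𝕜 n (n - k),
          z = OddCR.ONH.e' 1 (n - k) * h * OddCR.ONH.e' 1 (n - k)} ∧
        (∀ g, ∀ y ∈ OddCR.M.homog 𝕜 n (n - k) g, φ y ∈ OddCR.ONH.homog 𝕜 n (n - k) g) ∧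
        Function.Injective ψ ∧
        Set.range ψ = {z | ∃ h : OddCR.ONH 𝕜 n k, z = OddCR.ONH.e 1 k * h * OddCR.ONH.e 1 k} ∧
        (∀ g, ∀ y ∈ OddCR.M.homog 𝕜 n k g, ψ y ∈ OddCR.ONH.homog 𝕜 n k g) ∧
        (∀ (y : OddCR.M 𝕜 n (n - k)) (c : OddCR.ONH.cutC 𝕜 n k),
          ((y • c : OddCR.ONH.cutC 𝕜 n k) : OddCR.ONH.C 𝕜 n k) = φ y • (c : OddCR.ONH.C 𝕜 n k)) ∧
        (∀ (y : OddCR.M 𝕜 n k) (c : OddCR.ONH.cutC 𝕜 n k),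
          ((MulOpposite.op y • c : OddCR.ONH.cutC 𝕜 n k) : OddCR.ONH.C 𝕜 n k)
            = MulOpposite.op (ψ y) • (c : OddCR.ONH.C 𝕜 n k)) ∧
        OddCR.IsInvertible (OddCR.M.homog 𝕜 n (n - k)) (OddCR.M.homog 𝕜 n k)
          (OddCR.ONH.gradCutC 𝕜 n k)) := by
  refine ⟨fun a b m hm => OddCR.ONH.ker_diff a b m hm, fun k => OddCR.ONH.isInvertible_gradC 𝕜 k,
    fun k => ?_⟩
  have ha : n - (k : ℕ) ≤ n := Nat.sub_le n k
  have hb : (k : ℕ) ≤ n := Nat.lt_succ_iff.mp k.2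
  obtain ⟨φ, iφ, rφ, dφ⟩ := OddCR.ONH.exists_hom_e' (K := 𝕜) ha
  obtain ⟨ψ, iψ, rψ, dψ⟩ := OddCR.ONH.exists_hom_e (K := 𝕜) hb
  obtain ⟨m1, m2, h1, h2, h3⟩ := OddCR.ONH.isInvertible_gradCutC 𝕜 k (OddCR.M.isInternal ha)
    (OddCR.M.isInternal hb) OddCR.M.mul_mem_homog OddCR.M.one_mem_homog OddCR.M.one_mem_homog
    φ ψ iφ iψ rφ rψ dφ dψ
  exact ⟨φ, ψ, m1, m2, iφ, rφ, dφ, iψ, rψ, dψ, h1, h2, h3⟩
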